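/- **Setting.** Let $\Bbbk$ be a field of characteristic $0$ and $d\in\mathbb Z$. A graded quiver $\mathcal A$ with set of objects $\mathcal O$ is a family of $\mathbb Z$-graded vector spaces ${}_y\mathcal A_x$, $x,y\in\mathcal O$; $V[r]^i=V^{i+r}$. For a nonempty tuple $\bar x=(x_1,\dots,x_m)$ of objects put $\operatorname{lt}(\bar x)=x_1$, $\operatorname{rt}(\bar x)=x_m$, $\operatorname{lg}(\bar x)=m$ and $\mathcal A[1]^{\otimes\bar x}={}_{x_1}\mathcal A_{x_2}[1]\otimes\cdots\otimes{}_{x_{m-1}}\mathcal A_{x_m}[1]$ ($=\Bbbk$ if $m=1$). Let $\mathcal A,\mathcal B$ be graded quivers with sets of objects $\mathcal O_{\mathcal A},\mathcal O_{\mathcal B}$ and $F_0:\mathcal O_{\mathcal A}\to\mathcal O_{\mathcal B}$ a map. Let $\operatorname{Multi}(\mathcal A[1],\mathcal B[-d])$ consist of the families $\mathbf F=(F^{\bar x^1,\dots,\bar x^n})$, indexed by all $n\ge1$ and all $n$-tuples of nonempty tuples of objects of $\mathcal A$, of linear maps $$F^{\bar x^1,\dots,\bar x^n}:\ \bigotimes_{i=1}^n\mathcal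 A[1]^{\otimes\bar x^i}\longrightarrow\bigotimes_{i=1}^{n}{}_{F_0(\operatorname{lt}(\bar x^i))}\mathcal B_{F_0(\operatorname{rt}(\bar x^{i+1}))}[-d]\qquad(\bar x^{n+1}:=\bar x^1),$$ whose components with $n=1$, $\operatorname{lg}(\bar x^1)=1$ vanish. Such $\mathbf F$ is cyclically invariant if it is invariant under simultaneous cyclic permutation, with Koszul signs, of the $n$ blocks of arguments and of the $n$ factors of the value. Let $s_{d+1}$ be the shift of degree $-(d+1)$, so that $|s_{d+1}\mathbf F|=e$ means that all components of $\mathbf F$ have degree $e+d+1$. **Diagrams.** The component $F^{\bar x^1,\dots,\bar x^n}$ is drawn as a disc with $n$ outgoing arrows and, clockwise before the $i$-th outgoing arrow, $\operatorname{lg}(\bar x^i)-1$ incoming arrows (read counterclockwise, they are the factors of $\mathcal A[1]^{\otimes\bar x^i}$); the last outgoing arrow precedes the first block cyclically. A filled diagram is a planar arrangement of such discs in which some outgoing arrows are connected to incoming arrows of other discs with the same label (pair of objects and quiver), forming a connected graph without cycles, together with a choice of an outer (unconnected) outgoing arrow, the bold arrow of the diagram. Reading its outer arrows clockwise, ending with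 the bold arrow, gives the type of the diagram. Every disc has a bold arrow: the arrow lying on the path to the bold arrow of the diagram (the bold arrow itself for the disc carrying it). For every disc, number its outgoing arrows so that its bold arrow, if outgoing, and otherwise the outgoing arrow clockwise preceding its bold arrow, is last. The evaluation $\mathcal E(D)$ is obtained as follows. Write an operation with value $b_1\otimes\cdots\otimes b_n$ at $a_1\otimes\cdots\otimes a_m$ as a tensor $b_1\otimes\cdots\otimes b_n\otimes a_m^*\otimes\cdots\otimes a_1^*$ (the $a_j\in\mathcal A[1]$ and the $b_j\in\mathcal B[-d]$ homogeneous), and form the product of all the $s_{d+1}F_j$ over the discs, in the following order: for every disc, first the subdiagrams hanging on its non-bold outgoing arrows, then the disc, then the subdiagrams hanging on its non-bold incoming arrows, in each case in clockwise order starting after the bold arrow. Permute the symbols, with Koszul signs, so as to obtain $s_{d+1}$ of the disc carrying the bold arrow of the diagram, then the outer outputs $b_1\otimes\cdots\otimes b_n$, then the contractions $(a^*, s_{d+1}, b)$ along the connected pairs of arrows ($s_{d+1}$ being the shift of the disc of the pair which is farther from the bold arrow of the diagram, each contraction having total degree $0$), then the outer inputs $a_m^*\otimes\cdots\otimes a_1^*$;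 contract; and multiply by $(-1)^{(d+1)r}$, where $r$ is the number of discs whose bold arrow is incoming. The result is $s_{d+1}$ of a map of the type of the diagram. All the sums below are over the diagrams $D$ of a given type, the bold arrow thus being any outer outgoing arrow, and they are finite. **Pre-Calabi–Yau categories.** For $\mathbf F,\mathbf G\in\operatorname{Multi}(\mathcal A[1],\mathcal A[-d])$ (with $F_0=\mathrm{id}$) let $s_{d+1}\mathbf F\underset{\mathrm{nec}}\circ s_{d+1}\mathbf G$ be the sum of $\mathcal E(D)$ over all diagrams with one disc filled with $\mathbf F$ and one filled with $\mathbf G$, an outgoing arrow of the latter being connected to an incoming arrow of the former, and let $[x,y]_{\mathrm{nec}}=x\underset{\mathrm{nec}}\circ y-(-1)^{|x||y|}y\underset{\mathrm{nec}}\circ x$. A $d$-pre-Calabi–Yau category $(\mathcal A,s_{d+1}M_{\mathcal A})$ is a graded quiver $\mathcal A$ with a cyclically invariant $M_{\mathcal A}\in\operatorname{Multi}(\mathcal A[1],\mathcal A[-d])$ such that $|s_{d+1}M_{\mathcal A}|=1$ and $[s_{d+1}M_{\mathcal A},s_{d+1}M_{\mathcal A}]_{\mathrm{nec}}=0$. **Morphisms.**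 A $d$-pre-Calabi–Yau morphism $(\mathcal A,s_{d+1}M_{\mathcal A})\to(\mathcal B,s_{d+1}M_{\mathcal B})$ is a pair $(F_0,\mathbf F)$ of a map $F_0:\mathcal O_{\mathcal A}\to\mathcal O_{\mathcal B}$ and a cyclically invariant $\mathbf F\in\operatorname{Multi}(\mathcal A[1],\mathcal B[-d])$ such that $|s_{d+1}\mathbf F|=0$ and $$s_{d+1}\mathbf F\underset{\mathrm{multinec}}\circ s_{d+1}M_{\mathcal A}=s_{d+1}M_{\mathcal B}\underset{\mathrm{pre}}\circ s_{d+1}\mathbf F .$$ The left side is the sum of $\mathcal E(D)$ over all diagrams with one disc filled with $M_{\mathcal A}$, every outgoing arrow of which is connected to a disc filled with $\mathbf F$, and no other discs or connections. The right side is the sum over all diagrams with one disc filled with $M_{\mathcal B}$, every incoming arrow of which is connected to a disc filled with $\mathbf F$, and no other discs or connections. **Composition and identities.** For $(F_0,\mathbf F):\mathcal A\to\mathcal B$ and $(G_0,\mathbf G):\mathcal B\to\mathcal C$ the composition is $(G_0\circ F_0,\ \mathbf G\circ\mathbf F)$, where $s_{d+1}(\mathbf G\circ\mathbf F)$ is the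 sum of $\mathcal E(D)$ over all diagrams of discs filled with $\mathbf F$ and discs filled with $\mathbf G$ in which all outgoing arrows of the discs filled with $\mathbf F$ and all incoming arrows of the discs filled with $\mathbf G$ are connected with each other. The identity of $(\mathcal A,s_{d+1}M_{\mathcal A})$ is $(\mathrm{id}_{\mathcal O},\mathbf{Id})$, where $\mathrm{Id}^{(x,y)}:{}_x\mathcal A_y[1]\to{}_x\mathcal A_y[-d]$ is the identity of the underlying space for all $x,y\in\mathcal O$, and $\mathrm{Id}^{\bar x^1,\dots,\bar x^n}=0$ if $n\ne1$ or $\operatorname{lg}(\bar x^1)\neq2$. **Proposition.** For every $d\in\mathbb Z$, (small) $d$-pre-Calabi–Yau categories and $d$-pre-Calabi–Yau morphisms, with this composition and these identities, form a category $\mathrm{pCY}_d$. In particular the composition of two $d$-pre-Calabi–Yau morphisms and the identities are $d$-pre-Calabi–Yau morphisms, the composition is associative, and the identities are neutral. -/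

import Mathlib

open scoped DirectSum TensorProduct

universe u v w t

noncomputable section

namespace PreCY

/-! ### Graded quivers and the spaces of multilinear maps -/

/-- A (cohomologically) graded quiver with set of objects `O` over the field `k`:
`V y x i` is the component of degree `i` of the graded vector space `_yA_x`. -/
structure GrQuiver (k : Type w) [Field k] (O : Type u) where
  V : O → O → ℤ → Type v
  [acg : ∀ y x i, AddCommGroup (V y x i)]
  [mod : ∀ y x i, Module k (V y x i)]

attribute [instance] GrQuiver.acg GrQuiver.mod

variable {k : Type w} [Field k] {O P R : Type u}

/-- The underlying vector space of the graded vector space `_yA_x`. Shifts of the grading do not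
change it: an element of degree `i` has degree `i - 1` in `A[1]` and degree `i + d` in `A[-d]`. -/
abbrev GrQuiver.Hom (A : GrQuiver.{u, v, w} k O) (y x : O) : Type v := ⨁ i : ℤ, A.V y x i

/-- The index set of a homogeneous basis of `_yA_x`; the first component is the degree. -/
abbrev GrQuiver.Idx (A : GrQuiver.{u, v, w} k O) (y x : O) : Type v :=
  Σ i : ℤ, Module.Basis.ofVectorSpaceIndex k (A.V y x i)

/-- A homogeneous basis of `_yA_x`. It serves to write the contraction of tensors
in coordinates. -/
def GrQuiver.basis (A : GrQuiver.{u, v, w} k O) (y x : O) :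
    Module.Basis (A.Idx y x) k (A.Hom y x) :=
  DFinsupp.basis fun i => Module.Basis.ofVectorSpace k (A.V y x i)

/-- The quiver with set of objects `O` and spaces `_{f y}A_{f x}`. -/
def GrQuiver.pull (f : O → P) (A : GrQuiver.{u, v, w} k P) : GrQuiver.{u, v, w} k O where
  V y x i := A.V (f y) (f x) i
  acg y x i := A.acg (f y) (f x) i
  mod y x i := A.mod (f y) (f x) i

/-- A tuple `(x¹, …, x^{n+1})` of nonempty tuples of objects, the `i`-th one consisting of
`m i + 1` objects. It is the type of a disc with `n + 1` outgoing arrows and `m i` incoming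
arrows between the outgoing arrows `i - 1` and `i`. -/
structure DiscType (O : Type u) where
  n : ℕ
  m : Fin (n + 1) → ℕ
  x : ∀ i, Fin (m i + 1) → O

/-- The set of incoming arrows of a disc of type `τ`. -/
abbrev DiscType.In (τ : DiscType O) : Type := Σ i : Fin (τ.n + 1), Fin (τ.m i)

/-- The image of a type under a map between the sets of objects. -/
def DiscType.map (f : O → P) (τ : DiscType O) : DiscType P where
  n := τ.n
  m := τ.m
  x i j := f (τ.x i j)

/-- The underlying space of `A[1]^{⊗ x¹} ⊗ ⋯ ⊗ A[1]^{⊗ x^{n+1}}`. -/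
abbrev Source (A : GrQuiver.{u, v, w} k O) (τ : DiscType O) :=
  ⨂[k] p : τ.In, A.Hom (τ.x p.1 p.2.castSucc) (τ.x p.1 p.2.succ)

/-- The underlying space of `⨂ᵢ _{lt(xⁱ)}B_{rt(xⁱ⁺¹)}[-d]`, indices being read cyclically
(the addition of `Fin (n + 1)` wraps around). -/
abbrev Target (B : GrQuiver.{u, v, w} k O) (τ : DiscType O) :=
  ⨂[k] i : Fin (τ.n + 1), B.Hom (τ.x i 0) (τ.x (i + 1) (Fin.last _))

/-- Families of linear maps from tensor powers of `A[1]` to tensor powers of `B[-d]`. -/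
abbrev Multi (A B : GrQuiver.{u, v, w} k O) := ∀ τ : DiscType O, Source A τ →ₗ[k] Target B τ

/-- The restriction of a family of maps along a map of sets of objects. -/
def Multi.pull (f : O → P) {A B : GrQuiver.{u, v, w} k P} (F : Multi A B) :
    Multi (A.pull f) (B.pull f) :=
  fun τ => F (τ.map f)

/-! ### Coordinates -/

/-- A homogeneous basis vector of one of the spaces `_lA_r`. -/
structure Lab (A : GrQuiver.{u, v, w} k O) where
  l : O
  r : O
  e : A.Idx l r

/-- The (unshifted) degree of a basis vector. -/
def Lab.deg {A : GrQuiver.{u, v, w} k O} (a : Lab A) : ℤ := a.e.1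

/-- A disc of type `τ` with a basis vector of `A` on each incoming arrow, and one of `B` on each
outgoing arrow. -/
structure Filled (A B : GrQuiver.{u, v, w} k O) where
  τ : DiscType O
  a : ∀ p : τ.In, A.Idx (τ.x p.1 p.2.castSucc) (τ.x p.1 p.2.succ)
  b : ∀ i : Fin (τ.n + 1), B.Idx (τ.x i 0) (τ.x (i + 1) (Fin.last _))

/-- The labelled arrows of a disc in clockwise order, ending with the last outgoing arrow.
An arrow is a pair: `true` for outgoing, `false` for incoming, together with its label. The tuples
`xⁱ` are read counterclockwise, hence the reversal. -/
def Filled.word {Λ : Type t} {A B : GrQuiver.{u, v, w} k O} (i : Lab A → Λ) (o : Lab B → Λ)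
    (f : Filled A B) : List (Bool × Λ) :=
  (List.finRange (f.τ.n + 1)).flatMap fun s =>
    (List.ofFn fun j : Fin (f.τ.m s) => (false, i ⟨_, _, f.a ⟨s, j⟩⟩)).reverse ++
      [(true, o ⟨_, _, f.b s⟩)]

/-- The basis of the source given by the chosen homogeneous bases. -/
def srcBasis (A : GrQuiver.{u, v, w} k O) (τ : DiscType O) :
    Module.Basis (∀ p : τ.In, A.Idx (τ.x p.1 p.2.castSucc) (τ.x p.1 p.2.succ)) k (Source A τ) :=
  Basis.piTensorProduct fun p => A.basis (τ.x p.1 p.2.castSucc) (τ.x p.1 p.2.succ)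

/-- The basis of the target given by the chosen homogeneous bases. -/
def tgtBasis (B : GrQuiver.{u, v, w} k O) (τ : DiscType O) :
    Module.Basis (∀ i : Fin (τ.n + 1), B.Idx (τ.x i 0) (τ.x (i + 1) (Fin.last _))) k
      (Target B τ) :=
  Basis.piTensorProduct fun i => B.basis (τ.x i 0) (τ.x (i + 1) (Fin.last _))

open Classical in
/-- The matrix coefficients of `F`, as a function of clockwise words of labelled arrows
(the coefficient of the outgoing labels in the value of `F` at the incoming labels);
zero for the words which are not the word of a disc with incoming labels in `A`
and outgoing labels in `B`. A word determines the labelled disc. -/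
def Multi.coeff {Λ : Type t} {A B : GrQuiver.{u, v, w} k O} (F : Multi A B)
    (i : Lab A → Λ) (o : Lab B → Λ) (W : List (Bool × Λ)) : k :=
  if h : ∃ f : Filled A B, f.word i o = W then
    (tgtBasis B h.choose.τ).repr (F h.choose.τ (srcBasis A h.choose.τ h.choose.a)) h.choose.b
  else 0

/-- The family of maps with prescribed matrix coefficients. -/
def Multi.ofCoeff {Λ : Type t} {A B : GrQuiver.{u, v, w} k O} (i : Lab A → Λ) (o : Lab B → Λ)
    (c : List (Bool × Λ) → k) : Multi A B :=
  fun τ => (srcBasis A τ).constr k fun a =>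
    ∑ᶠ b, c ((⟨τ, a, b⟩ : Filled A B).word i o) • tgtBasis B τ b

/-! ### Degrees and cyclic invariance -/

section Degrees

variable {Λ : Type t} (d : ℤ) (deg : Λ → ℤ)

/-- The degree of an arrow: labels of incoming arrows belong to `A[1]`, those of outgoing arrows
to `B[-d]`. -/
def arrowDeg (p : Bool × Λ) : ℤ := if p.1 then deg p.2 + d else deg p.2 - 1

/-- The total degree of the incoming arrows of a word. -/
def inDeg (W : List (Bool × Λ)) : ℤ := ((W.filter fun p => !p.1).map (arrowDeg d deg)).sum

/-- The total degree of the outgoing arrows of a word. -/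
def outDeg (W : List (Bool × Λ)) : ℤ := ((W.filter fun p => p.1).map (arrowDeg d deg)).sum

/-- A word which is nonempty and ends with an outgoing arrow. -/
def EndsOut (W : List (Bool × Λ)) : Prop := ∃ U b, W = U ++ [(true, b)]

end Degrees

/-- `F` is homogeneous of degree `e`. -/
def Multi.Homogeneous {A B : GrQuiver.{u, v, w} k O} (d e : ℤ) (F : Multi A B) : Prop :=
  ∀ W, F.coeff Sum.inl Sum.inr W ≠ 0 →
    outDeg d (Sum.elim Lab.deg Lab.deg) W = inDeg d (Sum.elim Lab.deg Lab.deg) W + e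

/-- `F` is invariant under the simultaneous cyclic permutations, with Koszul signs, of the blocks
of arguments `A[1]^{⊗ xⁱ}` and of the tensor factors of the result. -/
def Multi.Cyclic {A B : GrQuiver.{u, v, w} k O} (d : ℤ) (F : Multi A B) : Prop :=
  ∀ U W, EndsOut U → EndsOut W →
    F.coeff Sum.inl Sum.inr (U ++ W) =
      ((Int.negOnePow (inDeg d (Sum.elim Lab.deg Lab.deg) U * inDeg d (Sum.elim Lab.deg Lab.deg) W +
        outDeg d (Sum.elim Lab.deg Lab.deg) U * outDeg d (Sum.elim Lab.deg Lab.deg) W) : ℤ) : k) *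
      F.coeff Sum.inl Sum.inr (W ++ U)

/-- There is no component with one outgoing arrow and no incoming arrow. -/
def Multi.Uncurved {A B : GrQuiver.{u, v, w} k O} (F : Multi A B) : Prop :=
  ∀ τ : DiscType O, τ.n = 0 → (∀ i, τ.m i = 0) → F τ = 0

/-! ### Diagrams of discs -/

/-- The arrows of a disc other than its bold arrow, listed clockwise starting after the bold arrow,
together with everything that hangs on them. `ext out a rest` is an arrow of the whole diagram.
`edge out a op sub rest` is an arrow connected with the bold or to-be-bold arrow of another disc,
which is filled with `op` and whose further arrows are `sub`. In both cases `out` tells whether the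
arrow of the disc at hand is outgoing, and `a` is the basis vector on the arrow. -/
inductive Legs (K : Type) (Λ : Type t) : Type t
  | nil : Legs K Λ
  | ext (out : Bool) (a : Λ) (rest : Legs K Λ) : Legs K Λ
  | edge (out : Bool) (a : Λ) (op : K) (sub rest : Legs K Λ) : Legs K Λ

/-- A connected planar diagram of discs without cycles, filled with the operations `K` and with
basis vectors `Λ` on all of its arrows, the last outgoing arrow of the diagram being bold:
`op` fills the disc carrying that arrow, `root` is the basis vector on it. -/
structure Diagram (K : Type) (Λ : Type t) where
  op : K
  root : Λ
  legs : Legs K Λ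

/-- The symbols which are permuted in the Koszul sign of a diagram. An arrow or pair of connected
arrows has an address `p`; `near p` is the (half) arrow at the disc closer to the bold arrow of the
diagram, `far p` is the one at the other disc, and `shift p` is the shift `s_{d+1}` of that other
disc. `rootOut` and `rootShift` belong to the bold arrow of the diagram and its disc. -/
inductive Sym : Type
  | rootOut | rootShift
  | near (p : List Bool) | far (p : List Bool) | shift (p : List Bool)
  deriving DecidableEq

/-- A disc of a diagram: the operation filling it, its arrows in clockwise order ending with its last
outgoing arrow (with direction, label and symbol), and the symbol of its shift. -/
structure Disc (K : Type) (Λ : Type t) where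
  op : K
  word : List (Bool × Λ × Sym)
  shift : Sym

/-- Rotate a clockwise cyclic word so that it ends with an outgoing arrow. -/
def normalize {Λ : Type t} (W : List (Bool × Λ × Sym)) : List (Bool × Λ × Sym) :=
  W.rtakeWhile (fun p => !p.1) ++ W.rdropWhile (fun p => !p.1)

namespace Legs

variable {K : Type} {Λ : Type t}

/-- The non-bold arrows of the disc at hand, in clockwise order. -/
def arrows : List Bool → Legs K Λ → List (Bool × Λ × Sym)
  | _, nil => []
  | p, ext out a rest => (out, a, Sym.near p) :: rest.arrows (false :: p)
  | p, edge out a _ _ rest => (out, a, Sym.near p) :: rest.arrows (false :: p)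

/-- The outer arrows, in clockwise order. -/
def boundary : List Bool → Legs K Λ → List (Bool × Λ × Sym)
  | _, nil => []
  | p, ext out a rest => (out, a, Sym.near p) :: rest.boundary (false :: p)
  | p, edge _ _ _ sub rest => sub.boundary (true :: p) ++ rest.boundary (false :: p)

/-- The disc hanging on the edge with address `p`. If the connected arrow of the disc at hand is
incoming, then the bold arrow of the hanging disc is outgoing and is its last one; otherwise it is
incoming, and the last outgoing arrow is the one clockwise preceding it. -/
def hanging (p : List Bool) (out : Bool) (a : Λ) (op : K) (sub : Legs K Λ) : Disc K Λ where
  op := op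
  word := if out then normalize ((false, a, Sym.far p) :: sub.arrows (true :: p))
    else sub.arrows (true :: p) ++ [(true, a, Sym.far p)]
  shift := Sym.shift p

/-- The discs of the subdiagrams hanging on outgoing arrows, and those of the subdiagrams hanging
on incoming arrows. In each list a disc stands before every disc from which it receives an input. -/
def discs : List Bool → Legs K Λ → List (Disc K Λ) × List (Disc K Λ)
  | _, nil => ([], [])
  | p, ext _ _ rest => rest.discs (false :: p)
  | p, edge out a op sub rest =>
    let s := sub.discs (true :: p)
    let r := rest.discs (false :: p)
    let all := s.1 ++ hanging p out a op sub :: s.2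
    if out then (all ++ r.1, r.2) else (r.1, all ++ r.2)

/-- The connected pairs of arrows, as pairs (operation of the disc of the outgoing arrow, operation
of the disc of the incoming arrow); `κ` is the operation filling the disc at hand. -/
def edges : K → Legs K Λ → List (K × K)
  | _, nil => []
  | κ, ext _ _ rest => rest.edges κ
  | κ, edge out _ op sub rest =>
    (if out then (κ, op) else (op, κ)) :: (sub.edges op ++ rest.edges κ)

/-- The operations filling the hanging discs. -/
def ops : Legs K Λ → List K
  | nil => []
  | ext _ _ rest => rest.ops
  | edge _ _ op sub rest => op :: (sub.ops ++ rest.ops)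

variable (d : ℤ) (deg : Λ → ℤ)

/-- For each connected pair of arrows, the symbols of the incoming arrow, of the shift used on this
connection and of the outgoing arrow, with their degrees. The three degrees sum up to zero. -/
def pairings : List Bool → Legs K Λ → List (Sym × ℤ)
  | _, nil => []
  | p, ext _ _ rest => rest.pairings (false :: p)
  | p, edge out a _ sub rest =>
    [(if out then Sym.far p else Sym.near p, -(deg a - 1)), (Sym.shift p, -(d + 1)),
      (if out then Sym.near p else Sym.far p, deg a + d)] ++
      (sub.pairings (true :: p) ++ rest.pairings (false :: p))

/-- The number of discs whose bold arrow is incoming. -/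
def outward : Legs K Λ → ℤ
  | nil => 0
  | ext _ _ rest => rest.outward
  | edge out _ _ sub rest => (if out then 1 else 0) + sub.outward + rest.outward

end Legs

/-- The incoming arrows of a clockwise word in the order of the tensor factors of
`A[1]^{⊗ x¹} ⊗ ⋯ ⊗ A[1]^{⊗ xⁿ}`: the blocks between outgoing arrows are taken clockwise, each
block being read counterclockwise. The first argument accumulates the current block. -/
def inputs {Λ : Type t} : List (Bool × Λ × Sym) → List (Bool × Λ × Sym) → List (Bool × Λ × Sym)
  | acc, [] => acc
  | acc, p :: W => if p.1 then acc ++ inputs [] W else inputs (p :: acc) W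

/-- A multilinear map with results `b₁ ⊗ ⋯ ⊗ bₙ` at `a₁ ⊗ ⋯ ⊗ aₘ`, written as the tensor
`b₁ ⊗ ⋯ ⊗ bₙ ⊗ aₘ* ⊗ ⋯ ⊗ a₁*`, the given list standing in the middle. Symbols
come with their degrees. -/
def tensorWord {Λ : Type t} (d : ℤ) (deg : Λ → ℤ) (mid : List (Sym × ℤ))
    (W : List (Bool × Λ × Sym)) : List (Sym × ℤ) :=
  ((W.filter fun p => p.1).map fun p => (p.2.2, deg p.2.1 + d)) ++ mid ++
    (inputs [] W).reverse.map fun p => (p.2.2, -(deg p.2.1 - 1))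

/-- The exponent of the Koszul sign of the permutation carrying the list `L` to the list `L'` of
symbols with degrees. -/
def koszul (L' : List (Sym × ℤ)) : List (Sym × ℤ) → ℤ
  | [] => 0
  | p :: L => (L.map fun q => if L'.idxOf q < L'.idxOf p then p.2 * q.2 else 0).sum + koszul L' L

namespace Diagram

variable {K : Type} {Λ : Type t}

/-- The disc carrying the bold arrow of the diagram. -/
def rootDisc (D : Diagram K Λ) : Disc K Λ where
  op := D.op
  word := D.legs.arrows [] ++ [(true, D.root, Sym.rootOut)]
  shift := Sym.rootShift

/-- All discs; a disc stands before every disc from which it receives an input. -/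
def discs (D : Diagram K Λ) : List (Disc K Λ) :=
  (D.legs.discs []).1 ++ D.rootDisc :: (D.legs.discs []).2

/-- The outer arrows of the diagram in clockwise order, ending with the bold one. -/
def boundary (D : Diagram K Λ) : List (Bool × Λ × Sym) :=
  D.legs.boundary [] ++ [(true, D.root, Sym.rootOut)]

/-- The word of the diagram, which determines its type and the labels of its outer arrows. -/
def word (D : Diagram K Λ) : List (Bool × Λ) := D.boundary.map fun p => (p.1, p.2.1)

/-- The connected pairs of arrows, as pairs (giving disc, receiving disc). -/
def edges (D : Diagram K Λ) : List (K × K) := D.legs.edges D.op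

/-- The operations filling the discs. -/
def ops (D : Diagram K Λ) : List K := D.op :: D.legs.ops

/-- The exponent of the sign of the evaluation of a diagram. One starts with the product
`(s_{d+1}F₁)(s_{d+1}F₂)⋯` over all discs, moves the shift of each disc to its bold arrow and the
tensor factors to their places, so that one ends with `s_{d+1}` times a tensor of the type of
the diagram times the contractions along the connected arrows. An incoming bold arrow contributes
the additional sign `(-1)^{d+1}`, thanks to which the evaluation does not depend on which outgoing
arrow of the diagram is bold. -/
def signExp (d : ℤ) (deg : Λ → ℤ) (D : Diagram K Λ) : ℤ :=
  koszul ((Sym.rootShift, -(d + 1)) :: tensorWord d deg (D.legs.pairings d deg []) D.boundary)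
      (D.discs.flatMap fun C => (C.shift, -(d + 1)) :: tensorWord d deg [] C.word) +
    (d + 1) * D.legs.outward

/-- The contribution of a labelled diagram: its sign times the product of the matrix coefficients
of the operations filling its discs. -/
def weight (d : ℤ) (deg : Λ → ℤ) (c : K → List (Bool × Λ) → k) (D : Diagram K Λ) : k :=
  ((Int.negOnePow (D.signExp d deg) : ℤ) : k) *
    (D.discs.map fun C => c C.op (C.word.map fun p => (p.1, p.2.1))).prod

end Diagram

/-- The sum of the evaluations of all filled diagrams of shape `S`, as a family of maps. The sum
over labelled diagrams with given outer arrows is the sum over all diagrams of a given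
type together with the sums over the basis vectors on the connected arrows. -/
def diagramSum {Λ : Type t} {K : Type} {A B : GrQuiver.{u, v, w} k O} (d : ℤ)
    (i : Lab A → Λ) (o : Lab B → Λ) (deg : Λ → ℤ) (c : K → List (Bool × Λ) → k)
    (S : Diagram K Λ → Prop) : Multi A B :=
  Multi.ofCoeff i o fun W =>
    ∑ᶠ D ∈ {D : Diagram K Λ | S D ∧ D.word = W}, D.weight d deg c

/-! ### Pre-Calabi-Yau categories -/

/-- The necklace product of `s_{d+1}F` and `s_{d+1}G`: the sum over all diagrams consisting of a
disc filled with `F` (`false`) and a disc filled with `G` (`true`), with an outgoing arrow of the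
latter connected to an incoming arrow of the former. The bold arrow is on the disc of `F` for the
inner compositions, and on the disc of `G` for the outer ones. -/
def necklace (d : ℤ) {A : GrQuiver.{u, v, w} k O} (F G : Multi A A) : Multi A A :=
  diagramSum d id id Lab.deg
    (fun κ => if κ then G.coeff id id else F.coeff id id)
    fun D : Diagram Bool (Lab A) => D.edges = [(true, false)]

/-- The necklace bracket of homogeneous elements `s_{d+1}F`, `s_{d+1}G` of degrees `p`, `q`. -/
def necklaceBracket (d p q : ℤ) {A : GrQuiver.{u, v, w} k O} (F G : Multi A A) : Multi A A :=
  necklace d F G - ((Int.negOnePow (p * q) : ℤ) : k) • necklace d G F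

/-- A `d`-pre-Calabi-Yau structure: a cyclically invariant element such that `s_{d+1}M` is of degree
`1` and satisfies the Maurer-Cartan equation. -/
structure IsPreCYStructure (d : ℤ) {A : GrQuiver.{u, v, w} k O} (M : Multi A A) : Prop where
  homogeneous : M.Homogeneous d (d + 2)
  cyclic : M.Cyclic d
  uncurved : M.Uncurved
  maurerCartan : necklaceBracket d 1 1 M M = 0

/-- A (small) `d`-pre-Calabi-Yau category. -/
structure PreCYCat (k : Type w) [Field k] (d : ℤ) where
  Obj : Type u
  quiver : GrQuiver.{u, v, w} k Obj
  M : Multi quiver quiver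
  isStructure : IsPreCYStructure d M

/-! ### Pre-Calabi-Yau morphisms -/

/-- The multinecklace composition of `s_{d+1}M` with `s_{d+1}F`: the sum over all diagrams
with one disc filled with `M : A → A` (`true`) whose outgoing arrows are all connected to
discs filled with `F : A → B` (`false`). As the labels in `A` and those in `B` are kept apart,
it is enough to require that there is exactly one disc filled with `M`. -/
def multinecklace (d : ℤ) {A B : GrQuiver.{u, v, w} k O} (F : Multi A B) (M : Multi A A) :
    Multi A B :=
  diagramSum d Sum.inl Sum.inr (Sum.elim Lab.deg Lab.deg)
    (fun κ => if κ then M.coeff Sum.inl Sum.inl else F.coeff Sum.inl Sum.inr)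
    fun D : Diagram Bool (Lab A ⊕ Lab B) => D.ops.count true = 1

/-- The pre composition of `s_{d+1}F` with `s_{d+1}M`: the sum over all diagrams with one disc
filled with `M : B → B` (`true`) whose incoming arrows are all connected to discs filled with
`F : A → B` (`false`). -/
def precomposition (d : ℤ) {A B : GrQuiver.{u, v, w} k O} (M : Multi B B) (F : Multi A B) :
    Multi A B :=
  diagramSum d Sum.inl Sum.inr (Sum.elim Lab.deg Lab.deg)
    (fun κ => if κ then M.coeff Sum.inr Sum.inr else F.coeff Sum.inl Sum.inr)
    fun D : Diagram Bool (Lab A ⊕ Lab B) => D.ops.count true = 1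

/-- The composition over a fixed set of objects: the sum over all diagrams of discs filled with
`F : A → B` (`false`) and `G : B → C` (`true`), such that all outgoing arrows of the former
and all incoming arrows of the latter are connected with each other. As the labels in `A`, `B`
and `C` are kept apart and the outer arrows are labelled in `A` and `C`, this shape is automatic. -/
def Multi.comp (d : ℤ) {A B C : GrQuiver.{u, v, w} k O} (F : Multi A B) (G : Multi B C) :
    Multi A C :=
  diagramSum d Sum.inl (fun z => Sum.inr (Sum.inr z))
    (Sum.elim Lab.deg (Sum.elim Lab.deg Lab.deg))
    (fun κ => if κ then G.coeff (fun y => Sum.inr (Sum.inl y)) (fun z => Sum.inr (Sum.inr z))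
      else F.coeff Sum.inl (fun y => Sum.inr (Sum.inl y)))
    fun _ : Diagram Bool (Lab A ⊕ Lab B ⊕ Lab C) => True

/-- The identity: the component with one outgoing and one incoming arrow is the identity
of `_xA_y` (as a map `A[1] → A[-d]`), the other components vanish. -/
def Multi.one (A : GrQuiver.{u, v, w} k O) : Multi A A :=
  fun τ => (srcBasis A τ).constr k fun a => ∑ᶠ b, open Classical in
    (if ∃ e : Lab A, (⟨τ, a, b⟩ : Filled A A).word id id = [(false, e), (true, e)]
      then (1 : k) else 0) • tgtBasis A τ b

/-- A map of sets of objects together with a family of maps. -/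
structure PreMor (A : GrQuiver.{u, v, w} k O) (B : GrQuiver.{u, v, w} k P) where
  obj : O → P
  map : Multi A (B.pull obj)

/-- The composition of `(F₀, F)` and `(G₀, G)`. -/
def PreMor.comp (d : ℤ) {A : GrQuiver.{u, v, w} k O} {B : GrQuiver.{u, v, w} k P}
    {C : GrQuiver.{u, v, w} k R} (F : PreMor A B) (G : PreMor B C) : PreMor A C where
  obj := fun x => G.obj (F.obj x)
  map := Multi.comp d F.map (G.map.pull F.obj)

/-- The identity. -/
def PreMor.one (A : GrQuiver.{u, v, w} k O) : PreMor A A where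
  obj := fun x => x
  map := Multi.one A

/-- A `d`-pre-Calabi-Yau morphism: a map of sets of objects together with a cyclically
invariant element such that `s_{d+1}F` is of degree `0` and intertwines the structures. -/
structure PreCYMor {d : ℤ} (X Y : PreCYCat.{u, v, w} k d) extends
    PreMor X.quiver Y.quiver where
  homogeneous : map.Homogeneous d (d + 1)
  cyclic : map.Cyclic d
  uncurved : map.Uncurved
  compatible : multinecklace d map X.M = precomposition d (Y.M.pull obj) map

end PreCY

end

open scoped DirectSum TensorProduct

noncomputable section

/-! Tensors are replaced by matrix coefficients in homogeneous bases. An operation becomes a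
function of words of labelled arrows. It is multiplied by the sign that turns `outputs ⊗ inputs`
into the clockwise order of the arrows (`ccw`); cyclic invariance then says that carrying one letter
around the word costs the Koszul sign of that letter (`ccw_cyc`, `cyc_of_ccw`). In this form the
evaluation of a diagram is a product of coefficients along a planar tree, with one sign `η` per edge
(`Tr.om`, `Diagram.weight_eq`), and the sum over trees does not depend on the arrow chosen as root
(`TS_cyc`).

Composition is a sum over trees whose edges carry labels of the middle quiver. A tree with edges of
two kinds is the same thing as a tree with edges of the second kind whose discs are subdivided by
trees with edges of the first kind, and values are multiplicative under this decomposition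
(`Tr.om_split`). Hence summing over one kind after the other is the same as summing over both kinds
at once (`TS_TS`), and both bracketings of a triple composition give the sum over trees with edges
in either middle quiver (`wcomp_assoc`). Labels carry a natural number, their level, lower for
inputs than for outputs, so that source, middle and target stay apart even if they are the same
quiver. Levels also make the sums finite (`Tr.finite_trees`): discs with three or more arrows use up
outer arrows, chains of discs with two arrows are bounded because levels are monotone, and
finiteness of the labels propagates from the inputs of a disc to its outputs.

Compatibility with the structures is reduced to associativity by deformation over the dual numbers
with an odd parameter `ε`. The composite of `Id + ε M` with `F` is `F` plus `ε` times the
multinecklace composition, and the composite of `F` with `Id + ε N` is `F` plus `ε` times the pre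
composition (`left_aux`, `right_aux`); diagrams with two structure discs disappear because `ε² = 0`.
So `F` is a morphism if and only if it intertwines `Id + ε M` and `Id + ε N` (`compatible_iff`).
That composites of morphisms are morphisms is then a computation with associativity
(`compatible_comp`), and that identities are morphisms is neutrality of `Id` applied to `Id + ε M`
(`compatible_one`). The twist `tau` records the sign for moving symbols past `ε`.

Three translations connect this with the definitions. The sign of a diagram is computed by a
calculus of rearrangements of symbols (`Kz`, `Legs.kz_legs`, `Diagram.signExp_eq`). Diagrams are
matched with trees by `Bridge.TS_eq`: in a tree for `Id + ε M` followed by `F`, each input of an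
`F`-disc not fed by `M` ends in an identity disc, which the diagram does not show. Finally,
restriction along a map of objects commutes with all constructions (`Lifts.TS_map`, `comp_pull`,
`compatible_pull`), because the objects at an inner edge are determined by the path of outer arrows
beyond it, so that inner labels lift uniquely. -/

namespace PreCY
section
/-! ### Signs and dual numbers -/

section Signs
variable {k : Type w} [Field k]

/-- The sign `(-1)^n`. -/
def sg (k : Type w) [Field k] (n : ZMod 2) : k := if n = 0 then 1 else -1

lemma zmod_two_cases (n : ZMod 2) : n = 0 ∨ n = 1 := by
  revert n; decide

@[simp] lemma sg_zero : sg k 0 = 1 := if_pos rfl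

@[simp] lemma sg_one : sg k 1 = -1 := if_neg (by decide)

lemma sg_add (m n : ZMod 2) : sg k (m + n) = sg k m * sg k n := by
  rcases zmod_two_cases m with rfl | rfl <;> rcases zmod_two_cases n with rfl | rfl <;>
    simp [show (1 + 1 : ZMod 2) = 0 from by decide]

@[simp] lemma sg_mul_self (n : ZMod 2) : sg k n * sg k n = 1 := by
  rcases zmod_two_cases n with rfl | rfl <;> simp

lemma sg_ne_zero (n : ZMod 2) : sg k n ≠ 0 := by
  rcases zmod_two_cases n with rfl | rfl <;> simp

lemma negOnePow_eq_sg (n : ℤ) : ((Int.negOnePow n : ℤ) : k) = sg k (n : ZMod 2) := by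
  rcases Int.even_or_odd n with h | h
  · rw [Int.negOnePow_even n h, (ZMod.intCast_eq_zero_iff_even).2 h]; simp
  · rw [Int.negOnePow_odd n h, (ZMod.intCast_eq_one_iff_odd).2 h]; simp

/-- The action of the parity `n` on the dual numbers, whose generator is odd. -/
def tau (n : ZMod 2) (x : DualNumber k) : DualNumber k :=
  TrivSqZeroExt.inl x.fst + TrivSqZeroExt.inr (sg k n * x.snd)

@[simp] lemma tau_fst (n : ZMod 2) (x : DualNumber k) : (tau n x).fst = x.fst := by simp [tau]

@[simp] lemma tau_snd (n : ZMod 2) (x : DualNumber k) : (tau n x).snd = sg k n * x.snd := by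
  simp [tau]

@[simp] lemma tau_zero (x : DualNumber k) : tau 0 x = x := by
  ext <;> simp

@[simp] lemma tau_apply_zero (n : ZMod 2) : tau n (0 : DualNumber k) = 0 := by
  ext <;> simp

@[simp] lemma tau_apply_one (n : ZMod 2) : tau n (1 : DualNumber k) = 1 := by
  ext <;> simp

lemma tau_tau (m n : ZMod 2) (x : DualNumber k) : tau m (tau n x) = tau (m + n) x := by
  ext <;> simp [sg_add, mul_assoc]

lemma tau_mul (n : ZMod 2) (x y : DualNumber k) : tau n (x * y) = tau n x * tau n y := by
  ext <;> simp; ring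

lemma tau_add (n : ZMod 2) (x y : DualNumber k) : tau n (x + y) = tau n x + tau n y := by
  ext <;> simp [mul_add]

lemma tau_smul (n : ZMod 2) (c : k) (x : DualNumber k) : tau n (c • x) = c • tau n x := by
  ext <;> simp; ring

lemma tau_eq_zero_iff {n : ZMod 2} {x : DualNumber k} : tau n x = 0 ↔ x = 0 := by
  refine ⟨fun h => ?_, fun h => by simp [h]⟩
  have h2 := congrArg (tau n) h
  rwa [tau_tau, CharTwo.add_self_eq_zero, tau_zero, tau_apply_zero] at h2

/-- `x` is homogeneous of parity `q`. -/
def Par (q : ZMod 2) (x : DualNumber k) : Prop := (q = 0 → x.snd = 0) ∧ (q = 1 → x.fst = 0)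

lemma par_zero (q : ZMod 2) : Par q (0 : DualNumber k) := by simp [Par]

lemma par_one : Par 0 (1 : DualNumber k) := by simp [Par]

lemma Par.mul {p q : ZMod 2} {x y : DualNumber k} (hx : Par p x) (hy : Par q y) :
    Par (p + q) (x * y) := by
  rcases zmod_two_cases p with rfl | rfl <;> rcases zmod_two_cases q with rfl | rfl <;>
    simp_all [Par, show (1 + 1 : ZMod 2) = 0 from by decide]

lemma Par.add {p : ZMod 2} {x y : DualNumber k} (hx : Par p x) (hy : Par p y) :
    Par p (x + y) := by
  constructor <;> intro h <;> simp [hx.1, hx.2, hy.1, hy.2, h]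

lemma Par.tau {p : ZMod 2} {x : DualNumber k} (n : ZMod 2) (hx : Par p x) :
    Par p (tau n x) := by
  constructor <;> intro h <;> simp [hx.1, hx.2, h]

lemma Par.smul {p : ZMod 2} {x : DualNumber k} (c : k) (hx : Par p x) :
    Par p (c • x) := by
  constructor <;> intro h <;> simp [hx.1, hx.2, h]

lemma par_finsum {ι : Sort*} {p : ZMod 2} {f : ι → DualNumber k} (h : ∀ i, Par p (f i)) :
    Par p (∑ᶠ i, f i) := by
  refine finsum_induction (Par p) (par_zero p) (fun _ _ => Par.add) h

/-- The even and the odd line are the eigenspaces of the twist. On homogeneous elements twists thus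
become exponents, which can be compared in `ZMod 2`. -/
lemma Par.tau_eq {p : ZMod 2} {x : DualNumber k} (hx : Par p x) (n : ZMod 2) :
    PreCY.tau n x = sg k (n * p) • x := by
  rcases zmod_two_cases p with rfl | rfl
  · ext <;> simp [hx.1 rfl]
  · ext <;> simp [hx.2 rfl]

/-- The product of an element of parity `p` with `y` does not change if `y` is twisted by `p`. -/
lemma Par.mul_tau {p : ZMod 2} {x : DualNumber k} (hx : Par p x) (n : ZMod 2) (y : DualNumber k) :
    x * PreCY.tau (n + p) y = x * PreCY.tau n y := by
  rcases zmod_two_cases p with rfl | rfl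
  · simp
  · ext <;> simp [hx.2 rfl]

/-- A product is zero if both factors are odd, and then its sign does not matter. -/
lemma Par.smul_mul {p q : ZMod 2} {x y : DualNumber k} (hx : Par p x) (hy : Par q y)
    {m m' : ZMod 2} (n : ZMod 2) (h : m = m' + n * (p * q)) :
    sg k m • (x * y) = sg k m' • (x * y) := by
  rcases zmod_two_cases p with rfl | rfl <;> rcases zmod_two_cases q with rfl | rfl
  · simp_all
  · simp_all
  · simp_all
  · have : x * y = 0 := by ext <;> simp [hx.2 rfl, hy.2 rfl]
    rw [this, smul_zero, smul_zero]

lemma smul_finsum_mem_sg {ι : Type*} (n : ZMod 2) (s : Set ι) (f : ι → DualNumber k) :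
    sg k n • ∑ᶠ i ∈ s, f i = ∑ᶠ i ∈ s, sg k n • f i := by
  rw [smul_finsum]
  exact finsum_congr fun i => smul_finsum _ _
end Signs

/-! ### Letters and planar trees -/

/-- The letters of the words: directions and labels. -/
abbrev Letter (Λ : Type t) := Bool × Λ

/-- The other half of an edge. -/
def bar {Λ : Type t} (x : Letter Λ) : Letter Λ := (!x.1, x.2)

@[simp] lemma bar_bar {Λ : Type t} (x : Letter Λ) : bar (bar x) = x := by simp [bar]

@[simp] lemma bar_fst {Λ : Type t} (x : Letter Λ) : (bar x).1 = !x.1 := rfl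
@[simp] lemma bar_snd {Λ : Type t} (x : Letter Λ) : (bar x).2 = x.2 := rfl

/-- The parities of labels, the shift, and the objects at the ends of a label. -/
structure Grading (Λ : Type t) (O : Type u) where
  q : Λ → ZMod 2
  D : ZMod 2
  l : Λ → O
  r : Λ → O

namespace Grading
variable {Λ : Type t} {O : Type u} (γ : Grading Λ O)

/-- The parity of a letter. -/
def p (x : Letter Λ) : ZMod 2 := if x.1 then γ.q x.2 else γ.q x.2 + γ.D

/-- The parity of a word. -/
def pw (w : List (Letter Λ)) : ZMod 2 := (w.map γ.p).sum

/-- The exponent of the sign of an edge whose half nearer to the root is `x`. -/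
def η (x : Letter Λ) : ZMod 2 := if x.1 then (γ.D + 1) * (γ.q x.2 + γ.D) else 0

/-- The object before a letter in clockwise order. -/
def bef (x : Letter Λ) : O := if x.1 then γ.l x.2 else γ.r x.2

/-- The object after a letter in clockwise order. -/
def aft (x : Letter Λ) : O := if x.1 then γ.r x.2 else γ.l x.2

/-- `w` is a path from the object `a` to the object `b`. -/
def Chain (γ : Grading Λ O) : O → List (Letter Λ) → O → Prop
  | a, [], b => a = b
  | a, x :: w, b => a = γ.bef x ∧ γ.Chain (γ.aft x) w b

@[simp] lemma pw_nil : γ.pw [] = 0 := rfl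
@[simp] lemma pw_cons (x : Letter Λ) (w : List (Letter Λ)) : γ.pw (x :: w) = γ.p x + γ.pw w := by
  simp [pw]
@[simp] lemma pw_append (w w' : List (Letter Λ)) : γ.pw (w ++ w') = γ.pw w + γ.pw w' := by
  simp [pw]

/-- In a contraction the two halves of an edge stand together with one shift, of parity `D`, and the
three have total degree zero. -/
lemma p_bar (x : Letter Λ) : γ.p (bar x) = γ.p x + γ.D := by
  rcases x with ⟨_ | _, a⟩ <;> simp [p, bar]
  generalize γ.q a = s; generalize γ.D = t; decide +revert

/-- The sign of an edge depends on which half is nearer to the root; this is the correction that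
arises when the root moves across the edge, in `Tr.val_move`. -/
lemma η_bar (x : Letter Λ) : γ.η (bar x) = γ.η x + (γ.D + 1) * γ.p x := by
  rcases x with ⟨_ | _, a⟩ <;> simp [p, η, bar] <;>
    (generalize γ.q a = s; generalize γ.D = t; decide +revert)

@[simp] lemma bef_bar (x : Letter Λ) : γ.bef (bar x) = γ.aft x := by
  rcases x with ⟨_ | _, a⟩ <;> rfl

@[simp] lemma aft_bar (x : Letter Λ) : γ.aft (bar x) = γ.bef x := by
  rcases x with ⟨_ | _, a⟩ <;> rfl

lemma chain_append {a b : O} {w w' : List (Letter Λ)} :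
    γ.Chain a (w ++ w') b ↔ ∃ c, γ.Chain a w c ∧ γ.Chain c w' b := by
  induction w generalizing a with
  | nil => simp [Chain]
  | cons x w ih => simp [Chain, ih, and_assoc]

/-- `w` is a closed path. -/
def Coh (w : List (Letter Λ)) : Prop := ∃ a, γ.Chain a w a

lemma coh_rotate {w w' : List (Letter Λ)} : γ.Coh (w ++ w') → γ.Coh (w' ++ w) := by
  rintro ⟨a, h⟩
  obtain ⟨c, h1, h2⟩ := (γ.chain_append).1 h
  exact ⟨c, (γ.chain_append).2 ⟨a, h2, h1⟩⟩

lemma coh_cons {x : Letter Λ} {w : List (Letter Λ)} :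
    γ.Coh (x :: w) ↔ γ.Chain (γ.aft x) w (γ.bef x) := by
  constructor
  · rintro ⟨a, rfl, h⟩; exact h
  · intro h; exact ⟨_, rfl, h⟩
end Grading

/-- Planar trees of discs, seen from one disc: the list of its arrows, with the subtrees hanging
on them. -/
inductive Tr (Λ : Type t) : Type t
  | nil : Tr Λ
  | ext (x : Letter Λ) (rest : Tr Λ) : Tr Λ
  | edge (x : Letter Λ) (sub rest : Tr Λ) : Tr Λ

namespace Tr
variable {Λ : Type t} {O : Type u}

/-- The arrows of the disc. -/
def arr : Tr Λ → List (Letter Λ)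
  | nil => []
  | ext x r => x :: r.arr
  | edge x _ r => x :: r.arr

/-- The outer arrows of the tree. -/
def bd : Tr Λ → List (Letter Λ)
  | nil => []
  | ext x r => x :: r.bd
  | edge _ s r => s.bd ++ r.bd

/-- Concatenation. -/
def app : Tr Λ → Tr Λ → Tr Λ
  | nil, T => T
  | ext x r, T => ext x (r.app T)
  | edge x s r, T => edge x s (r.app T)

/-- All edges have labels in `E`, and no disc has just one arrow. -/
def Good (E : Λ → Prop) : Tr Λ → Prop
  | nil => True
  | ext _ r => r.Good E
  | edge x s r => E x.2 ∧ s ≠ nil ∧ s.Good E ∧ r.Good E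

@[simp] lemma app_nil (T : Tr Λ) : T.app nil = T := by
  induction T <;> simp_all [app]

@[simp] lemma nil_app (T : Tr Λ) : nil.app T = T := rfl

lemma app_assoc (R S T : Tr Λ) : (R.app S).app T = R.app (S.app T) := by
  induction R <;> simp_all [app]

@[simp] lemma arr_app (S T : Tr Λ) : (S.app T).arr = S.arr ++ T.arr := by
  induction S <;> simp_all [app, arr]

@[simp] lemma bd_app (S T : Tr Λ) : (S.app T).bd = S.bd ++ T.bd := by
  induction S <;> simp_all [app, bd]

@[simp] lemma good_app (E : Λ → Prop) (S T : Tr Λ) :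
    (S.app T).Good E ↔ S.Good E ∧ T.Good E := by
  induction S <;> simp_all [app, Good, and_assoc]

@[simp] lemma app_eq_nil (S T : Tr Λ) : S.app T = nil ↔ S = nil ∧ T = nil := by
  cases S <;> simp [app]

/-- Passing to hanging subtrees must end at an outer arrow, since `Good` forbids discs that have no
arrow besides the bold one. -/
lemma bd_ne_nil {E : Λ → Prop} {T : Tr Λ} (h : T.Good E) (h0 : T ≠ nil) : T.bd ≠ [] := by
  induction T with
  | nil => exact absurd rfl h0
  | ext x r _ => simp [bd]
  | edge x s r ihs _ => simp [bd, ihs h.2.2.1 h.2.1]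

variable {k : Type w} [Field k] (γ : Grading Λ O) (c : List (Letter Λ) → DualNumber k)

/-- The product, with signs, of the coefficients of the discs hanging on the disc at hand. -/
def om : Tr Λ → DualNumber k
  | nil => 1
  | ext _ r => r.om
  | edge x s r => sg k (γ.η x) • (tau (γ.pw r.arr) (c (bar x :: s.arr) * s.om) * r.om)

/-- The product, with signs, of the coefficients of all discs. -/
def val (T : Tr Λ) : DualNumber k := c T.arr * T.om γ c

/-- The arrows of `T` come after those of `S`, so the discs hanging on `S` have to be moved past
them; this is the twist. -/
lemma om_app (S T : Tr Λ) : (S.app T).om γ c = tau (γ.pw T.arr) (S.om γ c) * T.om γ c := by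
  induction S with
  | nil => simp [om]
  | ext x r ih => simp [om, app, ih]
  | edge x s r _ ih =>
    simp only [om, app, ih, arr_app, γ.pw_append, tau_smul, tau_mul, tau_tau, smul_mul_assoc,
      add_comm (γ.pw r.arr)]
    congr 1; ring
end Tr

/-! ### Systems of coefficients -/

variable {k : Type w} [Field k] {Λ : Type t} {O : Type u}

/-- The coefficients of a family of operations of total parity zero, as a function of cyclic
words. -/
structure Sys (γ : Grading Λ O) (c : List (Letter Λ) → DualNumber k) : Prop where
  two_le : ∀ w, c w ≠ 0 → 2 ≤ w.length
  cyc : ∀ x w, c (x :: w) = sg k (γ.p x * γ.pw w) • c (w ++ [x])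
  par : ∀ w, Par (γ.pw w + γ.D) (c w)
  coh : ∀ w, c w ≠ 0 → γ.Coh w
  fin : ∀ (n : ℕ) (Φ : Set Λ) (Ω : Set O), Φ.Finite → Ω.Finite →
    {w | w.length ≤ n ∧ (∀ x ∈ w, x.1 = false → x.2 ∈ Φ) ∧ (∀ x ∈ w, γ.l x.2 ∈ Ω ∧ γ.r x.2 ∈ Ω) ∧
      c w ≠ 0}.Finite

open Classical in
/-- The sum of the values of all trees with edges labelled in `E` and given outer arrows. -/
def TS (γ : Grading Λ O) (c : List (Letter Λ) → DualNumber k) (E : Λ → Prop) :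
    List (Letter Λ) → DualNumber k
  | [] => 0
  | x :: w => ∑ᶠ L ∈ {L : Tr Λ | L.bd = w ∧ L.Good E}, (Tr.ext x L).val γ c

namespace Tr
variable {γ : Grading Λ O} {c : List (Letter Λ) → DualNumber k}

/-- A hanging disc contributes the parity of its arrows plus `D`, and by `p_bar` the two halves of
an edge together have parity `D`. What survives are the arrows of the disc at hand and the outer
arrows. -/
lemma par_om (hc : ∀ w, Par (γ.pw w + γ.D) (c w)) (T : Tr Λ) :
    Par (γ.pw T.arr + γ.pw T.bd) (T.om γ c) := by
  induction T with
  | nil => simpa [arr, bd, om] using par_one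
  | ext x r ih =>
    have : γ.pw (ext x r).arr + γ.pw (ext x r).bd = γ.pw r.arr + γ.pw r.bd := by
      simp only [arr, bd, γ.pw_cons]; grind
    rw [this]; exact ih
  | edge x s r ihs ihr =>
    have h := ((((hc (bar x :: s.arr)).mul ihs).tau (γ.pw r.arr)).mul ihr).smul (sg k (γ.η x))
    have h2 : γ.pw (edge x s r).arr + γ.pw (edge x s r).bd = γ.pw (bar x :: s.arr) + γ.D +
        (γ.pw s.arr + γ.pw s.bd) + (γ.pw r.arr + γ.pw r.bd) := by
      simp only [arr, bd, γ.pw_cons, γ.pw_append, γ.p_bar]; grind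
    rw [h2]
    exact h

lemma par_val (hc : ∀ w, Par (γ.pw w + γ.D) (c w)) (T : Tr Λ) :
    Par (γ.pw T.bd + γ.D) (T.val γ c) := by
  have h := (hc T.arr).mul (par_om hc T)
  have h2 : γ.pw T.bd + γ.D = γ.pw T.arr + γ.D + (γ.pw T.arr + γ.pw T.bd) := by grind
  rw [h2]
  exact h

lemma om_edge_ne_zero {x : Letter Λ} {s r : Tr Λ} (h : (edge x s r).om γ c ≠ 0) :
    c (bar x :: s.arr) ≠ 0 ∧ s.om γ c ≠ 0 ∧ r.om γ c ≠ 0 := by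
  have h1 : tau (γ.pw r.arr) (c (bar x :: s.arr) * s.om γ c) * r.om γ c ≠ 0 :=
    fun h0 => h (by simp only [om, h0, smul_zero])
  have h2 : c (bar x :: s.arr) * s.om γ c ≠ 0 := fun h0 => h1 (by simp [h0])
  exact ⟨left_ne_zero_of_mul h2, right_ne_zero_of_mul h2, right_ne_zero_of_mul h1⟩

lemma chain_bd (hc : ∀ w, c w ≠ 0 → γ.Coh w) {T : Tr Λ} (h : T.om γ c ≠ 0) {a b : O}
    (hT : γ.Chain a T.arr b) : γ.Chain a T.bd b := by
  induction T generalizing a b with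
  | nil => exact hT
  | ext x r ih => exact ⟨hT.1, ih h hT.2⟩
  | edge x s r ihs ihr =>
    obtain ⟨h1, h2, h3⟩ := om_edge_ne_zero h
    have h4 := (γ.coh_cons).1 (hc _ h1)
    rw [γ.aft_bar, γ.bef_bar] at h4
    obtain ⟨rfl, h5⟩ := hT
    exact (γ.chain_append).2 ⟨_, ihs h2 h4, ihr h3 h5⟩
end Tr
end
section
variable {k : Type w} [Field k] {Λ : Type t} {O : Type u}

/-! ### Independence of the root -/

namespace Tr
/-- Move the root to the last outer arrow. The first argument lists the arrows already passed. -/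
def zip : Tr Λ → Tr Λ → Tr Λ
  | R, nil => R
  | R, ext x nil => ext x R
  | R, ext x (ext y r) => zip (R.app (ext x nil)) (ext y r)
  | R, ext x (edge y s r) => zip (R.app (ext x nil)) (edge y s r)
  | R, edge x s nil => zip (edge (bar x) R nil) s
  | R, edge x s (ext y r) => zip (R.app (edge x s nil)) (ext y r)
  | R, edge x s (edge y s' r) => zip (R.app (edge x s nil)) (edge y s' r)

/-- Move the root to the first outer arrow. -/
def unzip : Tr Λ → Tr Λ → Tr Λ
  | nil, acc => acc
  | ext x r, acc => ext x (r.app acc)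
  | edge x s r, acc => unzip s (edge (bar x) (r.app acc) nil)

/-- Remove the first arrow. -/
def tail : Tr Λ → Tr Λ
  | nil => nil
  | ext _ r => r
  | edge _ _ r => r

lemma zip_ext {R r : Tr Λ} (x : Letter Λ) (h : r ≠ nil) :
    zip R (ext x r) = zip (R.app (ext x nil)) r := by
  cases r <;> simp_all [zip]

lemma zip_edge {R s r : Tr Λ} (x : Letter Λ) (h : r ≠ nil) :
    zip R (edge x s r) = zip (R.app (edge x s nil)) r := by
  cases r <;> simp_all [zip]

lemma zip_app (R : Tr Λ) (S : Tr Λ) {T : Tr Λ} (hT : T ≠ nil) :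
    zip R (S.app T) = zip (R.app S) T := by
  induction S generalizing R with
  | nil => simp
  | ext x r ih => rw [app, zip_ext x (by simp [hT]), ih, app_assoc]; rfl
  | edge x s r _ ih => rw [app, zip_edge x (by simp [hT]), ih, app_assoc]; rfl

lemma unzip_app (S : Tr Λ) (hS : S ≠ nil) (T acc : Tr Λ) :
    unzip (S.app T) acc = unzip S (T.app acc) := by
  cases S with
  | nil => exact absurd rfl hS
  | ext x r => simp [app, unzip, app_assoc]
  | edge x s r => simp [app, unzip, app_assoc]

/-- Induction along the path to the last outer arrow. -/
lemma zip_induction {E : Λ → Prop} {P : Tr Λ → Tr Λ → Prop}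
    (h1 : ∀ R x, P R (ext x nil))
    (h2 : ∀ R x r, r ≠ nil → P (R.app (ext x nil)) r → P R (ext x r))
    (h3 : ∀ R x s, R ≠ nil → R.Good E → E x.2 → s ≠ nil → P (edge (bar x) R nil) s →
      P R (edge x s nil))
    (h4 : ∀ R x s r, r ≠ nil → s ≠ nil → P (R.app (edge x s nil)) r → P R (edge x s r))
    (R S : Tr Λ) (hR0 : R ≠ nil) (hR : R.Good E) (hS0 : S ≠ nil) (hS : S.Good E) : P R S := by
  induction S generalizing R with
  | nil => exact absurd rfl hS0
  | ext x r ih =>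
    by_cases hr : r = nil
    · subst hr; exact h1 R x
    · exact h2 R x r hr (ih _ (by simp [hR0]) (by simp [hR, Good]) hr hS)
  | edge x s r ihs ihr =>
    obtain ⟨hx, hs0, hs, hrG⟩ := hS
    by_cases hr : r = nil
    · subst hr
      exact h3 R x s hR0 hR hx hs0 (ihs _ (by simp) ⟨hx, hR0, hR, trivial⟩ hs0 hs)
    · exact h4 R x s r hr hs0
        (ihr _ (by simp [hR0]) (by simp [hR, Good, hx, hs0, hs]) hr hrG)

lemma zip_spec {E : Λ → Prop} (R S : Tr Λ) (hR0 : R ≠ nil) (hR : R.Good E) (hS0 : S ≠ nil)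
    (hS : S.Good E) :
    ∃ y R', zip R S = ext y R' ∧ R'.Good E ∧ R.bd ++ S.bd = R'.bd ++ [y] := by
  refine zip_induction (E := E)
    (P := fun R S => R.Good E → S.Good E → ∃ y R', zip R S = ext y R' ∧ R'.Good E ∧
      R.bd ++ S.bd = R'.bd ++ [y]) ?_ ?_ ?_ ?_ R S hR0 hR hS0 hS hR hS
  · intro R x hR _
    exact ⟨x, R, rfl, hR, by simp [bd]⟩
  · intro R x r hr ih hR hS
    obtain ⟨y, R', h1, h2, h3⟩ := ih (by simp [hR, Good]) hS
    exact ⟨y, R', by rw [zip_ext x hr, h1], h2, by simpa [bd] using h3⟩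
  · intro R x s hR0 hR hx hs ih _ hS
    obtain ⟨y, R', h1, h2, h3⟩ := ih ⟨hx, hR0, hR, trivial⟩ hS.2.2.1
    exact ⟨y, R', by rw [zip, h1], h2, by simpa [bd] using h3⟩
  · intro R x s r hr hs ih hR hS
    obtain ⟨y, R', h1, h2, h3⟩ := ih (by simp [hR, Good, hS.1, hs, hS.2.2.1]) hS.2.2.2
    exact ⟨y, R', by rw [zip_edge x hr, h1], h2, by simpa [bd] using h3⟩

/-- Each move of `zip` shifts the reading point on a disc or crosses an edge. Rerooting at the first
outer arrow gives the same tree before and after such a move, so `unzip` undoes `zip`. -/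
lemma unzip_zip {E : Λ → Prop} (R S : Tr Λ) (hR0 : R ≠ nil) (hR : R.Good E) (hS0 : S ≠ nil)
    (hS : S.Good E) {y : Letter Λ} {R' : Tr Λ} (h : zip R S = ext y R') :
    unzip (R'.app (ext y nil)) nil = unzip (R.app S) nil := by
  revert y R'
  refine zip_induction (E := E)
    (P := fun R S => ∀ {y : Letter Λ} {R' : Tr Λ}, zip R S = ext y R' →
      unzip (R'.app (ext y nil)) nil = unzip (R.app S) nil) ?_ ?_ ?_ ?_ R S hR0 hR hS0 hS
  · intro R x y R' h
    simp only [zip, ext.injEq] at h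
    obtain ⟨rfl, rfl⟩ := h
    rfl
  · intro R x r hr ih y R' h
    rw [zip_ext x hr] at h
    rw [ih h, app_assoc]; rfl
  · intro R x s hR0 hR hx hs ih y R' h
    rw [zip] at h
    rw [ih h, app, unzip, bar_bar, unzip_app _ hR0]
    simp [app]
  · intro R x s r hr hs ih y R' h
    rw [zip_edge x hr] at h
    rw [ih h, app_assoc]; rfl

/-- Supplies the other half of the bijection in `TS_cyc`: `zip`, started at the first outer arrow,
passes back through the disc from which `unzip` came. -/
lemma unzip_spec {E : Λ → Prop} (S acc : Tr Λ) (hS0 : S ≠ nil) (hS : S.Good E)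
    (hacc0 : acc ≠ nil) (hacc : acc.Good E) :
    ∃ x L, unzip S acc = ext x L ∧ L ≠ nil ∧ L.Good E ∧ S.bd ++ acc.bd = x :: L.bd ∧
      zip (ext x nil) L = zip nil (S.app acc) := by
  induction S generalizing acc with
  | nil => exact absurd rfl hS0
  | ext x r =>
    refine ⟨x, r.app acc, rfl, by simp [hacc0], by simp [hacc]; exact hS, by simp [bd], ?_⟩
    rw [app, zip_ext x (by simp [hacc0])]; rfl
  | edge x s r ihs =>
    obtain ⟨hx, hs0, hs, hr⟩ := hS
    obtain ⟨y, L, h1, h2, h3, h4, h5⟩ := ihs (edge (bar x) (r.app acc) nil) hs0 hs (by simp)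
      ⟨hx, by simp [hacc0], by simp [hr, hacc], trivial⟩
    refine ⟨y, L, h1, h2, h3, by simpa [bd] using h4, ?_⟩
    rw [h5, zip_app _ _ (by simp), nil_app, app, zip_edge x (by simp [hacc0]), zip, bar_bar]

    rfl

variable {γ : Grading Λ O} {c : List (Letter Λ) → DualNumber k}

lemma cyc_append (hc : ∀ x w, c (x :: w) = sg k (γ.p x * γ.pw w) • c (w ++ [x]))
    (w w' : List (Letter Λ)) : c (w ++ w') = sg k (γ.pw w * γ.pw w') • c (w' ++ w) := by
  induction w generalizing w' with
  | nil => simp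
  | cons x w ih =>
    rw [List.cons_append, hc, List.append_assoc, ih, smul_smul, ← sg_add]
    simp only [List.append_assoc, List.singleton_append, γ.pw_cons, γ.pw_append, γ.pw_nil]
    congr 2
    grind

lemma sg_smul_eq_iff {n : ZMod 2} {x y : DualNumber k} : sg k n • x = y ↔ x = sg k n • y := by
  constructor <;> rintro rfl <;> rw [smul_smul, sg_mul_self, one_smul]

/-- Rotation of the arrows of the disc at hand. -/
lemma val_rotate (hc : ∀ x w, c (x :: w) = sg k (γ.p x * γ.pw w) • c (w ++ [x]))
    (hp : ∀ w, Par (γ.pw w + γ.D) (c w)) (R S : Tr Λ) :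
    (R.app S).val γ c = sg k (γ.pw R.bd * γ.pw S.bd) • (S.app R).val γ c := by
  simp only [val, arr_app, om_app]
  rw [cyc_append hc R.arr S.arr, (par_om hp R).tau_eq, (par_om hp S).tau_eq]
  simp only [smul_mul_assoc, mul_smul_comm, smul_smul, ← sg_add]
  rw [mul_comm (om γ c S), mul_comm (c _)]
  refine (smul_mul_assoc _ _ _).symm.trans (Eq.trans (congrArg (· * _) ?_) (smul_mul_assoc _ _ _))
  -- The two exponents differ by the product of the parities of the two `om` factors. If that is
  -- nonzero both factors are odd, and their product vanishes since `ε² = 0`.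
  refine (par_om hp R).smul_mul (par_om hp S) 1 ?_
  generalize γ.pw S.arr = s
  generalize γ.pw R.arr = r
  generalize γ.pw S.bd = s'
  generalize γ.pw R.bd = r'
  decide +revert

/-- Moving the root across an edge. -/
lemma val_move (hc : ∀ x w, c (x :: w) = sg k (γ.p x * γ.pw w) • c (w ++ [x]))
    (hp : ∀ w, Par (γ.pw w + γ.D) (c w)) (R s : Tr Λ) (x : Letter Λ) :
    (R.app (edge x s nil)).val γ c = (edge (bar x) R s).val γ c := by
  simp only [val, arr_app, om_app, arr, om, bar_bar, mul_one, γ.pw_cons, γ.pw_nil, add_zero,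
    tau_zero]
  rw [cyc_append hc R.arr [x], (par_om hp R).tau_eq]
  have hR := (hp (x :: R.arr)).mul (par_om hp R)
  rw [hR.tau_eq]
  simp only [List.singleton_append, γ.pw_cons, γ.pw_nil, add_zero, smul_mul_assoc, mul_smul_comm,
    smul_smul, ← sg_add, γ.η_bar]
  rw [show c (x :: R.arr) * (om γ c R * (c (bar x :: s.arr) * om γ c s)) =
    (c (bar x :: s.arr) * (c (x :: R.arr) * om γ c R)) * om γ c s by ring,
    show c (bar x :: s.arr) * (c (x :: R.arr) * om γ c R * om γ c s) =
    (c (bar x :: s.arr) * (c (x :: R.arr) * om γ c R)) * om γ c s by ring]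
  refine (smul_mul_assoc _ _ _).symm.trans (Eq.trans (congrArg (· * _) ?_) (smul_mul_assoc _ _ _))
  -- Again the exponents agree up to the product of two parities, now those of the disc beyond the
  -- edge and of everything on the near side.
  refine (hp (bar x :: s.arr)).smul_mul hR 1 ?_
  rw [γ.pw_cons, γ.pw_cons, γ.p_bar]
  generalize γ.pw R.arr = r
  generalize γ.pw R.bd = r'
  generalize γ.pw s.arr = s
  generalize γ.p x = x
  generalize γ.D = d
  generalize γ.η _ = e
  decide +revert

/-- Crossing an edge costs nothing by `val_move`; the only sign comes from the last rotation, on the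
disc that carries the new root. -/
lemma zip_val {E : Λ → Prop} (hc : ∀ x w, c (x :: w) = sg k (γ.p x * γ.pw w) • c (w ++ [x]))
    (hp : ∀ w, Par (γ.pw w + γ.D) (c w)) (R S : Tr Λ) (hR0 : R ≠ nil) (hR : R.Good E)
    (hS0 : S ≠ nil) (hS : S.Good E) {y : Letter Λ} {R' : Tr Λ} (h : zip R S = ext y R') :
    (R.app S).val γ c = sg k (γ.p y * γ.pw R'.bd) • (ext y R').val γ c := by
  revert y R'
  refine zip_induction (E := E)
    (P := fun R S => ∀ {y : Letter Λ} {R' : Tr Λ}, zip R S = ext y R' →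
      (R.app S).val γ c = sg k (γ.p y * γ.pw R'.bd) • (ext y R').val γ c)
    ?_ ?_ ?_ ?_ R S hR0 hR hS0 hS
  · intro R x y R' h
    simp only [zip, ext.injEq] at h
    obtain ⟨rfl, rfl⟩ := h
    rw [val_rotate hc hp, mul_comm]
    simp [bd, app]
  · intro R x r hr ih y R' h
    rw [zip_ext x hr] at h
    rw [← ih h, app_assoc]; rfl
  · intro R x s hR0 hR hx hs ih y R' h
    rw [zip] at h
    rw [← ih h, val_move hc hp]; rfl
  · intro R x s r hr hs ih y R' h
    rw [zip_edge x hr] at h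
    rw [← ih h, app_assoc]; rfl
end Tr

open Tr

/-- The sum over trees is invariant under cyclic permutations, i.e. it does not depend on the
root. -/
lemma TS_cyc {γ : Grading Λ O} {c : List (Letter Λ) → DualNumber k} (E : Λ → Prop)
    (h2 : ∀ w, c w ≠ 0 → 2 ≤ w.length)
    (hc : ∀ x w, c (x :: w) = sg k (γ.p x * γ.pw w) • c (w ++ [x]))
    (hp : ∀ w, Par (γ.pw w + γ.D) (c w)) (x : Letter Λ) (w : List (Letter Λ)) :
    TS γ c E (x :: w) = sg k (γ.p x * γ.pw w) • TS γ c E (w ++ [x]) := by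
  have h1 : ∀ y, c [y] = 0 := by
    intro y
    by_contra h; exact absurd (h2 _ h) (by simp)
  rcases w with _ | ⟨z, w⟩
  · simp
  rw [← sg_smul_eq_iff, List.cons_append]
  simp only [TS]
  rw [smul_finsum_mem_sg]
  symm
  have key : ∀ L : Tr Λ, L.bd = w ++ [x] → L.Good E → ∃ R, zip (ext z nil) L = ext x R ∧
      R.Good E ∧ R.bd = z :: w := by
    intro L hb hL
    have hL0 : L ≠ nil := by rintro rfl; simp [bd] at hb
    obtain ⟨y, R', e1, e2, e3⟩ := zip_spec (ext z nil) L (by simp) (E := E) trivial hL0 hL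
    rw [hb] at e3
    obtain ⟨e4, e5⟩ := List.append_inj' (s₁ := z :: w) (t₁ := [x]) (s₂ := R'.bd) (t₂ := [y])
      (by simpa [bd] using e3) rfl
    obtain rfl : x = y := by simpa using e5
    exact ⟨R', e1, e2, e4.symm⟩
  -- A tree rooted at `z` whose last outer arrow is `x` is rerooted at `x`; `unzip` provides the
  -- inverse.
  refine finsum_mem_eq_of_bijOn (fun L => (zip (ext z nil) L).tail) ?_ ?_
  · refine Set.InvOn.bijOn (f' := fun R => (unzip (R.app (ext x nil)) nil).tail) ⟨?_, ?_⟩ ?_ ?_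
    · rintro L ⟨hb, hL⟩
      have hL0 : L ≠ nil := by rintro rfl; simp [bd] at hb
      obtain ⟨R, e1, -⟩ := key L hb hL
      have := unzip_zip (E := E) (ext z nil) L (by simp) trivial hL0 hL e1
      simp [e1, tail, this, unzip, app]
    · rintro R ⟨hb, hR⟩
      have hR0 : R ≠ nil := by rintro rfl; simp [bd] at hb
      obtain ⟨y, L, e1, e2, e3, e4, e5⟩ := unzip_spec (E := E) R (ext x nil) hR0 hR (by simp) trivial
      obtain ⟨rfl, e6⟩ : z = y ∧ w ++ [x] = L.bd := by simpa [bd, hb] using e4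
      have : zip nil (R.app (ext x nil)) = ext x R := by rw [zip_app _ _ (by simp)]; rfl
      simp [unzip_app _ hR0, app, e1, tail, e5, this]
    · rintro L ⟨hb, hL⟩
      obtain ⟨R, e1, e2, e3⟩ := key L hb hL
      simp [e1, e2, e3, tail]
    · rintro R ⟨hb, hR⟩
      have hR0 : R ≠ nil := by rintro rfl; simp [bd] at hb
      obtain ⟨y, L, e1, e2, e3, e4, e5⟩ := unzip_spec (E := E) R (ext x nil) hR0 hR (by simp) trivial
      obtain ⟨rfl, e6⟩ : z = y ∧ w ++ [x] = L.bd := by simpa [bd, hb] using e4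
      simp [unzip_app _ hR0, app, e1, tail, e3, e6]
  · rintro L ⟨hb, hL⟩
    have hL0 : L ≠ nil := by rintro rfl; simp [bd] at hb
    obtain ⟨R, e1, e2, e3⟩ := key L hb hL
    have := zip_val (E := E) hc hp (ext z nil) L (by simp) trivial hL0 hL e1
    rw [e3] at this
    simp only [e1, tail]
    exact this
end
section
variable {k : Type w} [Field k] {Λ : Type t} {O : Type u}

/-! ### Finiteness of the sums over trees -/

/-- There is a bounded rank of letters which decreases when passing a disc with two arrows. -/
def Ranked (c : List (Letter Λ) → DualNumber k) : Prop :=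
  ∃ (r : Letter Λ → ℕ) (N : ℕ), (∀ x, r x ≤ N) ∧ ∀ x y, c [x, y] ≠ 0 → r (bar y) < r x

namespace Tr
/-- The number of edges. -/
def numEdges : Tr Λ → ℕ
  | nil => 0
  | ext _ r => r.numEdges
  | edge _ s r => 1 + s.numEdges + r.numEdges

/-- The number of arrows and edges. -/
def size : Tr Λ → ℕ
  | nil => 0
  | ext _ r => 1 + r.size
  | edge _ s r => 1 + s.size + r.size

/-- All labels satisfy `P`. -/
def Lab (P : Λ → Prop) : Tr Λ → Prop
  | nil => True
  | ext x r => P x.2 ∧ r.Lab P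
  | edge x s r => P x.2 ∧ s.Lab P ∧ r.Lab P

/-- The subtrees hanging on the disc at hand. -/
def subs : Tr Λ → List (Letter Λ × Tr Λ)
  | nil => []
  | ext _ r => r.subs
  | edge x s r => (x, s) :: r.subs

lemma size_eq (L : Tr Λ) : L.size = L.bd.length + L.numEdges := by
  induction L with
  | nil => rfl
  | ext x r ih => simp [size, bd, numEdges, ih]; omega
  | edge x s r ihs ihr => simp [size, bd, numEdges, ihs, ihr]; omega

lemma length_arr_le (L : Tr Λ) : L.arr.length ≤ L.size := by
  induction L <;> simp_all [arr, size] <;> omega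

lemma lab_iff (P : Λ → Prop) (L : Tr Λ) :
    L.Lab P ↔ (∀ y ∈ L.arr, P y.2) ∧ ∀ e ∈ L.subs, e.2.Lab P := by
  induction L with
  | nil => simp [Lab, arr, subs]
  | ext x r ih => simp only [Lab, arr, subs, ih, List.forall_mem_cons, and_assoc]
  | edge x s r _ ih =>
    simp only [Lab, arr, subs, ih, List.forall_mem_cons]
    tauto

lemma Lab.mono {P Q : Λ → Prop} (h : ∀ a, P a → Q a) {L : Tr Λ} (hL : L.Lab P) : L.Lab Q := by
  induction L with
  | nil => trivial
  | ext x r ih => exact ⟨h _ hL.1, ih hL.2⟩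
  | edge x s r ihs ihr => exact ⟨h _ hL.1, ihs hL.2.1, ihr hL.2.2⟩

lemma mem_arr {L : Tr Λ} {y : Letter Λ} (h : y ∈ L.arr) : y ∈ L.bd ∨ ∃ s, (y, s) ∈ L.subs := by
  induction L with
  | nil => simp [arr] at h
  | ext x r ih =>
    simp only [arr, bd, subs, List.mem_cons] at h ⊢
    rcases h with rfl | h
    · exact Or.inl (Or.inl rfl)
    · exact (ih h).imp_left Or.inr
  | edge x s r _ ih =>
    simp only [arr, bd, subs, List.mem_cons, List.mem_append] at h ⊢
    rcases h with rfl | h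
    · exact Or.inr ⟨s, Or.inl rfl⟩
    · rcases ih h with h | ⟨s, h⟩
      · exact Or.inl (Or.inr h)
      · exact Or.inr ⟨s, Or.inr h⟩

lemma mem_subs {E : Λ → Prop} {γ : Grading Λ O} {c : List (Letter Λ) → DualNumber k} {L : Tr Λ}
    {y : Letter Λ} {s : Tr Λ} (hL : L.Good E) (h0 : L.om γ c ≠ 0) (h : (y, s) ∈ L.subs) :
    y ∈ L.arr ∧ s.Good E ∧ s.size < L.size ∧ (∀ z ∈ s.bd, z ∈ L.bd) ∧ c (bar y :: s.arr) ≠ 0 ∧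
      s.om γ c ≠ 0 := by
  induction L with
  | nil => simp [subs] at h
  | ext x r ih =>
    obtain ⟨h1, h2, h3, h4, h5⟩ := ih hL h0 h
    refine ⟨by simp [arr, h1], h2, by simp [size]; omega, fun z hz => ?_, h5⟩
    simp [bd, h4 z hz]
  | edge x s' r _ ih =>
    obtain ⟨e1, e2, e3⟩ := om_edge_ne_zero h0
    simp only [subs, List.mem_cons, Prod.mk.injEq] at h
    rcases h with ⟨rfl, rfl⟩ | h
    · exact ⟨by simp [arr], hL.2.2.1, by simp [size]; omega, fun z hz => by simp [bd, hz], e1, e2⟩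
    · obtain ⟨h1, h2, h3, h4, h5⟩ := ih hL.2.2.2 e3 h
      refine ⟨by simp [arr, h1], h2, by simp [size]; omega, fun z hz => ?_, h5⟩
      simp [bd, h4 z hz]

lemma finite_of_size (Ψ : Set Λ) (hΨ : Ψ.Finite) (n : ℕ) :
    {L : Tr Λ | L.size ≤ n ∧ L.Lab (· ∈ Ψ)}.Finite := by
  induction n with
  | zero =>
    refine (Set.finite_singleton nil).subset ?_
    rintro (_ | _ | _) ⟨h, -⟩ <;> simp [size] at h ⊢
  | succ n ih =>
    have hX : {x : Letter Λ | x.2 ∈ Ψ}.Finite :=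
      (Set.finite_univ.prod hΨ).subset (fun x hx => ⟨Set.mem_univ x.1, hx⟩)
    refine ((Set.finite_singleton nil).union ((Set.Finite.image2 ext hX ih).union
      (Set.Finite.image2 (fun x (e : Tr Λ × Tr Λ) => edge x e.1 e.2) hX (ih.prod ih)))).subset ?_
    rintro (_ | ⟨x, r⟩ | ⟨x, s, r⟩) ⟨h, hl⟩
    · simp
    · exact Or.inr (Or.inl ⟨x, hl.1, r, ⟨by simp [size] at h; omega, hl.2⟩, rfl⟩)
    · refine Or.inr (Or.inr ⟨x, hl.1, (s, r), ⟨⟨?_, hl.2.1⟩, ⟨?_, hl.2.2⟩⟩, rfl⟩) <;>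
      · simp only [size] at h ⊢; omega

variable {γ : Grading Λ O} {c : List (Letter Λ) → DualNumber k} {E : Λ → Prop}

/-- A potential argument: an outer arrow is worth `2 * (N + 1)`, an arrow of the disc at hand costs
`N + 1`. A disc with two or more arrows besides its bold one pays for itself. A disc with just one
such arrow runs up a debt of one edge, but the rank drops there, so that the debt along a chain of
such discs never exceeds `N`. -/
lemma numEdges_le {r : Letter Λ → ℕ} {N : ℕ} (hN : ∀ x, r x ≤ N)
    (hr : ∀ x y, c [x, y] ≠ 0 → r (bar y) < r x) (L : Tr Λ) (hL : L.Good E) (h0 : L.om γ c ≠ 0) :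
    L.numEdges + (N + 1) * L.arr.length ≤ 2 * (N + 1) * L.bd.length ∧
    ∀ x, c (x :: L.arr) ≠ 0 → L ≠ nil →
      L.numEdges + 2 * (N + 1) ≤ r x + 2 * (N + 1) * L.bd.length := by
  have aux : ∀ {L : Tr Λ}, 2 ≤ L.arr.length →
      L.numEdges + (N + 1) * L.arr.length ≤ 2 * (N + 1) * L.bd.length →
      L.numEdges + 2 * (N + 1) ≤ 2 * (N + 1) * L.bd.length := by
    intro L h1 h2
    have : (N + 1) * 2 ≤ (N + 1) * L.arr.length := Nat.mul_le_mul_left _ h1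
    omega
  induction L with
  | nil => simp [numEdges, arr, bd]
  | ext y t ih =>
    have hA : (ext y t).numEdges + (N + 1) * (ext y t).arr.length ≤
        2 * (N + 1) * (ext y t).bd.length := by
      have := (ih hL h0).1
      simp only [numEdges, arr, bd, List.length_cons, mul_add, add_mul] at this ⊢
      omega
    refine ⟨hA, fun x hx _ => ?_⟩
    by_cases ht : t = nil
    · subst ht; simp [numEdges, bd]
    · have : 2 ≤ (ext y t).arr.length := by cases t <;> simp_all [arr]
      have := aux this hA
      omega
  | edge y s t ihs iht =>
    obtain ⟨e1, e2, e3⟩ := om_edge_ne_zero h0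
    have hs := (ihs hL.2.2.1 e2).2 _ e1 hL.2.1
    have hN' := hN (bar y)
    have hA : (edge y s t).numEdges + (N + 1) * (edge y s t).arr.length ≤
        2 * (N + 1) * (edge y s t).bd.length := by
      have := (iht hL.2.2.2 e3).1
      simp only [numEdges, arr, bd, List.length_cons, List.length_append, mul_add, add_mul]
        at this hs ⊢
      omega
    refine ⟨hA, fun x hx _ => ?_⟩
    by_cases ht : t = nil
    · subst ht
      -- The disc has no arrows but `x` and `y`: the additional edge is paid for by the drop of the
      -- rank from `x` to `bar y`.
      have := hr x y hx
      simp only [numEdges, bd, List.append_nil]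
      omega
    · have : 2 ≤ (edge y s t).arr.length := by cases t <;> simp_all [arr]
      have := aux this hA
      omega

lemma chain_mem {Ω : Set O} {w : List (Letter Λ)} (hw : w ≠ [])
    (h : ∀ x ∈ w, γ.l x.2 ∈ Ω ∧ γ.r x.2 ∈ Ω) {a b : O} (hc : γ.Chain a w b) : a ∈ Ω ∧ b ∈ Ω := by
  have h1 : ∀ x ∈ w, γ.bef x ∈ Ω ∧ γ.aft x ∈ Ω := by
    rintro ⟨_ | _, a⟩ hx
    · exact (h _ hx).symm
    · exact h _ hx
  clear h
  induction w generalizing a with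
  | nil => exact absurd rfl hw
  | cons x w ih =>
    obtain ⟨rfl, hc⟩ := hc
    refine ⟨(h1 x (by simp)).1, ?_⟩
    rcases w with _ | ⟨y, w⟩
    · obtain rfl : γ.aft x = b := hc
      exact (h1 x (by simp)).2
    · exact (ih (by simp) hc (fun z hz => h1 z (by simp [hz]))).2

/-- By `chain_bd` the objects at an inner edge are the ends of the path of outer arrows beyond it,
so no new objects occur inside the tree. -/
lemma lab_obj (hc : ∀ w, c w ≠ 0 → γ.Coh w) {Ω : Set O} (L : Tr Λ) (hL : L.Good E)
    (h0 : L.om γ c ≠ 0) (h : ∀ x ∈ L.bd, γ.l x.2 ∈ Ω ∧ γ.r x.2 ∈ Ω) :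
    L.Lab (fun a => γ.l a ∈ Ω ∧ γ.r a ∈ Ω) := by
  induction L with
  | nil => trivial
  | ext x r ih => exact ⟨h x (by simp [bd]), ih hL h0 (fun y hy => h y (by simp [bd, hy]))⟩
  | edge x s r ihs ihr =>
    obtain ⟨e1, e2, e3⟩ := om_edge_ne_zero h0
    have h4 := (γ.coh_cons).1 (hc _ e1)
    rw [γ.aft_bar, γ.bef_bar] at h4
    have hs : ∀ y ∈ s.bd, γ.l y.2 ∈ Ω ∧ γ.r y.2 ∈ Ω := fun y hy => h y (by simp [bd, hy])
    have h5 := chain_mem (bd_ne_nil hL.2.2.1 hL.2.1) hs (chain_bd hc e2 h4)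
    refine ⟨?_, ihs hL.2.2.1 e2 hs, ihr hL.2.2.2 e3 (fun y hy => h y (by simp [bd, hy]))⟩
    rcases x with ⟨_ | _, a⟩
    · exact h5.symm
    · exact h5

/-- Finiteness flows along the arrows: if the input labels and the objects of a disc lie in finite
sets, then `Sys.fin` leaves finitely many words. The root disc is bounded by means of the subtrees
feeding it, and then bounds the subtrees that it feeds. -/
lemma lab_finite (hc : Sys γ c) (n : ℕ) (Φ : Set Λ) (Ω : Set O) (hΦ : Φ.Finite) (hΩ : Ω.Finite) :
    ∃ Ψ : Set Λ, Ψ.Finite ∧ ∀ (x : Letter Λ) (L : Tr Λ), L.Good E → L.size ≤ n → L.om γ c ≠ 0 →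
      c (x :: L.arr) ≠ 0 → (∀ y ∈ x :: L.bd, y.1 = false → y.2 ∈ Φ) →
      (γ.l x.2 ∈ Ω ∧ γ.r x.2 ∈ Ω) → L.Lab (fun a => γ.l a ∈ Ω ∧ γ.r a ∈ Ω) →
      x.2 ∈ Ψ ∧ L.Lab (· ∈ Ψ) := by
  induction n generalizing Φ with
  | zero =>
    refine ⟨∅, Set.finite_empty, fun x L _ hs _ h => ?_⟩
    have h1 := hc.two_le _ h
    have h2 := L.length_arr_le
    simp only [List.length_cons] at h1
    omega
  | succ n ih =>
    -- `Ψ₁` contains the labels entering the root disc from subtrees: their bold arrow is outgoing,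
    -- so all their inputs are outer arrows of the whole tree.
    obtain ⟨Ψ₁, hΨ₁, h₁⟩ := ih Φ hΦ
    have hS := hc.fin (n + 2) (Φ ∪ Ψ₁) Ω (hΦ.union hΨ₁) hΩ
    set S := {w | w.length ≤ n + 2 ∧ (∀ x ∈ w, x.1 = false → x.2 ∈ Φ ∪ Ψ₁) ∧
      (∀ x ∈ w, γ.l x.2 ∈ Ω ∧ γ.r x.2 ∈ Ω) ∧ c w ≠ 0} with hSdef
    have hΨ₂ : (⋃ w ∈ S, {a | a ∈ w.map Prod.snd}).Finite :=
      hS.biUnion fun w _ => List.finite_toSet _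
    set Ψ₂ := ⋃ w ∈ S, {a | a ∈ w.map Prod.snd}
    -- Once the labels on the root disc are known to lie in `Ψ₂`, the subtrees fed by it have inputs
    -- in `Φ ∪ Ψ₂`.
    obtain ⟨Ψ₃, hΨ₃, h₃⟩ := ih (Φ ∪ Ψ₂) (hΦ.union hΨ₂)
    refine ⟨Ψ₂ ∪ Ψ₃, hΨ₂.union hΨ₃, fun x L hL hs h0 hx hΦx hΩx hlab => ?_⟩
    rw [lab_iff] at hlab
    have hw : x :: L.arr ∈ S := by
      refine ⟨?_, ?_, ?_, hx⟩
      · have := L.length_arr_le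
        simp only [List.length_cons]; omega
      · intro y hy hy1
        rcases List.mem_cons.1 hy with rfl | hy
        · exact Or.inl (hΦx _ (by simp) hy1)
        · rcases mem_arr hy with hy | ⟨s, hy⟩
          · exact Or.inl (hΦx _ (by simp [hy]) hy1)
          · obtain ⟨m1, m2, m3, m4, m5, m6⟩ := mem_subs hL h0 hy
            refine Or.inr (h₁ (bar y) s m2 (by omega) m6 m5 ?_ (hlab.1 y m1) (hlab.2 _ hy)).1
            intro z hz hz1
            rcases List.mem_cons.1 hz with rfl | hz
            · simp [hy1] at hz1
            · exact hΦx z (by simp [m4 z hz]) hz1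
      · intro y hy
        rcases List.mem_cons.1 hy with rfl | hy
        · exact hΩx
        · exact hlab.1 y hy
    have h2 : ∀ y ∈ x :: L.arr, y.2 ∈ Ψ₂ := fun y hy =>
      Set.mem_biUnion hw (List.mem_map_of_mem hy)
    refine ⟨Or.inl (h2 x (by simp)), (lab_iff _ _).2 ⟨fun y hy => Or.inl (h2 y (by simp [hy])), ?_⟩⟩
    rintro ⟨y, s⟩ hy
    obtain ⟨m1, m2, m3, m4, m5, m6⟩ := mem_subs hL h0 hy
    have h5 := (h₃ (bar y) s m2 (by omega) m6 m5 ?_ (hlab.1 y m1) (hlab.2 _ hy)).2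
    · exact h5.mono fun a ha => Or.inr ha
    · intro z hz hz1
      rcases List.mem_cons.1 hz with rfl | hz
      · exact Or.inr (h2 y (by simp [m1]))
      · exact Or.inl (hΦx z (by simp [m4 z hz]) hz1)

/-- There are only finitely many trees of nonzero value with bounded number of outer arrows,
and with outer incoming labels and objects in finite sets. -/
lemma finite_trees (hc : Sys γ c) (hr : Ranked c) (E : Λ → Prop) (n : ℕ) (Φ : Set Λ) (Ω : Set O)
    (hΦ : Φ.Finite) (hΩ : Ω.Finite) :
    {T : Letter Λ × Tr Λ | T.2.Good E ∧ T.2.bd.length ≤ n ∧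
      (∀ y ∈ T.1 :: T.2.bd, y.1 = false → y.2 ∈ Φ) ∧
      (∀ y ∈ T.1 :: T.2.bd, γ.l y.2 ∈ Ω ∧ γ.r y.2 ∈ Ω) ∧ (ext T.1 T.2).val γ c ≠ 0}.Finite := by
  obtain ⟨r, N, hN, hr⟩ := hr
  -- The size is the number of outer arrows, at most `n`, plus the number of edges, which
  -- `numEdges_le` bounds by `2 * (N + 1) * n`.
  obtain ⟨Ψ, hΨ, h⟩ := lab_finite (E := E) hc (n + 2 * (N + 1) * n) Φ Ω hΦ hΩ
  have hX : {x : Letter Λ | x.2 ∈ Ψ}.Finite :=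
    (Set.finite_univ.prod hΨ).subset (fun x hx => ⟨Set.mem_univ x.1, hx⟩)
  refine (hX.prod (finite_of_size Ψ hΨ (n + 2 * (N + 1) * n))).subset ?_
  rintro ⟨x, L⟩ ⟨h1, h2, h3, h4, h5⟩
  have e1 : c (x :: L.arr) ≠ 0 := left_ne_zero_of_mul h5
  have e2 : L.om γ c ≠ 0 := right_ne_zero_of_mul h5
  have hsz : L.size ≤ n + 2 * (N + 1) * n := by
    have h6 := (numEdges_le hN hr L h1 e2).1
    have h7 := Nat.mul_le_mul_left (2 * (N + 1)) h2
    rw [size_eq]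
    dsimp only at h2 h7
    omega
  obtain ⟨h6, h7⟩ := h x L h1 hsz e2 e1 h3 (h4 _ (by simp))
    (lab_obj hc.coh L h1 e2 (fun y hy => h4 y (by simp [hy])))
  exact ⟨h6, hsz, h7⟩

lemma finite_TS (hc : Sys γ c) (hr : Ranked c) (E : Λ → Prop) (x : Letter Λ)
    (w : List (Letter Λ)) :
    {L : Tr Λ | L.bd = w ∧ L.Good E ∧ (ext x L).val γ c ≠ 0}.Finite := by
  have h := finite_trees hc hr E w.length {a | a ∈ (x :: w).map Prod.snd}
    {o | o ∈ (x :: w).map (fun y : Letter Λ => γ.l y.2) ∨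
      o ∈ (x :: w).map (fun y : Letter Λ => γ.r y.2)}
    (List.finite_toSet _) ((List.finite_toSet _).union (List.finite_toSet _))
  refine (h.image Prod.snd).subset ?_
  rintro L ⟨rfl, h2, h3⟩
  refine ⟨(x, L), ⟨h2, le_rfl, fun y hy _ => List.mem_map_of_mem hy, fun y hy => ⟨?_, ?_⟩, h3⟩, rfl⟩
  · exact Or.inl (List.mem_map_of_mem (f := fun y : Letter Λ => γ.l y.2) hy)
  · exact Or.inr (List.mem_map_of_mem (f := fun y : Letter Λ => γ.r y.2) hy)
end Tr

/-- Sums over trees are systems of coefficients. -/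
lemma Sys.TS {γ : Grading Λ O} {c : List (Letter Λ) → DualNumber k} (hc : Sys γ c) (hr : Ranked c)
    (E : Λ → Prop) : Sys γ (TS γ c E) := by
  have hne : ∀ w, PreCY.TS γ c E w ≠ 0 → ∃ (x : Letter Λ) (L : Tr Λ), w = x :: L.bd ∧ L.Good E ∧
      c (x :: L.arr) ≠ 0 ∧ L.om γ c ≠ 0 := by
    rintro (_ | ⟨x, w⟩) h
    · exact absurd rfl h
    · obtain ⟨L, ⟨rfl, h1⟩, h2⟩ := exists_ne_zero_of_finsum_mem_ne_zero h
      exact ⟨x, L, rfl, h1, left_ne_zero_of_mul h2, right_ne_zero_of_mul h2⟩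
  refine ⟨fun w h => ?_, TS_cyc E hc.two_le hc.cyc hc.par, fun w => ?_, fun w h => ?_, ?_⟩
  · obtain ⟨x, L, rfl, h1, h2, -⟩ := hne w h
    have h3 := hc.two_le _ h2
    have h4 : L.bd ≠ [] := Tr.bd_ne_nil h1 (by rintro rfl; simp [Tr.arr] at h3)
    have := List.length_pos_of_ne_nil h4
    simp only [List.length_cons]; omega
  · rcases w with _ | ⟨x, w⟩
    · exact par_zero _
    · refine par_finsum fun L => par_finsum fun hL => ?_
      have := Tr.par_val hc.par (Tr.ext x L)
      rwa [Tr.bd, hL.1] at this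
  · obtain ⟨x, L, rfl, h1, h2, h3⟩ := hne w h
    exact (γ.coh_cons).2 (Tr.chain_bd hc.coh h3 ((γ.coh_cons).1 (hc.coh _ h2)))
  · intro n Φ Ω hΦ hΩ
    refine ((Tr.finite_trees hc hr E n Φ Ω hΦ hΩ).image (fun T => T.1 :: T.2.bd)).subset ?_
    rintro w ⟨h1, h2, h3, h4⟩
    rcases w with _ | ⟨x, w⟩
    · exact absurd rfl h4
    · obtain ⟨L, ⟨rfl, h5⟩, h6⟩ := exists_ne_zero_of_finsum_mem_ne_zero h4
      refine ⟨(x, L), ⟨h5, ?_, h2, h3, h6⟩, rfl⟩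
      simp only [List.length_cons] at h1
      show L.bd.length ≤ n
      omega
end
section
variable {k : Type w} [Field k] {Λ : Type t} {O : Type u}

/-! ### Finite sums over infinite sets -/

section Finsum
variable {α β : Type*}

lemma finsum_mem_fiberwise {M : Type*} [AddCommMonoid M] (s : Set α) (t : Set β) (g : α → β)
    (f : α → M) (hg : Set.MapsTo g s t) (hs : (s ∩ Function.support f).Finite) :
    ∑ᶠ a ∈ s, f a = ∑ᶠ b ∈ t, ∑ᶠ a ∈ {a | a ∈ s ∧ g a = b}, f a := by
  classical
  have h1 : ∀ b, ∑ᶠ a ∈ {a | a ∈ s ∧ g a = b}, f a =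
      ∑ a ∈ hs.toFinset with g a = b, f a := by
    intro b
    refine finsum_mem_eq_sum_of_inter_support_eq _ ?_
    ext a; simp; tauto
  simp only [h1]
  rw [finsum_mem_eq_sum (f := f) hs,
    finsum_mem_eq_sum_of_inter_support_eq (t := hs.toFinset.image g),
    Finset.sum_fiberwise_of_maps_to (fun a ha => Finset.mem_image_of_mem g ha)]
  ext b
  simp only [Set.mem_inter_iff, Function.mem_support, Finset.mem_coe, Finset.mem_image]
  constructor
  · rintro ⟨h2, h3⟩
    obtain ⟨a, ha, -⟩ := Finset.exists_ne_zero_of_sum_ne_zero h3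
    simp only [Finset.mem_filter] at ha
    exact ⟨⟨a, ha⟩, h3⟩
  · rintro ⟨⟨a, ha, rfl⟩, h3⟩
    exact ⟨hg (hs.mem_toFinset.1 ha).1, h3⟩

lemma finsum_mem_mul_finsum_mem {R : Type*} [CommRing R] (s : Set α) (t : Set β) (f : α → R)
    (g : β → R) (hs : (s ∩ Function.support f).Finite) (ht : (t ∩ Function.support g).Finite) :
    (∑ᶠ a ∈ s, f a) * ∑ᶠ b ∈ t, g b = ∑ᶠ e ∈ s ×ˢ t, f e.1 * g e.2 := by
  classical
  rw [finsum_mem_eq_sum (f := f) hs, finsum_mem_eq_sum (f := g) ht, Finset.sum_mul_sum,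
    ← Finset.sum_product']
  symm
  refine finsum_mem_eq_sum_of_inter_support_eq _ ?_
  ext ⟨a, b⟩
  simp only [Set.mem_inter_iff, Set.mem_prod, Function.mem_support, Finset.coe_product,
    Set.Finite.coe_toFinset]
  constructor
  · rintro ⟨⟨h1, h2⟩, h3⟩
    exact ⟨⟨⟨h1, left_ne_zero_of_mul h3⟩, h2, right_ne_zero_of_mul h3⟩, h3⟩
  · rintro ⟨⟨⟨h1, -⟩, h2, -⟩, h3⟩
    exact ⟨⟨h1, h2⟩, h3⟩

/-- The twist as an additive map. -/
def tauHom (n : ZMod 2) : DualNumber k →+ DualNumber k where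
  toFun := tau n
  map_zero' := tau_apply_zero n
  map_add' := tau_add n

lemma tau_finsum_mem (n : ZMod 2) (s : Set α) (f : α → DualNumber k)
    (hs : (s ∩ Function.support f).Finite) : tau n (∑ᶠ a ∈ s, f a) = ∑ᶠ a ∈ s, tau n (f a) :=
  AddMonoidHom.map_finsum_mem' (tauHom n) hs
end Finsum

/-! ### Substitution of trees into trees -/

/-- Trees whose discs, other than the disc at hand, are subdivided. -/
inductive DTr (Λ : Type t) : Type t
  | nil : DTr Λ
  | ext (x : Letter Λ) (rest : DTr Λ) : DTr Λ
  | edge (x : Letter Λ) (J : Tr Λ) (sub rest : DTr Λ) : DTr Λ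

namespace DTr
/-- The arrows of the disc at hand. -/
def arr : DTr Λ → List (Letter Λ)
  | nil => []
  | ext x r => x :: r.arr
  | edge x _ _ r => x :: r.arr

/-- The outer arrows. -/
def bd : DTr Λ → List (Letter Λ)
  | nil => []
  | ext x r => x :: r.bd
  | edge _ _ s r => s.bd ++ r.bd

/-- Concatenation. -/
def app : DTr Λ → DTr Λ → DTr Λ
  | nil, T => T
  | ext x r, T => ext x (r.app T)
  | edge x J s r, T => edge x J s (r.app T)

/-- The number of arrows and edges. -/
def size : DTr Λ → ℕ
  | nil => 0
  | ext _ r => 1 + r.size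
  | edge _ J s r => 1 + J.size + s.size + r.size

/-- Forget the subdivisions. -/
def sk : DTr Λ → Tr Λ
  | nil => .nil
  | ext x r => .ext x r.sk
  | edge x _ s r => .edge x s.sk r.sk

/-- The subdivisions have edges in `E₁` and fit to the arrows of the disc, and the other edges
are in `E₂`. -/
def Good (E₁ E₂ : Λ → Prop) : DTr Λ → Prop
  | nil => True
  | ext _ r => r.Good E₁ E₂
  | edge x J s r => E₂ x.2 ∧ J ≠ .nil ∧ J.Good E₁ ∧ J.bd = s.arr ∧ s.Good E₁ E₂ ∧ r.Good E₁ E₂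

/-- The product of coefficients and signs. -/
def om (γ : Grading Λ O) (c : List (Letter Λ) → DualNumber k) : DTr Λ → DualNumber k
  | nil => 1
  | ext _ r => r.om γ c
  | edge x J s r => sg k (γ.η x) •
      (tau (γ.pw r.arr) ((c (bar x :: J.arr) * J.om γ c) * s.om γ c) * r.om γ c)

@[simp] lemma arr_app (S T : DTr Λ) : (S.app T).arr = S.arr ++ T.arr := by
  induction S <;> simp_all [app, arr]

@[simp] lemma bd_app (S T : DTr Λ) : (S.app T).bd = S.bd ++ T.bd := by
  induction S <;> simp_all [app, bd]

@[simp] lemma size_app (S T : DTr Λ) : (S.app T).size = S.size + T.size := by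
  induction S <;> simp_all [app, size, add_assoc]

@[simp] lemma arr_sk (D : DTr Λ) : D.sk.arr = D.arr := by
  induction D <;> simp_all [sk, arr, Tr.arr]

@[simp] lemma bd_sk (D : DTr Λ) : D.sk.bd = D.bd := by
  induction D <;> simp_all [sk, bd, Tr.bd]

@[simp] lemma good_app (E₁ E₂ : Λ → Prop) (S T : DTr Λ) :
    (S.app T).Good E₁ E₂ ↔ S.Good E₁ E₂ ∧ T.Good E₁ E₂ := by
  induction S <;> simp_all [app, Good, and_assoc]

lemma arr_eq_nil {D : DTr Λ} (h : D.arr = []) : D = nil := by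
  cases D <;> simp_all [arr]

lemma sk_good {E₁ E₂ : Λ → Prop} {D : DTr Λ} (h : D.Good E₁ E₂) : D.sk.Good E₂ := by
  induction D with
  | nil => trivial
  | ext x r ih => exact ih h
  | edge x J s r ihs ihr =>
    refine ⟨h.1, fun h0 => ?_, ihs h.2.2.2.2.1, ihr h.2.2.2.2.2⟩
    refine Tr.bd_ne_nil h.2.2.1 h.2.1 ?_
    rw [h.2.2.2.1, ← arr_sk, h0]; rfl

lemma exists_app (w w' : List (Letter Λ)) (D : DTr Λ) (h : D.arr = w ++ w') :
    ∃ D₁ D₂ : DTr Λ, D = D₁.app D₂ ∧ D₁.arr = w ∧ D₂.arr = w' := by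
  induction w generalizing D with
  | nil => exact ⟨nil, D, rfl, rfl, h⟩
  | cons x w ih =>
    rcases D with _ | ⟨y, r⟩ | ⟨y, J, s, r⟩
    · simp [arr] at h
    · simp only [arr, List.cons_append, List.cons.injEq] at h
      obtain ⟨D₁, D₂, rfl, h1, h2⟩ := ih r h.2
      exact ⟨ext y D₁, D₂, rfl, by simp [arr, h.1, h1], h2⟩
    · simp only [arr, List.cons_append, List.cons.injEq] at h
      obtain ⟨D₁, D₂, rfl, h1, h2⟩ := ih r h.2
      exact ⟨edge y J s D₁, D₂, rfl, by simp [arr, h.1, h1], h2⟩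

lemma app_inj {D₁ D₂ D₁' D₂' : DTr Λ} (h : D₁.app D₂ = D₁'.app D₂') (h' : D₁.arr = D₁'.arr) :
    D₁ = D₁' ∧ D₂ = D₂' := by
  induction D₁ generalizing D₁' with
  | nil => cases D₁' <;> simp_all [app, arr]
  | ext x r ih =>
    cases D₁' with
    | nil => simp [arr] at h'
    | ext y r' =>
      simp only [app, ext.injEq, arr, List.cons.injEq] at h h'
      obtain ⟨rfl, rfl⟩ := ih h.2 h'.2
      exact ⟨by rw [h.1], rfl⟩
    | edge y J s r' => simp [app] at h
  | edge x J s r _ ih =>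
    cases D₁' with
    | nil => simp [arr] at h'
    | ext y r' => simp [app] at h
    | edge y J s r' =>
      simp only [app, edge.injEq, arr, List.cons.injEq] at h h'
      obtain ⟨rfl, rfl⟩ := ih h.2.2.2 h'.2
      exact ⟨by rw [h.1, h.2.1, h.2.2.1], rfl⟩

variable {γ : Grading Λ O} {c : List (Letter Λ) → DualNumber k} {E₁ E₂ : Λ → Prop}

lemma om_app (S T : DTr Λ) : (S.app T).om γ c = tau (γ.pw T.arr) (S.om γ c) * T.om γ c := by
  induction S with
  | nil => simp [om, app]
  | ext x r ih => simp [om, app, ih]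
  | edge x J s r _ ih =>
    simp only [om, app, ih, arr_app, γ.pw_append, tau_smul, tau_mul, tau_tau, smul_mul_assoc,
      add_comm (γ.pw r.arr)]
    congr 1; ring
end DTr
-- Trees with two kinds of edges
namespace Tr
open Classical in
/-- The part of the tree which is connected to the disc at hand by edges in `E`. -/
def inn (E : Λ → Prop) : Tr Λ → Tr Λ
  | nil => nil
  | ext x r => ext x (r.inn E)
  | edge x s r => if E x.2 then edge x (s.inn E) (r.inn E) else ext x (r.inn E)

open Classical in
/-- The tree which arises by contracting all edges in `E`, with the subdivisions of its discs. -/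
def out (E : Λ → Prop) : Tr Λ → DTr Λ
  | nil => .nil
  | ext x r => .ext x (r.out E)
  | edge x s r => if E x.2 then (s.out E).app (r.out E) else
      .edge x (s.inn E) (s.out E) (r.out E)

section Split
variable {E₁ E₂ : Λ → Prop}

@[simp] lemma arr_inn (L : Tr Λ) : (L.inn E₁).arr = L.arr := by
  induction L with
  | nil => rfl
  | ext x r ih => simp [inn, arr, ih]
  | edge x s r _ ih => by_cases h : E₁ x.2 <;> simp [inn, arr, ih, h]

lemma bd_inn (L : Tr Λ) : (L.inn E₁).bd = (L.out E₁).arr := by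
  induction L with
  | nil => rfl
  | ext x r ih => simp [inn, out, bd, DTr.arr, ih]
  | edge x s r ihs ih => by_cases h : E₁ x.2 <;> simp [inn, out, bd, DTr.arr, ih, ihs, h]

@[simp] lemma bd_out (L : Tr Λ) : (L.out E₁).bd = L.bd := by
  induction L with
  | nil => rfl
  | ext x r ih => simp [out, bd, DTr.bd, ih]
  | edge x s r ihs ih => by_cases h : E₁ x.2 <;> simp [out, bd, DTr.bd, ih, ihs, h]

lemma inn_ne_nil {L : Tr Λ} (h : L ≠ nil) : L.inn E₁ ≠ nil := by
  rcases L with _ | ⟨x, r⟩ | ⟨x, s, r⟩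
  · exact absurd rfl h
  · simp [inn]
  · by_cases h : E₁ x.2 <;> simp [inn, h]

lemma good_inn {E : Λ → Prop} {L : Tr Λ} (h : L.Good E) : (L.inn E₁).Good E₁ := by
  induction L with
  | nil => trivial
  | ext x r ih => exact ih h
  | edge x s r ihs ih =>
    by_cases hx : E₁ x.2
    · simp only [inn, hx, if_true]
      exact ⟨hx, inn_ne_nil h.2.1, ihs h.2.2.1, ih h.2.2.2⟩
    · simp only [inn, hx, if_false]
      exact ih h.2.2.2

lemma good_out {L : Tr Λ} (h : L.Good (fun a => E₁ a ∨ E₂ a)) : (L.out E₁).Good E₁ E₂ := by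
  induction L with
  | nil => trivial
  | ext x r ih => exact ih h
  | edge x s r ihs ih =>
    by_cases hx : E₁ x.2
    · simp only [out, hx, if_true, DTr.good_app]
      exact ⟨ihs h.2.2.1, ih h.2.2.2⟩
    · simp only [out, hx, if_false]
      exact ⟨h.1.resolve_left hx, inn_ne_nil h.2.1, good_inn h.2.2.1, bd_inn s, ihs h.2.2.1,
        ih h.2.2.2⟩

/-- Contracting an edge of the first kind concatenates two lists of arrows in `out`; the boundary of
the corresponding part of `inn` tells where to cut them apart again. -/
lemma split_inj {L L' : Tr Λ} (h1 : L.inn E₁ = L'.inn E₁) (h2 : L.out E₁ = L'.out E₁) :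
    L = L' := by
  induction L generalizing L' with
  | nil =>
    rcases L' with _ | ⟨y, r'⟩ | ⟨y, s', r'⟩
    · rfl
    · simp [inn] at h1
    · by_cases h : E₁ y.2 <;> simp [inn, h] at h1
  | ext x r ih =>
    rcases L' with _ | ⟨y, r'⟩ | ⟨y, s', r'⟩
    · simp [inn] at h1
    · simp only [inn, ext.injEq, out, DTr.ext.injEq] at h1 h2
      rw [h1.1, ih h1.2 h2.2]
    · by_cases h : E₁ y.2
      · simp [inn, h] at h1
      · simp [out, h] at h2
  | edge x s r ihs ih =>
    by_cases hx : E₁ x.2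
    · rcases L' with _ | ⟨y, r'⟩ | ⟨y, s', r'⟩
      · simp [inn, hx] at h1
      · simp [inn, hx] at h1
      · by_cases h : E₁ y.2
        · simp only [inn, hx, if_true, h, edge.injEq, out] at h1 h2
          obtain ⟨e1, e2⟩ := DTr.app_inj h2 (by rw [← bd_inn, ← bd_inn, h1.2.1])
          rw [h1.1, ihs h1.2.1 e1, ih h1.2.2 e2]
        · simp [inn, hx, h] at h1
    · rcases L' with _ | ⟨y, r'⟩ | ⟨y, s', r'⟩
      · simp [inn, hx] at h1
      · simp [out, hx] at h2
      · by_cases h : E₁ y.2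
        · simp [inn, hx, h] at h1
        · simp only [inn, hx, if_false, h, ext.injEq, out, DTr.edge.injEq] at h1 h2
          rw [h1.1, ihs h2.2.1 h2.2.2.1, ih h1.2 h2.2.2.2]

/-- A subdivided disc and a subdivided tree glue to a tree. -/
lemma split_surj (hE : ∀ a, E₂ a → ¬ E₁ a) (I : Tr Λ) (hI : I.Good E₁) (D : DTr Λ)
    (hD : D.Good E₁ E₂) (h : I.bd = D.arr) :
    ∃ L : Tr Λ, L.Good (fun a => E₁ a ∨ E₂ a) ∧ L.inn E₁ = I ∧ L.out E₁ = D := by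
  -- An edge of the first kind cuts both `I` and `D`, while one of the second kind replaces the
  -- inner tree by a subdivision stored in `D`. Only the total size decreases in both cases.
  induction hn : I.size + D.size using Nat.strong_induction_on generalizing I D with
  | _ n ih =>
    subst hn
    rcases I with _ | ⟨x, I⟩ | ⟨x, K, I⟩
    · obtain rfl := DTr.arr_eq_nil h.symm
      exact ⟨nil, trivial, rfl, rfl⟩
    · rcases D with _ | ⟨y, D⟩ | ⟨y, J, D, D'⟩
      · simp [bd, DTr.arr] at h
      · obtain ⟨rfl, h'⟩ : x = y ∧ I.bd = D.arr := by simpa [bd, DTr.arr] using h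
        obtain ⟨L, h1, h2, h3⟩ := ih _ (by simp only [size, DTr.size]; omega) I hI D hD h' rfl
        exact ⟨ext x L, h1, by rw [inn, h2], by rw [out, h3]⟩
      · obtain ⟨rfl, h'⟩ : x = y ∧ I.bd = D'.arr := by simpa [bd, DTr.arr] using h
        obtain ⟨d1, d2, d3, d4, d5, d6⟩ := hD
        obtain ⟨L, h1, h2, h3⟩ := ih _ (by simp only [size, DTr.size]; omega) I hI D' d6 h' rfl
        obtain ⟨L', h1', h2', h3'⟩ := ih _ (by simp only [size, DTr.size]; omega) J d3 D d5 d4 rfl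
        have hx := hE _ d1
        refine ⟨edge x L' L, ⟨Or.inr d1, ?_, h1', h1⟩, ?_, ?_⟩
        · rintro rfl; exact d2 h2'.symm
        · simp [inn, hx, h2]
        · simp [out, hx, h3, h2', h3']
    · obtain ⟨hx, hK0, hK, hI⟩ := hI
      obtain ⟨D₁, D₂, rfl, e1, e2⟩ := DTr.exists_app _ _ D h.symm
      rw [DTr.good_app] at hD
      obtain ⟨L, h1, h2, h3⟩ := ih _ (by simp only [size, DTr.size_app]; omega) K hK D₁ hD.1
        e1.symm rfl
      obtain ⟨L', h1', h2', h3'⟩ := ih _ (by simp only [size, DTr.size_app]; omega) I hI D₂ hD.2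
        e2.symm rfl
      refine ⟨edge x L L', ⟨Or.inl hx, ?_, h1, h1'⟩, ?_, ?_⟩
      · rintro rfl; exact hK0 h2.symm
      · simp [inn, hx, h2, h2']
      · simp [out, hx, h3, h3']

/-- Every edge of the tree appears in exactly one of the two factors, with the same sign; only the
twists differ, and the difference is absorbed by parity. -/
lemma om_split {c : List (Letter Λ) → DualNumber k} {γ : Grading Λ O}
    (hc : ∀ w, Par (γ.pw w + γ.D) (c w)) {L : Tr Λ} (hL : L.Good (fun a => E₁ a ∨ E₂ a)) :
    L.om γ c = (L.inn E₁).om γ c * (L.out E₁).om γ c := by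
  induction L with
  | nil => simp [inn, out, om, DTr.om]
  | ext x r ih => simp only [inn, out, om, DTr.om, ih hL]
  | edge x s r ihs ih =>
    -- The contracted tree twists by the arrows of `r.out E₁`, the original one by those of `r`. The
    -- difference is the parity of the factor `(r.inn E₁).om`, next to which it has no effect.
    have hr : ∀ y, (r.inn E₁).om γ c * tau (γ.pw (r.out E₁).arr) y =
        (r.inn E₁).om γ c * tau (γ.pw r.arr) y := by
      intro y
      rw [← (par_om hc (r.inn E₁)).mul_tau (γ.pw r.arr), arr_inn, bd_inn]
      congr 2
      generalize γ.pw r.arr = a; generalize γ.pw _ = b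
      decide +revert
    by_cases hx : E₁ x.2
    · simp only [inn, out, hx, if_true, om, DTr.om_app, arr_inn, ihs hL.2.2.1, ih hL.2.2.2,
        smul_mul_assoc, tau_mul]
      rw [show ∀ a b d e f g : DualNumber k, a * b * d * (e * f) = a * b * (d * e) * f from
        fun a b d e f g => by ring, hr]
      · congr 1; ring
      · exact 0
    · simp only [inn, out, hx, if_false, om, DTr.om, arr_inn, ihs hL.2.2.1, ih hL.2.2.2,
        mul_smul_comm]
      rw [← mul_assoc (om γ c (inn E₁ r)), hr, ← mul_assoc]
      congr 2
      rw [mul_comm, mul_assoc (c _)]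
end Split

/-- The values of a tree over the sums of all trees are the sums over all subdivisions. -/
lemma om_TS {γ : Grading Λ O} {c : List (Letter Λ) → DualNumber k} {E₁ E₂ : Λ → Prop}
    (hfin : ∀ x w, {L : Tr Λ | L.bd = w ∧ L.Good E₁ ∧ (ext x L).val γ c ≠ 0}.Finite) (L : Tr Λ)
    (hL : L.Good E₂) :
    ({D : DTr Λ | D.Good E₁ E₂ ∧ D.sk = L} ∩ Function.support (DTr.om γ c)).Finite ∧
    L.om γ (TS γ c E₁) = ∑ᶠ D ∈ {D : DTr Λ | D.Good E₁ E₂ ∧ D.sk = L}, D.om γ c := by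
  induction L with
  | nil =>
    have : {D : DTr Λ | D.Good E₁ E₂ ∧ D.sk = nil} = {DTr.nil} := by
      ext (_ | _ | _) <;> simp [DTr.Good, DTr.sk]
    rw [this]
    exact ⟨(Set.finite_singleton _).inter_of_left _, by simp [om, DTr.om]⟩
  | ext x r ih =>
    obtain ⟨ih1, ih2⟩ := ih hL
    have hb : Set.BijOn (DTr.ext x) {D : DTr Λ | D.Good E₁ E₂ ∧ D.sk = r}
        {D : DTr Λ | D.Good E₁ E₂ ∧ D.sk = ext x r} := by
      refine ⟨fun D hD => ⟨hD.1, by rw [DTr.sk, hD.2]⟩, fun D _ D' _ h => by simpa using h, ?_⟩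
      rintro (_ | ⟨y, D⟩ | _) ⟨h1, h2⟩
      · simp [DTr.sk] at h2
      · obtain ⟨rfl, rfl⟩ : y = x ∧ D.sk = r := by simpa [DTr.sk] using h2
        exact ⟨D, ⟨h1, rfl⟩, rfl⟩
      · simp [DTr.sk] at h2
    constructor
    · refine (ih1.image (DTr.ext x)).subset ?_
      rintro D ⟨h1, h2⟩
      obtain ⟨D', h3, rfl⟩ := hb.surjOn h1
      exact ⟨D', ⟨h3, h2⟩, rfl⟩
    · rw [om, ih2]
      exact finsum_mem_eq_of_bijOn _ hb fun D _ => rfl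
  | edge x s r ihs ihr =>
    obtain ⟨hx, hs0, hs, hr⟩ := hL
    obtain ⟨is1, is2⟩ := ihs hs
    obtain ⟨ir1, ir2⟩ := ihr hr
    -- Over the skeleton `edge x s r`, a subdivision is an independent choice of one for the disc
    -- beyond `x`, one over `s` and one over `r`, so the sum is a product of three sums.
    set e : (Tr Λ × DTr Λ) × DTr Λ → DTr Λ := fun T => DTr.edge x T.1.1 T.1.2 T.2 with he
    set S₁ := {J : Tr Λ | J.bd = s.arr ∧ J.Good E₁}
    set S₂ := {D : DTr Λ | D.Good E₁ E₂ ∧ D.sk = s}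
    set S₃ := {D : DTr Λ | D.Good E₁ E₂ ∧ D.sk = r}
    have hb : Set.BijOn e ((S₁ ×ˢ S₂) ×ˢ S₃) {D : DTr Λ | D.Good E₁ E₂ ∧ D.sk = edge x s r} := by
      refine ⟨?_, ?_, ?_⟩
      · rintro ⟨⟨J, D⟩, D'⟩ ⟨⟨⟨h1, h2⟩, ⟨h3, rfl⟩⟩, ⟨h4, rfl⟩⟩
        refine ⟨⟨hx, ?_, h2, by simpa using h1, h3, h4⟩, rfl⟩
        rintro rfl
        apply bd_ne_nil hs hs0
        rw [DTr.bd_sk]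
        have : D = .nil := DTr.arr_eq_nil (by simpa [bd] using h1.symm)
        rw [this]; rfl
      · rintro ⟨⟨J, D⟩, D'⟩ - ⟨⟨J₁, D₁⟩, D'₁⟩ - h
        simp only [he, DTr.edge.injEq] at h
        simp [h]
      · rintro (_ | _ | ⟨y, J, D, D'⟩) ⟨h1, h2⟩
        · simp [DTr.sk] at h2
        · simp [DTr.sk] at h2
        · obtain ⟨rfl, rfl, rfl⟩ : y = x ∧ D.sk = s ∧ D'.sk = r := by simpa [DTr.sk] using h2
          refine ⟨((J, D), D'), ⟨⟨⟨?_, h1.2.2.1⟩, h1.2.2.2.2.1, rfl⟩, h1.2.2.2.2.2, rfl⟩, rfl⟩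
          simpa using h1.2.2.2.1
    have f1 : (S₁ ∩ Function.support fun J : Tr Λ => c (bar x :: J.arr) * J.om γ c).Finite := by
      refine (hfin (bar x) s.arr).subset ?_
      rintro J ⟨⟨h1, h2⟩, h3⟩
      exact ⟨h1, h2, h3⟩
    have f2 : ((S₁ ×ˢ S₂) ∩ Function.support fun T : Tr Λ × DTr Λ =>
        c (bar x :: T.1.arr) * T.1.om γ c * T.2.om γ c).Finite := by
      refine (f1.prod is1).subset ?_
      rintro ⟨J, D⟩ ⟨⟨h1, h2⟩, h3⟩
      exact ⟨⟨h1, left_ne_zero_of_mul h3⟩, h2, right_ne_zero_of_mul h3⟩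
    have f3 : ((S₁ ×ˢ S₂) ∩ Function.support fun T : Tr Λ × DTr Λ =>
        tau (γ.pw r.arr) (c (bar x :: T.1.arr) * T.1.om γ c * T.2.om γ c)).Finite := by
      refine f2.subset ?_
      rintro T ⟨h1, h2⟩
      exact ⟨h1, fun h0 => h2 (tau_eq_zero_iff.2 h0)⟩
    have hval : (edge x s r).om γ (TS γ c E₁) =
        ∑ᶠ D ∈ {D : DTr Λ | D.Good E₁ E₂ ∧ D.sk = edge x s r}, D.om γ c := by
      have h1 : TS γ c E₁ (bar x :: s.arr) = ∑ᶠ J ∈ S₁, c (bar x :: J.arr) * J.om γ c := rfl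
      rw [om, h1, is2, ir2, finsum_mem_mul_finsum_mem _ _ _ _ f1 is1, tau_finsum_mem _ _ _ f2,
        finsum_mem_mul_finsum_mem _ _ _ _ f3 ir1, smul_finsum_mem_sg]
      refine finsum_mem_eq_of_bijOn e hb ?_
      rintro ⟨⟨J, D⟩, D'⟩ ⟨⟨h1, h2⟩, ⟨h3, rfl⟩⟩
      simp only [he, DTr.om, DTr.arr_sk]
    refine ⟨((f3.prod ir1).image e).subset ?_, hval⟩
    rintro D ⟨h1, h2⟩
    obtain ⟨⟨⟨J, D'⟩, D''⟩, h3, rfl⟩ := hb.surjOn h1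
    refine ⟨_, ⟨⟨h3.1, ?_⟩, h3.2, ?_⟩, rfl⟩
    · intro h0
      apply h2
      have h4 : D''.arr = r.arr := by rw [← h3.2.2, DTr.arr_sk]
      simp only [he, DTr.om, h4]
      simp only at h0
      rw [h0, zero_mul, smul_zero]
    · intro h0
      apply h2
      simp only [he, DTr.om]
      simp only at h0
      rw [h0, mul_zero, smul_zero]
end Tr

open Tr

/-- Substituting sums over trees into sums over trees gives sums over trees. -/
lemma TS_TS {γ : Grading Λ O} {c : List (Letter Λ) → DualNumber k} (hc : Sys γ c) (hr : Ranked c)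
    (E₁ E₂ : Λ → Prop) (hE : ∀ a, E₂ a → ¬ E₁ a) :
    TS γ (TS γ c E₁) E₂ = TS γ c (fun a => E₁ a ∨ E₂ a) := by
  funext w
  rcases w with _ | ⟨x, w⟩
  · rfl
  have hfin := fun x w => Tr.finite_TS hc hr E₁ x w
  set S := {T : Tr Λ × DTr Λ | T.1.Good E₁ ∧ T.2.Good E₁ E₂ ∧ T.1.bd = T.2.arr ∧ T.2.bd = w}
    with hS
  set f : Tr Λ × DTr Λ → DualNumber k := fun T => c (x :: T.1.arr) * T.1.om γ c * T.2.om γ c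
    with hf
  -- Trees with both kinds of edges correspond to a subdivision of the root disc together with a
  -- matching subdivided tree.
  have hb : Set.BijOn (fun L : Tr Λ => (L.inn E₁, L.out E₁))
      {L : Tr Λ | L.bd = w ∧ L.Good fun a => E₁ a ∨ E₂ a} S := by
    refine ⟨?_, ?_, ?_⟩
    · rintro L ⟨rfl, hL⟩
      exact ⟨good_inn hL, good_out hL, bd_inn L, bd_out L⟩
    · rintro L - L' - h
      simp only [Prod.mk.injEq] at h
      exact split_inj h.1 h.2
    · rintro ⟨I, D⟩ ⟨h1, h2, h3, h4⟩
      obtain ⟨L, e1, rfl, rfl⟩ := split_surj hE I h1 D h2 h3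
      exact ⟨L, ⟨by simpa using h4, e1⟩, rfl⟩
  have hval : ∀ L ∈ {L : Tr Λ | L.bd = w ∧ L.Good fun a => E₁ a ∨ E₂ a},
      (Tr.ext x L).val γ c = f (L.inn E₁, L.out E₁) := by
    rintro L ⟨-, hL⟩
    simp only [hf, val, om, arr, om_split hc.par hL, arr_inn, mul_assoc]
  have hfS : (S ∩ Function.support f).Finite := by
    refine ((Tr.finite_TS hc hr (fun a => E₁ a ∨ E₂ a) x w).image
      (fun L : Tr Λ => (L.inn E₁, L.out E₁))).subset ?_
    rintro T ⟨h1, h2⟩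
    obtain ⟨L, h3, rfl⟩ := hb.surjOn h1
    exact ⟨L, ⟨h3.1, h3.2, by rw [hval L h3]; exact h2⟩, rfl⟩
  have h1 : TS γ c (fun a => E₁ a ∨ E₂ a) (x :: w) = ∑ᶠ T ∈ S, f T :=
    finsum_mem_eq_of_bijOn _ hb hval
  -- Grouping by the skeleton turns the total sum into an outer sum over trees with edges in `E₂`;
  -- the inner sums are evaluated by `om_TS`.
  rw [h1, finsum_mem_fiberwise S {L : Tr Λ | L.bd = w ∧ L.Good E₂} (fun T => T.2.sk) f ?_ hfS]
  · refine finsum_mem_congr rfl ?_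
    rintro L ⟨rfl, hL⟩
    obtain ⟨g1, g2⟩ := om_TS hfin L hL
    have f1 : ({J : Tr Λ | J.bd = L.arr ∧ J.Good E₁} ∩
        Function.support fun J : Tr Λ => c (x :: J.arr) * J.om γ c).Finite := by
      refine (hfin x L.arr).subset ?_
      rintro J ⟨⟨h1, h2⟩, h3⟩
      exact ⟨h1, h2, h3⟩
    have h2 : TS γ c E₁ (x :: L.arr) = ∑ᶠ J ∈ {J : Tr Λ | J.bd = L.arr ∧ J.Good E₁},
      c (x :: J.arr) * J.om γ c := rfl
    rw [val, arr, om, h2, g2, finsum_mem_mul_finsum_mem _ _ _ _ f1 g1]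
    refine finsum_mem_congr ?_ fun T _ => rfl
    ext ⟨J, D⟩
    simp only [hS, Set.mem_prod, Set.mem_ofPred_eq]
    constructor
    · rintro ⟨⟨h3, h4⟩, h5, rfl⟩
      exact ⟨⟨h4, h5, by simpa using h3, by simp⟩, rfl⟩
    · rintro ⟨⟨h3, h4, h5, h6⟩, rfl⟩
      exact ⟨⟨by simpa using h5, h3⟩, h4, rfl⟩
  · rintro ⟨J, D⟩ ⟨h1, h2, h3, h4⟩
    exact ⟨by simpa using h4, DTr.sk_good h2⟩
end
section
variable {k : Type w} [Field k] {Λ : Type t} {O : Type u}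

/-! ### Composition of coefficient functions -/

namespace Tr
variable {γ : Grading Λ O} {c c' : List (Letter Λ) → DualNumber k} {E : Λ → Prop}

/-- A disc with outer arrows only. -/
def ofWord : List (Letter Λ) → Tr Λ
  | [] => nil
  | x :: w => ext x (ofWord w)

@[simp] lemma arr_ofWord (w : List (Letter Λ)) : (ofWord w).arr = w := by
  induction w <;> simp_all [ofWord, arr]

@[simp] lemma bd_ofWord (w : List (Letter Λ)) : (ofWord w).bd = w := by
  induction w <;> simp_all [ofWord, bd]

@[simp] lemma om_ofWord (w : List (Letter Λ)) : (ofWord w).om γ c = 1 := by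
  induction w <;> simp_all [ofWord, om]

lemma good_ofWord (w : List (Letter Λ)) : (ofWord w).Good E := by
  induction w <;> simp_all [ofWord, Good]

lemma eq_ofWord {L : Tr Λ} (hL : L.Good E) (h : ∀ x ∈ L.arr, ¬ E x.2) : L = ofWord L.bd := by
  induction L with
  | nil => rfl
  | ext x r ih =>
    have := ih hL (fun y hy => h y (by simp [arr, hy]))
    rw [bd, ofWord, ← this]
  | edge x s r => exact absurd hL.1 (h x (by simp [arr]))

lemma forall_arr {P : Letter Λ → Prop} (hP : ∀ x, E x.2 → P x) {L : Tr Λ} (hL : L.Good E)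
    (h : ∀ x ∈ L.bd, P x) : ∀ x ∈ L.arr, P x := by
  induction L with
  | nil => simp [arr]
  | ext x r ih =>
    intro y hy
    rcases List.mem_cons.1 hy with rfl | hy
    · exact h _ (by simp [bd])
    · exact ih hL (fun z hz => h z (by simp [bd, hz])) y hy
  | edge x s r _ ih =>
    intro y hy
    rcases List.mem_cons.1 hy with rfl | hy
    · exact hP _ hL.1
    · exact ih hL.2.2.2 (fun z hz => h z (by simp [bd, hz])) y hy

lemma om_congr {P : Letter Λ → Prop} (hP : ∀ x, E x.2 → P x)
    (hc : ∀ w, (∀ x ∈ w, P x) → c w = c' w) {L : Tr Λ} (hL : L.Good E)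
    (h : ∀ x ∈ L.bd, P x) : L.om γ c = L.om γ c' := by
  induction L with
  | nil => rfl
  | ext x r ih => exact ih hL (fun z hz => h z (by simp [bd, hz]))
  | edge x s r ihs ih =>
    have hs : ∀ z ∈ s.bd, P z := fun z hz => h z (by simp [bd, hz])
    rw [om, om, ihs hL.2.2.1 hs, ih hL.2.2.2 (fun z hz => h z (by simp [bd, hz])), hc]
    intro y hy
    rcases List.mem_cons.1 hy with rfl | hy
    · exact hP _ hL.1
    · exact forall_arr hP hL.2.2.1 hs y hy

/-- Every outer arrow belongs to a disc. -/
lemma mem_bd {L : Tr Λ} (h0 : L.om γ c ≠ 0) {x : Letter Λ} (hx : x ∈ L.bd) :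
    x ∈ L.arr ∨ ∃ w, c w ≠ 0 ∧ x ∈ w := by
  induction L with
  | nil => simp [bd] at hx
  | ext y r ih =>
    rcases List.mem_cons.1 hx with rfl | hx
    · exact Or.inl (by simp [arr])
    · exact (ih h0 hx).imp_left fun h => by simp [arr, h]
  | edge y s r ihs ih =>
    obtain ⟨e1, e2, e3⟩ := om_edge_ne_zero h0
    rcases List.mem_append.1 hx with hx | hx
    · rcases ihs e2 hx with h | h
      · exact Or.inr ⟨_, e1, by simp [h]⟩
      · exact Or.inr h
    · exact (ih e3 hx).imp_left fun h => by simp [arr, h]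

/-- If every disc has an outgoing arrow, then so has every tree. -/
lemma exists_out (hc : ∀ w, c w ≠ 0 → ∃ x ∈ w, x.1 = true) {L : Tr Λ} (h0 : L.om γ c ≠ 0)
    (h : ∃ x ∈ L.arr, x.1 = true) : ∃ x ∈ L.bd, x.1 = true := by
  induction L with
  | nil => exact h
  | ext y r ih =>
    obtain ⟨x, hx, h⟩ := h
    rcases List.mem_cons.1 hx with rfl | hx
    · exact ⟨x, by simp [bd], h⟩
    · obtain ⟨z, hz, h⟩ := ih h0 ⟨x, hx, h⟩
      exact ⟨z, by simp [bd, hz], h⟩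
  | edge y s r ihs ih =>
    obtain ⟨e1, e2, e3⟩ := om_edge_ne_zero h0
    obtain ⟨x, hx, h⟩ := h
    rcases List.mem_cons.1 hx with rfl | hx
    · obtain ⟨z, hz, h'⟩ := hc _ e1
      rcases List.mem_cons.1 hz with rfl | hz
      · simp [h] at h'
      · obtain ⟨z, hz, h⟩ := ihs e2 ⟨z, hz, h'⟩
        exact ⟨z, by simp [bd, hz], h⟩
    · obtain ⟨z, hz, h⟩ := ih e3 ⟨x, hx, h⟩
      exact ⟨z, by simp [bd, hz], h⟩
end Tr

open Tr

section Algebra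
variable {γ : Grading Λ O} {c c' : List (Letter Λ) → DualNumber k} {E : Λ → Prop}

lemma TS_ne_zero {w : List (Letter Λ)} (h : TS γ c E w ≠ 0) : ∃ (x : Letter Λ) (L : Tr Λ),
    w = x :: L.bd ∧ L.Good E ∧ c (x :: L.arr) ≠ 0 ∧ L.om γ c ≠ 0 := by
  rcases w with _ | ⟨x, w⟩
  · exact absurd rfl h
  · obtain ⟨L, ⟨rfl, h1⟩, h2⟩ := exists_ne_zero_of_finsum_mem_ne_zero h
    exact ⟨x, L, rfl, h1, left_ne_zero_of_mul h2, right_ne_zero_of_mul h2⟩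

lemma TS_mem {w : List (Letter Λ)} (h : TS γ c E w ≠ 0) {y : Letter Λ} (hy : y ∈ w) :
    ∃ w, c w ≠ 0 ∧ y ∈ w := by
  obtain ⟨x, L, rfl, h1, h2, h3⟩ := TS_ne_zero h
  rcases List.mem_cons.1 hy with rfl | hy
  · exact ⟨_, h2, by simp⟩
  · rcases mem_bd h3 hy with hy | h
    · exact ⟨_, h2, by simp [hy]⟩
    · exact h

lemma TS_exists_out (hc : ∀ w, c w ≠ 0 → ∃ x ∈ w, x.1 = true) {w : List (Letter Λ)}
    (h : TS γ c E w ≠ 0) : ∃ x ∈ w, x.1 = true := by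
  obtain ⟨x, L, rfl, h1, h2, h3⟩ := TS_ne_zero h
  obtain ⟨y, hy, h'⟩ := hc _ h2
  rcases List.mem_cons.1 hy with rfl | hy
  · exact ⟨y, by simp, h'⟩
  · obtain ⟨z, hz, h'⟩ := Tr.exists_out hc h3 ⟨y, hy, h'⟩
    exact ⟨z, by simp [hz], h'⟩

lemma TS_congr {P : Letter Λ → Prop} (hP : ∀ x, E x.2 → P x)
    (hc : ∀ w, (∀ x ∈ w, P x) → c w = c' w) {w : List (Letter Λ)} (h : ∀ x ∈ w, P x) :
    TS γ c E w = TS γ c' E w := by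
  rcases w with _ | ⟨x, w⟩
  · rfl
  · refine finsum_mem_congr rfl ?_
    rintro L ⟨rfl, hL⟩
    have h' : ∀ x ∈ L.bd, P x := fun z hz => h z (by simp [hz])
    simp only [val, om, arr]
    rw [om_congr hP hc hL h', hc]
    intro y hy
    rcases List.mem_cons.1 hy with rfl | hy
    · exact h _ (by simp)
    · exact forall_arr hP hL h' y hy

/-- Discs without arrows labelled in `E` do not take part in the trees with edges in `E`. -/
lemma TS_add (hc : Sys γ c) (hr : Ranked c) {h : List (Letter Λ) → DualNumber k}
    (hh : ∀ w, h w ≠ 0 → ∀ x ∈ w, ¬ E x.2) (h0 : h [] = 0) :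
    TS γ (c + h) E = TS γ c E + h := by
  funext w
  rcases w with _ | ⟨x, w⟩
  · simp [TS, h0]
  have hom : ∀ L : Tr Λ, L.Good E → L.om γ (c + h) = L.om γ c := by
    intro L hL
    induction L with
    | nil => rfl
    | ext x r ih => exact ih hL
    | edge y s r ihs ih =>
      have : h (bar y :: s.arr) = 0 := by
        by_contra h1
        exact hh _ h1 (bar y) (by simp) hL.1
      simp only [om, ihs hL.2.2.1, ih hL.2.2.2, Pi.add_apply, this, add_zero]
  have h1 : TS γ (c + h) E (x :: w) = ∑ᶠ L ∈ {L : Tr Λ | L.bd = w ∧ L.Good E},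
      ((ext x L).val γ c + h (x :: L.arr) * L.om γ c) := by
    refine finsum_mem_congr rfl ?_
    rintro L ⟨-, hL⟩
    simp only [val, om, arr, hom L hL, Pi.add_apply, add_mul]
  -- If `h` fills the root disc then no arrow there can carry an edge, so the tree is a single disc.
  have key : ∀ L : Tr Λ, L.bd = w → L.Good E → h (x :: L.arr) ≠ 0 → L = ofWord w := by
    rintro L rfl hL h2
    exact eq_ofWord hL fun y hy => hh _ h2 y (by simp [hy])
  have hs : ∑ᶠ L ∈ {L : Tr Λ | L.bd = w ∧ L.Good E}, h (x :: L.arr) * L.om γ c = h (x :: w) := by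
    rw [finsum_mem_inter_support_eq _ _ {ofWord w}, finsum_mem_singleton]
    · simp
    · ext L
      simp only [Set.mem_inter_iff, Set.mem_ofPred_eq, Set.mem_singleton_iff,
        Function.mem_support]
      constructor
      · rintro ⟨⟨h2, h3⟩, h4⟩
        exact ⟨key L h2 h3 (left_ne_zero_of_mul h4), h4⟩
      · rintro ⟨rfl, h4⟩
        exact ⟨⟨by simp, good_ofWord w⟩, h4⟩
  rw [h1, finsum_mem_add_distrib', hs]
  · rfl
  · refine (Tr.finite_TS hc hr E x w).subset ?_
    rintro L ⟨⟨h2, h3⟩, h4⟩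
    exact ⟨h2, h3, h4⟩
  · refine (Set.finite_singleton (ofWord w)).subset ?_
    rintro L ⟨⟨h2, h3⟩, h4⟩
    exact key L h2 h3 (left_ne_zero_of_mul h4)

lemma Sys.add (hc : Sys γ c) (hc' : Sys γ c') : Sys γ (c + c') := by
  have hor : ∀ w, (c + c') w ≠ 0 → c w ≠ 0 ∨ c' w ≠ 0 := by
    intro w h
    by_contra! h'
    exact h (by simp [h'])
  refine ⟨fun w h => ?_, fun x w => ?_, fun w => (hc.par w).add (hc'.par w), fun w h => ?_, ?_⟩
  · exact (hor w h).elim (hc.two_le w) (hc'.two_le w)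
  · simp only [Pi.add_apply, hc.cyc x w, hc'.cyc x w, smul_add]
  · exact (hor w h).elim (hc.coh w) (hc'.coh w)
  · intro n Φ Ω hΦ hΩ
    refine ((hc.fin n Φ Ω hΦ hΩ).union (hc'.fin n Φ Ω hΦ hΩ)).subset ?_
    rintro w ⟨h1, h2, h3, h4⟩
    exact (hor w h4).imp (fun h => ⟨h1, h2, h3, h⟩) (fun h => ⟨h1, h2, h3, h⟩)

open Classical in
/-- The restriction to words with letters in `P`. -/
def restr (P : Letter Λ → Prop) (c : List (Letter Λ) → DualNumber k) :
    List (Letter Λ) → DualNumber k :=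
  fun w => if ∀ x ∈ w, P x then c w else 0

lemma restr_ne_zero {P : Letter Λ → Prop} {w : List (Letter Λ)} (h : restr P c w ≠ 0) :
    (∀ x ∈ w, P x) ∧ c w ≠ 0 := by
  by_cases h1 : ∀ x ∈ w, P x
  · exact ⟨h1, by rwa [restr, if_pos h1] at h⟩
  · exact absurd (by rw [restr, if_neg h1]) h

lemma restr_eq {P : Letter Λ → Prop} {w : List (Letter Λ)} (h : ∀ x ∈ w, P x) :
    restr P c w = c w := if_pos h

lemma Sys.restr (P : Letter Λ → Prop) (hc : Sys γ c) : Sys γ (restr P c) := by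
  refine ⟨fun w h => hc.two_le w (restr_ne_zero h).2, fun x w => ?_, fun w => ?_,
    fun w h => hc.coh w (restr_ne_zero h).2, ?_⟩
  · by_cases h : ∀ y ∈ x :: w, P y
    · rw [restr_eq h, restr_eq, hc.cyc]
      intro y hy
      exact h y (by simpa [or_comm] using hy)
    · have h' : ¬ ∀ y ∈ w ++ [x], P y := fun h' => h fun y hy => h' y (by simpa [or_comm] using hy)
      rw [PreCY.restr, PreCY.restr, if_neg h, if_neg h', smul_zero]
  · rw [PreCY.restr]
    split_ifs
    · exact hc.par w
    · exact par_zero _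
  · intro n Φ Ω hΦ hΩ
    refine (hc.fin n Φ Ω hΦ hΩ).subset ?_
    rintro w ⟨h1, h2, h3, h4⟩
    exact ⟨h1, h2, h3, (restr_ne_zero h4).2⟩
end Algebra

/-- The coefficient functions of operations with incoming labels of level `n` and outgoing
labels of level `m`. -/
structure WMor (γ : Grading Λ O) (lev : Λ → ℕ) (n m : ℕ) (f : List (Letter Λ) → DualNumber k) :
    Prop extends Sys γ f where
  inp : ∀ w, f w ≠ 0 → ∀ x ∈ w, x.1 = false → lev x.2 = n
  out : ∀ w, f w ≠ 0 → ∀ x ∈ w, x.1 = true → lev x.2 = m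
  exists_out : ∀ w, f w ≠ 0 → ∃ x ∈ w, x.1 = true

/-- The composition of coefficient functions along the labels of level `m`. -/
def wcomp (γ : Grading Λ O) (lev : Λ → ℕ) (m : ℕ) (f g : List (Letter Λ) → DualNumber k) :
    List (Letter Λ) → DualNumber k :=
  restr (fun x => lev x.2 ≠ m) (TS γ (f + g) fun a => lev a = m)

/-! ### Levels of labels and associativity of the composition -/

section Levels
variable {γ : Grading Λ O} {lev : Λ → ℕ}

/-- Outgoing labels have higher level than incoming ones. -/
def Leveled (lev : Λ → ℕ) (N : ℕ) (c : List (Letter Λ) → DualNumber k) : Prop :=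
  ∀ w, c w ≠ 0 → (∃ x ∈ w, x.1 = true) ∧ (∀ x ∈ w, lev x.2 ≤ N) ∧
    (∀ x ∈ w, x.1 = true → 0 < lev x.2) ∧
    ∀ x ∈ w, x.1 = false → ∀ y ∈ w, y.1 = true → lev x.2 < lev y.2

lemma Leveled.add {N : ℕ} {c c' : List (Letter Λ) → DualNumber k} (hc : Leveled lev N c)
    (hc' : Leveled lev N c') : Leveled lev N (c + c') := by
  intro w h
  by_cases h' : c w = 0
  · exact hc' w (by simpa [h'] using h)
  · exact hc w h'

/-- Walking through discs with two arrows, one either follows the arrows, entering by inputs of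
increasing level, or goes against them, entering by outputs of decreasing level, or turns once from
going against them to following them at a disc with two outputs. Outputs are therefore ranked by
level above all inputs, which are ranked by the opposite of the level. The `min` bounds the rank for
labels that do not occur. -/
lemma Leveled.ranked {N : ℕ} {c : List (Letter Λ) → DualNumber k} (hc : Leveled lev N c) :
    Ranked c := by
  refine ⟨fun x => if x.1 then N + min (lev x.2) N else N - lev x.2, 2 * N, fun x => ?_, ?_⟩
  · dsimp only
    split_ifs <;> omega
  · rintro ⟨i, a⟩ ⟨j, b⟩ h
    obtain ⟨h1, h2, h3, h4⟩ := hc _ h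
    simp only [List.mem_cons, List.not_mem_nil, or_false, forall_eq_or_imp, forall_eq] at h1 h2 h3 h4
    rcases i with _ | _ <;> rcases j with _ | _ <;> simp at h1 h2 h3 h4 ⊢ <;> omega

lemma WMor.leveled {n m N : ℕ} {f : List (Letter Λ) → DualNumber k} (hf : WMor γ lev n m f)
    (h : n < m) (hN : m ≤ N) : Leveled lev N f := by
  intro w hw
  refine ⟨hf.exists_out w hw, fun x hx => ?_, fun x hx h1 => ?_, fun x hx h1 y hy h2 => ?_⟩
  · by_cases h1 : x.1 = true
    · rw [hf.out w hw x hx h1]; exact hN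
    · rw [hf.inp w hw x hx (by simpa using h1)]; omega
  · rw [hf.out w hw x hx h1]; omega
  · rw [hf.inp w hw x hx h1, hf.out w hw y hy h2]; exact h

lemma WMor.lev_eq {n m : ℕ} {f : List (Letter Λ) → DualNumber k} (hf : WMor γ lev n m f)
    {w : List (Letter Λ)} (hw : f w ≠ 0) {x : Letter Λ} (hx : x ∈ w) :
    lev x.2 = n ∨ lev x.2 = m := by
  by_cases h1 : x.1 = true
  · exact Or.inr (hf.out w hw x hx h1)
  · exact Or.inl (hf.inp w hw x hx (by simpa using h1))

lemma WMor.wcomp {n m l : ℕ} {f g : List (Letter Λ) → DualNumber k} (hf : WMor γ lev n m f)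
    (hg : WMor γ lev m l g) (h1 : n < m) (h2 : m < l) : WMor γ lev n l (wcomp γ lev m f g) := by
  have hS : Sys γ (f + g) := hf.toSys.add hg.toSys
  have hR : Ranked (f + g) := ((hf.leveled h1 h2.le).add (hg.leveled h2 le_rfl)).ranked
  have hor : ∀ w, (f + g) w ≠ 0 → f w ≠ 0 ∨ g w ≠ 0 := by
    intro w h
    by_contra! h'
    exact h (by simp [h'])
  refine ⟨(hS.TS hR _).restr _, fun w hw x hx hx1 => ?_, fun w hw x hx hx1 => ?_, fun w hw => ?_⟩
  · obtain ⟨h3, h4⟩ := restr_ne_zero hw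
    obtain ⟨u, hu, hxu⟩ := TS_mem h4 hx
    rcases hor u hu with h5 | h5
    · exact hf.inp u h5 x hxu hx1
    · exact absurd (hg.inp u h5 x hxu hx1) (h3 x hx)
  · obtain ⟨h3, h4⟩ := restr_ne_zero hw
    obtain ⟨u, hu, hxu⟩ := TS_mem h4 hx
    rcases hor u hu with h5 | h5
    · exact absurd (hf.out u h5 x hxu hx1) (h3 x hx)
    · exact hg.out u h5 x hxu hx1
  · exact TS_exists_out (fun u hu => (hor u hu).elim (hf.exists_out u) (hg.exists_out u))
      (restr_ne_zero hw).2

/-- Composition of coefficient functions is associative. -/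
lemma wcomp_assoc {n m l r : ℕ} {f g h : List (Letter Λ) → DualNumber k} (hf : WMor γ lev n m f)
    (hg : WMor γ lev m l g) (hh : WMor γ lev l r h) (h1 : n < m) (h2 : m < l) (h3 : l < r) :
    wcomp γ lev l (wcomp γ lev m f g) h = wcomp γ lev m f (wcomp γ lev l g h) := by
  have hfg := hf.wcomp hg h1 h2
  have hgh := hg.wcomp hh h2 h3
  have hl := hfg.wcomp hh (by omega) h3
  have hr := hf.wcomp hgh h1 (by omega)
  have Sfg := hf.toSys.add hg.toSys
  have Sgh := hg.toSys.add hh.toSys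
  have Lf := hf.leveled (N := r) h1 (by omega)
  have Lg := hg.leveled (N := r) h2 (by omega)
  have Lh := hh.leveled (N := r) h3 (by omega)
  have S := Sfg.add hh.toSys
  have R := ((Lf.add Lg).add Lh).ranked
  funext w
  by_cases hw : ∀ x ∈ w, lev x.2 = n ∨ lev x.2 = r
  swap
  · have e1 : wcomp γ lev l (wcomp γ lev m f g) h w = 0 := by
      by_contra h0; exact hw fun x hx => hl.lev_eq h0 hx
    have e2 : wcomp γ lev m f (wcomp γ lev l g h) w = 0 := by
      by_contra h0; exact hw fun x hx => hr.lev_eq h0 hx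
    rw [e1, e2]
  have hwm : ∀ x ∈ w, lev x.2 ≠ m := fun x hx => by rcases hw x hx with h | h <;> omega
  have hwl : ∀ x ∈ w, lev x.2 ≠ l := fun x hx => by rcases hw x hx with h | h <;> omega
  have zero : ∀ {f : List (Letter Λ) → DualNumber k}, Sys γ f → f [] = 0 := by
    intro f hf
    by_contra h0
    exact absurd (hf.two_le _ h0) (by simp)
  -- `h` has no arrow of level `m`, so it only adds itself to the sum over trees with edges of that
  -- level; similarly for `f` and the level `l` below.
  have eh : TS γ (f + g + h) (fun a => lev a = m) = TS γ (f + g) (fun a => lev a = m) + h := by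
    refine TS_add Sfg (Lf.add Lg).ranked (fun w hw x hx => ?_) (zero hh.toSys)
    rcases hh.lev_eq hw hx with h | h <;> omega
  have ef : TS γ (f + g + h) (fun a => lev a = l) = TS γ (g + h) (fun a => lev a = l) + f := by
    rw [show f + g + h = g + h + f by ring]
    refine TS_add Sgh (Lg.add Lh).ranked (fun w hw x hx => ?_) (zero hf.toSys)
    rcases hf.lev_eq hw hx with h | h <;> omega
  have e1 : wcomp γ lev l (wcomp γ lev m f g) h w =
      TS γ (TS γ (f + g + h) fun a => lev a = m) (fun a => lev a = l) w := by
    rw [wcomp, restr_eq hwl, eh]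
    refine TS_congr (P := fun x => lev x.2 ≠ m) (fun x hx => by omega) (fun u hu => ?_) hwm
    rw [Pi.add_apply, Pi.add_apply, wcomp, restr_eq hu]
  have e2 : wcomp γ lev m f (wcomp γ lev l g h) w =
      TS γ (TS γ (f + g + h) fun a => lev a = l) (fun a => lev a = m) w := by
    rw [wcomp, restr_eq hwm, ef]
    refine TS_congr (P := fun x => lev x.2 ≠ l) (fun x hx => by omega) (fun u hu => ?_) hwl
    rw [Pi.add_apply, Pi.add_apply, wcomp, restr_eq hu, add_comm]
  -- Both sides have become the sum over all trees of discs from `f`, `g`, `h` with edges of level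
  -- `m` or `l`.
  rw [e1, e2, TS_TS S R _ _ (fun a h => by omega), TS_TS S R _ _ (fun a h => by omega)]
  simp only [or_comm]
end Levels

/-! ### Trees and maps of objects -/

lemma finsum_mem_eq_of_bijOn_support {α β M : Type*} [AddCommMonoid M] {s : Set α} {t : Set β}
    {f : α → M} {g : β → M} (e : α → β)
    (he : Set.BijOn e (s ∩ Function.support f) (t ∩ Function.support g))
    (h : ∀ a ∈ s, f a ≠ 0 → f a = g (e a)) : ∑ᶠ a ∈ s, f a = ∑ᶠ b ∈ t, g b := by
  rw [← finsum_mem_inter_support f s, ← finsum_mem_inter_support g t]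
  exact finsum_mem_eq_of_bijOn e he fun a ha => h a ha.1 ha.2

section Pull
variable {Λ' : Type t} {O' : Type u}

/-- The map of letters. -/
def mapL (π : Λ' → Λ) (x : Letter Λ') : Letter Λ := (x.1, π x.2)

/-- Change the labels of a tree. -/
def Tr.map (π : Λ' → Λ) : Tr Λ' → Tr Λ
  | nil => nil
  | ext x r => ext (mapL π x) (r.map π)
  | edge x s r => edge (mapL π x) (s.map π) (r.map π)

/-- Labels with ends in `O'`, lying over labels with ends in `O`. -/
structure Lifts (γ' : Grading Λ' O') (γ : Grading Λ O) (π : Λ' → Λ) (φ : O' → O) : Prop where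
  q : ∀ a, γ.q (π a) = γ'.q a
  D : γ.D = γ'.D
  l : ∀ a, γ.l (π a) = φ (γ'.l a)
  r : ∀ a, γ.r (π a) = φ (γ'.r a)
  lift : ∀ a p q, γ.l a = φ p → γ.r a = φ q → ∃ a', γ'.l a' = p ∧ γ'.r a' = q ∧ π a' = a
  inj : ∀ a b, γ'.l a = γ'.l b → γ'.r a = γ'.r b → π a = π b → a = b

variable {γ' : Grading Λ' O'} {γ : Grading Λ O} {π : Λ' → Λ} {φ : O' → O}

namespace Tr
@[simp] lemma arr_map (L : Tr Λ') : (L.map π).arr = L.arr.map (mapL π) := by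
  induction L <;> simp_all [Tr.map, arr, mapL]

@[simp] lemma bd_map (L : Tr Λ') : (L.map π).bd = L.bd.map (mapL π) := by
  induction L <;> simp_all [Tr.map, bd, mapL]

lemma good_map {E : Λ → Prop} (L : Tr Λ') : (L.map π).Good E ↔ L.Good (fun a => E (π a)) := by
  induction L with
  | nil => rfl
  | ext x r ih => exact ih
  | edge x s r ihs ih =>
    have : s.map π = nil ↔ s = nil := by cases s <;> simp [Tr.map]
    simp only [Tr.map, Good, ihs, ih, ne_eq, this]
    rfl
end Tr
namespace Lifts
variable (H : Lifts γ' γ π φ)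
include H

lemma p (x : Letter Λ') : γ.p (mapL π x) = γ'.p x := by
  simp [Grading.p, mapL, H.q, H.D]

lemma η (x : Letter Λ') : γ.η (mapL π x) = γ'.η x := by
  simp [Grading.η, mapL, H.q, H.D]

lemma pw (w : List (Letter Λ')) : γ.pw (w.map (mapL π)) = γ'.pw w := by
  induction w with
  | nil => rfl
  | cons x w ih => simp [ih, H.p]

lemma bef (x : Letter Λ') : γ.bef (mapL π x) = φ (γ'.bef x) := by
  rcases x with ⟨_ | _, a⟩ <;> simp [Grading.bef, mapL, H.l, H.r]

lemma aft (x : Letter Λ') : γ.aft (mapL π x) = φ (γ'.aft x) := by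
  rcases x with ⟨_ | _, a⟩ <;> simp [Grading.aft, mapL, H.l, H.r]

lemma chain {a b : O'} {w : List (Letter Λ')} (h : γ'.Chain a w b) :
    γ.Chain (φ a) (w.map (mapL π)) (φ b) := by
  induction w generalizing a with
  | nil => exact congrArg φ h
  | cons x w ih =>
    obtain ⟨rfl, h⟩ := h
    exact ⟨(H.bef x).symm, by rw [H.aft]; exact ih h⟩

lemma lift_letter (x : Letter Λ) (p q : O') (h1 : γ.bef x = φ p) (h2 : γ.aft x = φ q) :
    ∃ x', γ'.bef x' = p ∧ γ'.aft x' = q ∧ mapL π x' = x := by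
  rcases x with ⟨_ | _, a⟩
  · obtain ⟨a', e1, e2, e3⟩ := H.lift a q p h2 h1
    exact ⟨(false, a'), e2, e1, by rw [mapL, e3]⟩
  · obtain ⟨a', e1, e2, e3⟩ := H.lift a p q h1 h2
    exact ⟨(true, a'), e1, e2, by rw [mapL, e3]⟩

lemma inj_letter {x y : Letter Λ'} (h1 : γ'.bef x = γ'.bef y) (h2 : γ'.aft x = γ'.aft y)
    (h3 : mapL π x = mapL π y) : x = y := by
  rcases x with ⟨i, a⟩
  rcases y with ⟨j, b⟩
  simp only [mapL, Prod.mk.injEq] at h3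
  obtain ⟨rfl, h3⟩ := h3
  rcases i with _ | _
  · rw [H.inj a b h2 h1 h3]
  · rw [H.inj a b h1 h2 h3]
end Lifts

lemma Grading.chain_unique {a b b' : O} {w : List (Letter Λ)} (h : γ.Chain a w b)
    (h' : γ.Chain a w b') : b = b' := by
  induction w generalizing a with
  | nil => exact h.symm.trans h'
  | cons x w ih => exact ih h.2 h'.2

variable {c' : List (Letter Λ') → DualNumber k} {c : List (Letter Λ) → DualNumber k}
  {E : Λ → Prop}

lemma Lifts.om_map (H : Lifts γ' γ π φ) (hcc : ∀ w, γ'.Coh w → c' w = c (w.map (mapL π)))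
    (hc' : ∀ w, c' w ≠ 0 → γ'.Coh w) (L : Tr Λ') (h0 : L.om γ' c' ≠ 0) :
    L.om γ' c' = (L.map π).om γ c := by
  induction L with
  | nil => rfl
  | ext x r ih => exact ih h0
  | edge x s r ihs ih =>
    obtain ⟨e1, e2, e3⟩ := om_edge_ne_zero h0
    have h1 := hcc _ (hc' _ e1)
    have h2 : (bar x :: s.arr).map (mapL π) = bar (mapL π x) :: (s.map π).arr := by
      simp [mapL, bar]
    rw [om, ihs e2, ih e3, h1, Tr.map, om, H.η, arr_map r, H.pw, h2]

/-- Different labels over `O'` may have the same image. A label is determined by its image and its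
two ends, and the ends of an inner edge can be read off from the outer arrows beyond it. -/
lemma Lifts.map_inj (H : Lifts γ' γ π φ) (hc' : ∀ w, c' w ≠ 0 → γ'.Coh w) {L L' : Tr Λ'}
    (h0 : L.om γ' c' ≠ 0) (h0' : L'.om γ' c' ≠ 0) {a b b' : O'} (hL : γ'.Chain a L.arr b)
    (hL' : γ'.Chain a L'.arr b') (hm : L.map π = L'.map π) (hb : L.bd = L'.bd) : L = L' := by
  induction L generalizing L' a b b' with
  | nil => cases L' <;> simp_all [Tr.map]
  | ext x r ih =>
    cases L' with
    | nil => simp [Tr.map] at hm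
    | ext y r' =>
      simp only [Tr.map, ext.injEq, bd, List.cons.injEq] at hm hb
      obtain ⟨rfl, hb⟩ := hb
      rw [ih (L' := r') h0 h0' hL.2 hL'.2 hm.2 hb]
    | edge y s' r' => simp [Tr.map] at hm
  | edge x s r ihs ih =>
    cases L' with
    | nil => simp [Tr.map] at hm
    | ext y r' => simp [Tr.map] at hm
    | edge y s' r' =>
      simp only [Tr.map, edge.injEq, bd] at hm hb
      obtain ⟨m1, m2, m3⟩ := hm
      obtain ⟨b1, b2⟩ := List.append_inj hb (by
        have := congrArg (fun T => T.bd.length) m2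
        simpa using this)
      obtain ⟨e1, e2, e3⟩ := om_edge_ne_zero h0
      obtain ⟨e1', e2', e3'⟩ := om_edge_ne_zero h0'
      have hs := (γ'.coh_cons).1 (hc' _ e1)
      have hs' := (γ'.coh_cons).1 (hc' _ e1')
      rw [γ'.aft_bar, γ'.bef_bar, ← hL.1] at hs
      rw [γ'.aft_bar, γ'.bef_bar, ← hL'.1] at hs'
      have h1 := chain_bd hc' e2 hs
      have h2 := chain_bd hc' e2' hs'
      rw [b1] at h1
      have h3 := Grading.chain_unique h1 h2
      obtain rfl := H.inj_letter (hL.1.symm.trans hL'.1) h3 m1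
      rw [ihs (L' := s') e2 e2' hs hs' m2 b1, ih (L' := r') e3 e3' hL.2 hL'.2 m3 b2]

/-- For each edge, the lifted part of the boundary beyond it provides lifts of its two ends, over
which its label can be lifted. Coherence of the discs downstairs makes these choices fit together.
-/
lemma Lifts.exists_map (H : Lifts γ' γ π φ) (hcc : ∀ w, γ'.Coh w → c' w = c (w.map (mapL π)))
    (hc : ∀ w, c w ≠ 0 → γ.Coh w) {L : Tr Λ} (h0 : L.om γ c ≠ 0) {a b : O'}
    {w' : List (Letter Λ')} (hw : γ'.Chain a w' b) (hb : L.bd = w'.map (mapL π))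
    (hL : γ.Chain (φ a) L.arr (φ b)) :
    ∃ L' : Tr Λ', L'.map π = L ∧ L'.bd = w' ∧ γ'.Chain a L'.arr b ∧
      L'.om γ' c' = L.om γ c := by
  induction L generalizing a b w' with
  | nil =>
    obtain rfl : w' = [] := by simpa [bd] using hb.symm
    exact ⟨nil, rfl, rfl, hw, by simp [om]⟩
  | ext x r ih =>
    rcases w' with _ | ⟨x', w'⟩
    · simp [bd] at hb
    simp only [bd, List.map_cons, List.cons.injEq] at hb
    obtain ⟨rfl, hb⟩ := hb
    have := hL.2
    rw [H.aft] at this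
    obtain ⟨L', e1, e2, e3, e4⟩ := ih h0 hw.2 hb this
    exact ⟨ext x' L', by rw [Tr.map, e1], by rw [bd, e2], ⟨hw.1, e3⟩, e4⟩
  | edge x s r ihs ih =>
    obtain ⟨e1, e2, e3⟩ := om_edge_ne_zero h0
    obtain ⟨w₁, w₂, rfl, b1, b2⟩ := List.map_eq_append_iff.1 hb.symm
    obtain ⟨m, c1, c2⟩ := (γ'.chain_append).1 hw
    have hs := (γ.coh_cons).1 (hc _ e1)
    rw [γ.aft_bar, γ.bef_bar, ← hL.1] at hs
    have h1 := chain_bd hc e2 hs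
    rw [← b1] at h1
    have h2 : γ.aft x = φ m := Grading.chain_unique h1 (H.chain c1)
    obtain ⟨x', x1, x2, x3⟩ := H.lift_letter x a m hL.1.symm h2
    rw [h2] at hs
    have hr := hL.2
    rw [h2] at hr
    obtain ⟨s', s1, s2, s3, s4⟩ := ihs e2 c1 b1.symm hs
    obtain ⟨r', r1, r2, r3, r4⟩ := ih e3 c2 b2.symm hr
    have hne : c' (bar x' :: s'.arr) = c (bar x :: s.arr) := by
      rw [hcc]
      · congr 1
        rw [← s1, ← x3]
        simp [mapL, bar]
      · rw [γ'.coh_cons, γ'.aft_bar, γ'.bef_bar, x1, x2]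
        exact s3
    refine ⟨edge x' s' r', by rw [Tr.map, s1, r1, ← x3], by rw [bd, s2, r2], ?_, ?_⟩
    · exact ⟨x1.symm, by rw [x2]; exact r3⟩
    · have h5 : γ.pw r.arr = γ'.pw r'.arr := by rw [← r1, arr_map, H.pw]
      rw [om, om, s4, r4, hne, ← H.η, x3, h5]

/-- With the outer arrows given upstairs, trees of nonzero value lift uniquely, so the two sums have
the same nonzero terms. This is what makes composition commute with restriction along a noninjective
map of objects. -/
lemma Lifts.TS_map (H : Lifts γ' γ π φ) (hcc : ∀ w, γ'.Coh w → c' w = c (w.map (mapL π)))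
    (hc' : ∀ w, c' w ≠ 0 → γ'.Coh w) (hc : ∀ w, c w ≠ 0 → γ.Coh w) {w : List (Letter Λ')}
    (hw : γ'.Coh w) : TS γ' c' (fun a => E (π a)) w = TS γ c E (w.map (mapL π)) := by
  rcases w with _ | ⟨x, w⟩
  · rfl
  have hw' := (γ'.coh_cons).1 hw
  have hval : ∀ L : Tr Λ', c' (x :: L.arr) * L.om γ' c' ≠ 0 →
      (ext x L).val γ' c' = (ext (mapL π x) (L.map π)).val γ c := by
    intro L h
    have h1 := left_ne_zero_of_mul h
    have h2 := right_ne_zero_of_mul h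
    simp only [val, arr, om, hcc _ (hc' _ h1), H.om_map hcc hc' L h2, arr_map, List.map_cons]
  refine finsum_mem_eq_of_bijOn_support (Tr.map π) ⟨?_, ?_, ?_⟩ fun L hL h => hval L h
  · rintro L ⟨⟨h1, h2⟩, h3⟩
    refine ⟨⟨by rw [bd_map, h1], (good_map L).2 h2⟩, ?_⟩
    rw [Function.mem_support] at h3 ⊢
    rwa [← hval L h3]
  · rintro L ⟨⟨h1, h2⟩, h3⟩ L' ⟨⟨h1', h2'⟩, h3'⟩ h
    have a1 := (γ'.coh_cons).1 (hc' _ (left_ne_zero_of_mul h3))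
    have a2 := (γ'.coh_cons).1 (hc' _ (left_ne_zero_of_mul h3'))
    exact H.map_inj hc' (right_ne_zero_of_mul h3) (right_ne_zero_of_mul h3') a1 a2 h
      (h1.trans h1'.symm)
  · rintro L ⟨⟨h1, h2⟩, h3⟩
    have a1 := (γ.coh_cons).1 (hc _ (left_ne_zero_of_mul h3))
    rw [H.aft, H.bef] at a1
    obtain ⟨L', b1, b2, b3, b4⟩ := H.exists_map (L := L) hcc hc (right_ne_zero_of_mul h3) hw' h1 a1
    refine ⟨L', ⟨⟨b2, (good_map L').1 (b1 ▸ h2)⟩, ?_⟩, b1⟩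
    have e : (ext x L').val γ' c' = (ext (mapL π x) L).val γ c := by
      simp only [val, arr, om, b4]
      rw [hcc _ ((γ'.coh_cons).2 b3), List.map_cons, ← arr_map, b1]
    rw [Function.mem_support, e]
    exact h3
end Pull
end
section
variable {k : Type w} [Field k] {Λ : Type t} {O : Type u}

/-! ### Koszul signs of permutations -/

section Koszul
variable {S : Type*}

/-- The total degree, modulo two, of a list of symbols. -/
def dg (L : List (S × ℤ)) : ZMod 2 := (L.map fun p => (p.2 : ZMod 2)).sum

@[simp] lemma dg_nil : dg ([] : List (S × ℤ)) = 0 := rfl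
@[simp] lemma dg_cons (p : S × ℤ) (L : List (S × ℤ)) : dg (p :: L) = p.2 + dg L := by simp [dg]
@[simp] lemma dg_append (L M : List (S × ℤ)) : dg (L ++ M) = dg L + dg M := by simp [dg]

lemma dg_perm {L M : List (S × ℤ)} (h : L.Perm M) : dg L = dg M := (h.map _).sum_eq

/-- The sum of `β` over the pairs of entries of a list. -/
def pairSum (β : S × ℤ → S × ℤ → ZMod 2) : List (S × ℤ) → ZMod 2
  | [] => 0
  | p :: L => (L.map (β p)).sum + pairSum β L

/-- The sum of `β` over the pairs of an entry of `L` and one of `M`. -/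
def crossSum (β : S × ℤ → S × ℤ → ZMod 2) (L M : List (S × ℤ)) : ZMod 2 :=
  (L.map fun p => (M.map (β p)).sum).sum

variable {β : S × ℤ → S × ℤ → ZMod 2}

lemma pairSum_append (L M : List (S × ℤ)) :
    pairSum β (L ++ M) = pairSum β L + pairSum β M + crossSum β L M := by
  induction L with
  | nil => simp [pairSum, crossSum]
  | cons p L ih =>
    simp only [List.cons_append, pairSum, ih, List.map_append, List.sum_append, crossSum,
      List.map_cons, List.sum_cons]
    ring

lemma crossSum_perm {L L' M M' : List (S × ℤ)} (h : L.Perm L') (h' : M.Perm M') :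
    crossSum β L M = crossSum β L' M' := by
  have : ∀ p, (M.map (β p)).sum = (M'.map (β p)).sum := fun p => (h'.map _).sum_eq
  simp only [crossSum, this]
  exact (h.map _).sum_eq

/-- `β` acts as a count of inversions: adding it over both orders of a pair leaves the product of
the degrees. As `Kz` quantifies over all such `β`, the signs of successive rearrangements add up
without a target order being fixed in advance. -/
lemma crossSum_swap {L M : List (S × ℤ)}
    (h : ∀ x ∈ L, ∀ y ∈ M, β x y + β y x = (x.2 : ZMod 2) * y.2) :
    crossSum β L M + crossSum β M L = dg L * dg M := by
  have hM : ∀ M : List (S × ℤ), crossSum β M [] = 0 := by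
    intro M; simp [crossSum]
  have hc : ∀ (M L : List (S × ℤ)) (p : S × ℤ), crossSum β M (p :: L) =
      (M.map fun q => β q p).sum + crossSum β M L := by
    intro M L p
    simp [crossSum, List.sum_map_add]
  induction L with
  | nil => simp [hM]; simp [crossSum]
  | cons p L ih =>
    have h1 : (M.map (β p)).sum + (M.map fun q => β q p).sum = p.2 * dg M := by
      have h' := fun y hy => h p (by simp) y hy
      clear h ih
      induction M with
      | nil => simp
      | cons q M ih =>
        have := h' q (by simp)
        have ih := ih fun y hy => h' y (by simp [hy])
        simp only [List.map_cons, List.sum_cons, dg_cons]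
        linear_combination this + ih
    have ih := ih fun x hx y hy => h x (by simp [hx]) y hy
    rw [hc, dg_cons]
    have : crossSum β (p :: L) M = (M.map (β p)).sum + crossSum β L M := by simp [crossSum]
    rw [this]
    linear_combination h1 + ih

/-- `M` is a permutation of the list `L` of symbols, with Koszul sign `n`. -/
def Kz (L M : List (S × ℤ)) (n : ZMod 2) : Prop :=
  L.Perm M ∧ ∀ β : S × ℤ → S × ℤ → ZMod 2,
    (∀ x ∈ L, ∀ y ∈ L, x ≠ y → β x y + β y x = (x.2 : ZMod 2) * y.2) → L.Nodup →
      pairSum β L = pairSum β M + n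

namespace Kz
variable {L M N : List (S × ℤ)} {m n : ZMod 2}

lemma refl (L : List (S × ℤ)) : Kz L L 0 := ⟨List.Perm.refl L, fun β _ _ => by simp⟩

lemma trans (h : Kz L M m) (h' : Kz M N n) : Kz L N (m + n) := by
  refine ⟨h.1.trans h'.1, fun β hβ hL => ?_⟩
  rw [h.2 β hβ hL, h'.2 β (fun x hx y hy => hβ x (h.1.mem_iff.2 hx) y (h.1.mem_iff.2 hy))
    (h.1.nodup_iff.1 hL)]
  ring

lemma congr (h : Kz L M m) {L' M' : List (S × ℤ)} {m' : ZMod 2} (hL : L = L') (hM : M = M')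
    (hm : m = m') : Kz L' M' m' := by
  subst hL hM hm; exact h

lemma left (X : List (S × ℤ)) (h : Kz L M m) : Kz (X ++ L) (X ++ M) m := by
  refine ⟨h.1.append_left X, fun β hβ hL => ?_⟩
  rw [pairSum_append, pairSum_append, crossSum_perm (List.Perm.refl X) h.1,
    h.2 β (fun x hx y hy => hβ x (by simp [hx]) y (by simp [hy])) (List.nodup_append.1 hL).2.1]
  ring

lemma right (X : List (S × ℤ)) (h : Kz L M m) : Kz (L ++ X) (M ++ X) m := by
  refine ⟨h.1.append_right X, fun β hβ hL => ?_⟩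
  rw [pairSum_append, pairSum_append, crossSum_perm h.1 (List.Perm.refl X),
    h.2 β (fun x hx y hy => hβ x (by simp [hx]) y (by simp [hy])) (List.nodup_append.1 hL).1]
  ring

lemma append {L' M' : List (S × ℤ)} (h : Kz L M m) (h' : Kz L' M' n) :
    Kz (L ++ L') (M ++ M') (m + n) :=
  (h.right L').trans (h'.left M)

lemma swap (L M : List (S × ℤ)) : Kz (L ++ M) (M ++ L) (dg L * dg M) := by
  refine ⟨List.perm_append_comm, fun β hβ hL => ?_⟩
  rw [pairSum_append, pairSum_append, ← crossSum_swap (β := β)]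
  · have h2 : crossSum β M L + crossSum β M L = 0 := CharTwo.add_self_eq_zero _
    linear_combination -h2
  · intro x hx y hy
    refine hβ x (by simp [hx]) y (by simp [hy]) ?_
    exact (List.nodup_append.1 hL).2.2 x hx y hy

/-- Exchange two blocks. -/
lemma move (X L M Y : List (S × ℤ)) :
    Kz (X ++ (L ++ (M ++ Y))) (X ++ (M ++ (L ++ Y))) (dg L * dg M) := by
  have h := ((swap L M).right Y).left X
  simpa only [List.append_assoc] using h

/-- Permuting blocks of which at most one is odd. -/
lemma flatten {B B' : List (List (S × ℤ))} (h : B.Perm B')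
    (h0 : B.Pairwise fun L M => dg L * dg M = 0) : Kz B.flatten B'.flatten 0 := by
  induction h with
  | nil => exact refl _
  | cons L h ih =>
    rw [List.pairwise_cons] at h0
    simpa using (ih h0.2).left L
  | swap L M B =>
    rw [List.pairwise_cons, List.pairwise_cons] at h0
    have h1 := h0.1 L (by simp)
    have h2 := move [] M L B.flatten
    rw [h1] at h2
    simpa using h2
  | trans h1 h2 ih1 ih2 =>
    have h3 := h0.perm h1 (fun {L M} h => by rwa [mul_comm])
    simpa using (ih1 h0).trans (ih2 h3)
end Kz
end Koszul

/-- Take for `β` the inversions relative to the positions in `L'`. This count vanishes on `L'`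
itself and is the Koszul exponent on `L`. -/
lemma koszul_eq {L' L : List (Sym × ℤ)} {n : ZMod 2} (h : Kz L L' n) (h0 : L'.Nodup) :
    ((koszul L' L : ℤ) : ZMod 2) = n := by
  let β : Sym × ℤ → Sym × ℤ → ZMod 2 := fun p q =>
    if L'.idxOf q < L'.idxOf p then (p.2 : ZMod 2) * q.2 else 0
  have h1 : ∀ M : List (Sym × ℤ), ((koszul L' M : ℤ) : ZMod 2) = pairSum β M := by
    intro M
    induction M with
    | nil => simp [koszul, pairSum]
    | cons p M ih =>
      simp only [koszul, pairSum, Int.cast_add, ih]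
      congr 1
      clear ih
      induction M with
      | nil => simp
      | cons q M ih =>
        simp only [List.map_cons, List.sum_cons, Int.cast_add, ih]
        congr 1
        simp only [β]
        split_ifs <;> simp
  have h2 : ∀ M : List (Sym × ℤ), M.Pairwise (fun p q => L'.idxOf p < L'.idxOf q) →
      pairSum β M = 0 := by
    intro M hM
    induction M with
    | nil => rfl
    | cons p M ih =>
      rw [List.pairwise_cons] at hM
      rw [pairSum, ih hM.2, add_zero]
      refine List.sum_eq_zero ?_
      simp only [List.mem_map]
      rintro _ ⟨q, hq, rfl⟩
      exact if_neg (not_lt.2 (hM.1 q hq).le)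
  rw [h1, h.2 β ?_ (h.1.nodup_iff.2 h0), h2, zero_add]
  · rw [List.pairwise_iff_getElem]
    intro i j hi hj hij
    rwa [h0.idxOf_getElem, h0.idxOf_getElem]
  · intro x hx y hy hxy
    have hx' := h.1.mem_iff.1 hx
    have : L'.idxOf x ≠ L'.idxOf y := fun h => hxy ((List.idxOf_inj hx').1 h)
    simp only [β]
    rcases lt_or_gt_of_ne this with h | h
    · rw [if_neg (not_lt.2 h.le), if_pos h, zero_add, mul_comm]
    · rw [if_neg (not_lt.2 h.le), if_pos h, add_zero]

/-! ### Reordering the tensor of an operation -/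

section Twist
variable (γ : Grading Λ O)

/-- The sign exponent between the tensor of an operation, `outputs ⊗ inputs`, and the tensor of
its arrows in clockwise order; `α` is the parity of the preceding incoming arrows. -/
def tw : ZMod 2 → List (Letter Λ) → ZMod 2
  | _, [] => 0
  | α, x :: W => if x.1 then α * (γ.p x + γ.pw W) + tw 0 W else tw (α + γ.p x) W

/-- The parities are those given by the degrees of labels. -/
structure Grading.Of (d : ℤ) (deg : Λ → ℤ) : Prop where
  q : ∀ a, γ.q a = ((deg a + d : ℤ) : ZMod 2)
  D : γ.D = ((d + 1 : ℤ) : ZMod 2)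

variable {γ} {d : ℤ} {deg : Λ → ℤ}

lemma Grading.Of.p_true (h : γ.Of d deg) (a : Λ) : γ.p (true, a) = ((deg a + d : ℤ) : ZMod 2) := by
  simp [Grading.p, h.q]

lemma Grading.Of.p_false (h : γ.Of d deg) (a : Λ) :
    γ.p (false, a) = ((-(deg a - 1) : ℤ) : ZMod 2) := by
  simp only [Grading.p, h.q, h.D]
  push_cast
  generalize (deg a : ZMod 2) = x
  generalize (d : ZMod 2) = y
  decide +revert

variable (d deg)

/-- The list of the symbols of a clockwise word. -/
def clock (W : List (Bool × Λ × Sym)) : List (Sym × ℤ) :=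
  W.map fun p => (p.2.2, if p.1 then deg p.2.1 + d else -(deg p.2.1 - 1))

/-- Forget the symbols. -/
def strip (W : List (Bool × Λ × Sym)) : List (Letter Λ) := W.map fun p => (p.1, p.2.1)

variable {d deg}

@[simp] lemma clock_append (W W' : List (Bool × Λ × Sym)) :
    clock d deg (W ++ W') = clock d deg W ++ clock d deg W' := by simp [clock]

@[simp] lemma strip_append (W W' : List (Bool × Λ × Sym)) :
    strip (W ++ W') = strip W ++ strip W' := by simp [strip]

@[simp] lemma strip_nil : strip ([] : List (Bool × Λ × Sym)) = [] := rfl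
@[simp] lemma clock_nil : clock d deg ([] : List (Bool × Λ × Sym)) = [] := rfl

@[simp] lemma strip_cons (p : Bool × Λ × Sym) (W : List (Bool × Λ × Sym)) :
    strip (p :: W) = (p.1, p.2.1) :: strip W := rfl

lemma Grading.Of.dg_clock (h : γ.Of d deg) (W : List (Bool × Λ × Sym)) :
    dg (clock d deg W) = γ.pw (strip W) := by
  induction W with
  | nil => rfl
  | cons p W ih =>
    rcases p with ⟨_ | _, a, s⟩
    · rw [strip_cons, γ.pw_cons, ← ih, h.p_false]; simp [clock]
    · rw [strip_cons, γ.pw_cons, ← ih, h.p_true]; simp [clock]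

/-- The incoming arrows collected in `acc` stand at the right end of the tensor. When an outgoing
arrow is met they are moved to the left, past it and all that follows, which gives the first term of
`tw`. The even list `mid` is passed for free. -/
lemma kz_tensor (h : γ.Of d deg) (mid : List (Sym × ℤ)) (hm : dg mid = 0)
    (W acc : List (Bool × Λ × Sym)) :
    Kz (((W.filter fun p => p.1).map fun p => (p.2.2, deg p.2.1 + d)) ++ mid ++
        (inputs acc W).reverse.map fun p => (p.2.2, -(deg p.2.1 - 1)))
      ((acc.reverse.map fun p => (p.2.2, -(deg p.2.1 - 1))) ++ clock d deg W ++ mid)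
      (tw γ (dg (acc.reverse.map fun p => (p.2.2, -(deg p.2.1 - 1)))) (strip W)) := by
  induction W generalizing acc with
  | nil =>
    have := Kz.swap mid (acc.reverse.map fun p => (p.2.2, -(deg p.2.1 - 1)))
    rw [hm, zero_mul] at this
    simpa [inputs, tw] using this
  | cons p W ih =>
    rcases p with ⟨_ | _, a, s⟩
    · have := ih ((false, a, s) :: acc)
      refine this.congr (by simp [inputs]) (by simp [clock]) ?_
      simp only [tw, strip_cons, Bool.false_eq_true, if_false, h.p_false]
      simp
    · have h1 := (((ih []).left [(s, deg a + d)]).right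
        (acc.reverse.map fun p => (p.2.2, -(deg p.2.1 - 1))))
      have h2 := Kz.swap ((s, deg a + d) :: (clock d deg W ++ mid))
        (acc.reverse.map fun p => (p.2.2, -(deg p.2.1 - 1)))
      refine (h1.congr ?_ ?_ rfl).trans (h2.congr rfl ?_ rfl) |>.congr rfl rfl ?_
      · simp [inputs]
      · simp
      · simp [clock]
      · simp only [tw, strip_cons, if_true, dg_cons, dg_append, hm, h.dg_clock, h.p_true]
        simp
        ring

lemma kz_tensorWord (h : γ.Of d deg) (mid : List (Sym × ℤ)) (hm : dg mid = 0)
    (W : List (Bool × Λ × Sym)) :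
    Kz (tensorWord d deg mid W) (clock d deg W ++ mid) (tw γ 0 (strip W)) := by
  simpa [tensorWord] using kz_tensor h mid hm W []

lemma dg_tensorWord (h : γ.Of d deg) (W : List (Bool × Λ × Sym)) :
    dg (tensorWord d deg [] W) = γ.pw (strip W) := by
  rw [dg_perm (kz_tensorWord h [] rfl W).1, List.append_nil, h.dg_clock]
end Twist

/-! ### The sign of a diagram -/

section Normal
/-- Rotate a word so that it ends with an outgoing arrow. -/
def norm (W : List (Letter Λ)) : List (Letter Λ) :=
  W.rtakeWhile (fun p => !p.1) ++ W.rdropWhile (fun p => !p.1)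

/-- The sign exponent between the coefficient of an operation and its clockwise version. -/
def nsg (γ : Grading Λ O) (W : List (Letter Λ)) : ZMod 2 :=
  γ.pw (W.rtakeWhile fun p => !p.1) * γ.pw (W.rdropWhile fun p => !p.1) + tw γ 0 (norm W)

/-- The coefficients of an operation, with all its arrows in clockwise order. -/
def ccw (γ : Grading Λ O) (c : List (Letter Λ) → k) (W : List (Letter Λ)) : k :=
  sg k (nsg γ W) * c (norm W)

lemma norm_concat (W : List (Letter Λ)) (b : Λ) : norm (W ++ [(true, b)]) = W ++ [(true, b)] := by
  simp [norm]

lemma ccw_concat (γ : Grading Λ O) (c : List (Letter Λ) → k) (W : List (Letter Λ)) (b : Λ) :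
    ccw γ c (W ++ [(true, b)]) = sg k (tw γ 0 (W ++ [(true, b)])) * c (W ++ [(true, b)]) := by
  simp [ccw, nsg, norm]

lemma strip_rtakeWhile (W : List (Bool × Λ × Sym)) :
    strip (W.rtakeWhile fun p => !p.1) = (strip W).rtakeWhile fun p => !p.1 := by
  simp only [strip, List.rtakeWhile, ← List.map_reverse, List.takeWhile_map]
  rfl

lemma strip_rdropWhile (W : List (Bool × Λ × Sym)) :
    strip (W.rdropWhile fun p => !p.1) = (strip W).rdropWhile fun p => !p.1 := by
  simp only [strip, List.rdropWhile, ← List.map_reverse, List.dropWhile_map]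
  rfl

lemma strip_normalize (W : List (Bool × Λ × Sym)) : strip (normalize W) = norm (strip W) := by
  simp [normalize, norm, strip_rtakeWhile, strip_rdropWhile]

variable {γ : Grading Λ O} {d : ℤ} {deg : Λ → ℤ}

/-- First the outputs and inputs are put in clockwise order, which costs `tw`; then the rotation
made by `normalize` is undone. -/
lemma kz_normalize (h : γ.Of d deg) (W : List (Bool × Λ × Sym)) :
    Kz (tensorWord d deg [] (normalize W)) (clock d deg W) (nsg γ (strip W)) := by
  have h1 := kz_tensorWord h [] rfl (normalize W)
  have h2 := Kz.swap (clock d deg (W.rtakeWhile fun p => !p.1))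
    (clock d deg (W.rdropWhile fun p => !p.1))
  rw [← clock_append, ← clock_append, List.rdropWhile_append_rtakeWhile] at h2
  refine ((h1.congr rfl (List.append_nil _) rfl).trans h2).congr rfl rfl ?_
  rw [nsg, h.dg_clock, h.dg_clock, strip_rtakeWhile, strip_rdropWhile, strip_normalize, add_comm]
end Normal
-- Signs of the hanging discs
namespace Legs
variable {K : Type}

/-- The arrows of the disc at hand, without symbols. -/
def arr : Legs K Λ → List (Letter Λ)
  | nil => []
  | ext o a r => (o, a) :: r.arr
  | edge o a _ _ r => (o, a) :: r.arr

/-- The outer arrows, without symbols. -/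
def bd : Legs K Λ → List (Letter Λ)
  | nil => []
  | ext o a r => (o, a) :: r.bd
  | edge _ _ _ s r => s.bd ++ r.bd

@[simp] lemma strip_arrows (L : Legs K Λ) (p : List Bool) : strip (L.arrows p) = L.arr := by
  induction L generalizing p <;> simp_all [arrows, arr]

@[simp] lemma strip_boundary (L : Legs K Λ) (p : List Bool) : strip (L.boundary p) = L.bd := by
  induction L generalizing p <;> simp_all [boundary, bd]

/-- The hanging discs, a disc standing before those hanging on it. -/
def discList : List Bool → Legs K Λ → List (Disc K Λ)
  | _, nil => []
  | p, ext _ _ r => r.discList (false :: p)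
  | p, edge o a op s r =>
    hanging p o a op s :: (s.discList (true :: p) ++ r.discList (false :: p))

/-- Allows the prescribed order of the discs to be replaced by one suited to recursion; the sign of
that reordering is treated by `Kz.flatten`. -/
lemma discs_perm (L : Legs K Λ) (p : List Bool) :
    ((L.discs p).1 ++ (L.discs p).2).Perm (L.discList p) := by
  induction L generalizing p with
  | nil => simp [discs, discList]
  | ext o a r ih => exact ih _
  | edge o a op s r ihs ih =>
    have h1 : ((s.discs (true :: p)).1 ++ hanging p o a op s :: (s.discs (true :: p)).2).Perm
        (hanging p o a op s :: s.discList (true :: p)) :=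
      List.perm_middle.trans ((ihs _).cons _)
    have h2 := h1.append (ih (false :: p))
    simp only [discs, discList]
    rcases o with _ | _
    · refine List.Perm.trans ?_ h2
      simp only [Bool.false_eq_true, if_false]
      exact List.perm_append_comm_assoc _ _ _
    · simpa using h2

/-- All discs have the parity prescribed by the operation filling them. -/
def Bal (γ : Grading Λ O) (odd : K → ℕ) : Legs K Λ → Prop
  | nil => True
  | ext _ _ r => r.Bal γ odd
  | edge o a op s r =>
    γ.pw (bar (o, a) :: s.arr) + γ.D = odd op ∧ s.Bal γ odd ∧ r.Bal γ odd

/-- The sign exponent between the coefficient of a hanging disc and its clockwise version, the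
bold arrow being first. -/
def hsg (γ : Grading Λ O) (x : Letter Λ) (w : List (Letter Λ)) : ZMod 2 :=
  if x.1 then nsg γ (bar x :: w) else γ.p (bar x) * γ.pw w + tw γ 0 (w ++ [bar x])

/-- The exponent of the sign of the permutation of the symbols of the hanging discs. -/
def kap (γ : Grading Λ O) (odd : K → ℕ) : Legs K Λ → ZMod 2
  | nil => 0
  | ext _ _ r => r.kap γ odd
  | edge o a op s r => (odd op + (s.ops.map odd).sum : ℕ) * γ.pw r.arr + hsg γ (o, a) s.arr +
      γ.η (o, a) + s.kap γ odd + r.kap γ odd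

/-- The product of a disc. -/
def block (d : ℤ) (deg : Λ → ℤ) (C : Disc K Λ) : List (Sym × ℤ) :=
  (C.shift, -(d + 1)) :: tensorWord d deg [] C.word

variable {γ : Grading Λ O} {odd : K → ℕ} {d : ℤ} {deg : Λ → ℤ}

lemma pw_norm (γ : Grading Λ O) (W : List (Letter Λ)) : γ.pw (norm W) = γ.pw W := by
  rw [norm, γ.pw_append, add_comm, ← γ.pw_append, List.rdropWhile_append_rtakeWhile]

lemma dg_block (h : γ.Of d deg) (C : Disc K Λ) :
    dg (block d deg C) = γ.D + γ.pw (strip C.word) := by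
  rw [block, dg_cons, dg_tensorWord h, h.D]
  simp only [Int.cast_neg, CharTwo.neg_eq]

lemma pw_hanging (γ : Grading Λ O) (p : List Bool) (o : Bool) (a : Λ) (op : K) (s : Legs K Λ) :
    γ.pw (strip (hanging p o a op s).word) = γ.pw (bar (o, a) :: s.arr) := by
  rcases o with _ | _
  · simp [hanging, bar]; ring
  · simp [hanging, strip_normalize, pw_norm, bar]

lemma dg_discList (h : γ.Of d deg) {L : Legs K Λ} (hL : L.Bal γ odd) (p : List Bool) :
    dg ((L.discList p).flatMap (block d deg)) = ((L.ops.map odd).sum : ℕ) := by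
  induction L generalizing p with
  | nil => simp [discList, ops]
  | ext o a r ih => exact ih hL _
  | edge o a op s r ihs ih =>
    simp only [discList, List.flatMap_cons, List.flatMap_append, dg_append, ihs hL.2.1,
      ih hL.2.2, dg_block h, pw_hanging, ops, List.map_cons, List.map_append, List.sum_cons,
      List.sum_append, Nat.cast_add, ← hL.1]
    ring

lemma dg_pairings (L : Legs K Λ) (p : List Bool) : dg (L.pairings d deg p) = 0 := by
  induction L generalizing p with
  | nil => rfl
  | ext o a r ih => exact ih _
  | edge o a op s r ihs ih =>
    simp only [pairings, dg_append, ihs, ih, dg_cons, dg_nil]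
    push_cast
    generalize (deg a : ZMod 2) = x
    generalize (d : ZMod 2) = y
    decide +revert

/-- An outgoing bold arrow is last in the word and has to be rotated to the front; with an incoming
one, the rotation made by `normalize` has to be undone. In both cases the bold arrow then follows
the shift directly. -/
lemma kz_hanging (h : γ.Of d deg) (p : List Bool) (o : Bool) (a : Λ) (op : K) (s : Legs K Λ) :
    Kz (block d deg (hanging p o a op s))
      ((Sym.shift p, -(d + 1)) :: clock d deg ((!o, a, Sym.far p) :: s.arrows (true :: p)))
      (hsg γ (o, a) s.arr) := by
  rcases o with _ | _
  · have h1 := kz_tensorWord h [] rfl (s.arrows (true :: p) ++ [(true, a, Sym.far p)])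
    have h2 := Kz.swap (clock d deg (s.arrows (true :: p))) (clock d deg [(true, a, Sym.far p)])
    rw [← clock_append, ← clock_append] at h2
    refine (((h1.congr rfl (List.append_nil _) rfl).trans h2).left
      [(Sym.shift p, -(d + 1))]).congr rfl rfl ?_
    simp [h.dg_clock, hsg, bar]
    ring
  · refine ((kz_normalize h ((false, a, Sym.far p) :: s.arrows (true :: p))).left
      [(Sym.shift p, -(d + 1))]).congr rfl rfl ?_
    simp [hsg, bar]

/-- The sign computation for one edge and its subtree: the blocks of the subtree are moved next to
the arrow on which they hang, written clockwise, treated recursively, and the three symbols of the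
edge are put in the order of a contraction. All contractions are even and can then be collected at
the end. -/
lemma kz_legs (h : γ.Of d deg) {L : Legs K Λ} (hL : L.Bal γ odd) (p : List Bool) :
    Kz (clock d deg (L.arrows p) ++ (L.discList p).flatMap (block d deg))
      (clock d deg (L.boundary p) ++ L.pairings d deg p)
      (L.kap γ odd + γ.D * (L.outward : ZMod 2)) := by
  induction L generalizing p with
  | nil => simpa [arrows, discList, boundary, pairings, kap, outward] using Kz.refl _
  | ext o a r ih =>
    refine ((ih hL (false :: p)).left (clock d deg [(o, a, Sym.near p)])).congr ?_ ?_ rfl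
    · simp [arrows, discList, clock]
    · simp [boundary, pairings, clock]
  | edge o a op s r ihs ih =>
    -- The subtree passes the remaining arrows of the disc at hand. Its parity is the number of odd
    -- operations in it, which is the first term of `kap`.
    have k1 := Kz.move (clock d deg [(o, a, Sym.near p)]) (clock d deg (r.arrows (false :: p)))
      (block d deg (hanging p o a op s) ++ (s.discList (true :: p)).flatMap (block d deg))
      ((r.discList (false :: p)).flatMap (block d deg))
    have e1 : dg (block d deg (hanging p o a op s) ++
        (s.discList (true :: p)).flatMap (block d deg)) =
        ((odd op + (s.ops.map odd).sum : ℕ) : ZMod 2) := by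
      rw [dg_append, dg_block h, pw_hanging, dg_discList h hL.2.1, Nat.cast_add, ← hL.1]
      ring
    rw [h.dg_clock, strip_arrows, e1] at k1
    have k2 := (kz_hanging h p o a op s).right ((s.discList (true :: p)).flatMap (block d deg))
    have k3 := (ihs hL.2.1 (true :: p)).left
      [(Sym.shift p, -(d + 1)), (Sym.far p, if !o then deg a + d else -(deg a - 1))]
    -- Near half, shift and far half already have the order of a contraction if the near half is
    -- incoming. Otherwise they are reversed, which costs `η` together with the shift parity counted
    -- by `outward`.
    have k4 : Kz [(Sym.near p, if o then deg a + d else -(deg a - 1)), (Sym.shift p, -(d + 1)),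
          (Sym.far p, if !o then deg a + d else -(deg a - 1))]
        [(if o then Sym.far p else Sym.near p, -(deg a - 1)), (Sym.shift p, -(d + 1)),
          (if o then Sym.near p else Sym.far p, deg a + d)]
        (γ.η (o, a) + γ.D * (if o then 1 else 0 : ℤ)) := by
      rcases o with _ | _
      · exact (Kz.refl _).congr rfl rfl (by simp [Grading.η])
      · have m1 := Kz.swap [(Sym.near p, deg a + d), (Sym.shift p, -(d + 1))]
          [(Sym.far p, -(deg a - 1))]
        have m2 := (Kz.swap [(Sym.near p, deg a + d)] [(Sym.shift p, -(d + 1))]).left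
          [(Sym.far p, -(deg a - 1))]
        refine (m1.trans m2).congr rfl rfl ?_
        simp only [Grading.η, dg_cons, dg_nil, h.q, h.D, if_true]
        push_cast
        generalize (deg a : ZMod 2) = x
        generalize (d : ZMod 2) = y
        decide +revert
    have e2 := dg_perm k4.1
    have e3 : dg [(if o then Sym.far p else Sym.near p, -(deg a - 1)), (Sym.shift p, -(d + 1)),
          (if o then Sym.near p else Sym.far p, deg a + d)] = 0 := by
      simp only [dg_cons, dg_nil]
      push_cast
      generalize (deg a : ZMod 2) = x
      generalize (d : ZMod 2) = y
      decide +revert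
    have e4 := dg_pairings (d := d) (deg := deg) s (true :: p)
    -- A completed contraction is even, so it can be moved behind the outer arrows without a sign.
    have k5 := Kz.move [] [(if o then Sym.far p else Sym.near p, -(deg a - 1)),
        (Sym.shift p, -(d + 1)), (if o then Sym.near p else Sym.far p, deg a + d)]
      (clock d deg (s.boundary (true :: p))) (s.pairings d deg (true :: p) ++
        (clock d deg (r.boundary (false :: p)) ++ r.pairings d deg (false :: p)))
    have k6 := Kz.move (clock d deg (s.boundary (true :: p)))
      ([(if o then Sym.far p else Sym.near p, -(deg a - 1)), (Sym.shift p, -(d + 1)),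
        (if o then Sym.near p else Sym.far p, deg a + d)] ++ s.pairings d deg (true :: p))
      (clock d deg (r.boundary (false :: p))) (r.pairings d deg (false :: p))
    rw [e3, zero_mul] at k5
    rw [dg_append, e3, e4, add_zero, zero_mul] at k6
    have k7 := ((k2.trans (k3.congr (by simp [clock]) rfl rfl)).append
      (ih hL.2.2 (false :: p))).left (clock d deg [(o, a, Sym.near p)])
    have k8 := k4.right (clock d deg (s.boundary (true :: p)) ++ (s.pairings d deg (true :: p) ++
        (clock d deg (r.boundary (false :: p)) ++ r.pairings d deg (false :: p))))
    have k9 := k8.trans ((k5.congr rfl rfl rfl).trans (k6.congr (by simp) rfl rfl))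
    refine ((k1.congr ?_ rfl rfl).trans ((k7.congr ?_ rfl rfl).trans
      (k9.congr ?_ rfl rfl))).congr rfl ?_ ?_
    · simp [arrows, discList, clock]
    · simp
    · simp [clock]
    · simp [boundary, pairings]
    · simp only [kap, outward]
      push_cast
      ring
end Legs
end
section
variable {k : Type w} [Field k] {Λ : Type t} {O : Type u}

namespace Legs
variable {K : Type} {γ : Grading Λ O} {odd : K → ℕ} {d : ℤ} {deg : Λ → ℤ}

/-- The symbol belongs to an address ending with `p`. -/
def Under (p : List Bool) : Sym → Prop
  | Sym.rootOut => False
  | Sym.rootShift => False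
  | Sym.near q => p <:+ q
  | Sym.far q => p <:+ q
  | Sym.shift q => p <:+ q

lemma Under.of_cons {b : Bool} {p : List Bool} {s : Sym} (h : Under (b :: p) s) : Under p s := by
  cases s <;> first | exact h | exact (List.suffix_cons b p).trans h

lemma Under.disjoint {p : List Bool} {s : Sym} (h : Under (true :: p) s)
    (h' : Under (false :: p) s) : False := by
  have key : ∀ q : List Bool, (true :: p) <:+ q → (false :: p) <:+ q → False := by
    intro q h1 h2
    have h3 := (List.suffix_of_suffix_length_le h1 h2 (by simp)).eq_of_length (by simp)
    simp at h3
  cases s <;> first | exact h | exact key _ h h'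

lemma not_under (b : Bool) (p : List Bool) : ¬ Under (b :: p) (Sym.near p) ∧
    ¬ Under (b :: p) (Sym.far p) ∧ ¬ Under (b :: p) (Sym.shift p) := by
  have key : ¬ (b :: p) <:+ p := fun h => by simpa using h.length_le
  exact ⟨key, key, key⟩

/-- The addresses in the hanging subtree end with `true :: p`, those in the rest with `false :: p`,
so all symbols differ. Thus positions found by `idxOf` in `koszul` are meaningful. -/
lemma nodup_symbols (L : Legs K Λ) (p : List Bool) :
    ((clock d deg (L.boundary p) ++ L.pairings d deg p).map Prod.fst).Nodup ∧
      ∀ s ∈ (clock d deg (L.boundary p) ++ L.pairings d deg p).map Prod.fst, Under p s := by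
  induction L generalizing p with
  | nil => simp [boundary, pairings]
  | ext o a r ih =>
    obtain ⟨h1, h2⟩ := ih (false :: p)
    have e : (clock d deg ((ext o a r).boundary p) ++ (ext o a r).pairings d deg p).map Prod.fst =
        Sym.near p :: (clock d deg (r.boundary (false :: p)) ++
          r.pairings d deg (false :: p)).map Prod.fst := by
      simp [boundary, pairings, clock]
    rw [e, List.nodup_cons]
    refine ⟨⟨fun h => (not_under false p).1 (h2 _ h), h1⟩, fun s hs => ?_⟩
    rcases List.mem_cons.1 hs with rfl | hs
    · exact List.suffix_refl p
    · exact (h2 s hs).of_cons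
  | edge o a op s r ihs ih =>
    obtain ⟨h1, h2⟩ := ih (false :: p)
    obtain ⟨g1, g2⟩ := ihs (true :: p)
    have e : ((clock d deg ((edge o a op s r).boundary p) ++
          (edge o a op s r).pairings d deg p).map Prod.fst).Perm
        ([Sym.near p, Sym.far p, Sym.shift p] ++ ((clock d deg (s.boundary (true :: p)) ++
            s.pairings d deg (true :: p)).map Prod.fst ++
          (clock d deg (r.boundary (false :: p)) ++ r.pairings d deg (false :: p)).map
            Prod.fst)) := by
      rw [List.perm_iff_count]
      intro x
      rcases o with _ | _ <;> simp [boundary, pairings, List.count_cons] <;> ring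
    refine ⟨e.nodup_iff.2 ?_, fun x hx => ?_⟩
    · refine List.nodup_append.2 ⟨by simp, List.nodup_append.2 ⟨g1, h1, ?_⟩, ?_⟩
      · rintro x hx y hy rfl
        exact (g2 x hx).disjoint (h2 x hy)
      · rintro x hx y hy rfl
        have hb : ∃ b, Under (b :: p) x := by
          rcases List.mem_append.1 hy with hy | hy
          · exact ⟨_, g2 x hy⟩
          · exact ⟨_, h2 x hy⟩
        obtain ⟨b, hb⟩ := hb
        obtain ⟨n1, n2, n3⟩ := not_under b p
        simp only [List.mem_cons, List.not_mem_nil, or_false] at hx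
        rcases hx with rfl | rfl | rfl
        · exact n1 hb
        · exact n2 hb
        · exact n3 hb
    · have hx := e.mem_iff.1 hx
      rcases List.mem_append.1 hx with hx | hx
      · simp only [List.mem_cons, List.not_mem_nil, or_false] at hx
        rcases hx with rfl | rfl | rfl <;> exact List.suffix_refl p
      · rcases List.mem_append.1 hx with hx | hx
        · exact (g2 x hx).of_cons
        · exact (h2 x hx).of_cons

/-- The product, with signs, of the coefficients of the hanging discs. -/
def om (γ : Grading Λ O) (c : K → List (Letter Λ) → DualNumber k) : Legs K Λ → DualNumber k
  | nil => 1
  | ext _ _ r => r.om γ c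
  | edge o a op s r =>
    sg k (γ.η (o, a)) • (tau (γ.pw r.arr) (c op (bar (o, a) :: s.arr) * s.om γ c) * r.om γ c)

lemma discList_op (L : Legs K Λ) (p : List Bool) : (L.discList p).map Disc.op = L.ops := by
  induction L generalizing p with
  | nil => rfl
  | ext o a r ih => exact ih _
  | edge o a op s r ihs ih =>
    simp [discList, ops, ihs, ih, hanging]

lemma bal_of_discList (L : Legs K Λ) (p : List Bool)
    (h : ∀ C ∈ L.discList p, γ.pw (strip C.word) + γ.D = odd C.op) : L.Bal γ odd := by
  induction L generalizing p with
  | nil => trivial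
  | ext o a r ih => exact ih _ h
  | edge o a op s r ihs ih =>
    simp only [discList, List.mem_cons, List.mem_append] at h
    refine ⟨?_, ihs (true :: p) fun C hC => h C (by simp [hC]),
      ih (false :: p) fun C hC => h C (by simp [hC])⟩
    rw [← pw_hanging γ p o a op s]
    exact h _ (Or.inl rfl)

lemma tau_eps (n : ZMod 2) (m : ℕ) :
    tau n ((DualNumber.eps : DualNumber k) ^ m) = sg k (n * m) • DualNumber.eps ^ m := by
  rcases m with _ | _ | m
  · simp
  · ext <;> simp
  · rw [pow_succ, pow_succ, mul_assoc, DualNumber.eps_mul_eps]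
    simp

/-- `hsg` converts the coefficient of a hanging disc into the clockwise one starting at its bold
arrow. Cyclic invariance enters only if the bold arrow is outgoing, since otherwise the rotation is
already part of `ccw`. -/
lemma sg_hsg_mul {c : List (Letter Λ) → k}
    (hcyc : ∀ x w, ccw γ c (x :: w) = sg k (γ.p x * γ.pw w) * ccw γ c (w ++ [x]))
    (p : List Bool) (o : Bool) (a : Λ) (op : K) (s : Legs K Λ) :
    sg k (hsg γ (o, a) s.arr) * c (strip (hanging p o a op s).word) =
      ccw γ c (bar (o, a) :: s.arr) := by
  rcases o with _ | _
  · rw [hcyc, bar]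
    simp only [Bool.not_false, ccw_concat, hanging, hsg, Bool.false_eq_true, if_false, sg_add,
      mul_assoc, strip_append, strip_arrows]
    rfl
  · simp [hanging, hsg, strip_normalize, ccw, bar]

/-- Applied to powers of `ε`, the twists of `om` produce the term of `kap` for moving a subtree past
the remaining arrows: that subtree has the parity of its number of odd discs. -/
lemma om_eq {c : K → List (Letter Λ) → k}
    (hcyc : ∀ κ x w, ccw γ (c κ) (x :: w) = sg k (γ.p x * γ.pw w) * ccw γ (c κ) (w ++ [x]))
    (L : Legs K Λ) (p : List Bool) :
    L.om γ (fun κ W => ccw γ (c κ) W • (DualNumber.eps : DualNumber k) ^ odd κ) =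
      (sg k (L.kap γ odd) * ((L.discList p).map fun C => c C.op (strip C.word)).prod) •
        DualNumber.eps ^ (L.ops.map odd).sum := by
  induction L generalizing p with
  | nil => simp [om, kap, discList, ops]
  | ext o a r ih => exact ih (false :: p)
  | edge o a op s r ihs ih =>
    rw [om, ihs (true :: p), ih (false :: p), ← sg_hsg_mul (hcyc op) p o a op s]
    simp only [discList, ops, List.map_cons, List.map_append, List.sum_cons, List.sum_append,
      List.prod_cons, List.prod_append, kap, smul_mul_smul_comm, ← pow_add, tau_smul, tau_eps,
      smul_smul, sg_add]
    congr 1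
    · have : (hanging p o a op s).op = op := rfl
      rw [this, mul_comm (γ.pw r.arr)]
      ring
    · ring
end Legs
-- Sign and weight of a whole diagram
namespace Diagram
variable {K : Type} {γ : Grading Λ O} {odd : K → ℕ} {d : ℤ} {deg : Λ → ℤ}

lemma discs_perm (D : Diagram K Λ) : D.discs.Perm (D.rootDisc :: D.legs.discList []) :=
  List.perm_middle.trans ((D.legs.discs_perm []).cons _)

lemma word_eq (D : Diagram K Λ) : D.word = D.legs.bd ++ [(true, D.root)] := by
  have : D.word = strip D.boundary := rfl
  simp [this, boundary]

lemma strip_rootDisc (D : Diagram K Λ) :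
    strip D.rootDisc.word = D.legs.arr ++ [(true, D.root)] := by
  simp [rootDisc]

/-- With at most one odd disc the order of the discs does not matter. The root disc then contributes
its reordering, the bold arrow passes the hanging discs, these contribute `kap`, and the outer
arrows are finally brought back into the order of a tensor. -/
lemma signExp_eq (h : γ.Of d deg) (D : Diagram K Λ)
    (hB : ∀ C ∈ D.rootDisc :: D.legs.discList [], γ.pw (strip C.word) + γ.D = odd C.op)
    (hodd : (D.ops.map odd).sum ≤ 1) :
    ((D.signExp d deg : ℤ) : ZMod 2) = tw γ 0 (D.legs.arr ++ [(true, D.root)]) +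
      γ.p (true, D.root) * (D.legs.ops.map odd).sum + D.legs.kap γ odd +
      tw γ 0 (D.legs.bd ++ [(true, D.root)]) := by
  have hL : D.legs.Bal γ odd :=
    D.legs.bal_of_discList [] fun C hC => hB C (List.mem_cons_of_mem _ hC)
  -- The discs are listed with the root first and each disc before those hanging on it. Of any two
  -- blocks at least one is even, so there is no sign.
  have k0 : Kz (D.discs.flatMap (Legs.block d deg))
      ((D.rootDisc :: D.legs.discList []).flatMap (Legs.block d deg)) 0 := by
    rw [List.flatMap_def, List.flatMap_def]
    refine Kz.flatten (D.discs_perm.map _) (List.Pairwise.map _ (fun _ _ h => h) ?_)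
    refine List.Pairwise.perm ?_ D.discs_perm.symm fun {L M} h => by rwa [mul_comm]
    have h1 : ((D.rootDisc :: D.legs.discList []).map fun C => odd C.op).sum ≤ 1 := by
      refine le_trans (le_of_eq ?_) hodd
      rw [Diagram.ops, ← D.legs.discList_op []]
      simp [rootDisc, Function.comp_def]
    revert hB h1
    generalize D.rootDisc :: D.legs.discList [] = B
    intro hB h1
    have h2 : B.Pairwise fun C C' => odd C.op * odd C'.op = 0 := by
      clear hB
      induction B with
      | nil => exact List.Pairwise.nil
      | cons C B ih =>
        simp only [List.map_cons, List.sum_cons] at h1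
        refine List.pairwise_cons.2 ⟨fun C' hC' => ?_, ih (by omega)⟩
        have : odd C'.op ≤ (B.map fun C => odd C.op).sum :=
          List.single_le_sum (by simp) _ (List.mem_map.2 ⟨C', hC', rfl⟩)
        rcases Nat.eq_zero_or_pos (odd C.op) with h | h
        · simp [h]
        · have : odd C'.op = 0 := by omega
          simp [this]
    refine h2.imp_of_mem fun {C C'} hC hC' h' => ?_
    rw [Legs.dg_block h, Legs.dg_block h, add_comm, hB C hC, add_comm, hB C' hC', ← Nat.cast_mul,
      h', Nat.cast_zero]
  have k1 := ((kz_tensorWord h [] rfl D.rootDisc.word).left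
    [(Sym.rootShift, -(d + 1))]).right ((D.legs.discList []).flatMap (Legs.block d deg))
  -- The bold arrow, at the end of the root disc, moves past all hanging discs, so that the other
  -- arrows stand next to what hangs on them.
  have k2 := Kz.move ((Sym.rootShift, -(d + 1)) :: clock d deg (D.legs.arrows []))
    (clock d deg [(true, D.root, Sym.rootOut)])
    ((D.legs.discList []).flatMap (Legs.block d deg)) []
  rw [Legs.dg_discList h hL, h.dg_clock] at k2
  have k3 := ((Legs.kz_legs h hL []).left [(Sym.rootShift, -(d + 1))]).right
    (clock d deg [(true, D.root, Sym.rootOut)])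
  have k4 := Kz.move ((Sym.rootShift, -(d + 1)) :: clock d deg (D.legs.boundary []))
    (D.legs.pairings d deg []) (clock d deg [(true, D.root, Sym.rootOut)]) []
  rw [Legs.dg_pairings, zero_mul] at k4
  -- This step goes from the clockwise order back to the tensor, so `kz_tensorWord` is used in
  -- reverse; modulo two the exponent is the same.
  have k5 : Kz ((Sym.rootShift, -(d + 1)) :: clock d deg D.boundary ++ D.legs.pairings d deg [])
      ((Sym.rootShift, -(d + 1)) :: tensorWord d deg (D.legs.pairings d deg []) D.boundary)
      (tw γ 0 (strip D.boundary)) := by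
    have k6 := (kz_tensorWord h (D.legs.pairings d deg []) (Legs.dg_pairings _ _) D.boundary).left
      [(Sym.rootShift, -(d + 1))]
    refine ⟨k6.1.symm, fun β hβ hn => ?_⟩
    rw [show (Sym.rootShift, -(d + 1)) :: clock d deg D.boundary ++ D.legs.pairings d deg [] =
      [(Sym.rootShift, -(d + 1))] ++ (clock d deg D.boundary ++ D.legs.pairings d deg []) from
        by simp] at hβ hn ⊢
    have := k6.2 β (fun x hx y hy => hβ x (k6.1.mem_iff.1 hx) y (k6.1.mem_iff.1 hy))
      (k6.1.nodup_iff.2 hn)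
    rw [List.singleton_append] at this
    rw [this, add_assoc, CharTwo.add_self_eq_zero, add_zero]
  have hn : ((Sym.rootShift, -(d + 1)) ::
      tensorWord d deg (D.legs.pairings d deg []) D.boundary).Nodup := by
    obtain ⟨n1, n2⟩ := Legs.nodup_symbols (d := d) (deg := deg) D.legs []
    refine (k5.1.nodup_iff.1 (List.Nodup.of_map Prod.fst ?_))
    have e : (((Sym.rootShift, -(d + 1)) :: clock d deg D.boundary ++
        D.legs.pairings d deg []).map Prod.fst).Perm (Sym.rootShift :: Sym.rootOut ::
          (clock d deg (D.legs.boundary []) ++ D.legs.pairings d deg []).map Prod.fst) := by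
      rw [List.perm_iff_count]
      intro x
      simp [boundary, clock, List.count_cons]
      ring
    rw [e.nodup_iff, List.nodup_cons, List.nodup_cons]
    refine ⟨fun hm => ?_, fun hm => n2 _ hm, n1⟩
    rcases List.mem_cons.1 hm with hm | hm
    · exact absurd hm (by simp)
    · exact n2 _ hm
  have k := k0.trans ((k1.congr ?_ rfl rfl).trans ((k2.congr ?_ rfl rfl).trans
    ((k3.congr ?_ rfl rfl).trans ((k4.congr ?_ rfl rfl).trans (k5.congr ?_ rfl rfl)))))
  · have := koszul_eq k hn
    rw [signExp]
    push_cast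
    rw [show (koszul ((Sym.rootShift, -(d + 1)) ::
      tensorWord d deg (D.legs.pairings d deg []) D.boundary) (D.discs.flatMap
        fun C => (C.shift, -(d + 1)) :: tensorWord d deg [] C.word) : ZMod 2) = _ from this]
    rw [strip_rootDisc, h.D]
    simp only [boundary, strip_append, Legs.strip_boundary, strip_cons, strip_nil, γ.pw_cons,
      γ.pw_nil]
    push_cast
    -- The sign `(-1)^((d+1)r)` put into the definition cancels the shift parities collected by
    -- `kz_legs` at the incoming bold arrows.
    have h2 : ∀ x : ZMod 2, x + x = 0 := CharTwo.add_self_eq_zero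
    linear_combination h2 (((d : ZMod 2) + 1) * D.legs.outward)
  · simp [Legs.block, rootDisc]
  · simp [rootDisc]
  · simp
  · simp
  · simp [boundary]

/-- The contribution of a diagram, in clockwise conventions. -/
lemma weight_eq (h : γ.Of d deg) {c : K → List (Letter Λ) → k}
    (hcyc : ∀ κ x w, ccw γ (c κ) (x :: w) = sg k (γ.p x * γ.pw w) * ccw γ (c κ) (w ++ [x]))
    (hpar : ∀ κ w, c κ w ≠ 0 → γ.pw w + γ.D = odd κ) (D : Diagram K Λ)
    (hodd : (D.ops.map odd).sum ≤ 1) :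
    (sg k (γ.p (true, D.root) * γ.pw D.legs.bd + tw γ 0 (D.legs.bd ++ [(true, D.root)])) *
        D.weight d deg c) • (DualNumber.eps : DualNumber k) ^ (D.ops.map odd).sum =
      ccw γ (c D.op) ((true, D.root) :: D.legs.arr) • DualNumber.eps ^ odd D.op *
        D.legs.om γ (fun κ W => ccw γ (c κ) W • (DualNumber.eps : DualNumber k) ^ odd κ) := by
  have hprod : (D.discs.map fun C => c C.op (C.word.map fun p => (p.1, p.2.1))).prod =
      c D.op (D.legs.arr ++ [(true, D.root)]) *
        ((D.legs.discList []).map fun C => c C.op (strip C.word)).prod := by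
    rw [(D.discs_perm.map _).prod_eq, List.map_cons, List.prod_cons, ← strip_rootDisc]
    rfl
  rw [weight, hprod, Legs.om_eq hcyc D.legs [], hcyc, ccw_concat, smul_mul_smul_comm, ← pow_add]
  -- If some coefficient vanishes both sides are zero. Otherwise each disc has the parity prescribed
  -- by its operation, as the sign computation requires.
  by_cases h0 : c D.op (D.legs.arr ++ [(true, D.root)]) *
      ((D.legs.discList []).map fun C => c C.op (strip C.word)).prod = 0
  · have h1 : ∀ x y : k, x * y * c D.op (D.legs.arr ++ [(true, D.root)]) * (sg k
        (D.legs.kap γ odd) * ((D.legs.discList []).map fun C => c C.op (strip C.word)).prod) =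
        x * y * sg k (D.legs.kap γ odd) * (c D.op (D.legs.arr ++ [(true, D.root)]) *
          ((D.legs.discList []).map fun C => c C.op (strip C.word)).prod) := by
      intro x y; ring
    rw [← mul_assoc (sg k _) (sg k _), h1, h0, mul_zero, mul_zero, mul_zero, zero_smul, zero_smul]
  have hB : ∀ C ∈ D.rootDisc :: D.legs.discList [], γ.pw (strip C.word) + γ.D = odd C.op := by
    intro C hC
    refine hpar _ _ ?_
    rcases List.mem_cons.1 hC with rfl | hC
    · rw [strip_rootDisc]; exact left_ne_zero_of_mul h0
    · intro h2
      refine right_ne_zero_of_mul h0 (List.prod_eq_zero ?_)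
      exact List.mem_map.2 ⟨C, hC, h2⟩
  have hL : D.legs.Bal γ odd :=
    D.legs.bal_of_discList [] fun C hC => hB C (List.mem_cons_of_mem _ hC)
  -- Rearranging symbols preserves the total parity and contractions are even, so the outer arrows
  -- differ in parity from those of the root disc by the number of odd hanging discs.
  have hbd : γ.pw D.legs.bd = γ.pw D.legs.arr + (D.legs.ops.map odd).sum := by
    have := dg_perm (Legs.kz_legs h hL []).1
    rw [dg_append, dg_append, h.dg_clock, h.dg_clock, Legs.dg_pairings, Legs.dg_discList h hL,
      Legs.strip_arrows, Legs.strip_boundary, add_zero] at this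
    exact this.symm
  congr 1
  · rw [negOnePow_eq_sg, signExp_eq h D hB hodd, hbd]
    have e : ∀ x y z w s : ZMod 2, sg k (x * (y + z) + w) * (sg k (s + x * z +
        D.legs.kap γ odd + w)) = sg k (x * y) * sg k s * sg k (D.legs.kap γ odd) := by
      intro x y z w s
      rw [← sg_add, ← sg_add, ← sg_add]
      congr 1
      generalize D.legs.kap γ odd = t
      decide +revert
    rw [← mul_assoc, e]
    ring
end Diagram
end
section
variable {k : Type w} [Field k] {Λ : Type t} {O : Type u}

/-! ### Words of labelled discs -/

section Words
variable {A B : GrQuiver.{u, v, w} k O}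

/-- The incoming labels of a disc, block by block, with the leftmost objects of the blocks. -/
def inCode (τ : DiscType O) (a : ∀ p : τ.In, A.Idx (τ.x p.1 p.2.castSucc) (τ.x p.1 p.2.succ)) :
    List (O × List (Lab A)) :=
  (List.finRange (τ.n + 1)).map fun s =>
    (τ.x s 0, List.ofFn fun j : Fin (τ.m s) => (⟨_, _, a ⟨s, j⟩⟩ : Lab A))

/-- An input label carries its two objects, so the labels give every object of a block except the
leftmost one, which matters for blocks without inputs and is recorded separately. -/
lemma inCode_injective {τ τ' : DiscType O}
    {a : ∀ p : τ.In, A.Idx (τ.x p.1 p.2.castSucc) (τ.x p.1 p.2.succ)}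
    {a' : ∀ p : τ'.In, A.Idx (τ'.x p.1 p.2.castSucc) (τ'.x p.1 p.2.succ)}
    (h : inCode τ a = inCode τ' a') :
    (⟨τ, a⟩ : Σ τ : DiscType O, ∀ p : τ.In, A.Idx (τ.x p.1 p.2.castSucc) (τ.x p.1 p.2.succ)) =
      ⟨τ', a'⟩ := by
  obtain ⟨n, m, x⟩ := τ
  obtain ⟨n', m', x'⟩ := τ'
  have hn : n = n' := by
    have := congrArg List.length h
    simpa [inCode] using this
  subst hn
  simp only [inCode, List.map_inj_left, List.mem_finRange, forall_true_left, Prod.mk.injEq] at h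
  have hm : m = m' := by
    funext s
    have := congrArg List.length (h s).2
    simpa using this
  subst hm
  have h2 : ∀ s j, (⟨_, _, a ⟨s, j⟩⟩ : Lab A) = ⟨_, _, a' ⟨s, j⟩⟩ := fun s j =>
    congrFun (List.ofFn_injective (h s).2) j
  have hx : x = x' := by
    funext s j
    refine Fin.cases (h s).1 (fun j => ?_) j
    exact congrArg Lab.r (h2 s j)
  subst hx
  congr 1
  funext ⟨s, j⟩
  have := h2 s j
  simpa using this

/-- The labels of a disc, block by block. -/
def Filled.blocks (f : Filled A B) : List (List (Lab A) × Lab B) :=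
  (List.finRange (f.τ.n + 1)).map fun s =>
    (List.ofFn fun j : Fin (f.τ.m s) => ⟨_, _, f.a ⟨s, j⟩⟩, ⟨_, _, f.b s⟩)

lemma Filled.blocks_injective : Function.Injective (Filled.blocks (A := A) (B := B)) := by
  intro f f' h
  have h1 : ∀ f : Filled A B, inCode f.τ f.a = f.blocks.map fun p => (p.2.l, p.1) := by
    intro f
    simp [inCode, Filled.blocks, Function.comp_def]
  have h2 := inCode_injective (((h1 f).trans (by rw [h])).trans (h1 f').symm)
  obtain ⟨τ, a, b⟩ := f
  obtain ⟨τ', a', b'⟩ := f'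
  obtain ⟨rfl, h2⟩ := Sigma.mk.inj h2
  obtain rfl := eq_of_heq h2
  simp only [Filled.blocks, List.map_inj_left, List.mem_finRange, forall_true_left,
    Prod.mk.injEq] at h
  congr 1
  funext s
  simpa using (h s).2

/-- The word of a block. -/
def blockWord (p : List Λ × Λ) : List (Letter Λ) :=
  (p.1.map fun a => (false, a)).reverse ++ [(true, p.2)]

lemma append_out_inj {U U' R R' : List (Letter Λ)} {b b' : Λ} (hU : ∀ x ∈ U, x.1 = false)
    (hU' : ∀ x ∈ U', x.1 = false) (h : U ++ (true, b) :: R = U' ++ (true, b') :: R') :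
    U = U' ∧ b = b' ∧ R = R' := by
  induction U generalizing U' with
  | nil =>
    cases U' with
    | nil => simpa using h
    | cons y U' =>
      simp only [List.nil_append, List.cons_append, List.cons.injEq] at h
      have := hU' y (by simp)
      rw [← h.1] at this
      simp at this
  | cons x U ih =>
    cases U' with
    | nil =>
      simp only [List.nil_append, List.cons_append, List.cons.injEq] at h
      have := hU x (by simp)
      rw [h.1] at this
      simp at this
    | cons y U' =>
      simp only [List.cons_append, List.cons.injEq] at h
      obtain ⟨rfl, h2, h3⟩ := (⟨h.1, ih (fun z hz => hU z (by simp [hz]))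
        (fun z hz => hU' z (by simp [hz])) h.2⟩ : _ ∧ _ ∧ _)
      exact ⟨by rw [h2], h3⟩

lemma flatMap_blockWord_injective :
    Function.Injective fun L : List (List Λ × Λ) => L.flatMap blockWord := by
  intro L L' h
  induction L generalizing L' with
  | nil =>
    cases L' with
    | nil => rfl
    | cons p L' => simp [blockWord] at h
  | cons p L ih =>
    cases L' with
    | nil => simp [blockWord] at h
    | cons p' L' =>
      simp only [List.flatMap_cons, blockWord, List.append_assoc, List.singleton_append] at h
      obtain ⟨h1, h2, h3⟩ := append_out_inj (by simp +contextual) (by simp +contextual) h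
      rw [ih h3]
      congr 1
      refine Prod.ext ?_ h2
      have := List.reverse_injective h1
      exact List.map_injective_iff.2 (fun a b h => by simpa using h) this

variable {i : Lab A → Λ} {o : Lab B → Λ}

lemma Filled.word_eq (f : Filled A B) :
    f.word i o = (f.blocks.map (Prod.map (List.map i) o)).flatMap blockWord := by
  simp only [Filled.word, Filled.blocks, List.flatMap_map, blockWord, Prod.map, List.map_ofFn,
    Function.comp_def]

/-- Outgoing letters mark the ends of the blocks, and output labels carry their objects, so nothing
is lost in the word. Hence the choice of a disc in `Multi.coeff` is harmless. -/
lemma Filled.word_injective (hi : Function.Injective i) (ho : Function.Injective o) :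
    Function.Injective fun f : Filled A B => f.word i o := by
  intro f f' h
  simp only [Filled.word_eq] at h
  have h2 := flatMap_blockWord_injective h
  refine Filled.blocks_injective (List.map_injective_iff.2 ?_ h2)
  exact (List.map_injective_iff.2 hi).prodMap ho

lemma Filled.word_map {Λ' : Type*} (φ : Λ → Λ') (f : Filled A B) :
    f.word (fun a => φ (i a)) (fun b => φ (o b)) =
      (f.word i o).map fun x => (x.1, φ x.2) := by
  simp [Filled.word, List.map_flatMap, List.map_reverse, List.map_ofFn, Function.comp_def]

lemma Filled.endsOut_word (f : Filled A B) : EndsOut (f.word i o) := by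
  rw [Filled.word, List.finRange_succ_last, List.flatMap_append]
  simp only [List.flatMap_singleton, ← List.append_assoc]
  exact ⟨_, _, rfl⟩

lemma Filled.mem_word (f : Filled A B) {x : Letter Λ} (hx : x ∈ f.word i o) :
    (x.1 = false ∧ ∃ a, i a = x.2) ∨ (x.1 = true ∧ ∃ b, o b = x.2) := by
  simp only [Filled.word, List.mem_flatMap, List.mem_append, List.mem_reverse, List.mem_ofFn,
    List.mem_singleton] at hx
  obtain ⟨s, -, ⟨j, rfl⟩ | rfl⟩ := hx
  · exact Or.inl ⟨rfl, _, rfl⟩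
  · exact Or.inr ⟨rfl, _, rfl⟩

/-! ### Coherence -/

section Coherence
variable (γ : Grading Λ O)

lemma Grading.chain_flatMap {n : ℕ} (y : Fin (n + 1) → O) (W : Fin n → List (Letter Λ))
    (h : ∀ s, γ.Chain (y s.castSucc) (W s) (y s.succ)) :
    γ.Chain (y 0) ((List.finRange n).flatMap W) (y (Fin.last n)) := by
  induction n with
  | zero => exact rfl
  | succ n ih =>
    rw [List.finRange_succ, List.flatMap_cons, List.flatMap_map]
    exact (γ.chain_append).2 ⟨_, h 0, ih (fun s => y s.succ) (fun s => W s.succ) fun s => h s.succ⟩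

lemma Grading.exists_of_chain_flatMap {n : ℕ} (W : Fin n → List (Letter Λ)) {a b : O}
    (h : γ.Chain a ((List.finRange n).flatMap W) b) : ∃ y : Fin (n + 1) → O,
      y 0 = a ∧ y (Fin.last n) = b ∧ ∀ s, γ.Chain (y s.castSucc) (W s) (y s.succ) := by
  induction n generalizing a with
  | zero => exact ⟨fun _ => a, rfl, h, fun s => s.elim0⟩
  | succ n ih =>
    rw [List.finRange_succ, List.flatMap_cons, List.flatMap_map] at h
    obtain ⟨c, h1, h2⟩ := (γ.chain_append).1 h
    obtain ⟨y, rfl, y2, y3⟩ := ih (fun s => W s.succ) h2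
    refine ⟨Fin.cases a y, rfl, by rw [← Fin.succ_last]; exact y2, fun s => ?_⟩
    rcases Fin.eq_zero_or_eq_succ s with rfl | ⟨s, rfl⟩
    · exact h1
    · exact y3 s

lemma Grading.chain_reverse {m : ℕ} (x : Fin (m + 1) → O) (u : Fin m → Letter Λ)
    (h1 : ∀ j, γ.bef (u j) = x j.succ) (h2 : ∀ j, γ.aft (u j) = x j.castSucc) :
    γ.Chain (x (Fin.last m)) (List.ofFn u).reverse (x 0) := by
  induction m with
  | zero => exact rfl
  | succ m ih =>
    rw [List.ofFn_succ, List.reverse_cons]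
    exact (γ.chain_append).2 ⟨_, ih (fun j => x j.succ) _ (fun j => h1 j.succ) fun j => h2 j.succ,
      (h1 0).symm, h2 0⟩

lemma Grading.of_chain_reverse {m : ℕ} (u : Fin m → Letter Λ) {p q : O}
    (h : γ.Chain p (List.ofFn u).reverse q) :
    (∀ j : Fin m, (Fin.cases q (fun j => γ.bef (u j)) j.castSucc : O) = γ.aft (u j)) ∧
      (Fin.cases q (fun j => γ.bef (u j)) (Fin.last m) : O) = p := by
  induction m generalizing q with
  | zero => exact ⟨fun j => j.elim0, h.symm⟩
  | succ m ih =>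
    rw [List.ofFn_succ, List.reverse_cons] at h
    obtain ⟨c, h1, rfl, h2⟩ := (γ.chain_append).1 h
    obtain ⟨h3, h4⟩ := ih (fun j => u j.succ) h1
    refine ⟨fun j => ?_, ?_⟩
    · rcases Fin.eq_zero_or_eq_succ j with rfl | ⟨j, rfl⟩
      · exact h2.symm
      · rw [← h3 j]
        rcases m with _ | m
        · exact j.elim0
        · rcases Fin.eq_zero_or_eq_succ j with rfl | ⟨j, rfl⟩ <;> rfl
    · rw [← h4]
      rcases m with _ | m <;> rfl

variable {γ}

lemma Filled.coh_word (f : Filled A B) (hil : ∀ a, γ.l (i a) = a.l) (hir : ∀ a, γ.r (i a) = a.r)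
    (hol : ∀ b, γ.l (o b) = b.l) (hor : ∀ b, γ.r (o b) = b.r) : γ.Coh (f.word i o) := by
  obtain ⟨⟨n, m, x⟩, a, b⟩ := f
  -- `y s` is the rightmost object of the block `s`, where its clockwise word begins; the index `n +
  -- 1` wraps around to `0`, so the path closes up.
  let y : Fin (n + 2) → O := fun s => x (Fin.ofNat (n + 1) s) (Fin.last _)
  have hxx : ∀ s s', s = s' → x s (Fin.last _) = x s' (Fin.last _) := by
    rintro s _ rfl; rfl
  have h := γ.chain_flatMap y (fun s => (List.ofFn fun j : Fin (m s) =>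
    ((false, i ⟨_, _, a ⟨s, j⟩⟩) : Letter Λ)).reverse ++ [(true, o ⟨_, _, b s⟩)]) fun s => ?_
  · refine ⟨y 0, ?_⟩
    have hy : y (Fin.last (n + 1)) = y 0 := hxx _ _ (by ext; simp)
    rw [hy] at h
    exact h
  · refine (γ.chain_append).2 ⟨x s 0, ?_, (hol ⟨x s 0, x (s + 1) (Fin.last _), b s⟩).symm, ?_⟩
    · rw [show y s.castSucc = x s (Fin.last _) from hxx _ _ (by ext; simp)]
      exact γ.chain_reverse (x s) _ (fun j => hir ⟨_, _, a ⟨s, j⟩⟩) fun j => hil ⟨_, _, a ⟨s, j⟩⟩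
    · rw [show y s.succ = x (s + 1) (Fin.last _) from hxx _ _ (by ext; simp [Fin.val_add])]
      exact hor ⟨x s 0, x (s + 1) (Fin.last _), b s⟩

lemma Lab.exists_eq (a : Lab A) {l r : O} (hl : a.l = l) (hr : a.r = r) :
    ∃ e : A.Idx l r, (⟨l, r, e⟩ : Lab A) = a := by
  subst hl hr
  exact ⟨a.e, rfl⟩

lemma exists_blocks (U : List (Letter Λ)) (h : ∀ x ∈ U,
    (x.1 = false ∧ ∃ a, i a = x.2) ∨ (x.1 = true ∧ ∃ b, o b = x.2)) :
    ∃ (L : List (List (Lab A) × Lab B)) (u : List (Lab A)),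
      U = (L.map (Prod.map (List.map i) o)).flatMap blockWord ++
        ((u.map i).map fun a => (false, a)).reverse := by
  induction U using List.reverseRecOn with
  | nil => exact ⟨[], [], rfl⟩
  | append_singleton U x ih =>
    obtain ⟨L, u, rfl⟩ := ih fun y hy => h y (by simp [hy])
    rcases x with ⟨s, c⟩
    rcases h (s, c) (by simp) with ⟨rfl, a, rfl⟩ | ⟨rfl, b, rfl⟩
    · exact ⟨L, a :: u, by simp⟩
    · exact ⟨L ++ [(u, b)], [], by simp [blockWord]⟩

/-- Converse of `Filled.coh_word`: for a properly typed word ending with an outgoing arrow, being a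
closed path is the only condition for being the word of a disc. -/
lemma exists_filled (hil : ∀ a, γ.l (i a) = a.l) (hir : ∀ a, γ.r (i a) = a.r)
    (hol : ∀ b, γ.l (o b) = b.l) (hor : ∀ b, γ.r (o b) = b.r) {W : List (Letter Λ)}
    (hW : γ.Coh W) (h0 : EndsOut W) (h : ∀ x ∈ W,
      (x.1 = false ∧ ∃ a, i a = x.2) ∨ (x.1 = true ∧ ∃ b, o b = x.2)) :
    ∃ f : Filled A B, f.word i o = W := by
  obtain ⟨U, c, rfl⟩ := h0
  obtain ⟨L, u, rfl⟩ := exists_blocks U fun x hx => h x (by simp [hx])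
  obtain ⟨b, rfl⟩ : ∃ b, o b = c := by
    rcases h (true, c) (by simp) with ⟨h, -⟩ | ⟨-, h⟩
    · simp at h
    · exact h
  obtain ⟨n, M, hM⟩ : ∃ (n : ℕ) (M : Fin (n + 1) → List (Lab A) × Lab B),
      L ++ [(u, b)] = List.ofFn M := by
    generalize hl : L ++ [(u, b)] = l
    have hn : l.length = L.length + 1 := by rw [← hl]; simp
    refine ⟨L.length, fun s => l.get (s.cast hn.symm), ?_⟩
    refine List.ext_getElem (by simp [hn]) fun j h1 h2 => ?_
    rw [List.getElem_ofFn]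
    rfl
  have e : (L.map (Prod.map (List.map i) o)).flatMap blockWord ++
      ((u.map i).map fun a => ((false, a) : Letter Λ)).reverse ++ [(true, o b)] =
      (List.finRange (n + 1)).flatMap fun s =>
        (List.ofFn fun j : Fin (M s).1.length => ((false, i ((M s).1.get j)) : Letter Λ)).reverse ++
          [(true, o (M s).2)] := by
    have e1 : (L.map (Prod.map (List.map i) o)).flatMap blockWord ++
      ((u.map i).map fun a => ((false, a) : Letter Λ)).reverse ++ [(true, o b)] =
        ((L ++ [(u, b)]).map (Prod.map (List.map i) o)).flatMap blockWord := by
      simp [blockWord]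
    rw [e1, hM, List.ofFn_eq_map, List.map_map, List.flatMap_map]
    congr 1
    funext s
    simp only [blockWord, Function.comp, Prod.map]
    congr 2
    refine List.ext_getElem (by simp) fun j h1 h2 => by simp
  rw [e] at hW ⊢
  obtain ⟨q, hW⟩ := hW
  obtain ⟨y, y1, y2, y3⟩ := γ.exists_of_chain_flatMap _ hW
  -- The leftmost object of a block is read off from the output that ends it, the other objects from
  -- the right ends of the inputs. The remaining coincidences of objects follow from the path.
  let x : ∀ s : Fin (n + 1), Fin ((M s).1.length + 1) → O := fun s =>
    Fin.cases (M s).2.l fun j => ((M s).1.get j).r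
  have hx : ∀ s, (∀ j : Fin (M s).1.length, x s j.castSucc = ((M s).1.get j).l) ∧
      x s (Fin.last _) = y s.castSucc ∧ (M s).2.r = y s.succ := by
    intro s
    obtain ⟨z, h1, h2, h3⟩ := (γ.chain_append).1 (y3 s)
    change z = γ.l (o (M s).2) at h2
    change γ.r (o (M s).2) = y s.succ at h3
    rw [hol] at h2
    rw [hor] at h3
    obtain ⟨h4, h5⟩ := γ.of_chain_reverse _ h1
    simp only [Grading.bef, Grading.aft, Bool.false_eq_true, if_false, hil, hir, h2] at h4 h5
    exact ⟨h4, h5, h3⟩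
  -- An output ends where the next block begins; for the last one this uses that the path is closed.
  have hb : ∀ s, x (s + 1) (Fin.last _) = (M s).2.r := by
    intro s
    rw [(hx (s + 1)).2.1, (hx s).2.2]
    rcases Fin.eq_castSucc_or_eq_last s with ⟨s, rfl⟩ | rfl
    · congr 1
      ext; simp
    · rw [Fin.last_add_one, Fin.castSucc_zero, y1, Fin.succ_last, y2]
  let τ : DiscType O := ⟨n, fun s => (M s).1.length, x⟩
  have ha : ∀ p : τ.In, ∃ e : A.Idx (τ.x p.1 p.2.castSucc) (τ.x p.1 p.2.succ),
      (⟨_, _, e⟩ : Lab A) = (M p.1).1.get p.2 := fun p =>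
    Lab.exists_eq _ ((hx p.1).1 p.2).symm rfl
  have hb' : ∀ s : Fin (τ.n + 1), ∃ e : B.Idx (τ.x s 0) (τ.x (s + 1) (Fin.last _)),
      (⟨_, _, e⟩ : Lab B) = (M s).2 := fun s => Lab.exists_eq _ rfl (hb s).symm
  choose a ha using ha
  choose b' hb' using hb'
  refine ⟨⟨τ, a, b'⟩, ?_⟩
  change ((List.finRange (n + 1)).flatMap fun s => (List.ofFn fun j : Fin (M s).1.length =>
    ((false, i ⟨_, _, a ⟨s, j⟩⟩) : Letter Λ)).reverse ++ [(true, o ⟨_, _, b' s⟩)]) = _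
  congr 1
  funext s
  have h1 : (fun j : Fin (M s).1.length => ((false, i ⟨_, _, a ⟨s, j⟩⟩) : Letter Λ)) =
      fun j => (false, i ((M s).1.get j)) :=
    funext fun j => congrArg (fun z => (false, i z)) (ha ⟨s, j⟩)
  have h2 : ((true, o ⟨_, _, b' s⟩) : Letter Λ) = (true, o (M s).2) :=
    congrArg (fun z => (true, o z)) (hb' s)
  rw [h1, h2]
end Coherence
end Words
end
section
variable {k : Type w} [Field k] {Λ : Type t} {O : Type u}

/-! ### Matrix coefficients -/

namespace Multi
variable {A B : GrQuiver.{u, v, w} k O} {i : Lab A → Λ} {o : Lab B → Λ}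

/-- The matrix coefficient at a labelled disc. -/
def val (F : Multi A B) (f : Filled A B) : k :=
  (tgtBasis B f.τ).repr (F f.τ (srcBasis A f.τ f.a)) f.b

lemma coeff_word (F : Multi A B) (hi : Function.Injective i) (ho : Function.Injective o)
    (f : Filled A B) : F.coeff i o (f.word i o) = F.val f := by
  have h : ∃ g : Filled A B, g.word i o = f.word i o := ⟨f, rfl⟩
  rw [coeff, dif_pos h]
  have h2 := Filled.word_injective hi ho h.choose_spec
  change F.val h.choose = _
  rw [h2]

lemma exists_of_coeff_ne_zero {F : Multi A B} {W : List (Letter Λ)} (h : F.coeff i o W ≠ 0) :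
    ∃ f : Filled A B, f.word i o = W := by
  by_contra h'
  exact h (dif_neg h')

lemma ext_val {F G : Multi A B} (h : ∀ f, F.val f = G.val f) : F = G := by
  funext τ
  refine (srcBasis A τ).ext fun a => (tgtBasis B τ).repr.injective (Finsupp.ext fun b => ?_)
  exact h ⟨τ, a, b⟩

lemma finite_val (F : Multi A B) (τ : DiscType O)
    (a : ∀ p : τ.In, A.Idx (τ.x p.1 p.2.castSucc) (τ.x p.1 p.2.succ)) :
    {b | F.val ⟨τ, a, b⟩ ≠ 0}.Finite := by
  refine (((tgtBasis B τ).repr (F τ (srcBasis A τ a))).hasFiniteSupport).subset fun b hb => hb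

lemma repr_finsum {ι M : Type*} [AddCommGroup M] [Module k M] (e : Module.Basis ι k M) (c : ι → k)
    (h : {b | c b ≠ 0}.Finite) (b : ι) : e.repr (∑ᶠ b, c b • e b) b = c b := by
  classical
  rw [finsum_eq_sum_of_support_subset (s := h.toFinset)]
  · simp only [map_sum, map_smul, Module.Basis.repr_self, Finsupp.smul_single, smul_eq_mul,
      mul_one, Finsupp.coe_finsetSum, Finset.sum_apply]
    simp only [Finsupp.single_apply]
    rw [Finset.sum_ite_eq']
    split_ifs with hb
    · rfl
    · have : c b = 0 := by simpa using hb
      exact this.symm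
  · intro b hb
    have : c b ≠ 0 := fun h0 => hb (by simp [h0])
    simpa using this

/-- Without finiteness of the column, the `finsum` in `Multi.ofCoeff` would take its default value
zero and the prescribed coefficients would be lost. -/
lemma val_ofCoeff {c : List (Letter Λ) → k} (f : Filled A B)
    (h : {b | c ((⟨f.τ, f.a, b⟩ : Filled A B).word i o) ≠ 0}.Finite) :
    (Multi.ofCoeff i o c : Multi A B).val f = c (f.word i o) := by
  rw [val, ofCoeff, Module.Basis.constr_basis]
  exact repr_finsum (tgtBasis B f.τ) _ h f.b

/-! ### Change of labels -/

/-- The directions of the letters fit their labels. -/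
def Typed (i : Lab A → Λ) (o : Lab B → Λ) (W : List (Letter Λ)) : Prop :=
  ∀ x ∈ W, (x.1 = false ∧ ∃ a, i a = x.2) ∨ (x.1 = true ∧ ∃ b, o b = x.2)

lemma typed_of_coeff {F : Multi A B} {W : List (Letter Λ)} (h : F.coeff i o W ≠ 0) :
    Typed i o W := by
  obtain ⟨f, rfl⟩ := exists_of_coeff_ne_zero h
  exact fun x hx => f.mem_word hx

lemma typed_iff {W : List (Letter Λ)} : Typed i o W ↔ ∃ W₀ : List (Letter (Lab A ⊕ Lab B)),
    Typed Sum.inl Sum.inr W₀ ∧ W₀.map (fun x => (x.1, Sum.elim i o x.2)) = W := by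
  constructor
  · intro h
    induction W with
    | nil => exact ⟨[], by simp [Typed], rfl⟩
    | cons x W ih =>
      obtain ⟨W₀, h1, rfl⟩ := ih fun y hy => h y (by simp [hy])
      rcases x with ⟨s, c⟩
      rcases h (s, c) (by simp) with ⟨rfl, a, rfl⟩ | ⟨rfl, b, rfl⟩
      · refine ⟨(false, Sum.inl a) :: W₀, fun y hy => ?_, rfl⟩
        rcases List.mem_cons.1 hy with rfl | hy
        · exact Or.inl ⟨rfl, a, rfl⟩
        · exact h1 y hy
      · refine ⟨(true, Sum.inr b) :: W₀, fun y hy => ?_, rfl⟩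
        rcases List.mem_cons.1 hy with rfl | hy
        · exact Or.inr ⟨rfl, b, rfl⟩
        · exact h1 y hy
  · rintro ⟨W₀, h, rfl⟩ x hx
    obtain ⟨y, hy, rfl⟩ := List.mem_map.1 hx
    rcases h y hy with ⟨h1, a, h2⟩ | ⟨h1, b, h2⟩
    · exact Or.inl ⟨h1, a, by rw [← h2]; rfl⟩
    · exact Or.inr ⟨h1, b, by rw [← h2]; rfl⟩

lemma typed_map_inj (hi : Function.Injective i) (ho : Function.Injective o)
    {W W' : List (Letter (Lab A ⊕ Lab B))} (h : Typed Sum.inl Sum.inr W)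
    (h' : Typed Sum.inl Sum.inr W')
    (he : W.map (fun x => (x.1, Sum.elim i o x.2)) = W'.map fun x => (x.1, Sum.elim i o x.2)) :
    W = W' := by
  induction W generalizing W' with
  | nil => cases W' <;> simp_all
  | cons x W ih =>
    cases W' with
    | nil => simp at he
    | cons y W' =>
      simp only [List.map_cons, List.cons.injEq, Prod.mk.injEq] at he
      rw [ih (fun z hz => h z (by simp [hz])) (fun z hz => h' z (by simp [hz])) he.2]
      congr 1
      rcases x with ⟨s, x⟩
      rcases y with ⟨s', y⟩
      obtain ⟨⟨rfl, h2⟩, -⟩ := he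
      have h3 := h (s, x) (by simp)
      have h4 := h' (s, y) (by simp)
      rcases s with _ | _
      · simp only [Bool.false_eq_true, false_and, or_false, true_and] at h3 h4
        obtain ⟨a, rfl⟩ := h3
        obtain ⟨b, rfl⟩ := h4
        rw [hi h2]
      · simp only [Bool.true_eq_false, false_and, false_or, true_and] at h3 h4
        obtain ⟨a, rfl⟩ := h3
        obtain ⟨b, rfl⟩ := h4
        rw [ho h2]

/-- The directions already tell inputs from outputs, so `i` and `o` need not have disjoint images;
the coefficients do not depend on the labelling. -/
lemma coeff_map (F : Multi A B) (hi : Function.Injective i) (ho : Function.Injective o)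
    {W : List (Letter (Lab A ⊕ Lab B))} (h : Typed Sum.inl Sum.inr W) :
    F.coeff i o (W.map fun x => (x.1, Sum.elim i o x.2)) = F.coeff Sum.inl Sum.inr W := by
  have hw : ∀ f : Filled A B, f.word i o =
      (f.word Sum.inl Sum.inr).map fun x => (x.1, Sum.elim i o x.2) :=
    fun f => f.word_map (i := Sum.inl) (o := Sum.inr) (Sum.elim i o)
  by_cases hf : ∃ f : Filled A B, f.word Sum.inl Sum.inr = W
  · obtain ⟨f, rfl⟩ := hf
    rw [← hw, coeff_word F hi ho, coeff_word F Sum.inl_injective Sum.inr_injective]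
  · have hf' : ¬ ∃ f : Filled A B, f.word i o = W.map fun x => (x.1, Sum.elim i o x.2) := by
      rintro ⟨f, hf'⟩
      rw [hw] at hf'
      exact hf ⟨f, typed_map_inj hi ho (fun x hx => f.mem_word hx) h hf'⟩
    rw [coeff, coeff, dif_neg hf, dif_neg hf']

lemma endsOut_of_coeff {F : Multi A B} {W : List (Letter Λ)} (h : F.coeff i o W ≠ 0) :
    EndsOut W := by
  obtain ⟨f, rfl⟩ := exists_of_coeff_ne_zero h
  exact f.endsOut_word

section
variable {d : ℤ} {deg : Λ → ℤ} (hdi : ∀ a, deg (i a) = a.deg) (hdo : ∀ b, deg (o b) = b.deg)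
include hdi hdo

lemma deg_map (W : List (Letter (Lab A ⊕ Lab B))) :
    inDeg d deg (W.map fun x => (x.1, Sum.elim i o x.2)) =
      inDeg d (Sum.elim Lab.deg Lab.deg) W ∧
    outDeg d deg (W.map fun x => (x.1, Sum.elim i o x.2)) =
      outDeg d (Sum.elim Lab.deg Lab.deg) W := by
  induction W with
  | nil => exact ⟨rfl, rfl⟩
  | cons x W ih =>
    have h : ∀ y, deg (Sum.elim i o y) = Sum.elim Lab.deg Lab.deg y := by
      rintro (a | b)
      · exact hdi a
      · exact hdo b
    simp only [inDeg, outDeg] at ih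
    rcases x with ⟨_ | _, y⟩ <;> simp [inDeg, outDeg, arrowDeg, h, ih]

variable (hi : Function.Injective i) (ho : Function.Injective o)
include hi ho

/-- Homogeneity is defined with one fixed labelling; this and the next lemma move the conditions to
any labelling, in particular to labels with levels. -/
lemma homogeneous_iff {F : Multi A B} {e : ℤ} : F.Homogeneous d e ↔
    ∀ W, F.coeff i o W ≠ 0 → outDeg d deg W = inDeg d deg W + e := by
  constructor
  · intro h W hW
    obtain ⟨W₀, h1, rfl⟩ := typed_iff.1 (typed_of_coeff hW)
    rw [coeff_map F hi ho h1] at hW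
    rw [(deg_map hdi hdo W₀).1, (deg_map hdi hdo W₀).2]
    exact h _ hW
  · intro h W hW
    have h1 := typed_of_coeff hW
    rw [← coeff_map F hi ho h1] at hW
    have := h _ hW
    rwa [(deg_map hdi hdo W).1, (deg_map hdi hdo W).2] at this

lemma cyclic_iff {F : Multi A B} : F.Cyclic d ↔ ∀ U W, EndsOut U → EndsOut W →
    F.coeff i o (U ++ W) = ((Int.negOnePow (inDeg d deg U * inDeg d deg W +
      outDeg d deg U * outDeg d deg W) : ℤ) : k) * F.coeff i o (W ++ U) := by
  constructor
  · intro h U W hU hW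
    by_cases hT : Typed i o U ∧ Typed i o W
    · obtain ⟨⟨U₀, h1, rfl⟩, W₀, h2, rfl⟩ := hT.imp typed_iff.1 typed_iff.1
      have e1 : Typed Sum.inl Sum.inr (U₀ ++ W₀) := fun x hx =>
        (List.mem_append.1 hx).elim (h1 x) (h2 x)
      have e2 : Typed Sum.inl Sum.inr (W₀ ++ U₀) := fun x hx =>
        (List.mem_append.1 hx).elim (h2 x) (h1 x)
      have hends : ∀ V : List (Letter (Lab A ⊕ Lab B)),
          EndsOut (V.map fun x => (x.1, Sum.elim i o x.2)) → EndsOut V := by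
        rintro V ⟨V', b, hV⟩
        obtain ⟨V₁, V₂, rfl, -, h4⟩ := List.map_eq_append_iff.1 hV
        obtain ⟨⟨s, y⟩, rfl, h5⟩ := List.map_eq_singleton_iff.1 h4
        obtain ⟨rfl, -⟩ := Prod.mk.inj h5
        exact ⟨V₁, y, rfl⟩
      rw [← List.map_append, ← List.map_append, coeff_map F hi ho e1, coeff_map F hi ho e2,
        (deg_map hdi hdo U₀).1, (deg_map hdi hdo U₀).2, (deg_map hdi hdo W₀).1,
        (deg_map hdi hdo W₀).2]
      exact h U₀ W₀ (hends _ hU) (hends _ hW)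
    · have e1 : F.coeff i o (U ++ W) = 0 := by
        by_contra h0
        have := typed_of_coeff h0
        exact hT ⟨fun x hx => this x (by simp [hx]), fun x hx => this x (by simp [hx])⟩
      have e2 : F.coeff i o (W ++ U) = 0 := by
        by_contra h0
        have := typed_of_coeff h0
        exact hT ⟨fun x hx => this x (by simp [hx]), fun x hx => this x (by simp [hx])⟩
      rw [e1, e2, mul_zero]
  · intro h U W hU hW
    by_cases hT : Typed Sum.inl Sum.inr U ∧ Typed Sum.inl Sum.inr W
    · have e1 : Typed Sum.inl Sum.inr (U ++ W) := fun x hx =>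
        (List.mem_append.1 hx).elim (hT.1 x) (hT.2 x)
      have e2 : Typed Sum.inl Sum.inr (W ++ U) := fun x hx =>
        (List.mem_append.1 hx).elim (hT.2 x) (hT.1 x)
      have hends : ∀ V : List (Letter (Lab A ⊕ Lab B)), EndsOut V →
          EndsOut (V.map fun x => (x.1, Sum.elim i o x.2)) := by
        rintro _ ⟨V, b, rfl⟩
        exact ⟨V.map fun x => (x.1, Sum.elim i o x.2), Sum.elim i o b, by simp⟩
      have := h _ _ (hends U hU) (hends W hW)
      rwa [← List.map_append, ← List.map_append, coeff_map F hi ho e1, coeff_map F hi ho e2,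
        (deg_map hdi hdo U).1, (deg_map hdi hdo U).2, (deg_map hdi hdo W).1,
        (deg_map hdi hdo W).2] at this
    · have e1 : F.coeff Sum.inl Sum.inr (U ++ W) = 0 := by
        by_contra h0
        have := typed_of_coeff h0
        exact hT ⟨fun x hx => this x (by simp [hx]), fun x hx => this x (by simp [hx])⟩
      have e2 : F.coeff Sum.inl Sum.inr (W ++ U) = 0 := by
        by_contra h0
        have := typed_of_coeff h0
        exact hT ⟨fun x hx => this x (by simp [hx]), fun x hx => this x (by simp [hx])⟩
      rw [e1, e2, mul_zero]
end
end Multi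

/-! ### Cyclic invariance in clockwise conventions -/

section Clockwise
variable {γ : Grading Λ O}

/-- The parity of the incoming arrows. -/
def Grading.inw (γ : Grading Λ O) (W : List (Letter Λ)) : ZMod 2 := γ.pw (W.filter fun p => !p.1)

/-- The parity of the outgoing arrows. -/
def Grading.outw (γ : Grading Λ O) (W : List (Letter Λ)) : ZMod 2 := γ.pw (W.filter fun p => p.1)

lemma Grading.inw_add_outw (W : List (Letter Λ)) : γ.inw W + γ.outw W = γ.pw W := by
  induction W with
  | nil => rfl
  | cons x W ih =>
    rcases x with ⟨_ | _, a⟩ <;> simp_all [Grading.inw, Grading.outw] <;> rw [← ih] <;> ring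

lemma Grading.Of.inDeg {d : ℤ} {deg : Λ → ℤ} (h : γ.Of d deg) (W : List (Letter Λ)) :
    ((PreCY.inDeg d deg W : ℤ) : ZMod 2) = γ.inw W := by
  induction W with
  | nil => rfl
  | cons x W ih =>
    simp only [PreCY.inDeg, Grading.inw] at ih
    rcases x with ⟨_ | _, a⟩
    · simp [PreCY.inDeg, Grading.inw, ih, h.p_false, arrowDeg]
      generalize (deg a : ZMod 2) = s
      decide +revert
    · simpa [PreCY.inDeg, Grading.inw] using ih

lemma Grading.Of.outDeg {d : ℤ} {deg : Λ → ℤ} (h : γ.Of d deg) (W : List (Letter Λ)) :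
    ((PreCY.outDeg d deg W : ℤ) : ZMod 2) = γ.outw W := by
  induction W with
  | nil => rfl
  | cons x W ih =>
    simp only [PreCY.outDeg, Grading.outw] at ih
    rcases x with ⟨_ | _, a⟩
    · simpa [PreCY.outDeg, Grading.outw] using ih
    · simp [PreCY.outDeg, Grading.outw, ih, h.p_true, arrowDeg]

lemma tw_append (U W : List (Letter Λ)) (b : Λ) (α : ZMod 2) :
    tw γ α (U ++ (true, b) :: W) =
      tw γ α (U ++ [(true, b)]) + tw γ 0 W + (α + γ.inw U) * γ.pw W := by
  induction U generalizing α with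
  | nil => simp [tw, Grading.inw]; ring
  | cons x U ih =>
    rcases x with ⟨_ | _, a⟩
    · simp only [List.cons_append, tw, Bool.false_eq_true, if_false, ih]
      simp [Grading.inw]
      left; ring
    · simp only [List.cons_append, tw, if_true, ih]
      simp [Grading.inw]
      ring

lemma tw_append_of_endsOut {U : List (Letter Λ)} (hU : EndsOut U) (W : List (Letter Λ)) :
    tw γ 0 (U ++ W) = tw γ 0 U + tw γ 0 W + γ.inw U * γ.pw W := by
  obtain ⟨U, b, rfl⟩ := hU
  rw [List.append_assoc, List.singleton_append, tw_append, zero_add]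
  simp [Grading.inw]

lemma exists_split (W : List (Letter Λ)) : ∃ X Y, W = X ++ Y ∧ (X = [] ∨ EndsOut X) ∧
    ∀ x ∈ Y, x.1 = false := by
  induction W using List.reverseRecOn with
  | nil => exact ⟨[], [], rfl, Or.inl rfl, by simp⟩
  | append_singleton W x ih =>
    obtain ⟨X, Y, rfl, h1, h2⟩ := ih
    rcases x with ⟨_ | _, a⟩
    · refine ⟨X, Y ++ [(false, a)], by simp, h1, fun x hx => ?_⟩
      rcases List.mem_append.1 hx with hx | hx
      · exact h2 x hx
      · rw [List.mem_singleton.1 hx]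
    · exact ⟨_, [], by simp, Or.inr ⟨X ++ Y, a, rfl⟩, by simp⟩

lemma take_drop_append {X Y : List (Letter Λ)} (hX : X = [] ∨ EndsOut X)
    (hY : ∀ x ∈ Y, x.1 = false) : (X ++ Y).rtakeWhile (fun p => !p.1) = Y ∧
      (X ++ Y).rdropWhile (fun p => !p.1) = X := by
  induction Y using List.reverseRecOn with
  | nil =>
    rcases hX with rfl | ⟨X, b, rfl⟩
    · simp
    · simp
  | append_singleton Y y ih =>
    have h := ih fun x hx => hY x (by simp [hx])
    have hy : (!y.1) = true := by simp [hY y (by simp)]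
    rw [← List.append_assoc, List.rtakeWhile_concat_pos (fun p : Letter Λ => !p.1) _ _ hy,
      List.rdropWhile_concat_pos (fun p : Letter Λ => !p.1) _ _ hy, h.1, h.2]
    exact ⟨rfl, rfl⟩

lemma norm_append {X Y : List (Letter Λ)} (hX : X = [] ∨ EndsOut X)
    (hY : ∀ x ∈ Y, x.1 = false) : norm (X ++ Y) = Y ++ X := by
  rw [norm, (take_drop_append hX hY).1, (take_drop_append hX hY).2]

lemma ccw_append {c : List (Letter Λ) → k} {X Y : List (Letter Λ)} (hX : X = [] ∨ EndsOut X)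
    (hY : ∀ x ∈ Y, x.1 = false) :
    ccw γ c (X ++ Y) = sg k (γ.pw Y * γ.pw X + tw γ 0 (Y ++ X)) * c (Y ++ X) := by
  rw [ccw, nsg, norm_append hX hY, (take_drop_append hX hY).1, (take_drop_append hX hY).2]

/-- Carrying an incoming letter around is harmless by the construction of `ccw`, which rotates such
letters back and records their sign. Only an outgoing letter moves the cut to another block, and
there invariance under cyclic permutation of blocks is needed; the signs agree once inputs and
outputs are counted separately. -/
lemma ccw_cyc {c : List (Letter Λ) → k} (h0 : ∀ W, c W ≠ 0 → EndsOut W)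
    (hc : ∀ U W, EndsOut U → EndsOut W →
      c (U ++ W) = sg k (γ.inw U * γ.inw W + γ.outw U * γ.outw W) * c (W ++ U))
    (x : Letter Λ) (w : List (Letter Λ)) :
    ccw γ c (x :: w) = sg k (γ.p x * γ.pw w) * ccw γ c (w ++ [x]) := by
  obtain ⟨X, Y, rfl, hX, hY⟩ := exists_split w
  rcases x with ⟨_ | _, a⟩
  · have hY' : ∀ x ∈ Y ++ [(false, a)], x.1 = false := by
      intro x hx
      rcases List.mem_append.1 hx with hx | hx
      · exact hY x hx
      · rw [List.mem_singleton.1 hx]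
    rw [List.append_assoc, ccw_append hX hY']
    rcases hX with rfl | hX
    · have hz : ∀ W : List (Letter Λ), (∀ x ∈ W, x.1 = false) → c W = 0 := by
        intro W hW
        by_contra hn
        obtain ⟨U, b, rfl⟩ := h0 W hn
        simpa using hW (true, b) (by simp)
      have e : ((false, a) :: ([] ++ Y) : List (Letter Λ)) = [] ++ ((false, a) :: Y) := rfl
      rw [e, ccw_append (Or.inl rfl) (by
        intro x hx
        rcases List.mem_cons.1 hx with rfl | hx
        · rfl
        · exact hY x hx), hz, hz]
      · simp
      · simpa using hY'
      · intro x hx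
        simp only [List.append_nil, List.mem_cons] at hx
        rcases hx with rfl | hx
        · rfl
        · exact hY x hx
    · have hX' : EndsOut ((false, a) :: X) := by
        obtain ⟨X, b, rfl⟩ := hX
        exact ⟨(false, a) :: X, b, rfl⟩
      rw [← List.cons_append, ccw_append (Or.inr hX') hY]
      have e : Y ++ [(false, a)] ++ X = Y ++ (false, a) :: X := by simp
      rw [e, ← mul_assoc, ← sg_add]
      congr 2
      simp only [γ.pw_append, γ.pw_cons, γ.pw_nil]
      generalize γ.p (false, a) = s
      generalize γ.pw X = s'
      generalize γ.pw Y = s''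
      generalize tw γ 0 _ = s'''
      decide +revert
  · have hX' : EndsOut ((true, a) :: X) := by
      rcases hX with rfl | ⟨X, b, rfl⟩
      · exact ⟨[], a, rfl⟩
      · exact ⟨(true, a) :: X, b, rfl⟩
    rw [← List.cons_append, ccw_append (Or.inr hX') hY, ccw_concat, List.append_assoc]
    have hU : EndsOut (Y ++ [(true, a)]) := ⟨Y, a, rfl⟩
    have e : Y ++ (true, a) :: X = (Y ++ [(true, a)]) ++ X := by simp
    rcases hX with rfl | hX
    · rw [List.nil_append, ← mul_assoc, ← sg_add]
      congr 2
      simp only [γ.pw_cons, γ.pw_nil, List.nil_append]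
      ring
    -- The block ending with the moved letter and the remaining blocks are exchanged: this is the
    -- one use of the invariance `hc`.
    · rw [e, hc _ _ hU hX, ← mul_assoc, ← mul_assoc, ← sg_add, ← sg_add]
      congr 2
      rw [tw_append_of_endsOut hU, tw_append_of_endsOut hX, ← γ.inw_add_outw (Y ++ [(true, a)]),
        ← γ.inw_add_outw X]
      have e1 : γ.pw ((true, a) :: X) = γ.p (true, a) + (γ.inw X + γ.outw X) := by
        rw [γ.pw_cons, γ.inw_add_outw]
      have e2 : γ.pw (X ++ Y) = γ.inw X + γ.outw X + γ.pw Y := by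
        rw [γ.pw_append, γ.inw_add_outw]
      have e3 : γ.inw (Y ++ [(true, a)]) = γ.pw Y + γ.p (true, a) + γ.outw (Y ++ [(true, a)]) := by
        have := γ.inw_add_outw (Y ++ [(true, a)])
        rw [γ.pw_append, γ.pw_cons, γ.pw_nil, add_zero] at this
        rw [← this, add_assoc, CharTwo.add_self_eq_zero, add_zero]
      rw [e1, e2, e3]
      generalize tw γ 0 X = t₁
      generalize tw γ 0 (Y ++ [(true, a)]) = t₂
      generalize γ.p (true, a) = s
      generalize γ.pw Y = s'
      generalize γ.outw (Y ++ [(true, a)]) = s''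
      generalize γ.inw X = r
      generalize γ.outw X = r'
      clear hX hX' hU hY e e1 e2 e3
      decide +revert

/-- Cyclic invariance follows from that in clockwise conventions. -/
lemma cyc_of_ccw {c : List (Letter Λ) → k} (h : ∀ x w,
    ccw γ c (x :: w) = sg k (γ.p x * γ.pw w) * ccw γ c (w ++ [x])) {U W : List (Letter Λ)}
    (hU : EndsOut U) (hW : EndsOut W) :
    c (U ++ W) = sg k (γ.inw U * γ.inw W + γ.outw U * γ.outw W) * c (W ++ U) := by
  have h1 : ∀ U W, ccw γ c (U ++ W) = sg k (γ.pw U * γ.pw W) * ccw γ c (W ++ U) := by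
    intro U
    induction U with
    | nil => simp
    | cons x U ih =>
      intro W
      rw [List.cons_append, h, List.append_assoc, ih, ← mul_assoc, ← sg_add]
      simp only [List.append_assoc, List.singleton_append, γ.pw_append, γ.pw_cons, γ.pw_nil]
      congr 2
      generalize γ.p x = s
      generalize γ.pw U = s'
      generalize γ.pw W = s''
      decide +revert
  have h2 := h1 U W
  have h3 : EndsOut (U ++ W) := by
    obtain ⟨W, b, rfl⟩ := hW
    exact ⟨U ++ W, b, by simp⟩
  have h4 : EndsOut (W ++ U) := by
    obtain ⟨U, b, rfl⟩ := hU
    exact ⟨W ++ U, b, by simp⟩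
  have e1 := ccw_append (γ := γ) (c := c) (Or.inr h3) (Y := []) (by simp)
  have e2 := ccw_append (γ := γ) (c := c) (Or.inr h4) (Y := []) (by simp)
  simp only [List.append_nil, List.nil_append, γ.pw_nil, zero_mul, zero_add] at e1 e2
  rw [e1, e2, tw_append_of_endsOut hU, tw_append_of_endsOut hW] at h2
  have h5 : ∀ (s : ZMod 2) (x : k), sg k s * (sg k s * x) = x := fun s x => by
    rw [← mul_assoc, sg_mul_self, one_mul]
  rw [← h5 (tw γ 0 U + tw γ 0 W + γ.inw U * γ.pw W) (c (U ++ W)), h2, ← mul_assoc, ← mul_assoc,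
    ← sg_add, ← sg_add]
  congr 2
  rw [← γ.inw_add_outw U, ← γ.inw_add_outw W]
  generalize tw γ 0 U = t₁
  generalize tw γ 0 W = t₂
  generalize γ.inw U = r₁
  generalize γ.inw W = r₂
  generalize γ.outw U = r₃
  generalize γ.outw W = r₄
  clear h h1 h2 h3 h4 h5 e1 e2 hU hW
  decide +revert
end Clockwise
end
section
variable {k : Type w} [Field k] {Λ : Type t} {O : Type u}

/-! ### Operations as systems of coefficients -/

/-- The grading given by integral degrees. -/
def Grading.ofDeg (d : ℤ) (deg : Λ → ℤ) (l r : Λ → O) : Grading Λ O where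
  q a := ((deg a + d : ℤ) : ZMod 2)
  D := ((d + 1 : ℤ) : ZMod 2)
  l := l
  r := r

lemma Grading.ofDeg_of (d : ℤ) (deg : Λ → ℤ) (l r : Λ → O) :
    (Grading.ofDeg d deg l r).Of d deg := ⟨fun _ => rfl, rfl⟩

lemma finite_lists {α : Type*} {S : Set α} (hS : S.Finite) (n : ℕ) :
    {l : List α | l.length ≤ n ∧ ∀ x ∈ l, x ∈ S}.Finite := by
  induction n with
  | zero =>
    refine (Set.finite_singleton []).subset ?_
    rintro l ⟨h, -⟩
    simpa using h
  | succ n ih =>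
    refine ((Set.finite_singleton []).union (hS.image2 List.cons ih)).subset ?_
    rintro l ⟨h1, h2⟩
    rcases l with _ | ⟨x, l⟩
    · exact Or.inl rfl
    · exact Or.inr ⟨x, h2 x (by simp), l, ⟨by simpa using h1, fun y hy => h2 y (by simp [hy])⟩, rfl⟩

lemma perm_norm (W : List (Letter Λ)) : (norm W).Perm W := by
  refine List.perm_append_comm.trans ?_
  rw [List.rdropWhile_append_rtakeWhile]

lemma finite_norm (W : List (Letter Λ)) : {w | norm w = W}.Finite := by
  refine ((Set.finite_Iic W.length).image fun j => W.rotate j).subset ?_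
  rintro w rfl
  refine ⟨(w.rtakeWhile fun p => !p.1).length, ?_, ?_⟩
  · simp [norm]
  · simp only [norm]
    rw [List.rotate_append_length_eq, List.rdropWhile_append_rtakeWhile]

lemma par_smul_eps (x : k) (j : ℕ) : Par (j : ZMod 2) (x • (DualNumber.eps : DualNumber k) ^ j) := by
  rcases j with _ | _ | j
  · simp [Par]
  · simp [Par]
  · rw [pow_succ, pow_succ, mul_assoc, DualNumber.eps_mul_eps]
    simp [Par]

/-- An operation of degree `d + 1 + j`, i.e. of degree `j` after the shift by `d + 1`. -/
structure IsOp (d : ℤ) (j : ℕ) {A B : GrQuiver.{u, v, w} k O} (F : Multi A B) : Prop where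
  homogeneous : F.Homogeneous d (d + 1 + j)
  cyclic : F.Cyclic d
  uncurved : F.Uncurved

/-- Labels of an embedded quiver. -/
structure IsEmb {A : GrQuiver.{u, v, w} k O} (deg : Λ → ℤ) (l r : Λ → O) (i : Lab A → Λ) :
    Prop where
  inj : Function.Injective i
  deg : ∀ a, deg (i a) = a.deg
  l : ∀ a, l (i a) = a.l
  r : ∀ a, r (i a) = a.r

section Rep
variable {A B : GrQuiver.{u, v, w} k O} {d : ℤ} {j : ℕ} {deg : Λ → ℤ} {l r : Λ → O}
  {i : Lab A → Λ} {o : Lab B → Λ} {F : Multi A B}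

/-- The coefficients of an operation in clockwise conventions. -/
def Multi.rep (γ : Grading Λ O) (F : Multi A B) (i : Lab A → Λ) (o : Lab B → Λ)
    (W : List (Letter Λ)) : k := ccw γ (F.coeff i o) W

/-- The coefficients of an operation of degree `j`, an element of degree one being multiplied
with an odd parameter. -/
def Multi.drep (γ : Grading Λ O) (j : ℕ) (F : Multi A B) (i : Lab A → Λ) (o : Lab B → Λ)
    (W : List (Letter Λ)) : DualNumber k := F.rep γ i o W • DualNumber.eps ^ j

namespace IsOp
lemma par (hF : IsOp d j F) (hi : IsEmb deg l r i) (ho : IsEmb deg l r o) {W : List (Letter Λ)}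
    (h : F.coeff i o W ≠ 0) : (Grading.ofDeg d deg l r).pw W + (Grading.ofDeg d deg l r).D = j := by
  have hγ := Grading.ofDeg_of d deg l r
  have h1 := (Multi.homogeneous_iff hi.deg ho.deg hi.inj ho.inj).1 hF.homogeneous W h
  rw [← Grading.inw_add_outw, ← hγ.inDeg, ← hγ.outDeg, h1, hγ.D]
  push_cast
  generalize (inDeg d deg W : ZMod 2) = s
  generalize (d : ZMod 2) = s'
  generalize (j : ZMod 2) = s''
  decide +revert

lemma rep_cyc (hF : IsOp d j F) (hi : IsEmb deg l r i) (ho : IsEmb deg l r o) (x : Letter Λ)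
    (w : List (Letter Λ)) : F.rep (Grading.ofDeg d deg l r) i o (x :: w) =
      sg k ((Grading.ofDeg d deg l r).p x * (Grading.ofDeg d deg l r).pw w) *
        F.rep (Grading.ofDeg d deg l r) i o (w ++ [x]) := by
  have hγ := Grading.ofDeg_of d deg l r
  refine ccw_cyc (fun W hW => Multi.endsOut_of_coeff hW) (fun U W hU hW => ?_) x w
  rw [(Multi.cyclic_iff hi.deg ho.deg hi.inj ho.inj).1 hF.cyclic U W hU hW, negOnePow_eq_sg]
  push_cast
  rw [hγ.inDeg, hγ.inDeg, hγ.outDeg, hγ.outDeg]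
end IsOp

lemma Multi.coeff_norm_ne_zero {γ : Grading Λ O} {W : List (Letter Λ)} (h : F.rep γ i o W ≠ 0) :
    F.coeff i o (norm W) ≠ 0 := right_ne_zero_of_mul h

lemma Multi.typed_of_rep {γ : Grading Λ O} {W : List (Letter Λ)} (h : F.rep γ i o W ≠ 0) :
    Multi.Typed i o W := fun _ hx =>
  Multi.typed_of_coeff (Multi.coeff_norm_ne_zero h) _ ((perm_norm W).mem_iff.2 hx)

lemma Multi.exists_out_of_rep {γ : Grading Λ O} {W : List (Letter Λ)} (h : F.rep γ i o W ≠ 0) :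
    ∃ x ∈ W, x.1 = true := by
  obtain ⟨U, b, hU⟩ := Multi.endsOut_of_coeff (Multi.coeff_norm_ne_zero h)
  exact ⟨(true, b), (perm_norm W).mem_iff.1 (by simp [hU]), rfl⟩

lemma Multi.coh_of_rep (hi : IsEmb deg l r i) (ho : IsEmb deg l r o) {W : List (Letter Λ)}
    (h : F.rep (Grading.ofDeg d deg l r) i o W ≠ 0) : (Grading.ofDeg d deg l r).Coh W := by
  obtain ⟨f, hf⟩ := Multi.exists_of_coeff_ne_zero (Multi.coeff_norm_ne_zero h)
  have h1 := f.coh_word (γ := Grading.ofDeg d deg l r) hi.l hi.r ho.l ho.r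
  rw [hf, norm] at h1
  have h2 := Grading.coh_rotate _ h1
  rwa [List.rdropWhile_append_rtakeWhile] at h2

lemma Filled.length_word (f : Filled A B) :
    (f.word i o).length = ∑ s, (f.τ.m s + 1) := by
  simp only [Filled.word, List.length_flatMap, List.length_append, List.length_reverse,
    List.length_ofFn, List.length_singleton]
  exact (Fin.sum_univ_def _).symm

lemma Multi.Uncurved.two_le (hF : F.Uncurved) {γ : Grading Λ O} (hi : Function.Injective i)
    (ho : Function.Injective o) {W : List (Letter Λ)} (h : F.rep γ i o W ≠ 0) : 2 ≤ W.length := by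
  have h1 := Multi.coeff_norm_ne_zero h
  obtain ⟨f, hf⟩ := Multi.exists_of_coeff_ne_zero h1
  rw [← (perm_norm W).length_eq, ← hf, f.length_word]
  by_contra! h2
  have hn : f.τ.n = 0 := by
    have : ∑ s : Fin (f.τ.n + 1), 1 ≤ ∑ s, (f.τ.m s + 1) :=
      Finset.sum_le_sum fun s _ => by omega
    simp at this
    omega
  have hm : ∀ s, f.τ.m s = 0 := fun s => by
    have := Finset.single_le_sum (f := fun s => f.τ.m s + 1) (fun s _ => Nat.zero_le _)
      (Finset.mem_univ s)
    omega
  rw [← hf, Multi.coeff_word F hi ho, Multi.val, hF f.τ hn hm] at h1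
  simp at h1

/-- Finitely many codes, hence finitely many types with labelled inputs, satisfy the bounds. Each of
them has finitely many outputs with nonzero coefficient, because a tensor has finitely many nonzero
coordinates, and each word has finitely many rotations. -/
lemma Multi.finite_rep (hi : IsEmb deg l r i) (ho : IsEmb deg l r o) (γ : Grading Λ O) (n : ℕ)
    (Φ : Set Λ) (Ω : Set O) (hΦ : Φ.Finite) (hΩ : Ω.Finite) :
    {w | w.length ≤ n ∧ (∀ x ∈ w, x.1 = false → x.2 ∈ Φ) ∧ (∀ x ∈ w, l x.2 ∈ Ω ∧ r x.2 ∈ Ω) ∧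
      F.rep γ i o w ≠ 0}.Finite := by
  let C : Set (List (O × List (Lab A))) := {L | L.length ≤ n ∧
    ∀ p ∈ L, p ∈ Ω ×ˢ {u : List (Lab A) | u.length ≤ n ∧ ∀ a ∈ u, a ∈ i ⁻¹' Φ}}
  have hC : C.Finite := finite_lists (hΩ.prod (finite_lists (hΦ.preimage hi.inj.injOn) n)) n
  let T := Σ τ : DiscType O, ∀ p : τ.In, A.Idx (τ.x p.1 p.2.castSucc) (τ.x p.1 p.2.succ)
  have hT : {t : T | inCode t.1 t.2 ∈ C}.Finite :=
    hC.preimage (f := fun t : T => inCode t.1 t.2) fun t _ t' _ h => inCode_injective h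
  have hS : (⋃ t ∈ {t : T | inCode t.1 t.2 ∈ C}, ⋃ b ∈ {b | F.val ⟨t.1, t.2, b⟩ ≠ 0},
      {w | norm w = (⟨t.1, t.2, b⟩ : Filled A B).word i o}).Finite :=
    hT.biUnion fun t _ => (F.finite_val t.1 t.2).biUnion fun b _ => finite_norm _
  refine hS.subset ?_
  rintro w ⟨h1, h2, h3, h4⟩
  have h5 := Multi.coeff_norm_ne_zero h4
  obtain ⟨f, hf⟩ := Multi.exists_of_coeff_ne_zero h5
  have hlen : ∑ s, (f.τ.m s + 1) ≤ n := by
    rw [← f.length_word (i := i) (o := o), hf, (perm_norm w).length_eq]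
    exact h1
  have hmem : ∀ x ∈ f.word i o, x ∈ w := fun x hx => (perm_norm w).mem_iff.1 (hf ▸ hx)
  simp only [Set.mem_iUnion]
  refine ⟨⟨f.τ, f.a⟩, ⟨?_, ?_⟩, f.b, ?_, hf.symm⟩
  · have : ∑ s : Fin (f.τ.n + 1), 1 ≤ ∑ s, (f.τ.m s + 1) :=
      Finset.sum_le_sum fun s _ => by omega
    simp at this
    simp [inCode]
    omega
  · intro p hp
    simp only [inCode, List.mem_map, List.mem_finRange, true_and] at hp
    obtain ⟨s, rfl⟩ := hp
    refine ⟨?_, ?_, ?_⟩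
    · have := (h3 _ (hmem (true, o ⟨_, _, f.b s⟩) ?_)).1
      · rwa [ho.l] at this
      · simp only [Filled.word, List.mem_flatMap]
        exact ⟨s, List.mem_finRange s, by simp⟩
    · have := Finset.single_le_sum (f := fun s => f.τ.m s + 1) (fun s _ => Nat.zero_le _)
        (Finset.mem_univ s)
      simp
      omega
    · intro a ha
      obtain ⟨q, rfl⟩ := List.mem_ofFn.1 ha
      refine h2 _ (hmem (false, i ⟨_, _, f.a ⟨s, q⟩⟩) ?_) rfl
      simp only [Filled.word, List.mem_flatMap]
      refine ⟨s, List.mem_finRange s, ?_⟩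
      simp only [List.mem_append, List.mem_reverse, List.mem_ofFn]
      exact Or.inl ⟨q, rfl⟩
  · rw [← hf, Multi.coeff_word F hi.inj ho.inj] at h5
    exact h5

lemma IsOp.sys (hF : IsOp d j F) (hi : IsEmb deg l r i) (ho : IsEmb deg l r o) :
    Sys (Grading.ofDeg d deg l r) (F.drep (Grading.ofDeg d deg l r) j i o) := by
  have hne : ∀ w, F.drep (Grading.ofDeg d deg l r) j i o w ≠ 0 →
      F.rep (Grading.ofDeg d deg l r) i o w ≠ 0 := by
    intro w h h0
    exact h (by rw [Multi.drep, h0, zero_smul])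
  refine ⟨fun w h => hF.uncurved.two_le hi.inj ho.inj (hne w h), fun x w => ?_, fun w => ?_,
    fun w h => Multi.coh_of_rep hi ho (hne w h), fun n Φ Ω hΦ hΩ => ?_⟩
  · rw [Multi.drep, Multi.drep, hF.rep_cyc hi ho, mul_smul]
  · by_cases h : F.rep (Grading.ofDeg d deg l r) i o w = 0
    · rw [Multi.drep, h, zero_smul]; exact par_zero _
    · have h1 := hF.par hi ho (Multi.coeff_norm_ne_zero h)
      rw [Legs.pw_norm] at h1
      rw [h1]
      exact par_smul_eps _ _
  · refine (Multi.finite_rep (F := F) hi ho (Grading.ofDeg d deg l r) n Φ Ω hΦ hΩ).subset ?_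
    rintro w ⟨h1, h2, h3, h4⟩
    exact ⟨h1, h2, h3, hne w h4⟩

lemma IsOp.wmor (hF : IsOp d j F) (hi : IsEmb deg l r i) (ho : IsEmb deg l r o) {lev : Λ → ℕ}
    {n m : ℕ} (hn : ∀ a, lev (i a) = n) (hm : ∀ b, lev (o b) = m) :
    WMor (Grading.ofDeg d deg l r) lev n m (F.drep (Grading.ofDeg d deg l r) j i o) := by
  have hne : ∀ w, F.drep (Grading.ofDeg d deg l r) j i o w ≠ 0 →
      F.rep (Grading.ofDeg d deg l r) i o w ≠ 0 := by
    intro w h h0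
    exact h (by rw [Multi.drep, h0, zero_smul])
  refine ⟨hF.sys hi ho, fun w hw x hx h => ?_, fun w hw x hx h => ?_,
    fun w hw => Multi.exists_out_of_rep (hne w hw)⟩
  · rcases Multi.typed_of_rep (hne w hw) x hx with ⟨-, a, ha⟩ | ⟨h', -⟩
    · rw [← ha, hn]
    · simp [h] at h'
  · rcases Multi.typed_of_rep (hne w hw) x hx with ⟨h', -⟩ | ⟨-, b, hb⟩
    · simp [h] at h'
    · rw [← hb, hm]

/-- An operation is determined by its coefficients. -/
lemma Multi.ext_rep {γ : Grading Λ O} {F G : Multi A B} (hi : Function.Injective i)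
    (ho : Function.Injective o)
    (h : ∀ U b, (∃ f : Filled A B, f.word i o = U ++ [(true, b)]) →
      F.rep γ i o (U ++ [(true, b)]) = G.rep γ i o (U ++ [(true, b)])) : F = G := by
  refine Multi.ext_val fun f => ?_
  obtain ⟨U, b, hf⟩ := f.endsOut_word (i := i) (o := o)
  have h1 := h U b ⟨f, hf⟩
  rw [Multi.rep, Multi.rep, ccw_concat, ccw_concat, ← hf, Multi.coeff_word F hi ho,
    Multi.coeff_word G hi ho] at h1
  exact mul_left_cancel₀ (sg_ne_zero _) h1

/-- Two invariant functions of coherent words with labels from `A` and `B` agree if they agree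
on the words of discs. -/
lemma eq_of_filled {γ : Grading Λ O} {f g : List (Letter Λ) → DualNumber k}
    (hf : Sys γ f) (hg : Sys γ g) (hft : ∀ w, f w ≠ 0 → Multi.Typed i o w ∧ ∃ x ∈ w, x.1 = true)
    (hgt : ∀ w, g w ≠ 0 → Multi.Typed i o w ∧ ∃ x ∈ w, x.1 = true)
    (hil : ∀ a, γ.l (i a) = a.l) (hir : ∀ a, γ.r (i a) = a.r)
    (hol : ∀ b, γ.l (o b) = b.l) (hor : ∀ b, γ.r (o b) = b.r)
    (h : ∀ U b, (∃ f : Filled A B, f.word i o = U ++ [(true, b)]) →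
      f ((true, b) :: U) = g ((true, b) :: U)) : f = g := by
  funext w
  by_contra hne
  have h1 : γ.Coh w ∧ Multi.Typed i o w ∧ ∃ x ∈ w, x.1 = true := by
    by_cases h0 : f w = 0
    · have h2 : g w ≠ 0 := fun h2 => hne (by rw [h0, h2])
      exact ⟨hg.coh w h2, hgt w h2⟩
    · exact ⟨hf.coh w h0, hft w h0⟩
  obtain ⟨hc, ht, ⟨s, b⟩, hx, hs⟩ := h1
  obtain rfl : s = true := hs
  obtain ⟨U, V, rfl⟩ := List.append_of_mem hx
  rw [Tr.cyc_append hf.cyc, Tr.cyc_append hg.cyc] at hne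
  refine hne ?_
  congr 1
  refine h (V ++ U) b ?_
  refine exists_filled hil hir hol hor ?_ ⟨_, _, rfl⟩ fun x hx => ht x ?_
  · have := Grading.coh_rotate γ (w := U ++ [(true, b)]) (w' := V) (by simpa using hc)
    simpa using this
  · simp only [List.mem_append, List.mem_cons, List.not_mem_nil, or_false] at hx ⊢
    tauto
end Rep
end
section
variable {k : Type w} [Field k] {Λ : Type t} {O : Type u}

/-! ### Diagrams of operations and trees with levels -/

variable {K : Type} {Λ₀ : Type t}

/-- The arrow `x` of a disc filled with `κ`, with the level of that disc. -/
def lift (lv : K → Bool → ℕ) (ι : Λ₀ → Λ) (κ : K) (x : Letter Λ₀) : Letter (ℕ × Λ) :=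
  (x.1, lv κ x.1, ι x.2)

/-- The outer arrow `x`, with its level. -/
def outer (ex : Bool → ℕ) (ι : Λ₀ → Λ) (x : Letter Λ₀) : Letter (ℕ × Λ) := (x.1, ex x.1, ι x.2)

/-- Replace the outer arrows selected by `J` by edges to identity discs. -/
def Legs.ins (lv : K → Bool → ℕ) (ex : Bool → ℕ) (ι : Λ₀ → Λ) (J : K → Bool → Bool) :
    K → Legs K Λ₀ → Tr (ℕ × Λ)
  | _, nil => Tr.nil
  | κ, ext o a r =>
    if J κ o then
      Tr.edge (lift lv ι κ (o, a)) (Tr.ext (outer ex ι (o, a)) Tr.nil) (r.ins lv ex ι J κ)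
    else Tr.ext (lift lv ι κ (o, a)) (r.ins lv ex ι J κ)
  | κ, edge o a op s r =>
    Tr.edge (lift lv ι κ (o, a)) (s.ins lv ex ι J op) (r.ins lv ex ι J κ)

/-- The coefficients `h` consist of the coefficients `c κ`, the arrows of the discs having levels
`lv`, and of identities, which connect the level `ex δ` of outer arrows with the level `e` of
edges. Outer arrows have labels `T`. -/
structure Bridge (γ₀ : Grading Λ₀ O) (γ : Grading (ℕ × Λ) O) (c : K → List (Letter Λ₀) → DualNumber k)
    (h : List (Letter (ℕ × Λ)) → DualNumber k) (lv : K → Bool → ℕ) (ex : Bool → ℕ) (e : ℕ)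
    (ι : Λ₀ → Λ) (J : K → Bool → Bool) (δ : Bool) (T : Letter Λ₀ → Prop) : Prop where
  q : ∀ n a, γ.q (n, ι a) = γ₀.q a
  D : γ.D = γ₀.D
  two_le : ∀ κ w, c κ w ≠ 0 → 2 ≤ w.length
  exists_out : ∀ κ w, c κ w ≠ 0 → ∃ x ∈ w, x.1 = true
  disc : ∀ κ w, c κ w ≠ 0 → h (w.map (lift lv ι κ)) = c κ w
  ident : ∀ κ w x, c κ w ≠ 0 → x ∈ w → J κ x.1 = true →
    h [bar (lift lv ι κ x), outer ex ι x] = sg k (γ.η (lift lv ι κ x)) • 1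
  ident_root : ∀ κ w a, c κ w ≠ 0 → (true, a) ∈ w → J κ true = true →
    h [outer ex ι (true, a), bar (lift lv ι κ (true, a))] = 1
  cases : ∀ w, h w ≠ 0 → (∃ κ w₀, c κ w₀ ≠ 0 ∧ w₀.map (lift lv ι κ) = w) ∨
    (∃ y z, w = [y, z] ∧ z.1 = !y.1 ∧ z.2.2 = y.2.2 ∧
      (∀ t ∈ w, (t.1 = δ → t.2.1 = ex δ) ∧ (t.1 ≠ δ → t.2.1 = e)) ∧ ∀ κ, lv κ δ = e → J κ δ = true)
  adj : ∀ κ op w w' x n, c κ w * tau n (c op w') ≠ 0 → x ∈ w → bar x ∈ w' →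
    lv κ x.1 = e ∧ lv op (!x.1) = e
  label_disc : ∀ κ w w' x x', c κ w ≠ 0 → c κ w' ≠ 0 → x ∈ w → x' ∈ w' → x.1 = x'.1 →
    ι x.2 = ι x'.2 → x = x'
  label_outer : ∀ κ w x b, T b → c κ w ≠ 0 → x ∈ w → x.1 = b.1 → ι x.2 = ι b.2 →
    (lv κ x.1 ≠ e ∨ J κ x.1 = true) → x = b
  outer_or : ∀ κ w x, T x → c κ w ≠ 0 → x ∈ w → J κ x.1 = true ∨ lv κ x.1 ≠ e
  label_edge : ∀ κ op w w' x x', c κ w ≠ 0 → c op w' ≠ 0 → x ∈ w → x' ∈ w' → x'.1 = !x.1 →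
    ι x'.2 = ι x.2 → lv κ x.1 = e → lv op x'.1 = e → x' = bar x
  fst_eq : ∀ κ op w o, J κ o = true → lv op (!o) = e → (c op w).fst = 0
  lv_of_J : ∀ κ o, J κ o = true → o = δ ∧ lv κ o = e
  lv_eq : ∀ κ o, lv κ o ≠ e → lv κ o = ex o
  ex_ne : ∀ o, ex o ≠ e
  lv_inj : ∀ κ κ', lv κ true = lv κ' true → κ = κ'

namespace Bridge
variable {γ₀ : Grading Λ₀ O} {γ : Grading (ℕ × Λ) O} {c : K → List (Letter Λ₀) → DualNumber k}
  {h : List (Letter (ℕ × Λ)) → DualNumber k} {lv : K → Bool → ℕ} {ex : Bool → ℕ} {e : ℕ}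
  {ι : Λ₀ → Λ} {J : K → Bool → Bool} {δ : Bool} {T : Letter Λ₀ → Prop}

@[simp] lemma arr_ins (κ : K) (L : Legs K Λ₀) :
    (L.ins lv ex ι J κ).arr = L.arr.map (lift lv ι κ) := by
  induction L with
  | nil => rfl
  | ext o a r ih =>
    rw [Legs.ins]
    split_ifs <;> simp [Tr.arr, Legs.arr, ih]
  | edge o a op s r _ ih => simp [Legs.ins, Tr.arr, Legs.arr, ih]

lemma bar_lift {κ op : K} {x : Letter Λ₀} (h1 : lv κ x.1 = e) (h2 : lv op (!x.1) = e) :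
    bar (lift lv ι κ x) = lift lv ι op (bar x) := by
  simp [bar, lift, h1, h2]

lemma factors_ne_zero {m n : ZMod 2} {a b x y : DualNumber k}
    (h : a * (sg k m • (tau n (b * x) * y)) ≠ 0) : a * tau n b ≠ 0 ∧ b * x ≠ 0 ∧ a * y ≠ 0 := by
  have h1 : a * (tau n (b * x) * y) ≠ 0 := fun h0 => h (by rw [mul_smul_comm, h0, smul_zero])
  refine ⟨fun h0 => h1 ?_, fun h0 => h1 ?_, fun h0 => h1 ?_⟩
  · rw [tau_mul, ← mul_assoc, ← mul_assoc, h0, zero_mul, zero_mul]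
  · rw [h0, tau_apply_zero, zero_mul, mul_zero]
  · rw [mul_left_comm, h0, mul_zero]

variable (H : Bridge γ₀ γ c h lv ex e ι J δ T)
include H

lemma p_lift (κ : K) (x : Letter Λ₀) : γ.p (lift lv ι κ x) = γ₀.p x := by
  simp [Grading.p, lift, H.q, H.D]

lemma η_lift (κ : K) (x : Letter Λ₀) : γ.η (lift lv ι κ x) = γ₀.η x := by
  simp [Grading.η, lift, H.q, H.D]

lemma pw_lift (κ : K) (w : List (Letter Λ₀)) : γ.pw (w.map (lift lv ι κ)) = γ₀.pw w := by
  induction w with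
  | nil => rfl
  | cons x w ih => simp [ih, H.p_lift]

/-- The coefficient of the identity is the sign `η` of its edge, so the two cancel and inserting the
identity does not change the value. -/
lemma om_ident {κ : K} {W : List (Letter Λ₀)} {x : Letter Λ₀} (hW : c κ W ≠ 0) (hx : x ∈ W)
    (hJ : J κ x.1 = true) (r : Tr (ℕ × Λ)) :
    (Tr.edge (lift lv ι κ x) (Tr.ext (outer ex ι x) Tr.nil) r).om γ h = r.om γ h := by
  simp only [Tr.om, Tr.arr, mul_one]
  rw [H.ident κ W x hW hx hJ, tau_smul, tau_apply_one, smul_mul_assoc, one_mul, smul_smul,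
    sg_mul_self, one_smul]

/-- Discs keep their coefficients under the change of labels, and inserted identities do not matter
by `om_ident`. By `outer_or`, an outer arrow either receives an identity or has the outer level
already. -/
lemma ins_spec (κ : K) (L : Legs K Λ₀) (W : List (Letter Λ₀)) (hA : ∀ x ∈ L.arr, x ∈ W)
    (h0 : c κ W * L.om γ₀ c ≠ 0) (hT : ∀ x ∈ L.bd, T x) :
    (L.ins lv ex ι J κ).om γ h = L.om γ₀ c ∧
      (L.ins lv ex ι J κ).bd = L.bd.map (outer ex ι) ∧
      (L.ins lv ex ι J κ).Good fun a => a.1 = e := by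
  induction L generalizing κ W with
  | nil => exact ⟨rfl, rfl, trivial⟩
  | ext o a r ih =>
    have hW : c κ W ≠ 0 := left_ne_zero_of_mul h0
    have hx : (o, a) ∈ W := hA _ (by simp [Legs.arr])
    obtain ⟨h1, h2, h3⟩ := ih κ W (fun x hx => hA x (by simp [Legs.arr, hx])) h0
      fun x hx => hT x (by simp [Legs.bd, hx])
    rw [Legs.ins]
    split_ifs with hJ
    · refine ⟨(H.om_ident hW hx hJ _).trans h1, ?_, ?_⟩
      · simp [Tr.bd, Legs.bd, h2]
      · exact ⟨(H.lv_of_J κ o hJ).2, by simp, trivial, h3⟩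
    · refine ⟨h1, ?_, h3⟩
      have h4 := (H.outer_or κ W (o, a) (hT _ (by simp [Legs.bd])) hW hx).resolve_left hJ
      have h5 := H.lv_eq κ o h4
      simp [Tr.bd, Legs.bd, h2, lift, outer, h5]
  | edge o a op s r ihs ih =>
    obtain ⟨n1, n2, n3⟩ := factors_ne_zero h0
    have hx : (o, a) ∈ W := hA _ (by simp [Legs.arr])
    obtain ⟨h1, h2, h3⟩ := ih κ W (fun x hx => hA x (by simp [Legs.arr, hx])) n3
      fun x hx => hT x (by simp [Legs.bd, hx])
    obtain ⟨g1, g2, g3⟩ := ihs op (bar (o, a) :: s.arr) (fun x hx => by simp [hx]) n2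
      fun x hx => hT x (by simp [Legs.bd, hx])
    obtain ⟨l1, l2⟩ := H.adj κ op W _ (o, a) _ n1 hx (by simp)
    have hd := H.disc op _ (left_ne_zero_of_mul n2)
    rw [Legs.ins]
    refine ⟨?_, by simp [Tr.bd, Legs.bd, h2, g2], l1, ?_, g3, h3⟩
    · rw [Tr.om, h1, g1, arr_ins, arr_ins, bar_lift l1 l2, ← List.map_cons, hd, H.pw_lift,
        H.η_lift]
      rfl
    · intro hs
      have h4 := H.two_le op _ (left_ne_zero_of_mul n2)
      have h5 : (s.ins lv ex ι J op).arr = [] := by rw [hs]; rfl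
      rw [arr_ins, List.map_eq_nil_iff] at h5
      simp [h5] at h4

/-- A tree shows where the discs are and how they are labelled. The only possible confusion is
between an inserted identity and an actual disc. -/
lemma ins_inj (κ : K) (L L' : Legs K Λ₀) (W W' : List (Letter Λ₀)) (hA : ∀ x ∈ L.arr, x ∈ W)
    (hA' : ∀ x ∈ L'.arr, x ∈ W') (h0 : c κ W * L.om γ₀ c ≠ 0) (h0' : c κ W' * L'.om γ₀ c ≠ 0)
    (he : L.ins lv ex ι J κ = L'.ins lv ex ι J κ) : L = L' := by
  -- An actual disc in the place of an identity has a coefficient without constant term by `fst_eq`,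
  -- while that of the identity is a sign. Equal words cannot have both.
  have hident : ∀ {κ op : K} {W : List (Letter Λ₀)} {x : Letter Λ₀} {s : Legs K Λ₀} {n : ZMod 2},
      c κ W * tau n (c op (bar x :: s.arr)) ≠ 0 → x ∈ W → J κ x.1 = true →
      s.ins lv ex ι J op = Tr.ext (outer ex ι x) Tr.nil → False := by
    intro κ op W x s n n1 hx hJ hs
    obtain ⟨l1, l2⟩ := H.adj κ op W _ x _ n1 hx (by simp)
    have n2 : c op (bar x :: s.arr) ≠ 0 := fun h0 => n1 (by simp [h0])
    have h1 := H.disc op _ n2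
    have h2 := congrArg Tr.arr hs
    rw [arr_ins] at h2
    rw [List.map_cons, h2, ← bar_lift l1 l2, Tr.arr, Tr.arr,
      H.ident κ W x (left_ne_zero_of_mul n1) hx hJ] at h1
    have h3 := congrArg TrivSqZeroExt.fst h1
    rw [H.fst_eq κ op _ x.1 hJ l2] at h3
    simp only [TrivSqZeroExt.fst_smul, TrivSqZeroExt.fst_one, smul_eq_mul, mul_one] at h3
    exact sg_ne_zero _ h3
  induction L generalizing κ L' W W' with
  | nil =>
    cases L' with
    | nil => rfl
    | ext o a r =>
      rw [Legs.ins, Legs.ins] at he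
      split_ifs at he
    | edge o a op s r => rw [Legs.ins, Legs.ins] at he; simp at he
  | ext o a r ih =>
    have hx : (o, a) ∈ W := hA _ (by simp [Legs.arr])
    have hA1 : ∀ x ∈ r.arr, x ∈ W := fun x hx => hA x (by simp [Legs.arr, hx])
    cases L' with
    | nil =>
      rw [Legs.ins, Legs.ins] at he
      split_ifs at he
    | ext o' a' r' =>
      have hx' : (o', a') ∈ W' := hA' _ (by simp [Legs.arr])
      have hl : (o, a) = (o', a') := by
        have := congrArg (fun t => t.arr.head?) he
        simp only [arr_ins, Legs.arr, List.map_cons, List.head?_cons, Option.some.injEq, lift,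
          Prod.mk.injEq] at this
        exact H.label_disc κ W W' _ _ (left_ne_zero_of_mul h0) (left_ne_zero_of_mul h0') hx hx'
          this.1 this.2.2
      obtain ⟨rfl, rfl⟩ := Prod.mk.inj hl
      have hr : r.ins lv ex ι J κ = r'.ins lv ex ι J κ := by
        rw [Legs.ins, Legs.ins] at he
        split_ifs at he
        · exact (Tr.edge.inj he).2.2
        · exact (Tr.ext.inj he).2
      rw [ih κ r' W W' hA1 (fun x hx => hA' x (by simp [Legs.arr, hx])) h0 h0' hr]
    | edge o' a' op s r' =>
      have hx' : (o', a') ∈ W' := hA' _ (by simp [Legs.arr])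
      have hl : (o, a) = (o', a') := by
        have := congrArg (fun t => t.arr.head?) he
        simp only [arr_ins, Legs.arr, List.map_cons, List.head?_cons, Option.some.injEq, lift,
          Prod.mk.injEq] at this
        exact H.label_disc κ W W' _ _ (left_ne_zero_of_mul h0) (left_ne_zero_of_mul h0') hx hx'
          this.1 this.2.2
      obtain ⟨rfl, rfl⟩ := Prod.mk.inj hl
      rw [Legs.ins, Legs.ins] at he
      split_ifs at he with hJ
      exact (hident (factors_ne_zero h0').1 hx' hJ (Tr.edge.inj he).2.1.symm).elim
  | edge o a op s r ihs ih =>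
    have hx : (o, a) ∈ W := hA _ (by simp [Legs.arr])
    have hA1 : ∀ x ∈ r.arr, x ∈ W := fun x hx => hA x (by simp [Legs.arr, hx])
    obtain ⟨n1, n2, n3⟩ := factors_ne_zero h0
    cases L' with
    | nil => rw [Legs.ins, Legs.ins] at he; simp at he
    | ext o' a' r' =>
      have hx' : (o', a') ∈ W' := hA' _ (by simp [Legs.arr])
      have hl : (o, a) = (o', a') := by
        have := congrArg (fun t => t.arr.head?) he
        simp only [arr_ins, Legs.arr, List.map_cons, List.head?_cons, Option.some.injEq, lift,
          Prod.mk.injEq] at this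
        exact H.label_disc κ W W' _ _ (left_ne_zero_of_mul h0) (left_ne_zero_of_mul h0') hx hx'
          this.1 this.2.2
      obtain ⟨rfl, rfl⟩ := Prod.mk.inj hl
      rw [Legs.ins, Legs.ins] at he
      split_ifs at he with hJ
      exact (hident n1 hx hJ (Tr.edge.inj he).2.1).elim
    | edge o' a' op' s' r' =>
      have hx' : (o', a') ∈ W' := hA' _ (by simp [Legs.arr])
      obtain ⟨n1', n2', n3'⟩ := factors_ne_zero h0'
      rw [Legs.ins, Legs.ins] at he
      obtain ⟨e1, e2, e3⟩ := Tr.edge.inj he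
      have hl : (o, a) = (o', a') := by
        simp only [lift, Prod.mk.injEq] at e1
        exact H.label_disc κ W W' _ _ (left_ne_zero_of_mul h0) (left_ne_zero_of_mul h0') hx hx'
          e1.1 e1.2.2
      obtain ⟨rfl, rfl⟩ := Prod.mk.inj hl
      -- The operation is recovered from the level of an outgoing arrow of the disc.
      have hop : op = op' := by
        have m1 := left_ne_zero_of_mul n2
        have m2 := left_ne_zero_of_mul n2'
        have l2 := (H.adj κ op W _ (o, a) _ n1 hx (by simp)).2
        have l2' := (H.adj κ op' W' _ (o, a) _ n1' hx' (by simp)).2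
        have e4 : (bar (o, a) :: s.arr).map (lift lv ι op) =
            (bar (o, a) :: s'.arr).map (lift lv ι op') := by
          have := congrArg Tr.arr e2
          rw [arr_ins, arr_ins] at this
          rw [List.map_cons, List.map_cons, this]
          simp only [lift, bar] at l2 l2' ⊢
          rw [l2, l2']
        obtain ⟨x, hx, hx1⟩ := H.exists_out op _ m1
        have hx2 := List.mem_map_of_mem (f := lift lv ι op) hx
        rw [e4] at hx2
        obtain ⟨y, -, hy⟩ := List.mem_map.1 hx2
        simp only [lift, Prod.mk.injEq] at hy
        obtain ⟨y1, y2, -⟩ := hy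
        rw [y1, hx1] at y2
        exact (H.lv_inj _ _ y2).symm
      subst hop
      rw [ihs op s' _ _ (fun x hx => List.mem_cons_of_mem _ hx)
        (fun x hx => List.mem_cons_of_mem _ hx) n2 n2' e2,
        ih κ r' W W' hA1 (fun x hx => hA' x (by simp [Legs.arr, hx])) n3 n3' e3]

/-- By `cases`, each disc of a tree of nonzero value is either the image of an operation or an
identity. The former become edges of the diagram; the latter are dropped, and their edges become
outer arrows. -/
lemma ins_surj (S : Tr (ℕ × Λ)) (κ : K) (W A B : List (Letter Λ₀)) (hA : ∀ x ∈ A, x ∈ W)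
    (hSA : S.arr = A.map (lift lv ι κ)) (hSB : S.bd = B.map (outer ex ι)) (hB : ∀ b ∈ B, T b)
    (hS : S.Good fun a => a.1 = e) (hW : c κ W ≠ 0) (h0 : S.om γ h ≠ 0) :
    ∃ L : Legs K Λ₀, L.ins lv ex ι J κ = S ∧ L.arr = A ∧ L.bd = B ∧ L.om γ₀ c = S.om γ h := by
  induction S generalizing κ W A B with
  | nil =>
    obtain rfl : A = [] := by simpa [Tr.arr] using hSA
    obtain rfl : B = [] := by simpa [Tr.bd] using hSB
    exact ⟨Legs.nil, rfl, rfl, rfl, rfl⟩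
  | ext y r ih =>
    rcases A with _ | ⟨x, A⟩
    · simp [Tr.arr] at hSA
    rcases B with _ | ⟨b, B⟩
    · simp [Tr.bd] at hSB
    simp only [Tr.arr, List.map_cons, List.cons.injEq] at hSA
    simp only [Tr.bd, List.map_cons, List.cons.injEq] at hSB
    obtain ⟨rfl, hSA⟩ := hSA
    obtain ⟨hb, hSB⟩ := hSB
    simp only [lift, outer, Prod.mk.injEq] at hb
    have hne : lv κ x.1 ≠ e := by rw [hb.2.1]; exact H.ex_ne _
    obtain rfl := H.label_outer κ W x b (hB b (by simp)) hW (hA x (by simp)) hb.1 hb.2.2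
      (Or.inl hne)
    obtain ⟨L, h1, h2, h3, h4⟩ := ih κ W A B (fun z hz => hA z (by simp [hz])) hSA hSB
      (fun z hz => hB z (by simp [hz])) hS hW h0
    refine ⟨Legs.ext x.1 x.2 L, ?_, by simp [Legs.arr, h2], by simp [Legs.bd, h3], h4⟩
    rw [Legs.ins, if_neg (fun hJ => hne (H.lv_of_J κ _ hJ).2), h1]
  | edge y s r ihs ih =>
    rcases A with _ | ⟨x, A⟩
    · simp [Tr.arr] at hSA
    simp only [Tr.arr, List.map_cons, List.cons.injEq] at hSA
    obtain ⟨rfl, hSA⟩ := hSA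
    obtain ⟨m1, m2, m3⟩ := Tr.om_edge_ne_zero h0
    have l1 : lv κ x.1 = e := hS.1
    obtain ⟨B₁, B₂, rfl, b1, b2⟩ := List.map_eq_append_iff.1 hSB.symm
    obtain ⟨L, h1, h2, h3, h4⟩ := ih κ W A B₂ (fun z hz => hA z (by simp [hz])) hSA b2.symm
      (fun z hz => hB z (by simp [hz])) hS.2.2.2 hW m3
    rcases H.cases _ m1 with ⟨op, w₀, g1, g2⟩ | ⟨y, z, g1, g2, g3, g4, g5⟩
    · rcases w₀ with _ | ⟨x', A'⟩
      · simp at g2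
      simp only [List.map_cons, List.cons.injEq] at g2
      obtain ⟨g2, g3⟩ := g2
      simp only [lift, bar, Prod.mk.injEq] at g2
      have l2 : lv op x'.1 = e := g2.2.1.trans l1
      obtain rfl := H.label_edge κ op W _ x x' hW g1 (hA x (by simp)) (by simp) g2.1 g2.2.2 l1 l2
      obtain ⟨L', q1, q2, q3, q4⟩ := ihs op _ A' B₁ (fun z hz => List.mem_cons_of_mem _ hz)
        g3.symm b1.symm (fun z hz => hB z (by simp [hz])) hS.2.2.1 g1 m2
      refine ⟨Legs.edge x.1 x.2 op L' L, ?_, by simp [Legs.arr, h2], by simp [Legs.bd, h3, q3], ?_⟩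
      · rw [Legs.ins, q1, h1]
      · rw [Legs.om, Tr.om, h4, q4, H.η_lift, bar_lift l1 l2, ← g3, ← List.map_cons,
          H.disc op _ g1, q2, hSA, H.pw_lift, h2]
    · simp only [List.cons.injEq] at g1
      obtain ⟨rfl, g1⟩ := g1
      have t1 := g4 (bar (lift lv ι κ x)) (by simp)
      have t2 := g4 z (by simp [g1])
      simp only [bar, lift] at t1 g2 g3
      have hxδ : x.1 = δ := by
        by_contra hc
        have : (!x.1) = δ := by revert hc; cases x.1 <;> cases δ <;> simp
        exact H.ex_ne δ ((t1.1 this).symm.trans l1)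
      rw [Bool.not_not] at g2
      -- The second arrow of an identity has the outer level, so it cannot carry an edge and the
      -- subtree consists of this disc alone.
      have hz : z.2.1 ≠ e := by rw [t2.1 (g2.trans hxδ)]; exact H.ex_ne δ
      have hs : s = Tr.ext z Tr.nil := by
        rcases s with _ | ⟨z', r'⟩ | ⟨z', s', r'⟩
        · simp [Tr.arr] at g1
        · simp only [Tr.arr, List.cons.injEq] at g1
          obtain ⟨rfl, g1⟩ := g1
          rcases r' with _ | _ | _
          · rfl
          · simp [Tr.arr] at g1
          · simp [Tr.arr] at g1
        · simp only [Tr.arr, List.cons.injEq] at g1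
          obtain ⟨rfl, g1⟩ := g1
          exact absurd hS.2.2.1.1 hz
      subst hs
      have hJ : J κ x.1 = true := by
        have := g5 κ (by rw [← hxδ]; exact l1)
        rwa [← hxδ] at this
      obtain ⟨b, rfl, hb⟩ := List.map_eq_singleton_iff.1 b1
      have hb' : b.1 = z.1 ∧ ι b.2 = z.2.2 := by
        rw [← hb]; exact ⟨rfl, rfl⟩
      obtain rfl := H.label_outer κ W x b (hB b (by simp)) hW (hA x (by simp))
        (by rw [hb'.1, g2]) (by rw [hb'.2, g3]) (Or.inr hJ)
      refine ⟨Legs.ext x.1 x.2 L, ?_, by simp [Legs.arr, h2], by simp [Legs.bd, h3], ?_⟩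
      · rw [Legs.ins, if_pos hJ, h1, ← hb]
      · rw [← hb, H.om_ident hW (hA x (by simp)) hJ, ← h4]
        rfl

open Classical in
/-- The sum of the values of trees is a sum over diagrams. -/
theorem TS_eq (b : Λ₀) (B : List (Letter Λ₀)) (hb : T (true, b)) (hB : ∀ x ∈ B, T x)
    (hfin : {L : Tr (ℕ × Λ) | L.bd = B.map (outer ex ι) ∧ L.Good (fun a => a.1 = e) ∧
      (Tr.ext (outer ex ι (true, b)) L).val γ h ≠ 0}.Finite) :
    ({p : K × Legs K Λ₀ | p.2.bd = B} ∩
      Function.support fun p => c p.1 ((true, b) :: p.2.arr) * p.2.om γ₀ c).Finite ∧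
    TS γ h (fun a => a.1 = e) (outer ex ι (true, b) :: B.map (outer ex ι)) =
      ∑ᶠ p ∈ {p : K × Legs K Λ₀ | p.2.bd = B}, c p.1 ((true, b) :: p.2.arr) * p.2.om γ₀ c := by
  have hroot : ∀ p : K × Legs K Λ₀, c p.1 ((true, b) :: p.2.arr) * p.2.om γ₀ c ≠ 0 →
      (J p.1 true = true ∧ lv p.1 true = e) ∨
        (J p.1 true ≠ true ∧ lv p.1 true = ex true) := by
    intro p h0
    by_cases hJ : J p.1 true = true
    · exact Or.inl ⟨hJ, (H.lv_of_J _ _ hJ).2⟩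
    · exact Or.inr ⟨hJ, H.lv_eq _ _
        ((H.outer_or p.1 _ (true, b) hb (left_ne_zero_of_mul h0) (by simp)).resolve_left hJ)⟩
  -- If the bold arrow itself receives an identity, then that identity becomes the root disc of the
  -- tree, and the root disc of the diagram hangs on it.
  let Θ : K × Legs K Λ₀ → Tr (ℕ × Λ) := fun p =>
    if J p.1 true then
      Tr.edge (bar (lift lv ι p.1 (true, b))) (p.2.ins lv ex ι J p.1) Tr.nil
    else p.2.ins lv ex ι J p.1
  have hbarη : ∀ κ, γ.η (bar (lift lv ι κ (true, b))) = 0 := fun κ => by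
    simp [Grading.η, bar, lift]
  have hval : ∀ p : K × Legs K Λ₀, p.2.bd = B →
      c p.1 ((true, b) :: p.2.arr) * p.2.om γ₀ c ≠ 0 →
      c p.1 ((true, b) :: p.2.arr) * p.2.om γ₀ c = (Tr.ext (outer ex ι (true, b)) (Θ p)).val γ h ∧
        (Θ p).bd = B.map (outer ex ι) ∧ (Θ p).Good fun a => a.1 = e := by
    intro p hp h0
    have hd := H.disc p.1 _ (left_ne_zero_of_mul h0)
    obtain ⟨h1, h2, h3⟩ := H.ins_spec p.1 p.2 ((true, b) :: p.2.arr)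
      (fun x hx => List.mem_cons_of_mem _ hx) h0 (fun x hx => hB x (hp ▸ hx))
    rcases hroot p h0 with ⟨hJ, hl⟩ | ⟨hJ, hl⟩
    · simp only [Θ, if_pos hJ]
      refine ⟨?_, by simp [Tr.bd, h2, hp], ?_, ?_, h3, trivial⟩
      · simp only [Tr.val, Tr.om, Tr.arr, hbarη, bar_bar, mul_one, sg_zero, one_smul, γ.pw_nil,
          tau_zero]
        rw [H.ident_root p.1 _ b (left_ne_zero_of_mul h0) (by simp) hJ, one_mul, arr_ins,
          ← List.map_cons, hd, h1]
      · exact hl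
      · intro hn
        have h4 := H.two_le p.1 _ (left_ne_zero_of_mul h0)
        have h5 : (p.2.ins lv ex ι J p.1).arr = [] := by rw [hn]; rfl
        rw [arr_ins, List.map_eq_nil_iff] at h5
        simp [h5] at h4
    · simp only [Θ, if_neg hJ]
      refine ⟨?_, by rw [h2, hp], h3⟩
      have h4 : outer ex ι (true, b) = lift lv ι p.1 (true, b) := by simp [outer, lift, hl]
      simp only [Tr.val, Tr.om, Tr.arr]
      rw [h4, arr_ins, ← List.map_cons, hd, h1]
  suffices hbij : Set.BijOn Θ ({p : K × Legs K Λ₀ | p.2.bd = B} ∩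
      Function.support fun p => c p.1 ((true, b) :: p.2.arr) * p.2.om γ₀ c)
      ({L : Tr (ℕ × Λ) | L.bd = B.map (outer ex ι) ∧ L.Good fun a => a.1 = e} ∩
        Function.support fun L => (Tr.ext (outer ex ι (true, b)) L).val γ h) from
    ⟨hbij.finite_iff_finite.2 (hfin.subset fun L hL => ⟨hL.1.1, hL.1.2, hL.2⟩),
      (finsum_mem_eq_of_bijOn_support Θ hbij fun p hp h0 => (hval p hp h0).1).symm⟩
  refine ⟨?_, ?_, ?_⟩
  · rintro p ⟨hp, h0⟩
    obtain ⟨h1, h2, h3⟩ := hval p hp h0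
    refine ⟨⟨h2, h3⟩, ?_⟩
    rw [Function.mem_support, ← h1]
    exact h0
  · rintro ⟨κ, L⟩ ⟨hp, h0⟩ ⟨κ', L'⟩ ⟨hp', h0'⟩ he
    -- A root disc that is an identity cannot coincide with one that is an actual disc, again
    -- because the constant terms differ.
    have hmix : ∀ (κ κ' : K) (L L' : Legs K Λ₀),
        c κ ((true, b) :: L.arr) * L.om γ₀ c ≠ 0 → c κ' ((true, b) :: L'.arr) * L'.om γ₀ c ≠ 0 →
        J κ true = true → lv κ true = e → J κ' true ≠ true → lv κ' true = ex true →
        Θ (κ, L) = Θ (κ', L') → False := by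
      intro κ κ' L L' h0 h0' hJ hl hJ' hl' he
      simp only [Θ, if_pos hJ, if_neg hJ'] at he
      have h1 := congrArg Tr.arr he
      rw [arr_ins, Tr.arr, Tr.arr] at h1
      have hd := H.disc κ' _ (left_ne_zero_of_mul h0')
      have h4 : outer ex ι (true, b) = lift lv ι κ' (true, b) := by simp [outer, lift, hl']
      rw [List.map_cons, ← h1, ← h4,
        H.ident_root κ _ b (left_ne_zero_of_mul h0) (by simp) hJ] at hd
      have h5 : lv κ' (!true) = e := by
        rcases hL : L'.arr with _ | ⟨z, A⟩
        · simp [hL] at h1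
        · rw [hL, List.map_cons, List.cons.injEq] at h1
          have h6 := h1.1
          simp only [bar, lift, Prod.mk.injEq] at h6
          rw [h6.1, ← h6.2.1, hl]
      have h7 := congrArg TrivSqZeroExt.fst hd
      rw [H.fst_eq κ κ' _ true hJ h5] at h7
      simp at h7
    rcases hroot _ h0 with ⟨hJ, hl⟩ | ⟨hJ, hl⟩ <;> rcases hroot _ h0' with ⟨hJ', hl'⟩ | ⟨hJ', hl'⟩
    · obtain rfl := H.lv_inj κ κ' (hl.trans hl'.symm)
      simp only [Θ, if_pos hJ] at he
      rw [H.ins_inj κ L L' _ _ (fun x hx => List.mem_cons_of_mem _ hx)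
        (fun x hx => List.mem_cons_of_mem _ hx) h0 h0' (Tr.edge.inj he).2.1]
    · exact (hmix κ κ' L L' h0 h0' hJ hl hJ' hl' he).elim
    · exact (hmix κ' κ L' L h0' h0 hJ' hl' hJ hl he.symm).elim
    · obtain rfl := H.lv_inj κ κ' (hl.trans hl'.symm)
      simp only [Θ, if_neg hJ] at he
      rw [H.ins_inj κ L L' _ _ (fun x hx => List.mem_cons_of_mem _ hx)
        (fun x hx => List.mem_cons_of_mem _ hx) h0 h0' he]
  · rintro S ⟨⟨hS1, hS2⟩, h0⟩
    have m1 : h (outer ex ι (true, b) :: S.arr) ≠ 0 := left_ne_zero_of_mul h0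
    have m2 : S.om γ h ≠ 0 := right_ne_zero_of_mul h0
    suffices hs : ∃ p : K × Legs K Λ₀, p.2.bd = B ∧ Θ p = S ∧
        c p.1 ((true, b) :: p.2.arr) * p.2.om γ₀ c = (Tr.ext (outer ex ι (true, b)) S).val γ h by
      obtain ⟨p, h1, h2, h3⟩ := hs
      exact ⟨p, ⟨h1, by rw [Function.mem_support, h3]; exact h0⟩, h2⟩
    rcases H.cases _ m1 with ⟨κ, w₀, g1, g2⟩ | ⟨y, z, g1, g2, g3, g4, g5⟩
    · rcases w₀ with _ | ⟨x, A⟩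
      · simp at g2
      simp only [List.map_cons, List.cons.injEq] at g2
      obtain ⟨g2, g3⟩ := g2
      have g2' := g2
      simp only [lift, outer, Prod.mk.injEq] at g2
      have hne : lv κ x.1 ≠ e := by rw [g2.2.1]; exact H.ex_ne _
      obtain rfl := H.label_outer κ _ x (true, b) hb g1 (by simp) g2.1 g2.2.2 (Or.inl hne)
      obtain ⟨L, h1, h2, h3, h4⟩ := H.ins_surj S κ _ A B (fun z hz => List.mem_cons_of_mem _ hz)
        g3.symm hS1 hB hS2 g1 m2
      have hJ : J κ true ≠ true := fun hJ => hne (H.lv_of_J κ _ hJ).2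
      refine ⟨(κ, L), h3, by simp only [Θ, if_neg hJ, h1], ?_⟩
      simp only [Tr.val, Tr.om, Tr.arr]
      rw [h2, h4, ← g2', ← g3, ← List.map_cons, H.disc κ _ g1]
    · simp only [List.cons.injEq] at g1
      obtain ⟨rfl, g1⟩ := g1
      have t1 := g4 (outer ex ι (true, b)) (by simp)
      have t2 := g4 z (by simp [g1])
      simp only [outer, Bool.not_true] at t1 g2 g3
      -- The root has the outer level, and in an identity only the arrow with direction `δ` has it.
      -- So identities at the root occur only where outputs are extended.
      have hδ : δ = true := by
        by_contra hc
        exact H.ex_ne true (t1.2 (Ne.symm hc))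
      subst hδ
      replace t2 := t2.2 (by rw [g2]; simp)
      have hzs : ∃ s, S = Tr.edge z s Tr.nil := by
        rcases S with _ | ⟨z', r'⟩ | ⟨z', s', r'⟩
        · simp [Tr.arr] at g1
        · simp only [Tr.arr, List.cons.injEq] at g1
          obtain ⟨rfl, g1⟩ := g1
          simp only [Tr.bd] at hS1
          rcases B with _ | ⟨b', B⟩
          · simp at hS1
          · rw [List.map_cons, List.cons.injEq] at hS1
            rw [hS1.1] at t2
            exact absurd t2 (H.ex_ne _)
        · simp only [Tr.arr, List.cons.injEq] at g1
          obtain ⟨rfl, g1⟩ := g1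
          refine ⟨s', ?_⟩
          rcases r' with _ | _ | _
          · rfl
          · simp [Tr.arr] at g1
          · simp [Tr.arr] at g1
      obtain ⟨s, rfl⟩ := hzs
      obtain ⟨n1, n2, -⟩ := Tr.om_edge_ne_zero m2
      rcases H.cases _ n1 with ⟨κ, w₀, f1, f2⟩ | ⟨y, z', f1, f2, f3, f4, f5⟩
      · rcases w₀ with _ | ⟨x, A⟩
        · simp at f2
        simp only [List.map_cons, List.cons.injEq] at f2
        obtain ⟨f2, f3⟩ := f2
        have f2' := f2
        simp only [lift, bar, Prod.mk.injEq, g2, Bool.not_false] at f2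
        have hl : lv κ true = e := by
          have := congrArg (fun p => p.1) f2.2
          rw [f2.1] at this
          exact this.trans t2
        have hι : ι x.2 = ι b := by
          have := congrArg (fun p => p.2) f2.2
          exact this.trans g3
        have hJ := g5 κ hl
        obtain rfl := H.label_outer κ _ x (true, b) hb f1 (by simp) f2.1 hι
          (Or.inr (by rw [f2.1]; exact hJ))
        obtain ⟨L, h1, h2, h3, h4⟩ := H.ins_surj s κ _ A B
          (fun z hz => List.mem_cons_of_mem _ hz) f3.symm (by simpa [Tr.bd] using hS1) hB
          hS2.2.2.1 f1 n2
        have hz : z = bar (lift lv ι κ (true, b)) := by rw [f2', bar_bar]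
        refine ⟨(κ, L), h3, by simp only [Θ, if_pos hJ, h1, ← hz], ?_⟩
        simp only [Tr.val, Tr.om, Tr.arr]
        rw [h2, h4, hz, hbarη, bar_bar, H.ident_root κ _ b f1 (by simp) hJ, ← f3,
          ← List.map_cons, H.disc κ _ f1]
        simp
      · have := f4 (bar z) (by simp)
        exact absurd ((this.1 (by simp [bar, g2])).symm.trans t2) (H.ex_ne _)
end Bridge
end
section
variable {k : Type w} [Field k] {Λ : Type t} {O : Type u}

/-! ### Sets of labels -/

/-- A set of labels with degrees and objects. -/
structure Labels (O : Type u) where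
  L : Type t
  deg : L → ℤ
  l : L → O
  r : L → O

namespace Labels
variable {A B : GrQuiver.{u, v, w} k O}

/-- The labels of a quiver. -/
abbrev of (A : GrQuiver.{u, v, w} k O) : Labels.{u, max u v} O := ⟨Lab A, Lab.deg, Lab.l, Lab.r⟩

/-- The disjoint union. -/
abbrev sum (U V : Labels.{u, t} O) : Labels.{u, t} O :=
  ⟨U.L ⊕ V.L, Sum.elim U.deg V.deg, Sum.elim U.l V.l, Sum.elim U.r V.r⟩

/-- Labels with levels. -/
abbrev lev (U : Labels.{u, t} O) : Labels.{u, t} O :=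
  ⟨ℕ × U.L, fun a => U.deg a.2, fun a => U.l a.2, fun a => U.r a.2⟩

/-- The grading of a set of labels. -/
abbrev γ (U : Labels.{u, t} O) (d : ℤ) : Grading U.L O := Grading.ofDeg d U.deg U.l U.r

/-- Embeddings of the labels of a quiver. -/
abbrev Emb (U : Labels.{u, t} O) (e : Lab A → U.L) : Prop := IsEmb U.deg U.l U.r e

/-- Embed labels at a level. -/
def pos {U : Labels.{u, t} O} (n : ℕ) (e : Lab A → U.L) : Lab A → U.lev.L := fun a => (n, e a)

variable {U V : Labels.{u, t} O}

lemma Emb.pos {e : Lab A → U.L} (h : U.Emb e) (n : ℕ) : U.lev.Emb (pos n e) :=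
  ⟨fun _ _ hab => h.inj (Prod.mk.inj hab).2, h.deg, h.l, h.r⟩

lemma emb_id : (of A).Emb (A := A) id :=
  ⟨fun _ _ h => h, fun _ => rfl, fun _ => rfl, fun _ => rfl⟩

lemma Emb.inl {e : Lab A → U.L} (h : U.Emb e) : (U.sum V).Emb fun a => Sum.inl (e a) :=
  ⟨fun _ _ hab => h.inj (Sum.inl_injective hab), h.deg, h.l, h.r⟩

lemma Emb.inr {e : Lab A → V.L} (h : V.Emb e) : (U.sum V).Emb fun a => Sum.inr (e a) :=
  ⟨fun _ _ hab => h.inj (Sum.inr_injective hab), h.deg, h.l, h.r⟩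

lemma of_γ (U : Labels.{u, t} O) (d : ℤ) : (U.γ d).Of d U.deg := Grading.ofDeg_of _ _ _ _
end Labels

/-! ### Change of labels of coefficients -/

section Transfer
variable {A B : GrQuiver.{u, v, w} k O} {Λ₀ : Type t} {i₀ : Lab A → Λ₀} {o₀ : Lab B → Λ₀}
  {i : Lab A → Λ} {o : Lab B → Λ} {ψ : Letter Λ₀ → Letter Λ}

lemma Filled.word_map_letter (hi : ∀ a, ψ (false, i₀ a) = (false, i a))
    (ho : ∀ b, ψ (true, o₀ b) = (true, o b)) (f : Filled A B) :
    (f.word i₀ o₀).map ψ = f.word i o := by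
  simp only [Filled.word, List.map_flatMap, List.map_append, List.map_reverse, List.map_ofFn,
    List.map_cons, List.map_nil, ho]
  congr 1
  funext s
  congr 3
  funext j
  exact hi _

lemma Multi.typed_norm {W : List (Letter Λ)} : Multi.Typed i o (norm W) ↔ Multi.Typed i o W := by
  simp only [Multi.Typed, (perm_norm W).mem_iff]

lemma Multi.map_letter (hi : ∀ a, ψ (false, i₀ a) = (false, i a))
    (ho : ∀ b, ψ (true, o₀ b) = (true, o b)) {W₀ : List (Letter (Lab A ⊕ Lab B))}
    (h : Multi.Typed Sum.inl Sum.inr W₀) :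
    (W₀.map fun x => (x.1, Sum.elim i₀ o₀ x.2)).map ψ =
      W₀.map fun x => (x.1, Sum.elim i o x.2) := by
  rw [List.map_map]
  refine List.map_congr_left fun x hx => ?_
  rcases x with ⟨s, y⟩
  rcases h _ hx with ⟨h1, a, h2⟩ | ⟨h1, a, h2⟩
  · obtain rfl : s = false := h1
    obtain rfl : Sum.inl a = y := h2
    exact hi a
  · obtain rfl : s = true := h1
    obtain rfl : Sum.inr a = y := h2
    exact ho a

lemma Multi.coeff_map_letter (F : Multi A B) (hi₀ : Function.Injective i₀)
    (ho₀ : Function.Injective o₀) (hii : Function.Injective i) (hoo : Function.Injective o)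
    (hi : ∀ a, ψ (false, i₀ a) = (false, i a)) (ho : ∀ b, ψ (true, o₀ b) = (true, o b))
    {W : List (Letter Λ₀)} (h : Multi.Typed i₀ o₀ W) :
    F.coeff i o (W.map ψ) = F.coeff i₀ o₀ W := by
  obtain ⟨W₀, h0, rfl⟩ := Multi.typed_iff.1 h
  rw [Multi.map_letter hi ho h0, Multi.coeff_map F hii hoo h0, Multi.coeff_map F hi₀ ho₀ h0]

lemma rtakeWhile_map (hψ : ∀ x, (ψ x).1 = x.1) (W : List (Letter Λ₀)) :
    ((W.map ψ).rtakeWhile fun p => !p.1) = (W.rtakeWhile fun p => !p.1).map ψ := by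
  simp only [List.rtakeWhile, ← List.map_reverse, List.takeWhile_map]
  congr 3
  funext x
  simp [hψ]

lemma rdropWhile_map (hψ : ∀ x, (ψ x).1 = x.1) (W : List (Letter Λ₀)) :
    ((W.map ψ).rdropWhile fun p => !p.1) = (W.rdropWhile fun p => !p.1).map ψ := by
  simp only [List.rdropWhile, ← List.map_reverse, List.dropWhile_map]
  congr 3
  funext x
  simp [hψ]

lemma norm_map (hψ : ∀ x, (ψ x).1 = x.1) (W : List (Letter Λ₀)) :
    norm (W.map ψ) = (norm W).map ψ := by
  rw [norm, rtakeWhile_map hψ, rdropWhile_map hψ, ← List.map_append]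
  rfl

variable {O₀ : Type*} {γ₀ : Grading Λ₀ O₀} {γ : Grading Λ O}

lemma pw_map (hp : ∀ x, γ.p (ψ x) = γ₀.p x) (W : List (Letter Λ₀)) :
    γ.pw (W.map ψ) = γ₀.pw W := by
  induction W with
  | nil => rfl
  | cons x W ih => simp [ih, hp]

lemma tw_map (hψ : ∀ x, (ψ x).1 = x.1) (hp : ∀ x, γ.p (ψ x) = γ₀.p x) (α : ZMod 2)
    (W : List (Letter Λ₀)) : tw γ α (W.map ψ) = tw γ₀ α W := by
  induction W generalizing α with
  | nil => rfl
  | cons x W ih => simp only [List.map_cons, tw, hψ, hp, pw_map hp, ih]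

lemma ccw_map (hψ : ∀ x, (ψ x).1 = x.1) (hp : ∀ x, γ.p (ψ x) = γ₀.p x)
    {c : List (Letter Λ) → k} {c₀ : List (Letter Λ₀) → k} {W : List (Letter Λ₀)}
    (h : c ((norm W).map ψ) = c₀ (norm W)) : ccw γ c (W.map ψ) = ccw γ₀ c₀ W := by
  rw [ccw, ccw, nsg, nsg, rtakeWhile_map hψ, rdropWhile_map hψ, pw_map hp, pw_map hp,
    norm_map hψ, tw_map hψ hp, h]

/-- The functions `c₀` and `f` of words are the coefficients of the same family of operations from
`A` to `B` with respect to two choices of labels. -/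
structure Transfer (i₀ : Lab A → Λ₀) (o₀ : Lab B → Λ₀) (ψ : Letter Λ₀ → Letter Λ)
    (c₀ : List (Letter Λ₀) → DualNumber k) (f : List (Letter Λ) → DualNumber k) : Prop where
  typed : ∀ w, c₀ w ≠ 0 → Multi.Typed i₀ o₀ w
  two_le : ∀ w, c₀ w ≠ 0 → 2 ≤ w.length
  exists_out : ∀ w, c₀ w ≠ 0 → ∃ x ∈ w, x.1 = true
  map : ∀ w, Multi.Typed i₀ o₀ w → f (w.map ψ) = c₀ w
  surj : ∀ w, f w ≠ 0 → ∃ w₀, Multi.Typed i₀ o₀ w₀ ∧ w₀.map ψ = w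

lemma Transfer.add {c₀ c₀' : List (Letter Λ₀) → DualNumber k}
    {f f' : List (Letter Λ) → DualNumber k} (h : Transfer i₀ o₀ ψ c₀ f)
    (h' : Transfer i₀ o₀ ψ c₀' f') : Transfer i₀ o₀ ψ (c₀ + c₀') (f + f') := by
  have key : ∀ w, (c₀ + c₀') w ≠ 0 → c₀ w ≠ 0 ∨ c₀' w ≠ 0 := by
    intro w hw
    by_contra! hc
    exact hw (by rw [Pi.add_apply, hc.1, hc.2, add_zero])
  refine ⟨fun w hw => ?_, fun w hw => ?_, fun w hw => ?_, fun w hw => ?_, fun w hw => ?_⟩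
  · exact (key w hw).elim (h.typed w) (h'.typed w)
  · exact (key w hw).elim (h.two_le w) (h'.two_le w)
  · exact (key w hw).elim (h.exists_out w) (h'.exists_out w)
  · rw [Pi.add_apply, Pi.add_apply, h.map w hw, h'.map w hw]
  · by_cases h0 : f w = 0
    · exact h'.surj w fun h1 => hw (by rw [Pi.add_apply, h0, h1, add_zero])
    · exact h.surj w h0

lemma Transfer.ne_zero {c₀ : List (Letter Λ₀) → DualNumber k}
    {f : List (Letter Λ) → DualNumber k} (h : Transfer i₀ o₀ ψ c₀ f) {w : List (Letter Λ)}
    (hw : f w ≠ 0) : ∃ w₀, c₀ w₀ ≠ 0 ∧ w₀.map ψ = w := by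
  obtain ⟨w₀, h1, rfl⟩ := h.surj w hw
  exact ⟨w₀, by rwa [← h.map w₀ h1], rfl⟩

lemma Multi.rep_ne_zero {γ : Grading Λ O} {F : Multi A B} {j : ℕ} {w : List (Letter Λ)}
    (h : F.drep γ j i o w ≠ 0) : F.rep γ i o w ≠ 0 :=
  fun h0 => h (by rw [Multi.drep, h0, zero_smul])

variable {γ₀ : Grading Λ₀ O}

lemma IsOp.transfer {d : ℤ} {j : ℕ} {F : Multi A B} (hF : IsOp d j F)
    (hi₀ : Function.Injective i₀) (ho₀ : Function.Injective o₀) (hii : Function.Injective i)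
    (hoo : Function.Injective o) (hψ : ∀ x, (ψ x).1 = x.1) (hp : ∀ x, γ.p (ψ x) = γ₀.p x)
    (hi : ∀ a, ψ (false, i₀ a) = (false, i a)) (ho : ∀ b, ψ (true, o₀ b) = (true, o b)) :
    Transfer i₀ o₀ ψ (F.drep γ₀ j i₀ o₀) (F.drep γ j i o) := by
  refine ⟨fun w hw => Multi.typed_of_rep (Multi.rep_ne_zero hw), fun w hw =>
    hF.uncurved.two_le hi₀ ho₀ (Multi.rep_ne_zero hw), fun w hw =>
    Multi.exists_out_of_rep (Multi.rep_ne_zero hw), fun w hw => ?_, fun w hw => ?_⟩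
  · rw [Multi.drep, Multi.drep, Multi.rep, Multi.rep]
    rw [ccw_map hψ hp (F.coeff_map_letter hi₀ ho₀ hii hoo hi ho (Multi.typed_norm.2 hw))]
  · obtain ⟨W₀, h0, rfl⟩ := Multi.typed_iff.1 (Multi.typed_of_rep (Multi.rep_ne_zero hw))
    exact ⟨_, Multi.typed_iff.2 ⟨W₀, h0, rfl⟩, Multi.map_letter hi ho h0⟩
end Transfer

/-! ### Values on discs -/

section Values
variable {A B : GrQuiver.{u, v, w} k O} {deg : Λ → ℤ} {i : Lab A → Λ} {o : Lab B → Λ}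
  {γ : Grading Λ O} {X : List (Letter Λ) → DualNumber k}

/-- Given the inputs, a system of coefficients is nonzero for finitely many outputs. -/
lemma Sys.finite_filled (hX : Sys γ X) (hi : Function.Injective i) (ho : Function.Injective o)
    (hil : ∀ a, γ.l (i a) = a.l) (hir : ∀ a, γ.r (i a) = a.r)
    (hol : ∀ b, γ.l (o b) = b.l) (hor : ∀ b, γ.r (o b) = b.r) (f : Filled A B) :
    {b | X ((⟨f.τ, f.a, b⟩ : Filled A B).word i o) ≠ 0}.Finite := by
  have h := hX.fin (∑ s, (f.τ.m s + 1))
    (Set.range fun p : f.τ.In => i ⟨_, _, f.a p⟩)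
    (Set.range fun p : (Σ s, Fin (f.τ.m s + 1)) => f.τ.x p.1 p.2) (Set.finite_range _)
    (Set.finite_range _)
  have hinj : Function.Injective fun b => (⟨f.τ, f.a, b⟩ : Filled A B).word i o := by
    intro b b' hb
    have := Filled.word_injective hi ho hb
    simpa using this
  refine (h.preimage hinj.injOn).subset ?_
  intro b hb
  have key : ∀ x ∈ (⟨f.τ, f.a, b⟩ : Filled A B).word i o,
      (x.1 = false ∧ ∃ p : f.τ.In, i ⟨_, _, f.a p⟩ = x.2) ∨
        (x.1 = true ∧ ∃ s, o ⟨_, _, b s⟩ = x.2) := by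
    intro x hx
    simp only [Filled.word, List.mem_flatMap, List.mem_append, List.mem_reverse, List.mem_ofFn,
      List.mem_singleton] at hx
    obtain ⟨s, -, ⟨j, rfl⟩ | rfl⟩ := hx
    · exact Or.inl ⟨rfl, ⟨s, j⟩, rfl⟩
    · exact Or.inr ⟨rfl, s, rfl⟩
  refine ⟨(Filled.length_word _).le, fun x hx h1 => ?_, fun x hx => ?_, hb⟩
  · rcases key x hx with ⟨-, h2⟩ | ⟨h2, -⟩
    · exact h2
    · simp [h1] at h2
  · rcases key x hx with ⟨-, ⟨s, j⟩, h2⟩ | ⟨-, s, h2⟩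
    · rw [← h2, hil, hir]
      exact ⟨⟨⟨s, j.castSucc⟩, rfl⟩, ⟨⟨s, j.succ⟩, rfl⟩⟩
    · rw [← h2, hol, hor]
      exact ⟨⟨⟨s, 0⟩, rfl⟩, ⟨⟨s + 1, Fin.last _⟩, rfl⟩⟩

variable {F : Multi A B} {j : ℕ}

/-- A system of coefficients which agrees with those of `F` on the words of discs. -/
lemma drep_eq_of_filled (hX : Sys γ X) (hXt : ∀ w, X w ≠ 0 → Multi.Typed i o w ∧
      ∃ x ∈ w, x.1 = true)
    (hil : ∀ a, γ.l (i a) = a.l) (hir : ∀ a, γ.r (i a) = a.r)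
    (hol : ∀ b, γ.l (o b) = b.l) (hor : ∀ b, γ.r (o b) = b.r)
    (h : ∀ U b, (∃ f : Filled A B, f.word i o = U ++ [(true, b)]) →
      F.drep γ j i o (U ++ [(true, b)]) = X (U ++ [(true, b)])) : F.drep γ j i o = X := by
  funext w
  obtain ⟨U, V, rfl, hU, hV⟩ := exists_split w
  rcases hU with rfl | ⟨U, b, rfl⟩
  · have h1 : F.drep γ j i o V = 0 := by
      by_contra hc
      obtain ⟨x, hx, h2⟩ := Multi.exists_out_of_rep (Multi.rep_ne_zero hc)
      simp [hV x hx] at h2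
    have h2 : X V = 0 := by
      by_contra hc
      obtain ⟨x, hx, h2⟩ := (hXt _ hc).2
      simp [hV x hx] at h2
    simp [h1, h2]
  · have e1 : X (U ++ [(true, b)] ++ V) =
        sg k (γ.pw (U ++ [(true, b)]) * γ.pw V) • X (V ++ (U ++ [(true, b)])) :=
      Tr.cyc_append hX.cyc _ _
    have e2 : F.drep γ j i o (U ++ [(true, b)] ++ V) =
        sg k (γ.pw (U ++ [(true, b)]) * γ.pw V) • F.drep γ j i o (V ++ (U ++ [(true, b)])) := by
      rw [Multi.drep, Multi.drep, Multi.rep, Multi.rep, ccw_append (Or.inr ⟨U, b, rfl⟩) hV,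
        ← List.append_assoc, ccw_concat, smul_smul, sg_add, mul_comm (γ.pw V), mul_assoc]
    rw [e1, e2, ← List.append_assoc]
    congr 1
    by_cases hf : ∃ f : Filled A B, f.word i o = V ++ U ++ [(true, b)]
    · exact h _ _ hf
    · have h1 : F.drep γ j i o (V ++ U ++ [(true, b)]) = 0 := by
        by_contra hc
        have h2 := Multi.coeff_norm_ne_zero (Multi.rep_ne_zero hc)
        rw [norm_concat] at h2
        exact hf (Multi.exists_of_coeff_ne_zero h2)
      have h2 : X (V ++ U ++ [(true, b)]) = 0 := by
        by_contra hc
        exact hf (exists_filled hil hir hol hor (hX.coh _ hc) ⟨_, _, rfl⟩ (hXt _ hc).1)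
      rw [h1, h2]
end Values
end
section
variable {k : Type w} [Field k] {Λ : Type t} {O : Type u}

/-! ### Sums over diagrams -/

lemma finsum_mem_smul_right {α : Type*} (s : Set α) (f : α → k) (x : DualNumber k) :
    (∑ᶠ a ∈ s, f a) • x = ∑ᶠ a ∈ s, f a • x := by
  rw [finsum_smul]
  exact finsum_congr fun a => finsum_smul _ _

lemma finsum_mem_mul_left {α : Type*} (s : Set α) (f : α → k) (x : k) :
    x * (∑ᶠ a ∈ s, f a) = ∑ᶠ a ∈ s, x * f a := by
  simp only [← smul_eq_mul]
  rw [smul_finsum]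
  exact finsum_congr fun a => smul_finsum _ _

/-- The sign exponent between the value of an operation and its coefficient at the clockwise
word starting with the last output. -/
def rsg (γ : Grading Λ O) (B : List (Letter Λ)) (b : Λ) : ZMod 2 :=
  γ.p (true, b) * γ.pw B + tw γ 0 (B ++ [(true, b)])

lemma Diagram.word_eq_iff {K : Type} (D : Diagram K Λ) (B : List (Letter Λ)) (b : Λ) :
    D.word = B ++ [(true, b)] ↔ D.legs.bd = B ∧ D.root = b := by
  rw [Diagram.word_eq]
  constructor
  · intro h
    have h1 := List.append_inj' h rfl
    simpa using h1
  · rintro ⟨h1, h2⟩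
    rw [h1, h2]

/-- Summation of `Diagram.weight_eq`. All diagrams considered contain the same number `n ≤ 1` of odd
discs, so a common power of `ε` can be factored out. -/
lemma finsum_weight {K : Type} {γ : Grading Λ O} {d : ℤ} {deg : Λ → ℤ} (h : γ.Of d deg)
    {odd : K → ℕ} {c : K → List (Letter Λ) → k}
    (hcyc : ∀ κ x w, ccw γ (c κ) (x :: w) = sg k (γ.p x * γ.pw w) * ccw γ (c κ) (w ++ [x]))
    (hpar : ∀ κ w, c κ w ≠ 0 → γ.pw w + γ.D = odd κ) {S : Diagram K Λ → Prop} {n : ℕ}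
    (hn : n ≤ 1) (hS : ∀ D, S D → (D.ops.map odd).sum = n) (B : List (Letter Λ)) (b : Λ) :
    ∑ᶠ p ∈ {p : K × Legs K Λ | p.2.bd = B ∧ S ⟨p.1, b, p.2⟩},
      (ccw γ (c p.1) ((true, b) :: p.2.arr) • (DualNumber.eps : DualNumber k) ^ odd p.1) *
        p.2.om γ (fun κ W => ccw γ (c κ) W • DualNumber.eps ^ odd κ) =
      (sg k (rsg γ B b) * ∑ᶠ D ∈ {D : Diagram K Λ | S D ∧ D.word = B ++ [(true, b)]},
        D.weight d deg c) • DualNumber.eps ^ n := by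
  rw [finsum_mem_mul_left, finsum_mem_smul_right]
  refine finsum_mem_eq_of_bijOn (fun p => ⟨p.1, b, p.2⟩) ⟨?_, ?_, ?_⟩ ?_
  · rintro p ⟨h1, h2⟩
    exact ⟨h2, (Diagram.word_eq_iff _ _ _).2 ⟨h1, rfl⟩⟩
  · rintro ⟨κ, L⟩ - ⟨κ', L'⟩ - he
    simpa using he
  · rintro ⟨κ, r, L⟩ ⟨h1, h2⟩
    obtain ⟨h3, rfl⟩ := (Diagram.word_eq_iff _ _ _).1 h2
    exact ⟨(κ, L), ⟨h3, h1⟩, rfl⟩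
  · rintro p ⟨rfl, h2⟩
    have h3 := hS _ h2
    have h4 := Diagram.weight_eq h hcyc hpar ⟨p.1, b, p.2⟩ (h3.trans_le hn)
    rw [h3] at h4
    exact h4.symm

section Values
variable {A B : GrQuiver.{u, v, w} k O} {Λ₀ : Type t} {i₀ : Lab A → Λ₀} {o₀ : Lab B → Λ₀}
  {i : Lab A → Λ} {o : Lab B → Λ} {ψ : Letter Λ₀ → Letter Λ} {γ : Grading Λ O}
  {X : List (Letter Λ) → DualNumber k}

/-- The finiteness of columns needed for `Multi.ofCoeff` is inherited from a system `X` that is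
nonzero wherever the prescribed coefficients are. -/
lemma val_ofCoeff_of_sys (hX : Sys γ X) (hii : Function.Injective i) (hoo : Function.Injective o)
    (hil : ∀ a, γ.l (i a) = a.l) (hir : ∀ a, γ.r (i a) = a.r)
    (hol : ∀ b, γ.l (o b) = b.l) (hor : ∀ b, γ.r (o b) = b.r)
    (hi : ∀ a, ψ (false, i₀ a) = (false, i a)) (ho : ∀ b, ψ (true, o₀ b) = (true, o b))
    {σ : List (Letter Λ₀) → k} (hσ : ∀ U b, (∃ f : Filled A B, f.word i₀ o₀ = U ++ [(true, b)]) →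
      σ (U ++ [(true, b)]) ≠ 0 → X (ψ (true, b) :: U.map ψ) ≠ 0) (f : Filled A B) :
    (Multi.ofCoeff i₀ o₀ σ : Multi A B).val f = σ (f.word i₀ o₀) := by
  refine Multi.val_ofCoeff f ((hX.finite_filled hii hoo hil hir hol hor f).subset fun b hb => ?_)
  obtain ⟨U, c, hU⟩ := Filled.endsOut_word (i := i₀) (o := o₀) (⟨f.τ, f.a, b⟩ : Filled A B)
  have h1 : σ (U ++ [(true, c)]) ≠ 0 := by rw [← hU]; exact hb
  have h2 := hσ U c ⟨_, hU⟩ h1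
  rw [hX.cyc] at h2
  have h3 := right_ne_zero_of_smul h2
  have h4 : U.map ψ ++ [ψ (true, c)] = (⟨f.τ, f.a, b⟩ : Filled A B).word i o := by
    rw [← Filled.word_map_letter hi ho, hU]
    simp
  rw [h4] at h3
  exact h3

lemma Filled.two_le_of_ne {f : Filled A B} (hX : Sys γ X) (h : X (f.word i o) ≠ 0) :
    2 ≤ ∑ s, (f.τ.m s + 1) := by
  have := hX.two_le _ h
  rwa [f.length_word] at this

/-- The family of maps whose coefficients form a system of coefficients of degree zero. -/
lemma isOp_of_sys {F : Multi A B} {d : ℤ} {deg : Λ → ℤ} {l r : Λ → O} (hi : IsEmb deg l r i)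
    (ho : IsEmb deg l r o) (hX : Sys (Grading.ofDeg d deg l r) X)
    (hdeg : ∀ w, X w ≠ 0 → outDeg d deg w = inDeg d deg w + (d + 1))
    (h : F.drep (Grading.ofDeg d deg l r) 0 i o = X) : IsOp d 0 F := by
  have hγ := Grading.ofDeg_of d deg l r
  have hrep : ∀ w, X w = F.rep (Grading.ofDeg d deg l r) i o w • 1 := by
    intro w; rw [← h, Multi.drep, pow_zero]
  have hne : ∀ w, F.coeff i o w ≠ 0 → X w ≠ 0 := by
    intro w hw h0
    obtain ⟨U, b, rfl⟩ := Multi.endsOut_of_coeff hw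
    rw [hrep, Multi.rep, ccw_concat] at h0
    have := congrArg TrivSqZeroExt.fst h0
    simp [hw, sg_ne_zero] at this
  refine ⟨?_, ?_, ?_⟩
  · rw [Multi.homogeneous_iff hi.deg ho.deg hi.inj ho.inj]
    intro W hW
    rw [hdeg W (hne W hW)]
    simp
  · rw [Multi.cyclic_iff hi.deg ho.deg hi.inj ho.inj]
    intro U W hU hW
    rw [cyc_of_ccw (γ := Grading.ofDeg d deg l r) (c := F.coeff i o) ?_ hU hW, negOnePow_eq_sg]
    · push_cast
      rw [hγ.inDeg, hγ.inDeg, hγ.outDeg, hγ.outDeg]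
    · intro x w
      have h1 := congrArg TrivSqZeroExt.fst (hX.cyc x w)
      rw [hrep, hrep] at h1
      simpa [Multi.rep] using h1
  · intro τ hn hm
    refine (srcBasis A τ).ext fun a => (tgtBasis B τ).repr.injective (Finsupp.ext fun b => ?_)
    rw [LinearMap.zero_apply, map_zero, Finsupp.zero_apply]
    by_contra hc
    have h1 : F.coeff i o ((⟨τ, a, b⟩ : Filled A B).word i o) ≠ 0 := by
      rw [Multi.coeff_word F hi.inj ho.inj]
      exact hc
    have h2 := Filled.two_le_of_ne hX (hne _ h1)
    have h3 : ∑ s : Fin (τ.n + 1), (τ.m s + 1) = 1 := by simp [hm, hn]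
    simp only at h2
    omega
end Values

/-! ### Degrees of sums over trees -/

section Deg
variable {d : ℤ} {deg : Λ → ℤ}

/-- The degree of a letter in an operation. -/
def ldeg (d : ℤ) (deg : Λ → ℤ) (x : Letter Λ) : ℤ := if x.1 then deg x.2 + d else 1 - deg x.2

lemma ldeg_sum (w : List (Letter Λ)) :
    (w.map (ldeg d deg)).sum = outDeg d deg w - inDeg d deg w := by
  induction w with
  | nil => simp [outDeg, inDeg]
  | cons x w ih =>
    rcases x with ⟨_ | _, a⟩
    · simp only [outDeg, inDeg] at ih ⊢
      simp [ih, ldeg, arrowDeg]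
      ring
    · simp only [outDeg, inDeg] at ih ⊢
      simp [ih, ldeg, arrowDeg]
      ring

lemma ldeg_bar (x : Letter Λ) : ldeg d deg (bar x) = d + 1 - ldeg d deg x := by
  rcases x with ⟨_ | _, a⟩ <;> simp [ldeg, bar] <;> ring

variable {γ : Grading Λ O} {c : List (Letter Λ) → DualNumber k} {E : Λ → Prop}

/-- The integral counterpart of `par_om`: the two halves of an edge have total degree `d + 1`, which
is also the degree of the disc beyond it. -/
lemma Tr.ldeg_bd (hc : ∀ w, c w ≠ 0 → (w.map (ldeg d deg)).sum = d + 1) (L : Tr Λ)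
    (h0 : L.om γ c ≠ 0) : (L.bd.map (ldeg d deg)).sum = (L.arr.map (ldeg d deg)).sum := by
  induction L with
  | nil => rfl
  | ext x r ih => simp [bd, arr, ih h0]
  | edge x s r ihs ih =>
    obtain ⟨h1, h2, h3⟩ := Tr.om_edge_ne_zero h0
    have h4 := hc _ h1
    rw [List.map_cons, List.sum_cons, ldeg_bar] at h4
    simp only [bd, arr, List.map_append, List.sum_append, List.map_cons, List.sum_cons, ihs h2,
      ih h3]
    linarith

lemma TS_deg (hc : ∀ w, c w ≠ 0 → outDeg d deg w = inDeg d deg w + (d + 1))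
    {w : List (Letter Λ)} (h : TS γ c E w ≠ 0) :
    outDeg d deg w = inDeg d deg w + (d + 1) := by
  have hc' : ∀ w, c w ≠ 0 → (w.map (ldeg d deg)).sum = d + 1 := by
    intro w hw
    rw [ldeg_sum, hc w hw]
    ring
  obtain ⟨x, L, rfl, -, h1, h2⟩ := TS_ne_zero h
  have h3 := hc' _ h1
  have h4 := ldeg_sum (d := d) (deg := deg) (x :: L.bd)
  rw [List.map_cons, List.sum_cons, Tr.ldeg_bd hc' L h2, ← List.sum_cons, ← List.map_cons, h3] at h4
  linarith
end Deg
end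
section
variable {k : Type w} [Field k] {Λ : Type t} {O : Type u}

/-! ### Bridges -/

section
variable {A B : GrQuiver.{u, v, w} k O} {Λ₀ : Type t} {i : Lab A → Λ₀} {o : Lab B → Λ₀}

lemma typed_letter_inj {ι : Λ₀ → Λ} (hi : Function.Injective fun a => ι (i a))
    (ho : Function.Injective fun b => ι (o b)) {w w' : List (Letter Λ₀)}
    (hw : Multi.Typed i o w) (hw' : Multi.Typed i o w') {x x' : Letter Λ₀} (hx : x ∈ w)
    (hx' : x' ∈ w') (h1 : x.1 = x'.1) (h2 : ι x.2 = ι x'.2) : x = x' := by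
  rcases x with ⟨s, x⟩
  rcases x' with ⟨s', x'⟩
  obtain rfl : s = s' := h1
  rcases hw _ hx with ⟨h3, a, rfl⟩ | ⟨h3, a, rfl⟩ <;>
    rcases hw' _ hx' with ⟨h4, a', rfl⟩ | ⟨h4, a', rfl⟩
  · rw [hi h2]
  · simp_all
  · simp_all
  · rw [ho h2]
end

variable {A B C : GrQuiver.{u, v, w} k O} {d : ℤ} {U : Labels.{u, max u v} O}
  {eA : Lab A → U.L} {eB : Lab B → U.L} {eC : Lab C → U.L}

/-- The levels of the arrows in a composition. -/
def compLev (n m l : ℕ) (κ s : Bool) : ℕ := if κ then if s then l else m else if s then m else n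

/-- The levels of outer arrows. -/
def exLev (n l : ℕ) (s : Bool) : ℕ := if s then l else n

/-- Labels of three different quivers already force every edge to be of the middle level, so no
identities are inserted. -/
lemma bridge_comp (hA : U.Emb eA) (hB : U.Emb eB) (hC : U.Emb eC) {n m l : ℕ} (h1 : n < m)
    (h2 : m < l) {c : Bool → List (Letter (Lab A ⊕ Lab B ⊕ Lab C)) → DualNumber k}
    {f g : List (Letter (ℕ × U.L)) → DualNumber k}
    (hf : Transfer Sum.inl (fun y => Sum.inr (Sum.inl y))
      (lift (compLev n m l) (Sum.elim eA (Sum.elim eB eC)) false) (c false) f)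
    (hg : Transfer (fun y => Sum.inr (Sum.inl y)) (fun z => Sum.inr (Sum.inr z))
      (lift (compLev n m l) (Sum.elim eA (Sum.elim eB eC)) true) (c true) g)
    (hfg : ∀ w, f w ≠ 0 → g w = 0) :
    Bridge (((Labels.of A).sum ((Labels.of B).sum (Labels.of C))).γ d) (U.lev.γ d) c (f + g)
      (compLev n m l) (exLev n l) m (Sum.elim eA (Sum.elim eB eC)) (fun _ _ => false) true
      (fun x => (x.1 = false ∧ ∃ a, Sum.inl a = x.2) ∨
        (x.1 = true ∧ ∃ b, Sum.inr (Sum.inr b) = x.2)) where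
  q n a := by
    rcases a with a | a | a <;> simp [Grading.ofDeg, hA.deg, hB.deg, hC.deg]
  D := rfl
  two_le κ := by cases κ; exacts [hf.two_le, hg.two_le]
  exists_out κ := by cases κ; exacts [hf.exists_out, hg.exists_out]
  disc κ w hw := by
    cases κ
    · have h3 := hf.map w (hf.typed w hw)
      have h4 := hfg (w.map (lift (compLev n m l) (Sum.elim eA (Sum.elim eB eC)) false))
        (by rwa [h3])
      rw [Pi.add_apply, h3, h4, add_zero]
    · have h3 := hg.map w (hg.typed w hw)
      have h4 : f (w.map (lift (compLev n m l) (Sum.elim eA (Sum.elim eB eC)) true)) = 0 := by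
        by_contra h5
        rw [hfg _ h5] at h3
        exact hw h3.symm
      rw [Pi.add_apply, h3, h4, zero_add]
  ident κ w x _ _ h := by simp at h
  ident_root κ w a _ _ h := by simp at h
  cases w hw := by
    left
    by_cases h0 : f w = 0
    · rw [Pi.add_apply, h0, zero_add] at hw
      exact ⟨true, hg.ne_zero hw⟩
    · exact ⟨false, hf.ne_zero h0⟩
  adj κ op w w' x j h0 hx hx' := by
    have m1 := left_ne_zero_of_mul h0
    have m2 : c op w' ≠ 0 := fun h3 => h0 (by simp [h3])
    rcases x with ⟨s, x⟩
    cases κ <;> cases op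
    · rcases hf.typed _ m1 _ hx with ⟨h3, a, h4⟩ | ⟨h3, a, h4⟩ <;>
        rcases hf.typed _ m2 _ hx' with ⟨h5, b, h6⟩ | ⟨h5, b, h6⟩ <;> simp_all [bar]
      all_goals (subst h4; simp at h6)
    · rcases hf.typed _ m1 _ hx with ⟨h3, a, h4⟩ | ⟨h3, a, h4⟩ <;>
        rcases hg.typed _ m2 _ hx' with ⟨h5, b, h6⟩ | ⟨h5, b, h6⟩ <;>
        simp_all [bar, compLev]
      all_goals (subst h4; simp at h6)
    · rcases hg.typed _ m1 _ hx with ⟨h3, a, h4⟩ | ⟨h3, a, h4⟩ <;>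
        rcases hf.typed _ m2 _ hx' with ⟨h5, b, h6⟩ | ⟨h5, b, h6⟩ <;>
        simp_all [bar, compLev]
      all_goals (subst h4; simp at h6)
    · rcases hg.typed _ m1 _ hx with ⟨h3, a, h4⟩ | ⟨h3, a, h4⟩ <;>
        rcases hg.typed _ m2 _ hx' with ⟨h5, b, h6⟩ | ⟨h5, b, h6⟩ <;> simp_all [bar]
      all_goals (subst h4; simp at h6)
  label_disc κ w w' x x' m1 m2 hx hx' h3 h4 := by
    cases κ
    · exact typed_letter_inj (i := Sum.inl) (o := fun y => Sum.inr (Sum.inl y)) hA.inj hB.inj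
        (hf.typed _ m1) (hf.typed _ m2) hx hx' h3 h4
    · exact typed_letter_inj (i := fun y => Sum.inr (Sum.inl y))
        (o := fun y => Sum.inr (Sum.inr y)) hB.inj hC.inj
        (hg.typed _ m1) (hg.typed _ m2) hx hx' h3 h4
  label_outer κ w x b hb m1 hx h3 h4 h5 := by
    rcases x with ⟨s, x⟩
    rcases b with ⟨s', b⟩
    obtain rfl : s = s' := h3
    simp only [Bool.false_eq_true, or_false] at h5
    cases κ
    · rcases hf.typed _ m1 _ hx with ⟨h6, a, rfl⟩ | ⟨h6, a, rfl⟩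
      · rcases hb with ⟨-, a', rfl⟩ | ⟨h7, -⟩
        · rw [hA.inj h4]
        · simp_all
      · simp only at h6
        simp [compLev, h6] at h5
    · rcases hg.typed _ m1 _ hx with ⟨h6, a, rfl⟩ | ⟨h6, a, rfl⟩
      · simp only at h6
        simp [compLev, h6] at h5
      · rcases hb with ⟨h7, -⟩ | ⟨-, a', rfl⟩
        · simp_all
        · rw [hC.inj h4]
  outer_or κ w x hb m1 hx := by
    right
    rcases x with ⟨s, x⟩
    cases κ
    · rcases hf.typed _ m1 _ hx with ⟨h6, a, rfl⟩ | ⟨h6, a, rfl⟩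
      · simp only at h6
        simp [compLev, h6, h1.ne]
      · simp_all
    · rcases hg.typed _ m1 _ hx with ⟨h6, a, rfl⟩ | ⟨h6, a, rfl⟩
      · simp_all
      · simp only at h6
        simp [compLev, h6, h2.ne']
  label_edge κ op w w' x x' m1 m2 hx hx' h3 h4 h5 h6 := by
    rcases x with ⟨s, x⟩
    rcases x' with ⟨s', x'⟩
    simp only at h3
    subst h3
    cases κ <;> cases op <;> cases s <;>
      simp [compLev, h1.ne, h2.ne'] at h5 h6
    · rcases hf.typed _ m1 _ hx with ⟨h7, -⟩ | ⟨-, a, rfl⟩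
      · simp at h7
      rcases hg.typed _ m2 _ hx' with ⟨-, a', rfl⟩ | ⟨h7, -⟩
      · rw [hB.inj h4]; rfl
      · simp at h7
    · rcases hg.typed _ m1 _ hx with ⟨-, a, rfl⟩ | ⟨h7, -⟩
      · rcases hf.typed _ m2 _ hx' with ⟨h7, -⟩ | ⟨-, a', rfl⟩
        · simp at h7
        · rw [hB.inj h4]; rfl
      · simp at h7
  fst_eq κ op w o h := by simp at h
  lv_of_J κ o h := by simp at h
  lv_eq κ o h := by
    cases κ <;> cases o <;> simp_all [compLev, exLev]
  ex_ne o := by cases o <;> simp [exLev, h1.ne, h2.ne']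
  lv_inj κ κ' h := by
    cases κ <;> cases κ' <;> simp [compLev, h2.ne, h2.ne'] at h ⊢
end
section
variable {k : Type w} [Field k] {Λ : Type t} {O : Type u}

variable {A B : GrQuiver.{u, v, w} k O} {d : ℤ} {U : Labels.{u, max u v} O}
  {eA : Lab A → U.L} {eB : Lab B → U.L}

/-- The coefficients of the identity, the inputs having level `n` and the outputs level `m`. -/
structure IsIdent (γ : Grading (ℕ × Λ) O) (n m : ℕ) (e : Lab A → Λ)
    (f : List (Letter (ℕ × Λ)) → DualNumber k) : Prop where
  cases : ∀ w, f w ≠ 0 → ∃ a, w = [(true, (m, e a)), (false, (n, e a))] ∨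
    w = [(false, (n, e a)), (true, (m, e a))]
  out_in : ∀ a, f [(true, (m, e a)), (false, (n, e a))] = 1
  in_out : ∀ a, f [(false, (n, e a)), (true, (m, e a))] = sg k (γ.η (true, (m, e a))) • 1

/-- Setting for `Id + ε M` followed by `F`: the structure discs and the identities lead from level
`n` to `m`, and `F` from `m` to `l`. The identities sit on those inputs of `F` which are outer
arrows of the diagram. -/
lemma bridge_left (hA : U.Emb eA) (hB : U.Emb eB) {n m l : ℕ} (h1 : n < m)
    (h2 : m < l) {c : Bool → List (Letter (Lab A ⊕ Lab B)) → DualNumber k}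
    {f g u : List (Letter (ℕ × U.L)) → DualNumber k}
    (hf : Transfer Sum.inl Sum.inr
      (lift (fun κ => compLev n m l (!κ)) (Sum.elim eA eB) false) (c false) f)
    (hg : Transfer Sum.inl Sum.inl
      (lift (fun κ => compLev n m l (!κ)) (Sum.elim eA eB) true) (c true) g)
    (hu : IsIdent (U.lev.γ d) n m eA u)
    (hfg : ∀ w, f w ≠ 0 → g w = 0) (huf : ∀ w, u w ≠ 0 → f w = 0) (hug : ∀ w, u w ≠ 0 → g w = 0)
    (hε : ∀ w, (c true w).fst = 0) :
    Bridge (((Labels.of A).sum (Labels.of B)).γ d) (U.lev.γ d) c (u + g + f)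
      (fun κ => compLev n m l (!κ)) (exLev n l) m (Sum.elim eA eB) (fun κ s => !κ && !s) false
      (fun x => (x.1 = false ∧ ∃ a, Sum.inl a = x.2) ∨ (x.1 = true ∧ ∃ b, Sum.inr b = x.2)) where
  q n a := by
    rcases a with a | a <;> simp [Grading.ofDeg, hA.deg, hB.deg]
  D := rfl
  two_le κ := by cases κ; exacts [hf.two_le, hg.two_le]
  exists_out κ := by cases κ; exacts [hf.exists_out, hg.exists_out]
  disc κ w hw := by
    cases κ
    · have h3 := hf.map w (hf.typed w hw)
      have h4 := hfg _ (h3.trans_ne hw)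
      have h5 := not_imp_not.2 (huf _) (h3.trans_ne hw)
      rw [not_not] at h5
      rw [Pi.add_apply, Pi.add_apply, h3, h4, h5, zero_add, zero_add]
    · have h3 := hg.map w (hg.typed w hw)
      have h4 := not_imp_not.2 (hfg _) (h3.trans_ne hw)
      have h5 := not_imp_not.2 (hug _) (h3.trans_ne hw)
      rw [not_not] at h4 h5
      rw [Pi.add_apply, Pi.add_apply, h3, h4, h5, zero_add, add_zero]
  ident κ w x hw hx h := by
    rcases x with ⟨s, x⟩
    cases κ <;> cases s <;> simp at h
    rcases hf.typed _ hw _ hx with ⟨-, a, rfl⟩ | ⟨h3, -⟩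
    · have h3 : u [(true, (m, eA a)), (false, (n, eA a))] ≠ 0 := by rw [hu.out_in]; simp
      have h4 : (u + g + f) [(true, (m, eA a)), (false, (n, eA a))] = 1 := by
        rw [Pi.add_apply, Pi.add_apply, hug _ h3, huf _ h3, hu.out_in, add_zero, add_zero]
      refine Eq.trans ?_ (h4.trans ?_)
      · simp [bar, lift, outer, compLev, exLev]
      · simp [Grading.η, lift]
    · simp at h3
  ident_root κ w a _ _ h := by simp at h
  cases w hw := by
    by_cases h0 : f w = 0
    · by_cases h3 : g w = 0
      · right
        rw [Pi.add_apply, Pi.add_apply, h0, h3, add_zero, add_zero] at hw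
        obtain ⟨a, rfl | rfl⟩ := hu.cases w hw
        · refine ⟨_, _, rfl, rfl, rfl, ?_, ?_⟩
          · simp [exLev]
          · intro κ; cases κ <;> simp [compLev, h1.ne]
        · refine ⟨_, _, rfl, rfl, rfl, ?_, ?_⟩
          · simp [exLev]
          · intro κ; cases κ <;> simp [compLev, h1.ne]
      · exact Or.inl ⟨true, hg.ne_zero h3⟩
    · exact Or.inl ⟨false, hf.ne_zero h0⟩
  adj κ op w w' x j h0 hx hx' := by
    have m1 := left_ne_zero_of_mul h0
    have m2 : c op w' ≠ 0 := fun h3 => h0 (by simp [h3])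
    rcases x with ⟨s, x⟩
    cases κ <;> cases op
    · rcases hf.typed _ m1 _ hx with ⟨h3, a, h4⟩ | ⟨h3, a, h4⟩ <;>
        rcases hf.typed _ m2 _ hx' with ⟨h5, b, h6⟩ | ⟨h5, b, h6⟩ <;> simp_all [bar]
      all_goals (subst h4; simp at h6)
    · rcases hf.typed _ m1 _ hx with ⟨h3, a, h4⟩ | ⟨h3, a, h4⟩ <;>
        rcases hg.typed _ m2 _ hx' with ⟨h5, b, h6⟩ | ⟨h5, b, h6⟩ <;>
        simp_all [bar, compLev]
      all_goals (subst h4; simp at h6)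
    · rcases hg.typed _ m1 _ hx with ⟨h3, a, h4⟩ | ⟨h3, a, h4⟩ <;>
        rcases hf.typed _ m2 _ hx' with ⟨h5, b, h6⟩ | ⟨h5, b, h6⟩ <;>
        simp_all [bar, compLev]
      all_goals (subst h4; simp at h6)
    -- Two adjacent structure discs would fit by their labels but not by their levels; such products
    -- are excluded by `ε² = 0`.
    · exact absurd (by ext <;> simp [hε]) h0
  label_disc κ w w' x x' m1 m2 hx hx' h3 h4 := by
    cases κ
    · exact typed_letter_inj (i := Sum.inl) (o := Sum.inr) hA.inj hB.inj
        (hf.typed _ m1) (hf.typed _ m2) hx hx' h3 h4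
    · exact typed_letter_inj (i := Sum.inl) (o := Sum.inl) hA.inj hA.inj
        (hg.typed _ m1) (hg.typed _ m2) hx hx' h3 h4
  label_outer κ w x b hb m1 hx h3 h4 h5 := by
    rcases x with ⟨s, x⟩
    rcases b with ⟨s', b⟩
    obtain rfl : s = s' := h3
    cases κ
    · rcases hf.typed _ m1 _ hx with ⟨h6, a, rfl⟩ | ⟨h6, a, rfl⟩
      · rcases hb with ⟨-, a', rfl⟩ | ⟨h7, -⟩
        · rw [hA.inj h4]
        · simp_all
      · rcases hb with ⟨h7, -⟩ | ⟨-, a', rfl⟩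
        · simp_all
        · rw [hB.inj h4]
    · rcases hg.typed _ m1 _ hx with ⟨h6, a, rfl⟩ | ⟨h6, a, rfl⟩
      · rcases hb with ⟨-, a', rfl⟩ | ⟨h7, -⟩
        · rw [hA.inj h4]
        · simp_all
      · simp only at h6
        simp [compLev, h6] at h5
  outer_or κ w x hb m1 hx := by
    rcases x with ⟨s, x⟩
    cases κ
    · cases s <;> simp [compLev, h2.ne']
    · rcases hg.typed _ m1 _ hx with ⟨h6, a, rfl⟩ | ⟨h6, a, rfl⟩
      · simp only at h6
        simp [compLev, h6, h1.ne]
      · simp_all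
  label_edge κ op w w' x x' m1 m2 hx hx' h3 h4 h5 h6 := by
    rcases x with ⟨s, x⟩
    rcases x' with ⟨s', x'⟩
    simp only at h3
    subst h3
    cases κ <;> cases op <;> cases s <;>
      simp [compLev, h1.ne, h2.ne'] at h5 h6
    · rcases hf.typed _ m1 _ hx with ⟨-, a, rfl⟩ | ⟨h7, -⟩
      · rcases hg.typed _ m2 _ hx' with ⟨h7, -⟩ | ⟨-, a', rfl⟩
        · simp at h7
        · rw [hA.inj h4]; rfl
      · simp at h7
    · rcases hg.typed _ m1 _ hx with ⟨h7, -⟩ | ⟨-, a, rfl⟩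
      · simp at h7
      rcases hf.typed _ m2 _ hx' with ⟨-, a', rfl⟩ | ⟨h7, -⟩
      · rw [hA.inj h4]; rfl
      · simp at h7
  fst_eq κ op w o h h3 := by
    cases κ <;> cases o <;> simp at h
    cases op
    · simp [compLev, h2.ne'] at h3
    · exact hε w
  lv_of_J κ o h := by cases κ <;> cases o <;> simp [compLev] at h ⊢
  lv_eq κ o h := by
    cases κ <;> cases o <;> simp_all [compLev, exLev]
  ex_ne o := by cases o <;> simp [exLev, h1.ne, h2.ne']
  lv_inj κ κ' h := by
    cases κ <;> cases κ' <;> simp [compLev, h2.ne, h2.ne'] at h ⊢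

/-- Mirror image of `bridge_left`: `F` comes first, and the identities sit on its outer outputs. One
of these may be the bold arrow, whence the condition `ident_root`. -/
lemma bridge_right (hA : U.Emb eA) (hB : U.Emb eB) {n m l : ℕ} (h1 : n < m)
    (h2 : m < l) {c : Bool → List (Letter (Lab A ⊕ Lab B)) → DualNumber k}
    {f g u : List (Letter (ℕ × U.L)) → DualNumber k}
    (hf : Transfer Sum.inl Sum.inr (lift (compLev n m l) (Sum.elim eA eB) false) (c false) f)
    (hg : Transfer Sum.inr Sum.inr (lift (compLev n m l) (Sum.elim eA eB) true) (c true) g)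
    (hu : IsIdent (U.lev.γ d) m l eB u)
    (hfg : ∀ w, f w ≠ 0 → g w = 0) (huf : ∀ w, u w ≠ 0 → f w = 0) (hug : ∀ w, u w ≠ 0 → g w = 0)
    (hε : ∀ w, (c true w).fst = 0) :
    Bridge (((Labels.of A).sum (Labels.of B)).γ d) (U.lev.γ d) c (f + (u + g))
      (compLev n m l) (exLev n l) m (Sum.elim eA eB) (fun κ s => !κ && s) true
      (fun x => (x.1 = false ∧ ∃ a, Sum.inl a = x.2) ∨ (x.1 = true ∧ ∃ b, Sum.inr b = x.2)) where
  q n a := by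
    rcases a with a | a <;> simp [Grading.ofDeg, hA.deg, hB.deg]
  D := rfl
  two_le κ := by cases κ; exacts [hf.two_le, hg.two_le]
  exists_out κ := by cases κ; exacts [hf.exists_out, hg.exists_out]
  disc κ w hw := by
    cases κ
    · have h3 := hf.map w (hf.typed w hw)
      have h4 := hfg _ (h3.trans_ne hw)
      have h5 := not_imp_not.2 (huf _) (h3.trans_ne hw)
      rw [not_not] at h5
      rw [Pi.add_apply, Pi.add_apply, h3, h4, h5, zero_add, add_zero]
    · have h3 := hg.map w (hg.typed w hw)
      have h4 := not_imp_not.2 (hfg _) (h3.trans_ne hw)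
      have h5 := not_imp_not.2 (hug _) (h3.trans_ne hw)
      rw [not_not] at h4 h5
      rw [Pi.add_apply, Pi.add_apply, h3, h4, h5, zero_add, zero_add]
  ident κ w x hw hx h := by
    rcases x with ⟨s, x⟩
    cases κ <;> cases s <;> simp at h
    rcases hf.typed _ hw _ hx with ⟨h3, -⟩ | ⟨-, b, rfl⟩
    · simp at h3
    · have h3 : u [(false, (m, eB b)), (true, (l, eB b))] ≠ 0 := by
        rw [hu.in_out]
        exact smul_ne_zero (sg_ne_zero _) one_ne_zero
      have h4 : (f + (u + g)) [(false, (m, eB b)), (true, (l, eB b))] =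
          sg k ((U.lev.γ d).η (true, (l, eB b))) • 1 := by
        rw [Pi.add_apply, Pi.add_apply, hug _ h3, huf _ h3, hu.in_out, zero_add, add_zero]
      refine Eq.trans ?_ (h4.trans ?_)
      · simp [bar, lift, outer, compLev, exLev]
      · simp [Grading.η, lift, Grading.ofDeg]
  ident_root κ w b hw _ h := by
    cases κ <;> simp at h
    rcases hf.typed _ hw (true, b) (by assumption) with ⟨h3, -⟩ | ⟨-, b, rfl⟩
    · simp at h3
    · have h3 : u [(true, (l, eB b)), (false, (m, eB b))] ≠ 0 := by
        rw [hu.out_in]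
        exact one_ne_zero
      have h4 : (f + (u + g)) [(true, (l, eB b)), (false, (m, eB b))] = 1 := by
        rw [Pi.add_apply, Pi.add_apply, hug _ h3, huf _ h3, hu.out_in, zero_add, add_zero]
      refine Eq.trans ?_ h4
      simp [bar, lift, outer, compLev, exLev]
  cases w hw := by
    by_cases h0 : f w = 0
    · by_cases h3 : g w = 0
      · right
        rw [Pi.add_apply, Pi.add_apply, h0, h3, zero_add, add_zero] at hw
        obtain ⟨a, rfl | rfl⟩ := hu.cases w hw
        · refine ⟨_, _, rfl, rfl, rfl, ?_, ?_⟩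
          · simp [exLev]
          · intro κ; cases κ <;> simp [compLev, h2.ne']
        · refine ⟨_, _, rfl, rfl, rfl, ?_, ?_⟩
          · simp [exLev]
          · intro κ; cases κ <;> simp [compLev, h2.ne']
      · exact Or.inl ⟨true, hg.ne_zero h3⟩
    · exact Or.inl ⟨false, hf.ne_zero h0⟩
  adj κ op w w' x j h0 hx hx' := by
    have m1 := left_ne_zero_of_mul h0
    have m2 : c op w' ≠ 0 := fun h3 => h0 (by simp [h3])
    rcases x with ⟨s, x⟩
    cases κ <;> cases op
    · rcases hf.typed _ m1 _ hx with ⟨h3, a, h4⟩ | ⟨h3, a, h4⟩ <;>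
        rcases hf.typed _ m2 _ hx' with ⟨h5, b, h6⟩ | ⟨h5, b, h6⟩ <;> simp_all [bar]
      all_goals (subst h4; simp at h6)
    · rcases hf.typed _ m1 _ hx with ⟨h3, a, h4⟩ | ⟨h3, a, h4⟩ <;>
        rcases hg.typed _ m2 _ hx' with ⟨h5, b, h6⟩ | ⟨h5, b, h6⟩ <;>
        simp_all [bar, compLev]
      all_goals (subst h4; simp at h6)
    · rcases hg.typed _ m1 _ hx with ⟨h3, a, h4⟩ | ⟨h3, a, h4⟩ <;>
        rcases hf.typed _ m2 _ hx' with ⟨h5, b, h6⟩ | ⟨h5, b, h6⟩ <;>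
        simp_all [bar, compLev]
      all_goals (subst h4; simp at h6)
    · exact absurd (by ext <;> simp [hε]) h0
  label_disc κ w w' x x' m1 m2 hx hx' h3 h4 := by
    cases κ
    · exact typed_letter_inj (i := Sum.inl) (o := Sum.inr) hA.inj hB.inj
        (hf.typed _ m1) (hf.typed _ m2) hx hx' h3 h4
    · exact typed_letter_inj (i := Sum.inr) (o := Sum.inr) hB.inj hB.inj
        (hg.typed _ m1) (hg.typed _ m2) hx hx' h3 h4
  label_outer κ w x b hb m1 hx h3 h4 h5 := by
    rcases x with ⟨s, x⟩
    rcases b with ⟨s', b⟩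
    obtain rfl : s = s' := h3
    cases κ
    · rcases hf.typed _ m1 _ hx with ⟨h6, a, rfl⟩ | ⟨h6, a, rfl⟩
      · rcases hb with ⟨-, a', rfl⟩ | ⟨h7, -⟩
        · rw [hA.inj h4]
        · simp_all
      · rcases hb with ⟨h7, -⟩ | ⟨-, a', rfl⟩
        · simp_all
        · rw [hB.inj h4]
    · rcases hg.typed _ m1 _ hx with ⟨h6, a, rfl⟩ | ⟨h6, a, rfl⟩
      · simp only at h6
        simp [compLev, h6] at h5
      · rcases hb with ⟨h7, -⟩ | ⟨-, a', rfl⟩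
        · simp_all
        · rw [hB.inj h4]
  outer_or κ w x hb m1 hx := by
    rcases x with ⟨s, x⟩
    cases κ
    · cases s <;> simp [compLev, h1.ne]
    · rcases hg.typed _ m1 _ hx with ⟨h6, a, rfl⟩ | ⟨h6, a, rfl⟩
      · simp_all
      · simp only at h6
        simp [compLev, h6, h2.ne']
  label_edge κ op w w' x x' m1 m2 hx hx' h3 h4 h5 h6 := by
    rcases x with ⟨s, x⟩
    rcases x' with ⟨s', x'⟩
    simp only at h3
    subst h3
    cases κ <;> cases op <;> cases s <;>
      simp [compLev, h1.ne, h2.ne'] at h5 h6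
    · rcases hf.typed _ m1 _ hx with ⟨h7, -⟩ | ⟨-, a, rfl⟩
      · simp at h7
      rcases hg.typed _ m2 _ hx' with ⟨-, a', rfl⟩ | ⟨h7, -⟩
      · rw [hB.inj h4]; rfl
      · simp at h7
    · rcases hg.typed _ m1 _ hx with ⟨-, a, rfl⟩ | ⟨h7, -⟩
      · rcases hf.typed _ m2 _ hx' with ⟨h7, -⟩ | ⟨-, a', rfl⟩
        · simp at h7
        · rw [hB.inj h4]; rfl
      · simp at h7
  fst_eq κ op w o h h3 := by
    cases κ <;> cases o <;> simp at h
    cases op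
    · simp [compLev, h1.ne] at h3
    · exact hε w
  lv_of_J κ o h := by cases κ <;> cases o <;> simp [compLev] at h ⊢
  lv_eq κ o h := by
    cases κ <;> cases o <;> simp_all [compLev, exLev]
  ex_ne o := by cases o <;> simp [exLev, h1.ne, h2.ne']
  lv_inj κ κ' h := by
    cases κ <;> cases κ' <;> simp [compLev, h2.ne, h2.ne'] at h ⊢
end
section
variable {k : Type w} [Field k] {Λ : Type t} {O : Type u}

/-! ### Splitting sums over diagrams by the number of odd discs -/

section Split
variable {γ : Grading Λ O} {c : Bool → List (Letter Λ) → DualNumber k}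

/-- The disc without edges. -/
def Legs.ofWord {K : Type} : List (Letter Λ) → Legs K Λ
  | [] => nil
  | x :: w => ext x.1 x.2 (ofWord w)

@[simp] lemma Legs.arr_ofWord {K : Type} (w : List (Letter Λ)) :
    (Legs.ofWord (K := K) w).arr = w := by
  induction w <;> simp_all [ofWord, arr]

@[simp] lemma Legs.bd_ofWord {K : Type} (w : List (Letter Λ)) :
    (Legs.ofWord (K := K) w).bd = w := by
  induction w <;> simp_all [ofWord, bd]

@[simp] lemma Legs.ops_ofWord {K : Type} (w : List (Letter Λ)) :
    (Legs.ofWord (K := K) w).ops = [] := by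
  induction w <;> simp_all [ofWord, ops]

@[simp] lemma Legs.om_ofWord (w : List (Letter Λ)) : (Legs.ofWord w).om γ c = 1 := by
  induction w <;> simp_all [ofWord, om]

/-- Two even discs can never be adjacent, so a contributing diagram without odd discs is a single
disc. -/
lemma Legs.eq_ofWord (hc : ∀ w w' x n, x ∈ w → bar x ∈ w' → c false w * tau n (c false w') = 0)
    (L : Legs Bool Λ) (W : List (Letter Λ)) (hA : ∀ x ∈ L.arr, x ∈ W)
    (h0 : c false W * L.om γ c ≠ 0) (hops : L.ops.count true = 0) : L = ofWord L.bd := by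
  induction L with
  | nil => rfl
  | ext o a r ih =>
    rw [bd, ofWord, ← ih (fun x hx => hA x (by simp [arr, hx])) h0 hops]
  | edge o a op s r _ _ =>
    obtain ⟨h1, -, -⟩ := Bridge.factors_ne_zero h0
    obtain rfl : op = false := by
      cases op
      · rfl
      · simp [ops] at hops
    exact absurd (hc _ _ (o, a) _ (hA _ (by simp [arr])) (by simp)) h1

/-- `x` is a multiple of the `n`-th power of the odd parameter. -/
def Ord (n : ℕ) (x : DualNumber k) : Prop := (1 ≤ n → x.fst = 0) ∧ (2 ≤ n → x.snd = 0)

lemma ord_zero (x : DualNumber k) : Ord 0 x := ⟨by omega, by omega⟩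

lemma Ord.mul {m n : ℕ} {x y : DualNumber k} (hx : Ord m x) (hy : Ord n y) :
    Ord (m + n) (x * y) := by
  obtain ⟨h1, h2⟩ := hx
  obtain ⟨h3, h4⟩ := hy
  constructor <;> intro h
  · rw [TrivSqZeroExt.fst_mul]
    rcases Nat.eq_zero_or_pos m with rfl | hm
    · rw [h3 (by omega), mul_zero]
    · rw [h1 hm, zero_mul]
  · rw [TrivSqZeroExt.snd_mul]
    rcases Nat.eq_zero_or_pos m with rfl | hm
    · rw [h3 (by omega), h4 (by omega)]; simp
    · rcases Nat.eq_zero_or_pos n with rfl | hn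
      · rw [h1 (by omega), h2 (by omega)]; simp
      · rw [h1 hm, h3 hn]; simp

lemma Ord.tau {n : ℕ} {x : DualNumber k} (hx : Ord n x) (m : ZMod 2) : Ord n (tau m x) :=
  ⟨fun h => by simp [hx.1 h], fun h => by simp [hx.2 h]⟩

lemma Ord.smul {n : ℕ} {x : DualNumber k} (hx : Ord n x) (a : k) : Ord n (a • x) :=
  ⟨fun h => by simp [hx.1 h], fun h => by simp [hx.2 h]⟩

lemma ord_coeff (hε : ∀ w, (c true w).fst = 0) (κ : Bool) (w : List (Letter Λ)) :
    Ord ([κ].count true) (c κ w) := by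
  cases κ
  · exact ord_zero _
  · exact ⟨fun _ => hε w, by simp⟩

/-- Each odd disc contributes a factor `ε`. -/
lemma Legs.ord_om (hε : ∀ w, (c true w).fst = 0) (L : Legs Bool Λ) :
    Ord (L.ops.count true) (L.om γ c) := by
  induction L with
  | nil => exact ord_zero _
  | ext o a r ih => exact ih
  | edge o a op s r ihs ih =>
    have h := ((((ord_coeff hε op (bar (o, a) :: s.arr)).mul ihs).tau (γ.pw r.arr)).mul ih).smul
      (sg k (γ.η (o, a)))
    rw [← List.count_append, ← List.count_append] at h
    exact h

lemma Legs.om_eq_zero (hc : ∀ w, c true w = 0) (L : Legs Bool Λ) (h : L.ops.count true ≠ 0) :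
    L.om γ c = 0 := by
  induction L with
  | nil => simp [ops] at h
  | ext o a r ih => exact ih h
  | edge o a op s r ihs ih =>
    rw [om]
    cases op
    · by_cases hs : s.ops.count true = 0
      · rw [ih (by simpa [ops, hs] using h), mul_zero, smul_zero]
      · rw [ihs hs, mul_zero, tau_apply_zero, zero_mul, smul_zero]
    · rw [hc, zero_mul, tau_apply_zero, zero_mul, smul_zero]

/-- Sorts the diagrams by the number of structure discs: with none there is just the disc of the
even operation, those with one form the sum wanted, and those with more vanish by `ε² = 0`. -/
lemma finsum_diagrams (hc : ∀ w w' x n, x ∈ w → bar x ∈ w' → c false w * tau n (c false w') = 0)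
    (hε : ∀ w, (c true w).fst = 0) (b : Λ) (B : List (Letter Λ))
    (hfin : ({p : Bool × Legs Bool Λ | p.2.bd = B} ∩
      Function.support fun p => c p.1 ((true, b) :: p.2.arr) * p.2.om γ c).Finite) :
    ∑ᶠ p ∈ {p : Bool × Legs Bool Λ | p.2.bd = B}, c p.1 ((true, b) :: p.2.arr) * p.2.om γ c =
      c false ((true, b) :: B) +
        ∑ᶠ p ∈ {p : Bool × Legs Bool Λ | p.2.bd = B ∧
          (Diagram.mk p.1 b p.2).ops.count true = 1},
          c p.1 ((true, b) :: p.2.arr) * p.2.om γ c := by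
  rw [← finsum_mem_inter_add_sdiff'
    {p : Bool × Legs Bool Λ | (Diagram.mk p.1 b p.2).ops.count true = 0} hfin]
  congr 1
  · have : ({p : Bool × Legs Bool Λ | p.2.bd = B} ∩
        {p | (Diagram.mk p.1 b p.2).ops.count true = 0}) ∩
          (Function.support fun p => c p.1 ((true, b) :: p.2.arr) * p.2.om γ c) =
        {((false, Legs.ofWord B) : Bool × Legs Bool Λ)} ∩
          (Function.support fun p => c p.1 ((true, b) :: p.2.arr) * p.2.om γ c) := by
      ext ⟨κ, L⟩
      constructor
      · rintro ⟨⟨rfl, h2⟩, h3⟩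
        refine ⟨?_, h3⟩
        have h4 : κ = false ∧ L.ops.count true = 0 := by
          cases κ
          · exact ⟨rfl, by simpa [Diagram.ops] using h2⟩
          · simp [Diagram.ops] at h2
        obtain ⟨rfl, h4⟩ := h4
        rw [Set.mem_singleton_iff]
        congr 1
        exact Legs.eq_ofWord hc L _ (fun x hx => List.mem_cons_of_mem _ hx) h3 h4
      · rintro ⟨h1, h3⟩
        rw [Set.mem_singleton_iff, Prod.mk.injEq] at h1
        obtain ⟨rfl, rfl⟩ := h1
        exact ⟨⟨by simp, by simp [Diagram.ops]⟩, h3⟩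
    rw [finsum_mem_inter_support_eq _ _ _ this, finsum_mem_singleton]
    simp
  · refine finsum_mem_inter_support_eq _ _ _ ?_
    ext ⟨κ, L⟩
    constructor
    · rintro ⟨⟨h1, h2⟩, h3⟩
      refine ⟨⟨h1, ?_⟩, h3⟩
      by_contra h4
      -- With two or more odd discs the product is divisible by `ε²`, so both of its components are
      -- zero.
      have h5 := (ord_coeff hε κ ((true, b) :: L.arr)).mul (L.ord_om (γ := γ) hε)
      rw [← List.count_append] at h5
      have h6 : 2 ≤ ([κ] ++ L.ops).count true := by
        have e : (Diagram.mk κ b L).ops.count true = ([κ] ++ L.ops).count true := rfl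
        rw [Set.mem_ofPred_eq, e] at h2
        simp only [e] at h4
        omega
      exact h3 (TrivSqZeroExt.ext (h5.1 (by omega)) (h5.2 h6))
    · rintro ⟨⟨h1, h2⟩, h3⟩
      refine ⟨⟨h1, ?_⟩, h3⟩
      rw [Set.mem_ofPred_eq, h2]
      exact one_ne_zero
end Split
end
section
variable {k : Type w} [Field k] {Λ : Type (max u v)} {O : Type u}

/-! ### The identity -/

section One
variable {A : GrQuiver.{u, v, w} k O} {i o : Lab A → Λ}

open Classical in
/-- The coefficients of the identity. -/
def oneCoeff (W : List (Letter (Lab A))) : k :=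
  if ∃ e : Lab A, W = [(false, e), (true, e)] then 1 else 0

lemma Multi.one_eq : Multi.one A = Multi.ofCoeff id id (oneCoeff (k := k)) := rfl

lemma oneCoeff_ne_zero {W : List (Letter (Lab A))} (h : oneCoeff (k := k) W ≠ 0) :
    ∃ e : Lab A, W = [(false, e), (true, e)] := by
  by_contra hc
  exact h (if_neg hc)

/-- A nonzero coefficient of the identity requires the output label to be one of the finitely many
input labels, so the column is finite. -/
lemma Multi.val_one (f : Filled A A) : (Multi.one A).val f = oneCoeff (f.word id id) := by
  rw [Multi.one_eq]
  refine Multi.val_ofCoeff f ?_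
  have hinj : Function.Injective fun b => (⟨f.τ, f.a, b⟩ : Filled A A).word id id := by
    intro b b' hb
    have := Filled.word_injective Function.injective_id Function.injective_id hb
    simpa using this
  have hfin : (Set.range fun p : f.τ.In => (⟨_, _, f.a p⟩ : Lab A)).Finite := Set.finite_range _
  refine ((hfin.image fun e => [(false, e), (true, e)]).preimage hinj.injOn).subset ?_
  intro b hb
  obtain ⟨e, he⟩ := oneCoeff_ne_zero hb
  refine ⟨e, ?_, he.symm⟩
  have h1 : (false, e) ∈ (⟨f.τ, f.a, b⟩ : Filled A A).word id id := by simp [he]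
  simp only [Filled.word, List.mem_flatMap, List.mem_append, List.mem_reverse, List.mem_ofFn,
    List.mem_singleton] at h1
  obtain ⟨s, -, ⟨j, hj⟩ | hj⟩ := h1
  · exact ⟨⟨s, j⟩, (Prod.mk.inj hj).2⟩
  · simp at hj

lemma exists_filled_pair (a : Lab A) (i o : Lab A → Λ) :
    ∃ f : Filled A A, f.word i o = [(false, i a), (true, o a)] := by
  have h := exists_filled (A := A) (B := A) (γ := (Labels.of A).γ 0) (i := id) (o := id)
    (W := [(false, a), (true, a)]) (fun _ => rfl) (fun _ => rfl) (fun _ => rfl) (fun _ => rfl)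
    ⟨a.r, rfl, rfl, rfl⟩ ⟨[(false, a)], a, rfl⟩ (by
      intro x hx
      simp only [List.mem_cons, List.not_mem_nil, or_false] at hx
      rcases hx with rfl | rfl
      · exact Or.inl ⟨rfl, a, rfl⟩
      · exact Or.inr ⟨rfl, a, rfl⟩)
  obtain ⟨f, hf⟩ := h
  refine ⟨f, ?_⟩
  rw [← Filled.word_map_letter (i₀ := id) (o₀ := id) (i := i) (o := o)
    (ψ := fun x => (x.1, if x.1 then o x.2 else i x.2)) (fun _ => rfl) (fun _ => rfl), hf]
  rfl

lemma Multi.coeff_one_ne_zero {W : List (Letter Λ)} (h : (Multi.one A).coeff i o W ≠ 0)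
    (hi : Function.Injective i) (ho : Function.Injective o) :
    ∃ a, W = [(false, i a), (true, o a)] := by
  obtain ⟨f, rfl⟩ := Multi.exists_of_coeff_ne_zero h
  rw [Multi.coeff_word _ hi ho, Multi.val_one] at h
  obtain ⟨e, he⟩ := oneCoeff_ne_zero h
  refine ⟨e, ?_⟩
  rw [← Filled.word_map_letter (i₀ := id) (o₀ := id) (i := i) (o := o)
    (ψ := fun x => (x.1, if x.1 then o x.2 else i x.2)) (fun _ => rfl) (fun _ => rfl), he]
  rfl

lemma Multi.coeff_one (hi : Function.Injective i) (ho : Function.Injective o) (a : Lab A) :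
    (Multi.one A).coeff i o [(false, i a), (true, o a)] = 1 := by
  obtain ⟨f, hf⟩ := exists_filled_pair a i o
  rw [← hf, Multi.coeff_word _ hi ho, Multi.val_one, oneCoeff, if_pos]
  refine ⟨a, ?_⟩
  have h1 := Filled.word_map_letter (i₀ := id) (o₀ := id) (i := i) (o := o)
    (ψ := fun x => (x.1, if x.1 then o x.2 else i x.2)) (fun _ => rfl) (fun _ => rfl) f
  rw [hf] at h1
  have h2 : Function.Injective
      fun x : Letter (Lab A) => (x.1, if x.1 then o x.2 else i x.2) := by
    rintro ⟨s, x⟩ ⟨s', x'⟩ h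
    obtain ⟨rfl, h⟩ := Prod.mk.inj h
    cases s
    · exact Prod.ext rfl (hi h)
    · exact Prod.ext rfl (ho h)
  exact List.map_injective_iff.2 h2 (h1.trans rfl)

/-- Cyclic invariance is vacuous: the words of the identity have a single outgoing arrow and cannot
be cut into two parts that both end with one. -/
lemma isOp_one (d : ℤ) : IsOp d 0 (Multi.one A) := by
  refine ⟨fun W hW => ?_, fun U W hU hW => ?_, fun τ hn hm => ?_⟩
  · rw [← Multi.coeff_map (Multi.one A) (Labels.emb_id (A := A)).inj (Labels.emb_id (A := A)).inj
      (Multi.typed_of_coeff hW)] at hW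
    obtain ⟨a, ha⟩ := Multi.coeff_one_ne_zero hW Function.injective_id Function.injective_id
    have h1 := Multi.deg_map (A := A) (B := A) (d := d) (deg := Lab.deg) (i := id) (o := id)
      (fun _ => rfl) (fun _ => rfl) W
    rw [← h1.1, ← h1.2, ha]
    simp [inDeg, outDeg, arrowDeg]
  · have key : ∀ U W, EndsOut U → EndsOut W →
        (Multi.one A).coeff Sum.inl Sum.inr (U ++ W) = 0 := by
      intro U W hU hW
      by_contra hc
      obtain ⟨a, ha⟩ := Multi.coeff_one_ne_zero hc Sum.inl_injective Sum.inr_injective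
      obtain ⟨U, b, rfl⟩ := hU
      obtain ⟨W, b', rfl⟩ := hW
      have h1 := congrArg (fun w => w.countP fun x => x.1) ha
      simp at h1
      omega
    rw [key U W hU hW, key W U hW hU, mul_zero]
  · refine (srcBasis A τ).ext fun a => (tgtBasis A τ).repr.injective (Finsupp.ext fun b => ?_)
    rw [LinearMap.zero_apply, map_zero, Finsupp.zero_apply]
    by_contra hc
    have h1 : (Multi.one A).val ⟨τ, a, b⟩ ≠ 0 := hc
    rw [Multi.val_one] at h1
    obtain ⟨e, he⟩ := oneCoeff_ne_zero h1
    have h2 := congrArg List.length he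
    rw [Filled.length_word] at h2
    have h3 : ∑ s : Fin (τ.n + 1), (τ.m s + 1) = 1 := by simp [hm, hn]
    simp only [h3] at h2
    simp at h2

variable {d : ℤ} {U : Labels.{u, max u v} O} {e : Lab A → U.L}

/-- When the input is read first, the clockwise sign is the product of the parities of the two
arrows. This equals `η` of the outgoing arrow, which is why identities can be inserted into edges
without a sign. -/
lemma isIdent_one (he : U.Emb e) (n m : ℕ) :
    IsIdent (U.lev.γ d) n m e
      ((Multi.one A).drep (U.lev.γ d) 0 (Labels.pos n e) (Labels.pos m e)) := by
  have hi := (he.pos n).inj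
  have ho := (he.pos m).inj
  refine ⟨fun w hw => ?_, fun a => ?_, fun a => ?_⟩
  · have h1 := Multi.coeff_norm_ne_zero (Multi.rep_ne_zero hw)
    obtain ⟨a, ha⟩ := Multi.coeff_one_ne_zero h1 hi ho
    refine ⟨a, ?_⟩
    have h2 := (ha ▸ perm_norm w : [(false, Labels.pos n e a), (true, Labels.pos m e a)].Perm w)
    have h3 := h2.length_eq
    rcases w with _ | ⟨x, _ | ⟨y, _ | ⟨z, w⟩⟩⟩
    · simp at h3
    · simp at h3
    · have h4 := h2.symm.mem_iff (a := x)
      have h5 := h2.symm.mem_iff (a := y)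
      have h6 := h2.mem_iff (a := (false, Labels.pos n e a))
      have h7 := h2.mem_iff (a := (true, Labels.pos m e a))
      simp only [List.mem_cons, List.not_mem_nil, or_false, true_or, or_true, true_iff]
        at h4 h5 h6 h7
      rcases h4 with rfl | rfl
      · right
        rcases h7 with h7 | h7
        · simp at h7
        · rw [← h7]; rfl
      · left
        rcases h6 with h6 | h6
        · simp at h6
        · rw [← h6]; rfl
    · simp at h3
  · have h1 := ccw_append (γ := U.lev.γ d)
      (c := (Multi.one A).coeff (Labels.pos n e) (Labels.pos m e))
      (X := [(true, Labels.pos m e a)]) (Y := [(false, Labels.pos n e a)])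
      (Or.inr ⟨[], _, rfl⟩) (by simp)
    rw [List.singleton_append, List.singleton_append, Multi.coeff_one hi ho] at h1
    have h2 : (Multi.one A).drep (U.lev.γ d) 0 (Labels.pos n e) (Labels.pos m e)
        [(true, Labels.pos m e a), (false, Labels.pos n e a)] = 1 := by
      rw [Multi.drep, Multi.rep, h1, pow_zero, mul_one, ← one_smul k (1 : DualNumber k), smul_smul,
        mul_one]
      congr 1
      simp only [tw, Grading.pw_cons, Grading.pw_nil]
      simp [sg_add]
    exact h2
  · have h1 := ccw_concat (U.lev.γ d) ((Multi.one A).coeff (Labels.pos n e) (Labels.pos m e))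
      [(false, Labels.pos n e a)] (Labels.pos m e a)
    rw [List.singleton_append, Multi.coeff_one hi ho] at h1
    have h2 : (Multi.one A).drep (U.lev.γ d) 0 (Labels.pos n e) (Labels.pos m e)
        [(false, Labels.pos n e a), (true, Labels.pos m e a)] =
          sg k ((U.lev.γ d).η (true, Labels.pos m e a)) • 1 := by
      rw [Multi.drep, Multi.rep, h1, pow_zero, mul_one]
      congr 2
      simp only [tw, Grading.pw_nil, Grading.p, Grading.η, Labels.pos, Grading.ofDeg]
      simp
      generalize (U.deg (e a) : ZMod 2) = x
      generalize (d : ZMod 2) = y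
      decide +revert
    exact h2
end One

/-! ### Systems of coefficients with labels in two quivers -/

section TMor
variable {A B C : GrQuiver.{u, v, w} k O} {d : ℤ} {U : Labels.{u, max u v} O}
  {eA : Lab A → U.L} {eB : Lab B → U.L} {eC : Lab C → U.L} {n m l : ℕ}

/-- The coefficients of a family of operations from `A` at level `n` to `B` at level `m`. -/
structure TMor (U : Labels.{u, max u v} O) (d : ℤ) (eA : Lab A → U.L) (eB : Lab B → U.L)
    (n m : ℕ) (f : List (Letter (ℕ × U.L)) → DualNumber k) : Prop extends
    WMor (U.lev.γ d) Prod.fst n m f where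
  typed : ∀ w, f w ≠ 0 → Multi.Typed (Labels.pos (U := U) n eA) (Labels.pos (U := U) m eB) w

lemma IsOp.tmor {F : Multi A B} {j : ℕ} (hF : IsOp d j F) (hA : U.Emb eA) (hB : U.Emb eB)
    (n m : ℕ) : TMor U d eA eB n m
      (F.drep (U.lev.γ d) j (Labels.pos (U := U) n eA) (Labels.pos (U := U) m eB)) :=
  ⟨hF.wmor (hA.pos n) (hB.pos m) (fun _ => rfl) (fun _ => rfl),
    fun _ hw => Multi.typed_of_rep (Multi.rep_ne_zero hw)⟩

lemma TMor.add {f g : List (Letter (ℕ × U.L)) → DualNumber k} (hf : TMor U d eA eB n m f)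
    (hg : TMor U d eA eB n m g) : TMor U d eA eB n m (f + g) := by
  have key : ∀ w, (f + g) w ≠ 0 → f w ≠ 0 ∨ g w ≠ 0 := by
    intro w hw
    by_contra! hc
    exact hw (by rw [Pi.add_apply, hc.1, hc.2, add_zero])
  exact ⟨⟨hf.toSys.add hg.toSys, fun w hw => (key w hw).elim (hf.inp w) (hg.inp w),
    fun w hw => (key w hw).elim (hf.out w) (hg.out w),
    fun w hw => (key w hw).elim (hf.exists_out w) (hg.exists_out w)⟩,
    fun w hw => (key w hw).elim (hf.typed w) (hg.typed w)⟩

lemma TMor.wcomp {f g : List (Letter (ℕ × U.L)) → DualNumber k} (hf : TMor U d eA eB n m f)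
    (hg : TMor U d eB eC m l g) (h1 : n < m) (h2 : m < l) :
    TMor U d eA eC n l (wcomp (U.lev.γ d) Prod.fst m f g) := by
  refine ⟨hf.toWMor.wcomp hg.toWMor h1 h2, fun w hw x hx => ?_⟩
  obtain ⟨h3, h4⟩ := restr_ne_zero hw
  obtain ⟨w', h5, h6⟩ := TS_mem h4 hx
  have h7 := h3 x hx
  by_cases h0 : f w' = 0
  · rw [Pi.add_apply, h0, zero_add] at h5
    rcases hg.typed _ h5 _ h6 with ⟨h8, b, h9⟩ | h8
    · exact absurd (congrArg Prod.fst h9).symm h7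
    · exact Or.inr h8
  · rcases hf.typed _ h0 _ h6 with h8 | ⟨h8, b, h9⟩
    · exact Or.inl h8
    · exact absurd (congrArg Prod.fst h9).symm h7

/-- Every word has an outgoing letter, and its level tells the two operations apart. -/
lemma TMor.eq_zero {f g : List (Letter (ℕ × U.L)) → DualNumber k} {D : GrQuiver.{u, v, w} k O}
    {eD : Lab D → U.L} {n' m' : ℕ} (hf : TMor U d eA eB n m f) (hg : TMor U d eC eD n' m' g)
    (h : m ≠ m') {w : List (Letter (ℕ × U.L))} (hw : f w ≠ 0) : g w = 0 := by
  by_contra hc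
  obtain ⟨x, hx, h1⟩ := hf.exists_out w hw
  exact h ((hf.out w hw x hx h1).symm.trans (hg.out w hc x hx h1))

variable {Λ₀ : Type (max u v)} {i₀ : Lab A → Λ₀} {o₀ : Lab B → Λ₀}
  {ψ : Letter Λ₀ → Letter (ℕ × U.L)}

lemma TMor.ext_filled {f g : List (Letter (ℕ × U.L)) → DualNumber k} (hA : U.Emb eA)
    (hB : U.Emb eB) (hf : TMor U d eA eB n m f) (hg : TMor U d eA eB n m g)
    (hi : ∀ a, ψ (false, i₀ a) = (false, Labels.pos (U := U) n eA a))
    (ho : ∀ b, ψ (true, o₀ b) = (true, Labels.pos (U := U) m eB b))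
    (h : ∀ W b, (∃ f : Filled A B, f.word i₀ o₀ = W ++ [(true, b)]) →
      f (ψ (true, b) :: W.map ψ) = g (ψ (true, b) :: W.map ψ)) : f = g := by
  refine eq_of_filled hf.toSys hg.toSys (fun w hw => ⟨hf.typed w hw, hf.exists_out w hw⟩)
    (fun w hw => ⟨hg.typed w hw, hg.exists_out w hw⟩) (hA.pos n).l (hA.pos n).r
    (hB.pos m).l (hB.pos m).r ?_
  rintro W b ⟨φ, hφ⟩
  obtain ⟨W₀, b₀, h0⟩ := φ.endsOut_word (i := i₀) (o := o₀)
  have h1 := φ.word_map_letter hi ho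
  rw [h0, hφ, List.map_append] at h1
  obtain ⟨rfl, h2⟩ := List.append_inj' h1 rfl
  have h3 : ψ (true, b₀) = (true, b) := by simpa using h2
  rw [← h3]
  exact h W₀ b₀ ⟨φ, h0⟩
end TMor
end
section
variable {k : Type w} [Field k] {O : Type u}

variable {A B C : GrQuiver.{u, v, w} k O} {d : ℤ} {U : Labels.{u, max u v} O}
  {eA : Lab A → U.L} {eB : Lab B → U.L} {eC : Lab C → U.L} {n m l : ℕ}

/-! ### Compositions in terms of trees -/

lemma wcomp_eq_TS {γ : Grading (ℕ × U.L) O} {f g : List (Letter (ℕ × U.L)) → DualNumber k}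
    {Λ₀ : Type (max u v)} {ι : Λ₀ → U.L} (h1 : n < m) (h2 : m < l) (x : Letter Λ₀)
    (w : List (Letter Λ₀)) :
    wcomp γ Prod.fst m f g (outer (exLev n l) ι x :: w.map (outer (exLev n l) ι)) =
      TS γ (f + g) (fun a => a.1 = m)
        (outer (exLev n l) ι x :: w.map (outer (exLev n l) ι)) := by
  have key : ∀ y : Letter Λ₀, (outer (exLev n l) ι y).2.1 ≠ m := by
    rintro ⟨s, y⟩
    cases s <;> simp [outer, exLev, h1.ne, h2.ne']
  refine restr_eq fun y hy => ?_
  rcases List.mem_cons.1 hy with rfl | hy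
  · exact key x
  · obtain ⟨z, -, rfl⟩ := List.mem_map.1 hy
    exact key z

lemma TMor.finite_trees {f g : List (Letter (ℕ × U.L)) → DualNumber k}
    (hf : TMor U d eA eB n m f) (hg : TMor U d eB eC m l g) (h1 : n < m) (h2 : m < l)
    (x : Letter (ℕ × U.L)) (w : List (Letter (ℕ × U.L))) :
    {L : Tr (ℕ × U.L) | L.bd = w ∧ L.Good (fun a => a.1 = m) ∧
      (Tr.ext x L).val (U.lev.γ d) (f + g) ≠ 0}.Finite :=
  Tr.finite_TS (hf.toSys.add hg.toSys)
    ((hf.leveled h1 h2.le).add (hg.leveled h2 le_rfl)).ranked _ x w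

/-- The labels of two quivers. -/
abbrev Labels.two (A B : GrQuiver.{u, v, w} k O) : Labels.{u, max u v} O :=
  (Labels.of A).sum (Labels.of B)

/-- The labels of three quivers. -/
abbrev Labels.three (A B C : GrQuiver.{u, v, w} k O) : Labels.{u, max u v} O :=
  (Labels.of A).sum ((Labels.of B).sum (Labels.of C))

lemma typed_of_filled {Λ : Type t} {i : Lab A → Λ} {o : Lab B → Λ} {W : List (Letter Λ)} {b : Λ}
    (h : ∃ f : Filled A B, f.word i o = W ++ [(true, b)]) :
    ((true, b).1 = true ∧ ∃ c, o c = (true, b).2) ∧ Multi.Typed i o W := by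
  obtain ⟨f, hf⟩ := h
  have key : ∀ x ∈ W ++ [(true, b)], (x.1 = false ∧ ∃ a, i a = x.2) ∨
      (x.1 = true ∧ ∃ b, o b = x.2) := fun x hx => f.mem_word (hf ▸ hx)
  refine ⟨?_, fun x hx => key x (by simp [hx])⟩
  simpa using key (true, b) (by simp)

-- Compares the two descriptions of a composite: `bridge_comp` turns the sum over trees into a sum
-- over diagrams, and `finsum_weight`, with no odd discs, supplies the signs.
set_option maxHeartbeats 1000000 in
lemma comp_aux (hA : U.Emb eA) (hB : U.Emb eB) (hC : U.Emb eC) (h1 : n < m) (h2 : m < l)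
    {F : Multi A B} {G : Multi B C} (hF : IsOp d 0 F) (hG : IsOp d 0 G)
    {W : List (Letter (Lab A ⊕ Lab B ⊕ Lab C))} {b : Lab A ⊕ Lab B ⊕ Lab C}
    (hW : ∃ f : Filled A C, f.word Sum.inl (fun z => Sum.inr (Sum.inr z)) = W ++ [(true, b)]) :
    wcomp (U.lev.γ d) Prod.fst m
      (F.drep (U.lev.γ d) 0 (Labels.pos (U := U) n eA) (Labels.pos (U := U) m eB))
      (G.drep (U.lev.γ d) 0 (Labels.pos (U := U) m eB) (Labels.pos (U := U) l eC))
      (outer (exLev n l) (Sum.elim eA (Sum.elim eB eC)) (true, b) ::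
        W.map (outer (exLev n l) (Sum.elim eA (Sum.elim eB eC)))) =
      (sg k (rsg ((Labels.three A B C).γ d) W b) *
        ∑ᶠ D ∈ {D : Diagram Bool (Lab A ⊕ Lab B ⊕ Lab C) | True ∧ D.word = W ++ [(true, b)]},
          D.weight d (Sum.elim Lab.deg (Sum.elim Lab.deg Lab.deg))
            (fun κ => if κ then G.coeff (fun y => Sum.inr (Sum.inl y)) (fun z => Sum.inr (Sum.inr z))
              else F.coeff Sum.inl (fun y => Sum.inr (Sum.inl y)))) • 1 := by
  set γ₀ := (Labels.three A B C).γ d with hγ₀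
  have eA₀ : (Labels.three A B C).Emb (A := A) Sum.inl := Labels.emb_id.inl
  have eB₀ : (Labels.three A B C).Emb (A := B) fun y => Sum.inr (Sum.inl y) :=
    Labels.emb_id.inl.inr
  have eC₀ : (Labels.three A B C).Emb (A := C) fun y => Sum.inr (Sum.inr y) :=
    Labels.emb_id.inr.inr
  have tF := hF.tmor hA hB n m
  have tG := hG.tmor hB hC m l
  have hq : ∀ a, U.deg (Sum.elim eA (Sum.elim eB eC) a) = (Labels.three A B C).deg a := by
    rintro (a | a | a)
    · exact hA.deg a
    · exact hB.deg a
    · exact hC.deg a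
  have hp : ∀ κ x, (U.lev.γ d).p (lift (compLev n m l) (Sum.elim eA (Sum.elim eB eC)) κ x) =
      γ₀.p x := by
    rintro κ ⟨s, x⟩
    simp [Grading.p, lift, Grading.ofDeg, hq, hγ₀]
  have fF := hF.transfer (γ₀ := γ₀) eA₀.inj eB₀.inj (hA.pos n).inj (hB.pos m).inj
    (ψ := lift (compLev n m l) (Sum.elim eA (Sum.elim eB eC)) false) (fun _ => rfl) (hp false)
    (fun _ => rfl) (fun _ => rfl)
  have fG := hG.transfer (γ₀ := γ₀) eB₀.inj eC₀.inj (hB.pos m).inj (hC.pos l).inj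
    (ψ := lift (compLev n m l) (Sum.elim eA (Sum.elim eB eC)) true) (fun _ => rfl) (hp true)
    (fun _ => rfl) (fun _ => rfl)
  let c : Bool → List (Letter (Lab A ⊕ Lab B ⊕ Lab C)) → k := fun κ =>
    if κ then G.coeff (fun y => Sum.inr (Sum.inl y)) (fun z => Sum.inr (Sum.inr z))
      else F.coeff Sum.inl (fun y => Sum.inr (Sum.inl y))
  have hb := bridge_comp (d := d) hA hB hC h1 h2
    (c := fun κ W => ccw γ₀ (c κ) W • DualNumber.eps ^ (fun _ : Bool => 0) κ) fF fG
    (fun w hw => tF.eq_zero tG h2.ne hw)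
  obtain ⟨hT, hW'⟩ := typed_of_filled hW
  rw [wcomp_eq_TS h1 h2, (hb.TS_eq b W (Or.inr hT) hW' (tF.finite_trees tG h1 h2 _ _)).2]
  have hS : {p : Bool × Legs Bool (Lab A ⊕ Lab B ⊕ Lab C) | p.2.bd = W} =
      {p | p.2.bd = W ∧ (fun _ : Diagram Bool (Lab A ⊕ Lab B ⊕ Lab C) => True)
        ⟨p.1, b, p.2⟩} := by simp
  rw [hS]
  refine (finsum_weight (γ := γ₀) (c := c) (odd := fun _ => 0) (n := 0)
    (S := fun _ => True) ((Labels.three A B C).of_γ d) ?_ ?_ (by omega) ?_ W b).trans ?_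
  · rintro (_ | _) x w
    · exact hF.rep_cyc eA₀ eB₀ x w
    · exact hG.rep_cyc eB₀ eC₀ x w
  · rintro (_ | _) w hw
    · simp only [c, Bool.false_eq_true, if_false] at hw
      exact hF.par eA₀ eB₀ hw
    · simp only [c, if_true] at hw
      exact hG.par eB₀ eC₀ hw
  · intro D _
    simp
  · rw [pow_zero]

/-- The composition of operations is the composition of their systems of coefficients. -/
theorem comp_spec (hA : U.Emb eA) (hB : U.Emb eB) (hC : U.Emb eC) (h1 : n < m) (h2 : m < l)
    {F : Multi A B} {G : Multi B C} (hF : IsOp d 0 F) (hG : IsOp d 0 G) :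
    IsOp d 0 (Multi.comp d F G) ∧
    (Multi.comp d F G).drep (U.lev.γ d) 0 (Labels.pos (U := U) n eA) (Labels.pos (U := U) l eC) =
      wcomp (U.lev.γ d) Prod.fst m
        (F.drep (U.lev.γ d) 0 (Labels.pos (U := U) n eA) (Labels.pos (U := U) m eB))
        (G.drep (U.lev.γ d) 0 (Labels.pos (U := U) m eB) (Labels.pos (U := U) l eC)) := by
  have tF := hF.tmor hA hB n m
  have tG := hG.tmor hB hC m l
  have tX := tF.wcomp tG h1 h2
  set X := wcomp (U.lev.γ d) Prod.fst m
    (F.drep (U.lev.γ d) 0 (Labels.pos (U := U) n eA) (Labels.pos (U := U) m eB))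
    (G.drep (U.lev.γ d) 0 (Labels.pos (U := U) m eB) (Labels.pos (U := U) l eC)) with hX
  have hi : ∀ a : Lab A, outer (exLev n l) (Sum.elim eA (Sum.elim eB eC)) (false, Sum.inl a) =
      (false, Labels.pos (U := U) n eA a) := fun _ => rfl
  have ho : ∀ b : Lab C,
      outer (exLev n l) (Sum.elim eA (Sum.elim eB eC)) (true, Sum.inr (Sum.inr b)) =
        (true, Labels.pos (U := U) l eC b) := fun _ => rfl
  have hq : ∀ a, U.deg (Sum.elim eA (Sum.elim eB eC) a) = (Labels.three A B C).deg a := by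
    rintro (a | a | a)
    · exact hA.deg a
    · exact hB.deg a
    · exact hC.deg a
  have hp : ∀ x, (U.lev.γ d).p (outer (exLev n l) (Sum.elim eA (Sum.elim eB eC)) x) =
      ((Labels.three A B C).γ d).p x := by
    rintro ⟨s, x⟩
    simp [Grading.p, outer, Grading.ofDeg, hq]
  have hval := val_ofCoeff_of_sys tX.toSys (hA.pos n).inj (hC.pos l).inj (hA.pos n).l (hA.pos n).r
    (hC.pos l).l (hC.pos l).r hi ho
    (σ := fun W => ∑ᶠ D ∈ {D : Diagram Bool (Lab A ⊕ Lab B ⊕ Lab C) | True ∧ D.word = W},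
          D.weight d (Sum.elim Lab.deg (Sum.elim Lab.deg Lab.deg))
            (fun κ => if κ then G.coeff (fun y => Sum.inr (Sum.inl y)) (fun z => Sum.inr (Sum.inr z))
              else F.coeff Sum.inl (fun y => Sum.inr (Sum.inl y)))) (by
      intro W b hW h0
      rw [hX, comp_aux hA hB hC h1 h2 hF hG hW]
      exact smul_ne_zero (mul_ne_zero (sg_ne_zero _) h0) one_ne_zero)
  have hdrep : (Multi.comp d F G).drep (U.lev.γ d) 0 (Labels.pos (U := U) n eA)
      (Labels.pos (U := U) l eC) = X := by
    refine drep_eq_of_filled tX.toSys (fun w hw => ⟨tX.typed w hw, tX.exists_out w hw⟩)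
      (hA.pos n).l (hA.pos n).r (hC.pos l).l (hC.pos l).r ?_
    rintro W' b' ⟨φ, hφ⟩
    obtain ⟨W, b, h0⟩ := φ.endsOut_word (i := Sum.inl)
      (o := fun z => (Sum.inr (Sum.inr z) : Lab A ⊕ Lab B ⊕ Lab C))
    have h3 := φ.word_map_letter hi ho
    rw [h0, hφ, List.map_append] at h3
    obtain ⟨rfl, h4⟩ := List.append_inj' h3 rfl
    have h5 : outer (exLev n l) (Sum.elim eA (Sum.elim eB eC)) (true, b) = (true, b') := by
      simpa using h4
    have h6 := comp_aux (d := d) hA hB hC h1 h2 hF hG ⟨φ, h0⟩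
    rw [← hX, tX.cyc, h5] at h6
    have h7 : (Multi.comp d F G).coeff (Labels.pos (U := U) n eA) (Labels.pos (U := U) l eC)
        (φ.word (Labels.pos (U := U) n eA) (Labels.pos (U := U) l eC)) =
        (Multi.comp d F G).val φ := Multi.coeff_word _ (hA.pos n).inj (hC.pos l).inj φ
    rw [Multi.drep, Multi.rep, ccw_concat, ← hφ, h7, hφ, pow_zero]
    have h8 : (Multi.comp d F G).val φ = _ := hval φ
    rw [h8, h0]
    have h9 := congrArg (fun z => sg k ((U.lev.γ d).p (true, b') *
      (U.lev.γ d).pw (W.map (outer (exLev n l) (Sum.elim eA (Sum.elim eB eC))))) • z) h6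
    simp only [smul_smul, sg_mul_self, one_smul] at h9
    rw [h9]
    congr 1
    rw [← mul_assoc, ← sg_add, rsg, ← h5, pw_map hp, hp, ← add_assoc, CharTwo.add_self_eq_zero,
      zero_add]
    congr 2
    have h10 := tw_map (γ := U.lev.γ d) (ψ := outer (exLev n l) (Sum.elim eA (Sum.elim eB eC)))
      (fun _ => rfl) hp 0 (W ++ [(true, b)])
    rw [List.map_append] at h10
    exact h10
  -- Cyclic invariance and the absence of curvature are part of being a system. Systems only know
  -- parities, so the integral degree is computed separately by `TS_deg`.
  refine ⟨isOp_of_sys (hA.pos n) (hC.pos l) tX.toSys (fun w hw => ?_) hdrep, hdrep⟩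
  obtain ⟨h3, h4⟩ := restr_ne_zero hw
  refine TS_deg (fun w hw => ?_) h4
  have key : ∀ {A B : GrQuiver.{u, v, w} k O} {H : Multi A B} {i : Lab A → ℕ × U.L}
      {o : Lab B → ℕ × U.L}, U.lev.Emb i → U.lev.Emb o → IsOp d 0 H → ∀ w,
      H.drep (U.lev.γ d) 0 i o w ≠ 0 →
      outDeg d U.lev.deg w = inDeg d U.lev.deg w + (d + 1) := by
    intro A B H i o hi ho hH w hw
    have h5 := (Multi.homogeneous_iff hi.deg ho.deg hi.inj ho.inj).1 hH.homogeneous _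
      (Multi.coeff_norm_ne_zero (Multi.rep_ne_zero hw))
    rw [outDeg, inDeg, (((perm_norm w).filter _).map _).sum_eq,
      (((perm_norm w).filter _).map _).sum_eq] at h5
    rw [outDeg, inDeg, h5]
    simp
  by_cases h0 : F.drep (U.lev.γ d) 0 (Labels.pos (U := U) n eA) (Labels.pos (U := U) m eB) w = 0
  · rw [Pi.add_apply, h0, zero_add] at hw
    exact key (hB.pos m) (hC.pos l) hG w hw
  · exact key (hA.pos n) (hB.pos m) hF w h0
end
section
variable {k : Type w} [Field k] {O : Type u}

variable {A B : GrQuiver.{u, v, w} k O} {d : ℤ} {U : Labels.{u, max u v} O}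
  {eA : Lab A → U.L} {eB : Lab B → U.L} {n m l : ℕ}

/-! ### Compositions with perturbed identities -/

/-- The operation `F` with inputs at level `n` and outputs at level `m`. -/
abbrev opAt (U : Labels.{u, max u v} O) (d : ℤ) (j : ℕ) (F : Multi A B) (n m : ℕ)
    (eA : Lab A → U.L) (eB : Lab B → U.L) : List (Letter (ℕ × U.L)) → DualNumber k :=
  F.drep (U.lev.γ d) j (Labels.pos (U := U) n eA) (Labels.pos (U := U) m eB)

/-- The identity, perturbed by the odd operation `M`. -/
abbrev pert (U : Labels.{u, max u v} O) (d : ℤ) (M : Multi A A) (n m : ℕ) (eA : Lab A → U.L) :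
    List (Letter (ℕ × U.L)) → DualNumber k :=
  opAt U d 0 (Multi.one A) n m eA eA + opAt U d 1 M n m eA eA

lemma IsOp.tmor_pert {M : Multi A A} (hM : IsOp d 1 M) (hA : U.Emb eA) (n m : ℕ) :
    TMor U d eA eA n m (pert U d M n m eA) :=
  ((isOp_one d).tmor hA hA n m).add (hM.tmor hA hA n m)

lemma p_two (hA : U.Emb eA) (hB : U.Emb eB) (g : Bool → ℕ) (x : Letter (Lab A ⊕ Lab B)) :
    (U.lev.γ d).p (x.1, g x.1, Sum.elim eA eB x.2) = ((Labels.two A B).γ d).p x := by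
  rcases x with ⟨s, x | x⟩
  · simp [Grading.p, Grading.ofDeg, hA.deg]
  · simp [Grading.p, Grading.ofDeg, hB.deg]

lemma emb_two_left : (Labels.two A B).Emb (A := A) Sum.inl := Labels.emb_id.inl

lemma emb_two_right : (Labels.two A B).Emb (A := B) Sum.inr := Labels.emb_id.inr

lemma drep_one_fst {F : Multi A B} {Λ : Type t} {γ : Grading Λ O} {i : Lab A → Λ} {o : Lab B → Λ}
    (w : List (Letter Λ)) : (F.drep γ 1 i o w).fst = 0 := by
  simp [Multi.drep]

lemma drep_zero_snd {F : Multi A B} {Λ : Type t} {γ : Grading Λ O} {i : Lab A → Λ} {o : Lab B → Λ}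
    (w : List (Letter Λ)) : (F.drep γ 0 i o w).snd = 0 := by
  simp [Multi.drep]

/-- The words of the identity have even total parity, whereas a multiple of `ε` can be nonzero only
on words of odd parity. -/
lemma IsIdent.disjoint {u g : List (Letter (ℕ × U.L)) → DualNumber k}
    (hu : IsIdent (U.lev.γ d) n m eA u) (hg : ∀ w, Par ((U.lev.γ d).pw w + (U.lev.γ d).D) (g w))
    (hε : ∀ w, (g w).fst = 0) (w : List (Letter (ℕ × U.L))) (hw : u w ≠ 0) : g w = 0 := by
  have h1 : (U.lev.γ d).pw w + (U.lev.γ d).D = 0 := by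
    obtain ⟨a, rfl | rfl⟩ := hu.cases w hw <;>
    · simp only [Grading.pw_cons, Grading.pw_nil, Grading.p, Grading.ofDeg]
      simp
      generalize (U.deg (eA a) : ZMod 2) = x
      generalize (d : ZMod 2) = y
      decide +revert
  exact TrivSqZeroExt.ext (hε w) ((hg w).1 h1)

/-- Inputs carry labels of `A` and outputs labels of `B`, so an output of one such disc never
matches an input of another. -/
lemma typed_disjoint {c : List (Letter (Lab A ⊕ Lab B)) → DualNumber k}
    (hc : ∀ w, c w ≠ 0 → Multi.Typed Sum.inl Sum.inr w) (w w' : List (Letter (Lab A ⊕ Lab B)))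
    (x : Letter (Lab A ⊕ Lab B)) (j : ZMod 2) (hx : x ∈ w) (hx' : bar x ∈ w') :
    c w * tau j (c w') = 0 := by
  by_contra h0
  have m1 := left_ne_zero_of_mul h0
  have m2 : c w' ≠ 0 := fun h3 => h0 (by simp [h3])
  rcases x with ⟨s, x⟩
  rcases hc _ m1 _ hx with ⟨h3, a, h4⟩ | ⟨h3, a, h4⟩ <;>
    rcases hc _ m2 _ hx' with ⟨h5, b, h6⟩ | ⟨h5, b, h6⟩ <;> simp_all [bar]
  all_goals (subst h4; simp at h6)

lemma transfer_zero {Λ Λ₀ : Type t} {i : Lab A → Λ₀} {o : Lab B → Λ₀}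
    {ψ : Letter Λ₀ → Letter Λ} : Transfer (k := k) i o ψ 0 0 :=
  ⟨fun _ h => absurd rfl h, fun _ h => absurd rfl h, fun _ h => absurd rfl h, fun _ _ => rfl,
    fun _ h => absurd rfl h⟩

lemma finsum_diagrams_of_zero {Λ : Type t} {γ : Grading Λ O}
    {c : Bool → List (Letter Λ) → DualNumber k}
    (hc : ∀ w w' x n, x ∈ w → bar x ∈ w' → c false w * tau n (c false w') = 0)
    (h0 : ∀ w, c true w = 0) (b : Λ) (B : List (Letter Λ))
    (hfin : ({p : Bool × Legs Bool Λ | p.2.bd = B} ∩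
      Function.support fun p => c p.1 ((true, b) :: p.2.arr) * p.2.om γ c).Finite) :
    ∑ᶠ p ∈ {p : Bool × Legs Bool Λ | p.2.bd = B}, c p.1 ((true, b) :: p.2.arr) * p.2.om γ c =
      c false ((true, b) :: B) := by
  rw [finsum_diagrams hc (fun w => by rw [h0]; rfl) b B hfin,
    finsum_mem_eq_zero_of_forall_eq_zero, add_zero]
  rintro ⟨κ, L⟩ ⟨-, h1⟩
  cases κ
  · rw [L.om_eq_zero h0, mul_zero]
    simp only [Diagram.ops] at h1
    rw [List.count_cons_of_ne (by simp)] at h1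
    rw [h1]
    exact one_ne_zero
  · simp only [h0, zero_mul]

/-- The identity is neutral on the side of the inputs. -/
lemma left_unit (hA : U.Emb eA) (hB : U.Emb eB) (h1 : n < m) (h2 : m < l)
    {f₀ : List (Letter (Lab A ⊕ Lab B)) → DualNumber k}
    {f f' : List (Letter (ℕ × U.L)) → DualNumber k}
    (hf : Transfer Sum.inl Sum.inr
      (lift (fun κ => compLev n m l (!κ)) (Sum.elim eA eB) false) f₀ f)
    (hf' : Transfer Sum.inl Sum.inr (outer (exLev n l) (Sum.elim eA eB)) f₀ f')
    (tf : TMor U d eA eB m l f) (tf' : TMor U d eA eB n l f') :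
    wcomp (U.lev.γ d) Prod.fst m (opAt U d 0 (Multi.one A) n m eA eA) f = f' := by
  have hu := isIdent_one (d := d) hA n m
  have tu := (isOp_one (A := A) d).tmor hA hA n m
  refine (tu.wcomp tf h1 h2).ext_filled hA hB tf' (i₀ := Sum.inl) (o₀ := Sum.inr)
    (ψ := outer (exLev n l) (Sum.elim eA eB)) (fun _ => rfl) (fun _ => rfl) fun W b hW => ?_
  obtain ⟨hT, hW'⟩ := typed_of_filled hW
  -- Neutrality is the case of a vanishing perturbation: only diagrams with a single disc filled
  -- with `f₀` remain.
  have hb := bridge_left (d := d) (c := fun κ => if κ then 0 else f₀) (g := 0) hA hB h1 h2 hf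
    transfer_zero hu (fun _ _ => rfl) (fun w hw => tu.eq_zero tf h2.ne hw) (fun _ _ => rfl)
    (fun _ => rfl)
  rw [add_zero] at hb
  obtain ⟨hfin, hTS⟩ := hb.TS_eq b W (Or.inr hT) hW' (tu.finite_trees tf h1 h2 _ _)
  rw [wcomp_eq_TS h1 h2]
  refine hTS.trans ?_
  refine (finsum_diagrams_of_zero (γ := (Labels.two A B).γ d)
    (c := fun κ => if κ then 0 else f₀) (typed_disjoint hf.typed) (fun _ => rfl) b W hfin).trans ?_
  have h3 := hf'.map ((true, b) :: W) (by
    intro x hx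
    rcases List.mem_cons.1 hx with rfl | hx
    · exact Or.inr hT
    · exact hW' x hx)
  exact h3.symm

/-- The identity is neutral on the side of the outputs. -/
lemma right_unit (hA : U.Emb eA) (hB : U.Emb eB) (h1 : n < m) (h2 : m < l)
    {f₀ : List (Letter (Lab A ⊕ Lab B)) → DualNumber k}
    {f f' : List (Letter (ℕ × U.L)) → DualNumber k}
    (hf : Transfer Sum.inl Sum.inr (lift (compLev n m l) (Sum.elim eA eB) false) f₀ f)
    (hf' : Transfer Sum.inl Sum.inr (outer (exLev n l) (Sum.elim eA eB)) f₀ f')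
    (tf : TMor U d eA eB n m f) (tf' : TMor U d eA eB n l f') :
    wcomp (U.lev.γ d) Prod.fst m f (opAt U d 0 (Multi.one B) m l eB eB) = f' := by
  have hu := isIdent_one (d := d) hB m l
  have tu := (isOp_one (A := B) d).tmor hB hB m l
  refine (tf.wcomp tu h1 h2).ext_filled hA hB tf' (i₀ := Sum.inl) (o₀ := Sum.inr)
    (ψ := outer (exLev n l) (Sum.elim eA eB)) (fun _ => rfl) (fun _ => rfl) fun W b hW => ?_
  obtain ⟨hT, hW'⟩ := typed_of_filled hW
  have hb := bridge_right (d := d) (c := fun κ => if κ then 0 else f₀) (g := 0) hA hB h1 h2 hf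
    transfer_zero hu (fun _ _ => rfl) (fun w hw => tu.eq_zero tf h2.ne' hw) (fun _ _ => rfl)
    (fun _ => rfl)
  rw [add_zero] at hb
  obtain ⟨hfin, hTS⟩ := hb.TS_eq b W (Or.inr hT) hW' (tf.finite_trees tu h1 h2 _ _)
  rw [wcomp_eq_TS h1 h2]
  refine hTS.trans ?_
  refine (finsum_diagrams_of_zero (γ := (Labels.two A B).γ d)
    (c := fun κ => if κ then 0 else f₀) (typed_disjoint hf.typed) (fun _ => rfl) b W hfin).trans ?_
  have h3 := hf'.map ((true, b) :: W) (by
    intro x hx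
    rcases List.mem_cons.1 hx with rfl | hx
    · exact Or.inr hT
    · exact hW' x hx)
  exact h3.symm

lemma sum_odd (L : List Bool) : (L.map fun κ => if κ then 1 else 0).sum = L.count true := by
  induction L with
  | nil => rfl
  | cons κ L ih => cases κ <;> simp [ih, add_comm]

-- First order expansion of `(Id + ε M)` followed by `F`: the constant term is `F`, and the
-- coefficient of `ε` is the sum over diagrams with one disc filled with `M`, which defines the
-- multinecklace composition.
set_option maxHeartbeats 1000000 in
lemma left_aux (hA : U.Emb eA) (hB : U.Emb eB) (h1 : n < m) (h2 : m < l)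
    {F : Multi A B} {M : Multi A A} (hF : IsOp d 0 F) (hM : IsOp d 1 M)
    {W : List (Letter (Lab A ⊕ Lab B))} {b : Lab A ⊕ Lab B}
    (hW : ∃ f : Filled A B, f.word Sum.inl Sum.inr = W ++ [(true, b)]) :
    wcomp (U.lev.γ d) Prod.fst m (pert U d M n m eA) (opAt U d 0 F m l eA eB)
      (outer (exLev n l) (Sum.elim eA eB) (true, b) ::
        W.map (outer (exLev n l) (Sum.elim eA eB))) =
      F.drep ((Labels.two A B).γ d) 0 Sum.inl Sum.inr ((true, b) :: W) +
      (sg k (rsg ((Labels.two A B).γ d) W b) *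
        ∑ᶠ D ∈ {D : Diagram Bool (Lab A ⊕ Lab B) | D.ops.count true = 1 ∧
            D.word = W ++ [(true, b)]},
          D.weight d (Sum.elim Lab.deg Lab.deg)
            (fun κ => if κ then M.coeff Sum.inl Sum.inl else F.coeff Sum.inl Sum.inr)) •
        DualNumber.eps := by
  set γ₀ := (Labels.two A B).γ d with hγ₀
  have tF := hF.tmor hA hB m l
  have tM := hM.tmor hA hA n m
  have hu := isIdent_one (d := d) hA n m
  have tu := (isOp_one (A := A) d).tmor hA hA n m
  have hp : ∀ κ x, (U.lev.γ d).p (lift (fun κ => compLev n m l (!κ)) (Sum.elim eA eB) κ x) =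
      γ₀.p x := fun κ x => p_two hA hB _ x
  have fF := hF.transfer (γ₀ := γ₀) (i₀ := Sum.inl) (o₀ := Sum.inr) Sum.inl_injective
    Sum.inr_injective (hA.pos m).inj (hB.pos l).inj
    (ψ := lift (fun κ => compLev n m l (!κ)) (Sum.elim eA eB) false) (fun _ => rfl) (hp false)
    (fun _ => rfl) (fun _ => rfl)
  have fM := hM.transfer (γ₀ := γ₀) (i₀ := Sum.inl) (o₀ := Sum.inl) Sum.inl_injective
    Sum.inl_injective (hA.pos n).inj (hA.pos m).inj
    (ψ := lift (fun κ => compLev n m l (!κ)) (Sum.elim eA eB) true) (fun _ => rfl) (hp true)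
    (fun _ => rfl) (fun _ => rfl)
  let c : Bool → List (Letter (Lab A ⊕ Lab B)) → k := fun κ =>
    if κ then M.coeff Sum.inl Sum.inl else F.coeff Sum.inl Sum.inr
  let odd : Bool → ℕ := fun κ => if κ then 1 else 0
  have hb := bridge_left (d := d) (c := fun κ W => ccw γ₀ (c κ) W • DualNumber.eps ^ odd κ)
    hA hB h1 h2 fF fM hu (fun w hw => tF.eq_zero tM h2.ne' hw)
    (fun w hw => tu.eq_zero tF h2.ne hw) (hu.disjoint tM.par drep_one_fst)
    (fun w => drep_one_fst (F := M) (γ := γ₀) (i := Sum.inl) (o := Sum.inl) w)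
  obtain ⟨hT, hW'⟩ := typed_of_filled hW
  obtain ⟨hfin, hTS⟩ := hb.TS_eq b W (Or.inr hT) hW'
    ((hM.tmor_pert hA n m).finite_trees tF h1 h2 _ _)
  rw [wcomp_eq_TS h1 h2]
  refine hTS.trans ?_
  refine (finsum_diagrams (γ := γ₀) (c := fun κ W => ccw γ₀ (c κ) W • DualNumber.eps ^ odd κ)
    (typed_disjoint fF.typed)
    (fun w => drep_one_fst (F := M) (γ := γ₀) (i := Sum.inl) (o := Sum.inl) w) b W hfin).trans ?_
  congr 1
  refine (finsum_weight (γ := γ₀) (c := c) (odd := odd) (n := 1)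
    (S := fun D => D.ops.count true = 1) ((Labels.two A B).of_γ d) ?_ ?_ le_rfl ?_ W b).trans ?_
  · rintro (_ | _) x w
    · exact hF.rep_cyc emb_two_left emb_two_right x w
    · exact hM.rep_cyc emb_two_left emb_two_left x w
  · rintro (_ | _) w hw
    · simp only [c, Bool.false_eq_true, if_false] at hw
      exact hF.par emb_two_left emb_two_right hw
    · simp only [c, if_true] at hw
      exact hM.par emb_two_left emb_two_left hw
  · intro D hD
    exact (sum_odd D.ops).trans hD
  · rw [pow_one]

-- The corresponding expansion of `F` followed by `(Id + ε M)`, whose coefficient of `ε` is the sum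
-- defining the pre composition.
set_option maxHeartbeats 1000000 in
lemma right_aux (hA : U.Emb eA) (hB : U.Emb eB) (h1 : n < m) (h2 : m < l)
    {F : Multi A B} {M : Multi B B} (hF : IsOp d 0 F) (hM : IsOp d 1 M)
    {W : List (Letter (Lab A ⊕ Lab B))} {b : Lab A ⊕ Lab B}
    (hW : ∃ f : Filled A B, f.word Sum.inl Sum.inr = W ++ [(true, b)]) :
    wcomp (U.lev.γ d) Prod.fst m (opAt U d 0 F n m eA eB) (pert U d M m l eB)
      (outer (exLev n l) (Sum.elim eA eB) (true, b) ::
        W.map (outer (exLev n l) (Sum.elim eA eB))) =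
      F.drep ((Labels.two A B).γ d) 0 Sum.inl Sum.inr ((true, b) :: W) +
      (sg k (rsg ((Labels.two A B).γ d) W b) *
        ∑ᶠ D ∈ {D : Diagram Bool (Lab A ⊕ Lab B) | D.ops.count true = 1 ∧
            D.word = W ++ [(true, b)]},
          D.weight d (Sum.elim Lab.deg Lab.deg)
            (fun κ => if κ then M.coeff Sum.inr Sum.inr else F.coeff Sum.inl Sum.inr)) •
        DualNumber.eps := by
  set γ₀ := (Labels.two A B).γ d with hγ₀
  have tF := hF.tmor hA hB n m
  have tM := hM.tmor hB hB m l
  have hu := isIdent_one (d := d) hB m l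
  have tu := (isOp_one (A := B) d).tmor hB hB m l
  have hp : ∀ κ x, (U.lev.γ d).p (lift (compLev n m l) (Sum.elim eA eB) κ x) =
      γ₀.p x := fun κ x => p_two hA hB _ x
  have fF := hF.transfer (γ₀ := γ₀) (i₀ := Sum.inl) (o₀ := Sum.inr) Sum.inl_injective
    Sum.inr_injective (hA.pos n).inj (hB.pos m).inj
    (ψ := lift (compLev n m l) (Sum.elim eA eB) false) (fun _ => rfl) (hp false)
    (fun _ => rfl) (fun _ => rfl)
  have fM := hM.transfer (γ₀ := γ₀) (i₀ := Sum.inr) (o₀ := Sum.inr) Sum.inr_injective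
    Sum.inr_injective (hB.pos m).inj (hB.pos l).inj
    (ψ := lift (compLev n m l) (Sum.elim eA eB) true) (fun _ => rfl) (hp true)
    (fun _ => rfl) (fun _ => rfl)
  let c : Bool → List (Letter (Lab A ⊕ Lab B)) → k := fun κ =>
    if κ then M.coeff Sum.inr Sum.inr else F.coeff Sum.inl Sum.inr
  let odd : Bool → ℕ := fun κ => if κ then 1 else 0
  have hb := bridge_right (d := d) (c := fun κ W => ccw γ₀ (c κ) W • DualNumber.eps ^ odd κ)
    hA hB h1 h2 fF fM hu (fun w hw => tF.eq_zero tM h2.ne hw)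
    (fun w hw => tu.eq_zero tF h2.ne' hw) (hu.disjoint tM.par drep_one_fst)
    (fun w => drep_one_fst (F := M) (γ := γ₀) (i := Sum.inr) (o := Sum.inr) w)
  obtain ⟨hT, hW'⟩ := typed_of_filled hW
  obtain ⟨hfin, hTS⟩ := hb.TS_eq b W (Or.inr hT) hW'
    (tF.finite_trees (hM.tmor_pert hB m l) h1 h2 _ _)
  rw [wcomp_eq_TS h1 h2]
  refine hTS.trans ?_
  refine (finsum_diagrams (γ := γ₀) (c := fun κ W => ccw γ₀ (c κ) W • DualNumber.eps ^ odd κ)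
    (typed_disjoint fF.typed)
    (fun w => drep_one_fst (F := M) (γ := γ₀) (i := Sum.inr) (o := Sum.inr) w) b W hfin).trans ?_
  congr 1
  refine (finsum_weight (γ := γ₀) (c := c) (odd := odd) (n := 1)
    (S := fun D => D.ops.count true = 1) ((Labels.two A B).of_γ d) ?_ ?_ le_rfl ?_ W b).trans ?_
  · rintro (_ | _) x w
    · exact hF.rep_cyc emb_two_left emb_two_right x w
    · exact hM.rep_cyc emb_two_right emb_two_right x w
  · rintro (_ | _) w hw
    · simp only [c, Bool.false_eq_true, if_false] at hw
      exact hF.par emb_two_left emb_two_right hw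
    · simp only [c, if_true] at hw
      exact hM.par emb_two_right emb_two_right hw
  · intro D hD
    exact (sum_odd D.ops).trans hD
  · rw [pow_one]
end
section
variable {k : Type w} [Field k] {O : Type u}

variable {A B : GrQuiver.{u, v, w} k O} {d : ℤ} {U : Labels.{u, max u v} O}
  {eA : Lab A → U.L} {eB : Lab B → U.L} {n m m' l : ℕ}

lemma ne_zero_of_snd {x y : DualNumber k} {a b : k} (hx : x.snd = 0)
    (h : y = x + (a * b) • DualNumber.eps) (ha : a ≠ 0) (hb : b ≠ 0) : y ≠ 0 := by
  intro h0
  rw [h0] at h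
  have h1 := congrArg TrivSqZeroExt.snd h
  simp [hx, ha, hb] at h1

/-- The sum over diagrams is, up to sign, the `ε`-part of a system of coefficients, so its columns
are finite and `Multi.ofCoeff` reproduces it. The levels `0`, `1`, `2` are just some increasing
choice. -/
lemma val_multinecklace {F : Multi A B} {M : Multi A A} (hF : IsOp d 0 F) (hM : IsOp d 1 M)
    (f : Filled A B) : (multinecklace d F M).val f =
      ∑ᶠ D ∈ {D : Diagram Bool (Lab A ⊕ Lab B) | D.ops.count true = 1 ∧
            D.word = f.word Sum.inl Sum.inr},
          D.weight d (Sum.elim Lab.deg Lab.deg)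
            (fun κ => if κ then M.coeff Sum.inl Sum.inl else F.coeff Sum.inl Sum.inr) := by
  have hA : (Labels.two A B).Emb (A := A) Sum.inl := emb_two_left
  have hB : (Labels.two A B).Emb (A := B) Sum.inr := emb_two_right
  have tX := (hM.tmor_pert hA 0 1).wcomp (hF.tmor hA hB 1 2) (by omega) (by omega)
  have h := val_ofCoeff_of_sys tX.toSys (hA.pos 0).inj (hB.pos 2).inj (hA.pos 0).l (hA.pos 0).r
    (hB.pos 2).l (hB.pos 2).r (i₀ := (Sum.inl : Lab A → Lab A ⊕ Lab B)) (o₀ := Sum.inr)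
    (ψ := outer (exLev 0 2) (Sum.elim Sum.inl Sum.inr)) (fun _ => rfl) (fun _ => rfl)
    (σ := fun W => ∑ᶠ D ∈ {D : Diagram Bool (Lab A ⊕ Lab B) | D.ops.count true = 1 ∧ D.word = W},
      D.weight d (Sum.elim Lab.deg Lab.deg)
        (fun κ => if κ then M.coeff Sum.inl Sum.inl else F.coeff Sum.inl Sum.inr))
    (fun W b hW h0 => ?_)
  · exact h f
  exact ne_zero_of_snd (drep_zero_snd _)
    (left_aux hA hB (by omega : 0 < 1) (by omega : 1 < 2) hF hM hW) (sg_ne_zero _) h0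

lemma val_precomposition {F : Multi A B} {M : Multi B B} (hF : IsOp d 0 F) (hM : IsOp d 1 M)
    (f : Filled A B) : (precomposition d M F).val f =
      ∑ᶠ D ∈ {D : Diagram Bool (Lab A ⊕ Lab B) | D.ops.count true = 1 ∧
            D.word = f.word Sum.inl Sum.inr},
          D.weight d (Sum.elim Lab.deg Lab.deg)
            (fun κ => if κ then M.coeff Sum.inr Sum.inr else F.coeff Sum.inl Sum.inr) := by
  have hA : (Labels.two A B).Emb (A := A) Sum.inl := emb_two_left
  have hB : (Labels.two A B).Emb (A := B) Sum.inr := emb_two_right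
  have tX := (hF.tmor hA hB 0 1).wcomp (hM.tmor_pert hB 1 2) (by omega) (by omega)
  have h := val_ofCoeff_of_sys tX.toSys (hA.pos 0).inj (hB.pos 2).inj (hA.pos 0).l (hA.pos 0).r
    (hB.pos 2).l (hB.pos 2).r (i₀ := (Sum.inl : Lab A → Lab A ⊕ Lab B)) (o₀ := Sum.inr)
    (ψ := outer (exLev 0 2) (Sum.elim Sum.inl Sum.inr)) (fun _ => rfl) (fun _ => rfl)
    (σ := fun W => ∑ᶠ D ∈ {D : Diagram Bool (Lab A ⊕ Lab B) | D.ops.count true = 1 ∧ D.word = W},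
      D.weight d (Sum.elim Lab.deg Lab.deg)
        (fun κ => if κ then M.coeff Sum.inr Sum.inr else F.coeff Sum.inl Sum.inr))
    (fun W b hW h0 => ?_)
  · exact h f
  exact ne_zero_of_snd (drep_zero_snd _)
    (right_aux hA hB (by omega : 0 < 1) (by omega : 1 < 2) hF hM hW) (sg_ne_zero _) h0

/-- The compatibility of a morphism with structures in terms of systems of coefficients. -/
theorem compatible_iff (hA : U.Emb eA) (hB : U.Emb eB) (h1 : n < m) (h2 : m < l) (h1' : n < m')
    (h2' : m' < l) {F : Multi A B} {M : Multi A A} {N : Multi B B} (hF : IsOp d 0 F)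
    (hM : IsOp d 1 M) (hN : IsOp d 1 N) :
    multinecklace d F M = precomposition d N F ↔
      wcomp (U.lev.γ d) Prod.fst m (pert U d M n m eA) (opAt U d 0 F m l eA eB) =
        wcomp (U.lev.γ d) Prod.fst m' (opAt U d 0 F n m' eA eB) (pert U d N m' l eB) := by
  constructor
  · intro h
    have tX := (hM.tmor_pert hA n m).wcomp (hF.tmor hA hB m l) h1 h2
    have tY := (hF.tmor hA hB n m').wcomp (hN.tmor_pert hB m' l) h1' h2'
    refine tX.ext_filled hA hB tY (i₀ := Sum.inl) (o₀ := Sum.inr)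
      (ψ := outer (exLev n l) (Sum.elim eA eB)) (fun _ => rfl) (fun _ => rfl) ?_
    rintro W b ⟨f, hf⟩
    refine (left_aux hA hB h1 h2 hF hM ⟨f, hf⟩).trans
      (Eq.trans ?_ (right_aux hA hB h1' h2' hF hN ⟨f, hf⟩).symm)
    have h3 := val_multinecklace hF hM f
    have h4 := val_precomposition hF hN f
    rw [hf] at h3 h4
    rw [← h3, ← h4, h]
  · intro h
    refine Multi.ext_val fun f => ?_
    obtain ⟨W, b, hf⟩ := f.endsOut_word (i := Sum.inl) (o := Sum.inr)
    have h3 := val_multinecklace hF hM f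
    have h4 := val_precomposition hF hN f
    rw [hf] at h3 h4
    have h5 := left_aux hA hB h1 h2 hF hM ⟨f, hf⟩
    have h6 := right_aux hA hB h1' h2' hF hN ⟨f, hf⟩
    rw [← h3] at h5
    rw [← h4] at h6
    rw [h] at h5
    -- The constant terms are both `F` and cancel; the coefficients of `ε` carry the same sign on
    -- both sides.
    have h7 := congrArg TrivSqZeroExt.snd (add_left_cancel (h5.symm.trans h6))
    simpa [sg_ne_zero] using h7

lemma transfer_outer {F : Multi A B} {j : ℕ} (hF : IsOp d j F) (hA : U.Emb eA) (hB : U.Emb eB)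
    (n l : ℕ) : Transfer Sum.inl Sum.inr (outer (exLev n l) (Sum.elim eA eB))
      (F.drep ((Labels.two A B).γ d) j Sum.inl Sum.inr) (opAt U d j F n l eA eB) :=
  hF.transfer Sum.inl_injective Sum.inr_injective (hA.pos n).inj (hB.pos l).inj (fun _ => rfl)
    (fun x => p_two hA hB _ x) (fun _ => rfl) (fun _ => rfl)

lemma left_unit_op (hA : U.Emb eA) (hB : U.Emb eB) (h1 : n < m) (h2 : m < l) {F : Multi A B}
    (hF : IsOp d 0 F) :
    wcomp (U.lev.γ d) Prod.fst m (opAt U d 0 (Multi.one A) n m eA eA) (opAt U d 0 F m l eA eB) =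
      opAt U d 0 F n l eA eB :=
  left_unit hA hB h1 h2 (transfer_outer hF hA hB m l) (transfer_outer hF hA hB n l)
    (hF.tmor hA hB m l) (hF.tmor hA hB n l)

lemma right_unit_op (hA : U.Emb eA) (hB : U.Emb eB) (h1 : n < m) (h2 : m < l) {F : Multi A B}
    (hF : IsOp d 0 F) :
    wcomp (U.lev.γ d) Prod.fst m (opAt U d 0 F n m eA eB) (opAt U d 0 (Multi.one B) m l eB eB) =
      opAt U d 0 F n l eA eB :=
  right_unit hA hB h1 h2 (transfer_outer hF hA hB n m) (transfer_outer hF hA hB n l)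
    (hF.tmor hA hB n m) (hF.tmor hA hB n l)

/-- The identity is compatible with every structure. -/
theorem compatible_one {M : Multi A A} (hM : IsOp d 1 M) :
    multinecklace d (Multi.one A) M = precomposition d M (Multi.one A) := by
  have hA : (Labels.of A).Emb (A := A) id := Labels.emb_id
  have h1 : (0 : ℕ) < 1 := by omega
  have h2 : (1 : ℕ) < 2 := by omega
  rw [compatible_iff hA hA h1 h2 h1 h2 (isOp_one d) hM hM]
  -- Neutrality of the identity is applied to `Id + ε M` itself, on both sides.
  have e1 := right_unit hA hA h1 h2
    ((transfer_outer (isOp_one d) hA hA 0 1).add (transfer_outer hM hA hA 0 1))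
    ((transfer_outer (isOp_one d) hA hA 0 2).add (transfer_outer hM hA hA 0 2))
    (hM.tmor_pert hA 0 1) (hM.tmor_pert hA 0 2)
  have e2 := left_unit hA hA h1 h2
    ((transfer_outer (isOp_one d) hA hA 1 2).add (transfer_outer hM hA hA 1 2))
    ((transfer_outer (isOp_one d) hA hA 0 2).add (transfer_outer hM hA hA 0 2))
    (hM.tmor_pert hA 1 2) (hM.tmor_pert hA 0 2)
  exact e1.trans e2.symm

lemma Multi.ext_drep {F G : Multi A B} (hA : U.Emb eA) (hB : U.Emb eB)
    (h : opAt U d 0 F n l eA eB = opAt U d 0 G n l eA eB) : F = G := by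
  refine Multi.ext_rep (γ := U.lev.γ d) (hA.pos n).inj (hB.pos l).inj fun W b _ => ?_
  have h1 := congrArg TrivSqZeroExt.fst (congrFun h (W ++ [(true, b)]))
  simpa [Multi.drep] using h1

theorem one_comp {F : Multi A B} (hF : IsOp d 0 F) : Multi.comp d (Multi.one A) F = F := by
  have hA : (Labels.two A B).Emb (A := A) Sum.inl := emb_two_left
  have hB : (Labels.two A B).Emb (A := B) Sum.inr := emb_two_right
  have h1 : (0 : ℕ) < 1 := by omega
  have h2 : (1 : ℕ) < 2 := by omega
  refine Multi.ext_drep (d := d) (n := 0) (l := 2) hA hB ?_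
  exact (comp_spec hA hA hB h1 h2 (isOp_one d) hF).2.trans (left_unit_op hA hB h1 h2 hF)

theorem comp_one {F : Multi A B} (hF : IsOp d 0 F) : Multi.comp d F (Multi.one B) = F := by
  have hA : (Labels.two A B).Emb (A := A) Sum.inl := emb_two_left
  have hB : (Labels.two A B).Emb (A := B) Sum.inr := emb_two_right
  have h1 : (0 : ℕ) < 1 := by omega
  have h2 : (1 : ℕ) < 2 := by omega
  refine Multi.ext_drep (d := d) (n := 0) (l := 2) hA hB ?_
  exact (comp_spec hA hB hB h1 h2 hF (isOp_one d)).2.trans (right_unit_op hA hB h1 h2 hF)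

variable {C D : GrQuiver.{u, v, w} k O}

/-- In the disjoint union of the four sets of labels, with levels `0 < 1 < 2 < 3`, this is
`wcomp_assoc`, since operations are determined by their coefficients. -/
theorem comp_assoc {F : Multi A B} {G : Multi B C} {H : Multi C D} (hF : IsOp d 0 F)
    (hG : IsOp d 0 G) (hH : IsOp d 0 H) :
    Multi.comp d (Multi.comp d F G) H = Multi.comp d F (Multi.comp d G H) := by
  let U := ((Labels.of A).sum (Labels.of B)).sum ((Labels.of C).sum (Labels.of D))
  have hA : U.Emb (A := A) fun a => Sum.inl (Sum.inl a) := Labels.emb_id.inl.inl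
  have hB : U.Emb (A := B) fun a => Sum.inl (Sum.inr a) := Labels.emb_id.inr.inl
  have hC : U.Emb (A := C) fun a => Sum.inr (Sum.inl a) := Labels.emb_id.inl.inr
  have hD : U.Emb (A := D) fun a => Sum.inr (Sum.inr a) := Labels.emb_id.inr.inr
  have h1 : (0 : ℕ) < 1 := by omega
  have h2 : (1 : ℕ) < 2 := by omega
  have h3 : (2 : ℕ) < 3 := by omega
  have cFG := comp_spec hA hB hC h1 h2 hF hG
  have cGH := comp_spec hB hC hD h2 h3 hG hH
  refine Multi.ext_drep (d := d) (n := 0) (l := 3) hA hD ?_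
  rw [opAt, (comp_spec hA hC hD (h1.trans h2) h3 cFG.1 hH).2, cFG.2, opAt,
    (comp_spec hA hB hD h1 (h2.trans h3) hF cGH.1).2, cGH.2]
  exact wcomp_assoc (hF.tmor hA hB 0 1).toWMor (hG.tmor hB hC 1 2).toWMor
    (hH.tmor hC hD 2 3).toWMor h1 h2 h3

/-- The composition of morphisms compatible with structures is compatible with structures. -/
theorem compatible_comp {F : Multi A B} {G : Multi B C} {M : Multi A A} {N : Multi B B}
    {K : Multi C C} (hF : IsOp d 0 F) (hG : IsOp d 0 G) (hM : IsOp d 1 M) (hN : IsOp d 1 N)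
    (hK : IsOp d 1 K) (hFc : multinecklace d F M = precomposition d N F)
    (hGc : multinecklace d G N = precomposition d K G) :
    multinecklace d (Multi.comp d F G) M = precomposition d K (Multi.comp d F G) := by
  have hA : (Labels.three A B C).Emb (A := A) Sum.inl := Labels.emb_id.inl
  have hB : (Labels.three A B C).Emb (A := B) fun y => Sum.inr (Sum.inl y) :=
    Labels.emb_id.inl.inr
  have hC : (Labels.three A B C).Emb (A := C) fun y => Sum.inr (Sum.inr y) :=
    Labels.emb_id.inr.inr
  have h01 : (0 : ℕ) < 1 := by omega
  have h12 : (1 : ℕ) < 2 := by omega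
  have h23 : (2 : ℕ) < 3 := by omega
  have h02 : (0 : ℕ) < 2 := by omega
  have h13 : (1 : ℕ) < 3 := by omega
  have hFG := (comp_spec hA hB hC h01 h12 hF hG).1
  rw [compatible_iff hA hC h01 h13 h02 h23 hFG hM hK]
  have eF := (compatible_iff hA hB h01 h12 h01 h12 hF hM hN).1 hFc
  have eG := (compatible_iff hB hC h12 h23 h12 h23 hG hN hK).1 hGc
  have c1 := (comp_spec hA hB hC h12 h23 hF hG).2
  have c2 := (comp_spec hA hB hC h01 h12 hF hG).2
  rw [opAt, c1, opAt, c2]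
  -- In order of composition: `(1 + ε M)(F G) = ((1 + ε M) F) G = (F (1 + ε N)) G = F ((1 + ε N) G)
  -- = F (G (1 + ε K)) = (F G)(1 + ε K)`.
  rw [← wcomp_assoc (hM.tmor_pert hA 0 1).toWMor (hF.tmor hA hB 1 2).toWMor
    (hG.tmor hB hC 2 3).toWMor h01 h12 h23, eF,
    wcomp_assoc (hF.tmor hA hB 0 1).toWMor (hN.tmor_pert hB 1 2).toWMor
    (hG.tmor hB hC 2 3).toWMor h01 h12 h23, eG,
    ← wcomp_assoc (hF.tmor hA hB 0 1).toWMor (hG.tmor hB hC 1 2).toWMor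
    (hK.tmor_pert hC 2 3).toWMor h01 h12 h23]
end
section
variable {k : Type w} [Field k] {O P : Type u}

/-! ### Restriction along a map of sets of objects -/

/-- The label of `A` underlying a label of the restriction of `A`. -/
def plab (f : O → P) {A : GrQuiver.{u, v, w} k P} (a : Lab (A.pull f)) : Lab A :=
  ⟨f a.l, f a.r, a.e⟩

/-- The disc labelled in `A` and `B` underlying a disc labelled in their restrictions. -/
def Filled.push (f : O → P) {A B : GrQuiver.{u, v, w} k P} (φ : Filled (A.pull f) (B.pull f)) :
    Filled A B :=
  ⟨φ.τ.map f, φ.a, φ.b⟩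

section Lifts
variable {f : O → P} {A B : GrQuiver.{u, v, w} k P} {d : ℤ}

/-- A label of the restricted quiver is a label of `A` together with chosen preimages of its two
objects. -/
lemma lifts_of (f : O → P) (A : GrQuiver.{u, v, w} k P) (d : ℤ) :
    Lifts ((Labels.of (A.pull f)).γ d) ((Labels.of A).γ d) (plab f) f where
  q _ := rfl
  D := rfl
  l _ := rfl
  r _ := rfl
  lift := by
    rintro ⟨l, r, e⟩ p q hp hq
    obtain rfl : l = f p := hp
    obtain rfl : r = f q := hq
    exact ⟨⟨p, q, e⟩, rfl, rfl, rfl⟩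
  inj := by
    rintro ⟨l, r, e⟩ ⟨l', r', e'⟩ hl hr h
    obtain rfl : l = l' := hl
    obtain rfl : r = r' := hr
    have h1 := (Lab.mk.inj (show (⟨f l, f r, e⟩ : Lab A) = ⟨f l, f r, e'⟩ from h)).2.2
    obtain rfl : e = e' := eq_of_heq h1
    rfl

variable {U' V' : Labels.{u, t} O} {U V : Labels.{u, t} P} {π : U'.L → U.L} {ρ : V'.L → V.L}

lemma Lifts.sum (h : Lifts (U'.γ d) (U.γ d) π f) (h' : Lifts (V'.γ d) (V.γ d) ρ f) :
    Lifts ((U'.sum V').γ d) ((U.sum V).γ d) (Sum.map π ρ) f where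
  q := by
    rintro (a | a)
    · exact h.q a
    · exact h'.q a
  D := rfl
  l := by
    rintro (a | a)
    · exact h.l a
    · exact h'.l a
  r := by
    rintro (a | a)
    · exact h.r a
    · exact h'.r a
  lift := by
    rintro (a | a) p q hp hq
    · obtain ⟨b, h1, h2, rfl⟩ := h.lift a p q hp hq
      exact ⟨Sum.inl b, h1, h2, rfl⟩
    · obtain ⟨b, h1, h2, rfl⟩ := h'.lift a p q hp hq
      exact ⟨Sum.inr b, h1, h2, rfl⟩
  inj := by
    rintro (a | a) (b | b) hl hr hab
    · exact congrArg _ (h.inj a b hl hr (Sum.inl_injective hab))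
    · simp at hab
    · simp at hab
    · exact congrArg _ (h'.inj a b hl hr (Sum.inr_injective hab))

lemma Lifts.lev (h : Lifts (U'.γ d) (U.γ d) π f) :
    Lifts (U'.lev.γ d) (U.lev.γ d) (Prod.map id π) f where
  q a := h.q a.2
  D := rfl
  l a := h.l a.2
  r a := h.r a.2
  lift := by
    rintro ⟨n, a⟩ p q hp hq
    obtain ⟨b, h1, h2, rfl⟩ := h.lift a p q hp hq
    exact ⟨(n, b), h1, h2, rfl⟩
  inj := by
    rintro ⟨n, a⟩ ⟨n', b⟩ hl hr hab
    simp only [Prod.map, id, Prod.mk.injEq] at hab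
    rw [hab.1, h.inj a b hl hr hab.2]
end Lifts
-- Coefficients of restricted operations
section Coefficients
variable {f : O → P} {A B : GrQuiver.{u, v, w} k P} {Λ' Λ : Type t} {γ' : Grading Λ' O}
  {γ : Grading Λ P} {π : Λ' → Λ} {i' : Lab (A.pull f) → Λ'} {o' : Lab (B.pull f) → Λ'}
  {i : Lab A → Λ} {o : Lab B → Λ}

lemma Filled.word_push (hi : ∀ a, π (i' a) = i (plab f a)) (ho : ∀ b, π (o' b) = o (plab f b))
    (φ : Filled (A.pull f) (B.pull f)) :
    (φ.push f).word i o = (φ.word i' o').map (mapL π) := by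
  simp only [Filled.word, List.map_flatMap, List.map_append, List.map_reverse, List.map_ofFn,
    List.map_cons, List.map_nil, mapL, ho]
  congr 1
  funext s
  congr 3
  funext j
  simp only [Function.comp, mapL, hi]
  rfl

lemma Multi.val_pull (F : Multi A B) (φ : Filled (A.pull f) (B.pull f)) :
    (F.pull f).val φ = F.val (φ.push f) := rfl

lemma Lifts.exists_lab (H : Lifts γ' γ π f) (hi : ∀ a, π (i' a) = i (plab f a))
    (hl' : ∀ a, γ'.l (i' a) = a.l) (hr' : ∀ a, γ'.r (i' a) = a.r) (hl : ∀ a, γ.l (i a) = a.l)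
    (hr : ∀ a, γ.r (i a) = a.r) {x : Λ'} {a : Lab A} (h : i a = π x) : ∃ a', i' a' = x := by
  obtain ⟨l, r, e⟩ := a
  have h1 := hl ⟨l, r, e⟩
  have h2 := hr ⟨l, r, e⟩
  rw [h, H.l] at h1
  rw [h, H.r] at h2
  obtain rfl : f (γ'.l x) = l := h1
  obtain rfl : f (γ'.r x) = r := h2
  exact ⟨⟨γ'.l x, γ'.r x, e⟩, H.inj _ _ (hl' _) (hr' _) ((hi _).trans h)⟩

/-- Embeddings of the labels of a quiver and of its restriction which fit together. -/
structure EmbOver (γ' : Grading Λ' O) (γ : Grading Λ P) (π : Λ' → Λ) (i' : Lab (A.pull f) → Λ')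
    (i : Lab A → Λ) : Prop where
  map : ∀ a, π (i' a) = i (plab f a)
  inj' : Function.Injective i'
  l' : ∀ a, γ'.l (i' a) = a.l
  r' : ∀ a, γ'.r (i' a) = a.r
  inj : Function.Injective i
  l : ∀ a, γ.l (i a) = a.l
  r : ∀ a, γ.r (i a) = a.r

/-- The word must be a closed path upstairs: objects with the same image may differ, and then the
image can be the word of a disc although the word itself is not. -/
lemma Multi.coeff_pull (H : Lifts γ' γ π f) (hi : EmbOver γ' γ π i' i) (ho : EmbOver γ' γ π o' o)
    (F : Multi A B) {W : List (Letter Λ')} (hW : γ'.Coh W) :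
    (F.pull f).coeff i' o' W = F.coeff i o (W.map (mapL π)) := by
  by_cases h : ∃ φ : Filled (A.pull f) (B.pull f), φ.word i' o' = W
  · obtain ⟨φ, rfl⟩ := h
    rw [← φ.word_push hi.map ho.map, Multi.coeff_word _ hi.inj' ho.inj',
      Multi.coeff_word _ hi.inj ho.inj, Multi.val_pull]
  · have h1 : (F.pull f).coeff i' o' W = 0 := by
      by_contra hc
      exact h (Multi.exists_of_coeff_ne_zero hc)
    rw [h1]
    by_contra hc
    have hc' := Ne.symm hc
    refine h (exists_filled hi.l' hi.r' ho.l' ho.r' hW ?_ fun x hx => ?_)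
    · obtain ⟨V, b, hV⟩ := Multi.endsOut_of_coeff hc'
      obtain ⟨W₁, W₂, rfl, -, h3⟩ := List.map_eq_append_iff.1 hV
      obtain ⟨⟨s, c⟩, rfl, h4⟩ := List.map_eq_singleton_iff.1 h3
      obtain rfl : s = true := congrArg Prod.fst h4
      exact ⟨W₁, c, rfl⟩
    · rcases Multi.typed_of_coeff hc' _ (List.mem_map_of_mem hx) with ⟨h2, a, h3⟩ | ⟨h2, a, h3⟩
      · exact Or.inl ⟨h2, H.exists_lab hi.map hi.l' hi.r' hi.l hi.r h3⟩
      · exact Or.inr ⟨h2, H.exists_lab ho.map ho.l' ho.r' ho.l ho.r h3⟩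

lemma Multi.drep_pull (H : Lifts γ' γ π f) (hi : EmbOver γ' γ π i' i) (ho : EmbOver γ' γ π o' o)
    (F : Multi A B) (j : ℕ) {W : List (Letter Λ')} (hW : γ'.Coh W) :
    (F.pull f).drep γ' j i' o' W = F.drep γ j i o (W.map (mapL π)) := by
  have hn : γ'.Coh (norm W) := γ'.coh_rotate (by rwa [List.rdropWhile_append_rtakeWhile])
  have h1 := F.coeff_pull H hi ho hn
  have h : (F.pull f).rep γ' i' o' W = F.rep γ i o (W.map (mapL π)) :=
    (ccw_map (ψ := mapL π) (γ₀ := γ') (c₀ := (F.pull f).coeff i' o') (fun _ => rfl) H.p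
      h1.symm).symm
  rw [Multi.drep, Multi.drep, h]

/-- Restriction does not affect levels, so the condition on outer letters is the same upstairs and
downstairs, and the sums over trees agree by `Lifts.TS_map`. -/
lemma wcomp_pull {γ' : Grading (ℕ × Λ') O} {γ : Grading (ℕ × Λ) P}
    (H : Lifts γ' γ (Prod.map id π) f) {m : ℕ} {X' Y' : List (Letter (ℕ × Λ')) → DualNumber k}
    {X Y : List (Letter (ℕ × Λ)) → DualNumber k} (sX' : Sys γ' X') (sY' : Sys γ' Y')
    (sX : Sys γ X) (sY : Sys γ Y)
    (hX : ∀ w, γ'.Coh w → X' w = X (w.map (mapL (Prod.map id π))))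
    (hY : ∀ w, γ'.Coh w → Y' w = Y (w.map (mapL (Prod.map id π))))
    {w : List (Letter (ℕ × Λ'))} (hw : γ'.Coh w) :
    wcomp γ' Prod.fst m X' Y' w = wcomp γ Prod.fst m X Y (w.map (mapL (Prod.map id π))) := by
  have h := H.TS_map (c' := X' + Y') (c := X + Y) (E := fun a => a.1 = m)
    (fun w hw => by simp only [Pi.add_apply, hX w hw, hY w hw]) (sX'.add sY').coh
    (sX.add sY).coh hw
  simp only [wcomp, restr, List.forall_mem_map]
  by_cases hx : ∀ x ∈ w, x.2.1 ≠ m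
  · exact (if_pos hx).trans (h.trans (if_pos hx).symm)
  · exact (if_neg hx).trans (if_neg hx).symm
end Coefficients

/-! ### Restriction of operations -/

section Restriction
variable {f : O → P} {A B C : GrQuiver.{u, v, w} k P} {d : ℤ} {j : ℕ}

lemma lifts_two (f : O → P) (A B : GrQuiver.{u, v, w} k P) (d : ℤ) :
    Lifts ((Labels.two (A.pull f) (B.pull f)).γ d) ((Labels.two A B).γ d)
      (Sum.map (plab f) (plab f)) f :=
  (lifts_of f A d).sum (lifts_of f B d)

lemma embOver_lev {U' : Labels.{u, max u v} O} {U : Labels.{u, max u v} P} {π : U'.L → U.L}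
    {i' : Lab (A.pull f) → U'.L} {i : Lab A → U.L} (h' : U'.Emb i') (h : U.Emb i)
    (hπ : ∀ a, π (i' a) = i (plab f a)) (n : ℕ) :
    EmbOver (U'.lev.γ d) (U.lev.γ d) (Prod.map id π) (Labels.pos (U := U') n i')
      (Labels.pos (U := U) n i) :=
  ⟨fun a => congrArg (Prod.mk n) (hπ a), (h'.pos n).inj, h'.l, h'.r, (h.pos n).inj, h.l, h.r⟩

lemma coeff_pull_two (F : Multi A B) {W : List (Letter (Lab (A.pull f) ⊕ Lab (B.pull f)))}
    (hW : ((Labels.two (A.pull f) (B.pull f)).γ d).Coh W) :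
    (F.pull f).coeff Sum.inl Sum.inr W =
      F.coeff Sum.inl Sum.inr (W.map (mapL (Sum.map (plab f) (plab f)))) :=
  F.coeff_pull (lifts_two f A B d)
    ⟨fun _ => rfl, Sum.inl_injective, fun _ => rfl, fun _ => rfl, Sum.inl_injective,
      fun _ => rfl, fun _ => rfl⟩
    ⟨fun _ => rfl, Sum.inr_injective, fun _ => rfl, fun _ => rfl, Sum.inr_injective,
      fun _ => rfl, fun _ => rfl⟩ hW

lemma coh_of_coeff_two {A B : GrQuiver.{u, v, w} k O} {F : Multi A B}
    {W : List (Letter (Lab A ⊕ Lab B))} (h : F.coeff Sum.inl Sum.inr W ≠ 0) :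
    ((Labels.two A B).γ d).Coh W := by
  obtain ⟨φ, rfl⟩ := Multi.exists_of_coeff_ne_zero h
  exact φ.coh_word (fun _ => rfl) (fun _ => rfl) (fun _ => rfl) (fun _ => rfl)

lemma arrowDeg_plab (x : Letter (Lab (A.pull f) ⊕ Lab (B.pull f))) :
    arrowDeg d (Sum.elim Lab.deg Lab.deg) (mapL (Sum.map (plab f) (plab f)) x) =
      arrowDeg d (Sum.elim Lab.deg Lab.deg) x := by
  rcases x with ⟨s, x | x⟩ <;> rfl

lemma deg_plab (W : List (Letter (Lab (A.pull f) ⊕ Lab (B.pull f)))) :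
    inDeg d (Sum.elim Lab.deg Lab.deg) (W.map (mapL (Sum.map (plab f) (plab f)))) =
      inDeg d (Sum.elim Lab.deg Lab.deg) W ∧
    outDeg d (Sum.elim Lab.deg Lab.deg) (W.map (mapL (Sum.map (plab f) (plab f)))) =
      outDeg d (Sum.elim Lab.deg Lab.deg) W := by
  constructor
  all_goals
    simp only [inDeg, outDeg, List.filter_map, List.map_map]
    congr 1
    exact List.map_congr_left fun x _ => arrowDeg_plab x

lemma IsOp.pull {F : Multi A B} (hF : IsOp d j F) (f : O → P) : IsOp d j (F.pull f) where
  homogeneous W h := by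
    have h1 := h
    rw [coeff_pull_two F (coh_of_coeff_two (d := d) h)] at h1
    have h2 := hF.homogeneous _ h1
    rwa [(deg_plab W).1, (deg_plab W).2] at h2
  cyclic V W hV hW := by
    have hm : ∀ {V : List (Letter (Lab (A.pull f) ⊕ Lab (B.pull f)))}, EndsOut V →
        EndsOut (V.map (mapL (Sum.map (plab f) (plab f)))) := by
      rintro _ ⟨X, b, rfl⟩
      exact ⟨_, _, List.map_append⟩
    by_cases h : ((Labels.two (A.pull f) (B.pull f)).γ d).Coh (V ++ W)
    · have h1 := hF.cyclic _ _ (hm hV) (hm hW)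
      rwa [(deg_plab V).1, (deg_plab V).2, (deg_plab W).1, (deg_plab W).2, ← List.map_append,
        ← List.map_append, ← coeff_pull_two F h,
        ← coeff_pull_two F (Grading.coh_rotate _ h)] at h1
    · have h1 : (F.pull f).coeff Sum.inl Sum.inr (V ++ W) = 0 := by
        by_contra hc
        exact h (coh_of_coeff_two hc)
      have h2 : (F.pull f).coeff Sum.inl Sum.inr (W ++ V) = 0 := by
        by_contra hc
        exact h (Grading.coh_rotate _ (coh_of_coeff_two hc))
      rw [h1, h2, mul_zero]
  uncurved τ hn hm := hF.uncurved (τ.map f) hn hm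

/-- If the two letters of a closed path have the same image then they also have the same ends, hence
are equal; so no new identity coefficients arise by restriction. -/
theorem one_pull (f : O → P) (A : GrQuiver.{u, v, w} k P) :
    (Multi.one A).pull f = Multi.one (A.pull f) := by
  refine Multi.ext_val fun φ => ?_
  rw [Multi.val_pull, Multi.val_one, Multi.val_one,
    Filled.word_push (π := plab f) (i' := id) (o' := id) (fun _ => rfl) (fun _ => rfl)]
  have hφ := φ.coh_word (γ := (Labels.of (A.pull f)).γ 0) (i := id) (o := id) (fun _ => rfl)
    (fun _ => rfl) (fun _ => rfl) (fun _ => rfl)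
  generalize φ.word id id = W at hφ
  have key : (∃ e : Lab A, W.map (mapL (plab f)) = [(false, e), (true, e)]) ↔
      ∃ e : Lab (A.pull f), W = [(false, e), (true, e)] := by
    constructor
    · rintro ⟨e, he⟩
      rcases W with _ | ⟨⟨s, a⟩, _ | ⟨⟨s', b⟩, _ | _⟩⟩
      · simp at he
      · simp at he
      · simp only [List.map_cons, List.map_nil, mapL, List.cons.injEq, Prod.mk.injEq,
          and_true] at he
        obtain ⟨⟨rfl, h1⟩, rfl, h2⟩ := he
        obtain ⟨p, h3, h4, h5⟩ := hφ
        have h6 := (lifts_of f A 0).inj a b h4 (h3.symm.trans h5.symm) (h1.trans h2.symm)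
        exact ⟨b, by rw [h6]⟩
      · simp at he
    · rintro ⟨e, rfl⟩
      exact ⟨_, rfl⟩
  by_cases h : ∃ e : Lab (A.pull f), W = [(false, e), (true, e)]
  · rw [oneCoeff, oneCoeff, if_pos h, if_pos (key.2 h)]
  · rw [oneCoeff, oneCoeff, if_neg h, if_neg (mt key.1 h)]

theorem comp_pull {F : Multi A B} {G : Multi B C} (hF : IsOp d 0 F) (hG : IsOp d 0 G)
    (f : O → P) : (Multi.comp d F G).pull f = Multi.comp d (F.pull f) (G.pull f) := by
  have hA : (Labels.three A B C).Emb (A := A) Sum.inl := Labels.emb_id.inl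
  have hB : (Labels.three A B C).Emb (A := B) fun y => Sum.inr (Sum.inl y) :=
    Labels.emb_id.inl.inr
  have hC : (Labels.three A B C).Emb (A := C) fun y => Sum.inr (Sum.inr y) :=
    Labels.emb_id.inr.inr
  let U := Labels.three (A.pull f) (B.pull f) (C.pull f)
  have hA' : U.Emb (A := A.pull f) Sum.inl := Labels.emb_id.inl
  have hB' : U.Emb (A := B.pull f) fun y => Sum.inr (Sum.inl y) := Labels.emb_id.inl.inr
  have hC' : U.Emb (A := C.pull f) fun y => Sum.inr (Sum.inr y) := Labels.emb_id.inr.inr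
  have H := ((lifts_of f A d).sum ((lifts_of f B d).sum (lifts_of f C d))).lev
  have h1 : (0 : ℕ) < 1 := by omega
  have h2 : (1 : ℕ) < 2 := by omega
  have c := comp_spec hA hB hC h1 h2 hF hG
  have c' := comp_spec hA' hB' hC' h1 h2 (hF.pull f) (hG.pull f)
  let π := Sum.map (plab f (A := A)) (Sum.map (plab f (A := B)) (plab f (A := C)))
  have oA := embOver_lev (π := π) (d := d) hA' hA (fun _ => rfl)
  have oB := embOver_lev (π := π) (d := d) hB' hB (fun _ => rfl)
  have oC := embOver_lev (π := π) (d := d) hC' hC (fun _ => rfl)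
  refine Multi.ext_drep (d := d) (n := 0) (l := 2) hA' hC' ?_
  funext w
  by_cases hw : (U.lev.γ d).Coh w
  · rw [opAt, opAt, Multi.drep_pull H (oA 0) (oC 2) _ 0 hw, c.2, c'.2]
    refine (wcomp_pull H ((hF.pull f).tmor hA' hB' 0 1).toSys ((hG.pull f).tmor hB' hC' 1 2).toSys
      (hF.tmor hA hB 0 1).toSys (hG.tmor hB hC 1 2).toSys (fun w hw => ?_) (fun w hw => ?_)
      hw).symm
    · exact F.drep_pull H (oA 0) (oB 1) 0 hw
    · exact G.drep_pull H (oB 1) (oC 2) 0 hw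
  -- On words that are not closed paths both systems vanish.
  · exact (not_not.1 fun h => hw (((c.1.pull f).tmor hA' hC' 0 2).coh w h)).trans
      (not_not.1 fun h => hw ((c'.1.tmor hA' hC' 0 2).coh w h)).symm

/-- Compatibility with structures is preserved by restriction. -/
theorem compatible_pull {F : Multi A B} {M : Multi A A} {N : Multi B B} (hF : IsOp d 0 F)
    (hM : IsOp d 1 M) (hN : IsOp d 1 N) (h : multinecklace d F M = precomposition d N F)
    (f : O → P) :
    multinecklace d (F.pull f) (M.pull f) = precomposition d (N.pull f) (F.pull f) := by
  have hA : (Labels.two A B).Emb (A := A) Sum.inl := emb_two_left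
  have hB : (Labels.two A B).Emb (A := B) Sum.inr := emb_two_right
  let U := Labels.two (A.pull f) (B.pull f)
  have hA' : U.Emb (A := A.pull f) Sum.inl := emb_two_left
  have hB' : U.Emb (A := B.pull f) Sum.inr := emb_two_right
  have h1 : (0 : ℕ) < 1 := by omega
  have h2 : (1 : ℕ) < 2 := by omega
  have H := (lifts_two f A B d).lev
  let π := Sum.map (plab f (A := A)) (plab f (A := B))
  have oA := embOver_lev (π := π) (d := d) hA' hA (fun _ => rfl)
  have oB := embOver_lev (π := π) (d := d) hB' hB (fun _ => rfl)
  rw [compatible_iff hA hB h1 h2 h1 h2 hF hM hN] at h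
  rw [compatible_iff hA' hB' h1 h2 h1 h2 (hF.pull f) (hM.pull f) (hN.pull f)]
  have tL := ((hM.pull f).tmor_pert hA' 0 1).wcomp ((hF.pull f).tmor hA' hB' 1 2) h1 h2
  have tR := ((hF.pull f).tmor hA' hB' 0 1).wcomp ((hN.pull f).tmor_pert hB' 1 2) h1 h2
  funext w
  by_cases hw : (U.lev.γ d).Coh w
  · refine (wcomp_pull H ((hM.pull f).tmor_pert hA' 0 1).toSys
      ((hF.pull f).tmor hA' hB' 1 2).toSys (hM.tmor_pert hA 0 1).toSys
      (hF.tmor hA hB 1 2).toSys (fun w hw => ?_) (fun w hw => ?_) hw).trans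
      ((congrFun h _).trans (wcomp_pull H ((hF.pull f).tmor hA' hB' 0 1).toSys
      ((hN.pull f).tmor_pert hB' 1 2).toSys (hF.tmor hA hB 0 1).toSys
      (hN.tmor_pert hB 1 2).toSys (fun w hw => ?_) (fun w hw => ?_) hw).symm)
    -- The perturbed identity restricts to the perturbed identity, as the identity restricts to the
    -- identity.
    · rw [pert, pert, Pi.add_apply, Pi.add_apply, ← one_pull]
      exact congrArg₂ _ (Multi.drep_pull H (oA 0) (oA 1) _ 0 hw)
        (Multi.drep_pull H (oA 0) (oA 1) _ 1 hw)
    · exact F.drep_pull H (oA 1) (oB 2) 0 hw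
    · exact F.drep_pull H (oA 0) (oB 1) 0 hw
    · rw [pert, pert, Pi.add_apply, Pi.add_apply, ← one_pull]
      exact congrArg₂ _ (Multi.drep_pull H (oB 1) (oB 2) _ 0 hw)
        (Multi.drep_pull H (oB 1) (oB 2) _ 1 hw)
  · exact (not_not.1 fun h => hw (tL.coh w h)).trans (not_not.1 fun h => hw (tR.coh w h)).symm
end Restriction
end
end PreCY
end

/-! ### The category of pre-Calabi–Yau categories -/

noncomputable section

variable {k : Type w} [Field k] {d : ℤ}

namespace PreCY
lemma IsPreCYStructure.isOp {O : Type u} {A : GrQuiver.{u, v, w} k O} {M : Multi A A}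
    (h : IsPreCYStructure d M) : IsOp d 1 M :=
  ⟨by have := h.homogeneous; rwa [show d + 2 = d + 1 + (1 : ℕ) by push_cast; ring] at this,
    h.cyclic, h.uncurved⟩

namespace PreCYMor
variable {X Y Z : PreCYCat.{u, v, w} k d}

lemma isOp (f : PreCYMor X Y) : IsOp d 0 f.map :=
  ⟨by simpa using f.homogeneous, f.cyclic, f.uncurved⟩

/-- A compatible operation as a morphism. -/
def mk' (f : PreMor X.quiver Y.quiver) (h : IsOp d 0 f.map)
    (hc : multinecklace d f.map X.M = precomposition d (Y.M.pull f.obj) f.map) : PreCYMor X Y where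
  toPreMor := f
  homogeneous := by simpa using h.homogeneous
  cyclic := h.cyclic
  uncurved := h.uncurved
  compatible := hc

@[ext] lemma ext {f g : PreCYMor X Y} (h : f.toPreMor = g.toPreMor) : f = g := by
  cases f
  cases g
  cases h
  rfl

/-- The identity. -/
def id (X : PreCYCat.{u, v, w} k d) : PreCYMor X X :=
  mk' (PreMor.one X.quiver) (isOp_one d) (compatible_one X.isStructure.isOp)

/-- The composition. -/
def comp (f : PreCYMor X Y) (g : PreCYMor Y Z) : PreCYMor X Z :=
  have hg := g.isOp.pull f.obj
  mk' (PreMor.comp d f.toPreMor g.toPreMor)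
    (comp_spec (U := Labels.three X.quiver (Y.quiver.pull f.obj)
      ((Z.quiver.pull g.obj).pull f.obj)) Labels.emb_id.inl Labels.emb_id.inl.inr
      Labels.emb_id.inr.inr zero_lt_one one_lt_two f.isOp hg).1
    (compatible_comp f.isOp hg X.isStructure.isOp (Y.isStructure.isOp.pull f.obj)
      ((Z.isStructure.isOp.pull g.obj).pull f.obj) f.compatible
      (compatible_pull g.isOp Y.isStructure.isOp (Z.isStructure.isOp.pull g.obj) g.compatible f.obj))

lemma id_comp (f : PreCYMor X Y) : (id X).comp f = f := by
  ext
  exact congrArg (PreMor.mk f.obj) (one_comp f.isOp)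

lemma comp_id (f : PreCYMor X Y) : f.comp (id Y) = f := by
  ext
  refine congrArg (PreMor.mk f.obj) (Eq.trans ?_ (comp_one f.isOp))
  exact congrArg (Multi.comp d f.map) (one_pull f.obj Y.quiver)

lemma assoc {T : PreCYCat.{u, v, w} k d} (f : PreCYMor X Y) (g : PreCYMor Y Z)
    (h : PreCYMor Z T) : (f.comp g).comp h = f.comp (g.comp h) := by
  ext
  refine congrArg (PreMor.mk fun x => h.obj (g.obj (f.obj x))) ?_
  -- Over the objects of `X` this is associativity of three restricted operations; `comp_pull`
  -- identifies the restriction of the composite of `g` and `h` with the composite of their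
  -- restrictions.
  refine (comp_assoc f.isOp (g.isOp.pull f.obj) ((h.isOp.pull g.obj).pull f.obj)).trans ?_
  exact congrArg (Multi.comp d f.map) (comp_pull g.isOp (h.isOp.pull g.obj) f.obj).symm
end PreCYMor

/-- Pre-Calabi-Yau categories form a category. -/
instance : CategoryTheory.Category.{max u v w} (PreCYCat.{u, v, w} k d) where
  Hom := PreCYMor
  id := PreCYMor.id
  comp := PreCYMor.comp
  id_comp := PreCYMor.id_comp
  comp_id := PreCYMor.comp_id
  assoc := PreCYMor.assoc
end PreCY
end

theorem mainTheorem10 (k : Type w) [Field k] [CharZero k] (d : ℤ) :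
    ∃ (_ : CategoryTheory.Category.{max u v w} (PreCY.PreCYCat.{u, v, w} k d))
      (e : ∀ X Y : PreCY.PreCYCat.{u, v, w} k d, (X ⟶ Y) ≃ PreCY.PreCYMor X Y),
      (∀ X : PreCY.PreCYCat.{u, v, w} k d,
        (e X X (CategoryTheory.CategoryStruct.id X)).toPreMor = PreCY.PreMor.one X.quiver) ∧
      ∀ (X Y Z : PreCY.PreCYCat.{u, v, w} k d) (f : X ⟶ Y) (g : Y ⟶ Z),
        (e X Z (CategoryTheory.CategoryStruct.comp f g)).toPreMor =
          PreCY.PreMor.comp d (e X Y f).toPreMor (e Y Z g).toPreMor :=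
  ⟨inferInstance, fun _ _ => Equiv.refl _, fun _ => rfl, fun _ _ _ _ _ => rfl⟩
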